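/- **Setting.** A *conical affine special Kähler manifold* $(M,J,g,\nabla,\xi)$ of complex dimension $n+1$ is a pseudo-Kähler manifold $(M,J,g)$ with a flat torsion-free connection $\nabla$ and a nowhere vanishing vector field $\xi$ such that $\nabla\omega=0$ for $\omega=g(J\cdot,\cdot)$, $d^\nabla J=0$, $\nabla\xi=D\xi=\mathrm{Id}$ ($D$ the Levi-Civita connection), and $g$ is positive definite on $\mathcal D=\mathrm{span}\{\xi,J\xi\}$ and negative definite on $\mathcal D^\perp$. Put $f=g(\xi,\xi)$, $\alpha=g(\xi,\cdot)$. If $\xi$ and $J\xi$ generate a principal $\mathbb C^*$-action (the flow of $\xi$ being $e^t$, that of $J\xi$ being $e^{it}$), then $\bar M=M/\mathbb C^*$ carries the metric $\bar g$ with $\pi^*\bar g=-\frac gf+\frac{\alpha^2+(J^*\alpha)^2}{f^2}$, and $(\bar M,\bar g)$ is called a projective special Kähler manifold. It has *regular boundary behaviour* if there is a smooth embedding of $M$ onto the interior of a manifold with boundary $\mathcal M$ such that $(J,g,\xi)$ extend smoothly to $\mathcal M$; at every $p\in\partial\mathcal M$ one has $f(p)=0$, $df_p\ne0$, and $g_p$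 is negative semi-definite on $\mathcal H_p=T_p\partial\mathcal M\cap J(T_p\partial\mathcal M)$ with kernel $\mathrm{span}\{\xi_p,J\xi_p\}$; the extended fields $\xi,J\xi$ generate a principal $\mathbb C^*$-action on $\mathcal M$; and $\mathcal M/\mathbb C^*$ is compact. A *conical special Kähler domain* is a $\mathbb C^*$-invariant open set $U\subset\mathbb C^{n+1}\setminus\{0\}$ with a holomorphic function $F$, homogeneous of degree $2$, such that $N_{IJ}=2\,\mathrm{Im}\,F_{IJ}$ has signature $(1,n)$ and $\sum N_{IJ}z^I\bar z^J>0$ on $U$; it is endowed with $g=\sum N_{IJ}dz^Id\bar z^J$, the position vector field, and the flat connection for which the functions $\mathrm{Re}\,z^I,\mathrm{Re}\,F_I$ are affine. Let $M=\bigcup_\alpha M_\alpha$ be a covering by $\mathbb C^*$-invariant open sets, each with an isomorphism $z_\alpha$ of conical affine special Kähler manifolds onto a conical special Kähler domain with prepotential $F_\alpha$ contained in $\{z^0\neq0\}$. Put $\bar M_\alpha=M_\alpha/\mathbb C^*$, with coordinates $X^\mu=z^\mu/z^0$ ($X^0=1$), and $\phi_\alpha=(z^I_\alpha,\partial_IF_\alpha)\colon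 M_\alpha\to\mathbb C^{2n+2}$. **The manifold.** For $c\ge0$ let $S^1_c=\mathbb R/2\pi c\mathbb Z$ (so $S^1_0=\mathbb R$), and let $\bar N$ be the quotient of the disjoint union of the sets $\bar N_\alpha=\bar M_\alpha\times\mathbb R^{>0}\times S^1_c\times\mathbb R^{2n+2}$, with coordinates $(X^\mu,\rho,\tilde\phi,v)$, $v=(p_a)=(\tilde\zeta_I,\zeta^J)$, by $$(m_\alpha,\rho_\alpha,\tilde\phi_\alpha,v_\alpha)\sim(m_\beta,\rho_\beta,\tilde\phi_\beta,v_\beta)\iff m_\alpha=m_\beta,\ \rho_\alpha=\rho_\beta,\ \tilde\phi_\beta=\tilde\phi_\alpha-ic\log\frac{z^0_\alpha\bar z^0_\beta}{z^0_\beta\bar z^0_\alpha},\ v_\beta=(\mathcal O^t)^{-1}v_\alpha,$$ where $\mathcal O$ is the real symplectic matrix with $\phi_\beta=\mathcal O\phi_\alpha$ near the fibre over $m_\alpha=m_\beta$. On each $\bar N_\alpha$ consider $$g^c_{FS}=\tfrac{\rho+c}{\rho}\bar g+\tfrac1{4\rho^2}\tfrac{\rho+2c}{\rho+c}d\rho^2+\tfrac1{4\rho^2}\tfrac{\rho+c}{\rho+2c}\Big(d\tilde\phi+\sum_I(\zeta^Id\tilde\zeta_I-\tilde\zeta_Id\zeta^I)+c\,d^c\mathcal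 K\Big)^2+\tfrac1{2\rho}\sum_{a,b} dp_a\hat H^{ab}dp_b+\tfrac{2c}{\rho^2}e^{\mathcal K}\Big|\sum_I(X^Id\tilde\zeta_I+F_I(X)d\zeta^I)\Big|^2,$$ where $\mathcal K=-\log\sum X^IN_{IJ}(X)\bar X^J$, $d^c\mathcal K=-d\mathcal K\circ J$, $\hat H=\begin{pmatrix}\mathcal I^{-1}&\mathcal I^{-1}\mathcal R\\ \mathcal R\mathcal I^{-1}&\mathcal I+\mathcal R\mathcal I^{-1}\mathcal R\end{pmatrix}$ and $\mathcal R_{IJ}+i\mathcal I_{IJ}=\bar F_{IJ}+i\,\frac{\sum_KN_{IK}z^K\sum_LN_{JL}z^L}{\sum_{KL} N_{KL}z^Kz^L}$. **Theorem.** Let $(\bar M,\bar g)$ be a projective special Kähler manifold with regular boundary behaviour and $c\ge0$. Then, for every covering as above, $\bar N$ is Hausdorff and second countable, it carries a smooth structure and a smooth Riemannian metric $g^c_{FS}$ for which the coordinates on the $\bar N_\alpha$ are local diffeomorphisms and $g^c_{FS}$ is given by the formula above on every $\bar N_\alpha$, and the Riemannian manifold $(\bar N,g^c_{FS})$ is complete.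 -/

import Mathlib

open scoped Manifold ContDiff Topology Bundle

noncomputable section

namespace OneLoop

/-! ### Conical affine special Kähler manifolds -/

section Tensors

variable {E : Type*} [NormedAddCommGroup E] [NormedSpace ℝ E]
  {H : Type*} [TopologicalSpace H] (I : ModelWithCorners ℝ E H)
  (M : Type*) [TopologicalSpace M] [ChartedSpace H M] [IsManifold I ∞ M]

/-- Smooth vector fields. -/
def SmoothField {I : ModelWithCorners ℝ E H} {M : Type*} [TopologicalSpace M]
    [ChartedSpace H M] [IsManifold I ∞ M] (X : ∀ p : M, TangentSpace I p) : Prop :=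
  ContMDiff I I.tangent ∞ (fun p => (⟨p, X p⟩ : TangentBundle I M))

/-- Smooth tensor fields `(J, g, ξ)` on a manifold, possibly with boundary: an endomorphism field,
a symmetric bilinear form and a vector field. -/
structure TensorTriple where
  /-- the endomorphism field -/
  J : ∀ p : M, TangentSpace I p →L[ℝ] TangentSpace I p
  /-- the bilinear form -/
  g : ∀ p : M, TangentSpace I p →L[ℝ] TangentSpace I p →L[ℝ] ℝ
  /-- the vector field -/
  xi : ∀ p : M, TangentSpace I p
  smooth_J : ContMDiff I (I.prod 𝓘(ℝ, E →L[ℝ] E)) ∞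
    (fun p => Bundle.TotalSpace.mk' (E →L[ℝ] E)
      (E := fun p : M => TangentSpace I p →L[ℝ] TangentSpace I p) p (J p))
  smooth_g : ContMDiff I (I.prod 𝓘(ℝ, E →L[ℝ] E →L[ℝ] ℝ)) ∞
    (fun p => Bundle.TotalSpace.mk' (E →L[ℝ] E →L[ℝ] ℝ)
      (E := fun p : M => TangentSpace I p →L[ℝ] TangentSpace I p →L[ℝ] ℝ) p (g p))
  smooth_xi : SmoothField xi
  symm_g : ∀ (p : M) (v w : TangentSpace I p), g p v w = g p w v

variable {I M}

/-- The function `f = g(ξ, ξ)`. -/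
def TensorTriple.f (T : TensorTriple I M) (p : M) : ℝ := T.g p (T.xi p) (T.xi p)

/-- The span of `ξ` and `Jξ` at `p`. -/
def TensorTriple.dist (T : TensorTriple I M) (p : M) : Submodule ℝ (TangentSpace I p) :=
  Submodule.span ℝ {T.xi p, T.J p (T.xi p)}

/-- The affine connection `nabla` has vanishing curvature:
`∇_X ∇_Y Z - ∇_Y ∇_X Z - ∇_[X,Y] Z = 0`. -/
def IsFlat (nabla : CovariantDerivative I E (TangentSpace I : M → Type _)) : Prop :=
  ∀ X Y Z : (∀ p : M, TangentSpace I p), SmoothField X → SmoothField Y → SmoothField Z →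
    ∀ p : M, nabla (fun q => nabla Z q (Y q)) p (X p) - nabla (fun q => nabla Z q (X q)) p (Y p)
      - nabla Z p (VectorField.mlieBracket I X Y p) = 0

/-- `X ↦ (∇_X b)(Y, Z) = X (b(Y, Z)) - b(∇_X Y, Z) - b(Y, ∇_X Z)` vanishes: the bilinear form `b`
is parallel for the connection `nabla`. -/
def IsParallelForm (nabla : CovariantDerivative I E (TangentSpace I : M → Type _))
    (b : ∀ p : M, TangentSpace I p → TangentSpace I p → ℝ) : Prop :=
  ∀ X Y Z : (∀ p : M, TangentSpace I p), SmoothField X → SmoothField Y → SmoothField Z →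
    ∀ p : M, mvfderiv I (fun q => b q (Y q) (Z q)) p (X p)
      = b p (nabla Y p (X p)) (Z p) + b p (Y p) (nabla Z p (X p))

/-- The function `h` is affine on the set `s` for the connection `nabla`, that is, `∇ dh = 0`
there: `X (Y h) = (∇_X Y) h`. -/
def IsAffineFunOn (nabla : CovariantDerivative I E (TangentSpace I : M → Type _))
    (h : M → ℝ) (s : Set M) : Prop :=
  ∀ X Y : (∀ p : M, TangentSpace I p), SmoothField X → SmoothField Y →
    ∀ p ∈ s, mvfderiv I (fun q => mvfderiv I h q (Y q)) p (X p)
      = mvfderiv I h p (nabla Y p (X p))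

/-- The element `exp w` of `ℂ^*`. -/
def expUnit (w : ℂ) : ℂˣ := Units.mk0 (Complex.exp w) (Complex.exp_ne_zero w)

/-- The action of `ℂ^*` on `M` is principal (smooth, free and proper) and is generated by the
vector fields `ξ` (the generator of `t ↦ e^t`) and `Jξ` (the generator of `t ↦ e^{it}`). -/
structure IsPrincipalAction [MulAction ℂˣ M] (T : TensorTriple I M) : Prop where
  smooth : ContMDiffSMul 𝓘(ℝ, ℂ) I ∞ ℂˣ M
  free : ∀ (a : ℂˣ) (p : M), a • p = p → a = 1
  proper : ProperSMul ℂˣ M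
  generator_xi : ∀ p : M, IsMIntegralCurve (I := I) (fun t : ℝ => expUnit t • p) T.xi
  generator_J_xi : ∀ p : M, IsMIntegralCurve (I := I) (fun t : ℝ => expUnit (t * Complex.I) • p)
    (fun q => T.J q (T.xi q))

end Tensors

section Kaehler

variable (n : ℕ) (M : Type*) [TopologicalSpace M]
  [ChartedSpace (EuclideanSpace ℝ (Fin (2 * n + 2))) M] [IsManifold (𝓡 (2 * n + 2)) ∞ M]

/-- A conical affine special Kähler manifold `(M, J, g, ∇, ξ)` of complex dimension `n + 1`. -/
structure ConicalSpecialKaehler extends TensorTriple (𝓡 (2 * n + 2)) M where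
  /-- the Levi-Civita connection of `g` -/
  D : CovariantDerivative (𝓡 (2 * n + 2)) (EuclideanSpace ℝ (Fin (2 * n + 2)))
    (TangentSpace (𝓡 (2 * n + 2)) : M → Type _)
  /-- the special connection -/
  nabla : CovariantDerivative (𝓡 (2 * n + 2)) (EuclideanSpace ℝ (Fin (2 * n + 2)))
    (TangentSpace (𝓡 (2 * n + 2)) : M → Type _)
  /- `(M, J, g)` is pseudo-Kähler -/
  nondegenerate : ∀ (p : M) (v : TangentSpace (𝓡 (2 * n + 2)) p), (∀ w, g p v w = 0) → v = 0
  J_sq : ∀ (p : M) (v : TangentSpace (𝓡 (2 * n + 2)) p), J p (J p v) = -v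
  hermitian : ∀ (p : M) (v w : TangentSpace (𝓡 (2 * n + 2)) p), g p (J p v) (J p w) = g p v w
  D_torsion : D.torsion = 0
  D_metric : IsParallelForm D (fun p v w => g p v w)
  D_J : ∀ Y : (∀ p : M, TangentSpace (𝓡 (2 * n + 2)) p), SmoothField Y →
    ∀ (p : M) (v : TangentSpace (𝓡 (2 * n + 2)) p), D (fun q => J q (Y q)) p v = J p (D Y p v)
  /- `∇` is a flat torsion-free connection -/
  nabla_smooth : CovariantDerivative.ContMDiffCovariantDerivative nabla ∞
  nabla_torsion : nabla.torsion = 0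
  nabla_flat : IsFlat nabla
  /- `∇ω = 0` for `ω = g(J·, ·)` -/
  nabla_omega : IsParallelForm nabla (fun p v w => g p (J p v) w)
  /- `d^∇ J = 0` -/
  nabla_J : ∀ X Y : (∀ p : M, TangentSpace (𝓡 (2 * n + 2)) p), SmoothField X → SmoothField Y →
    ∀ p : M, nabla (fun q => J q (Y q)) p (X p) - nabla (fun q => J q (X q)) p (Y p)
      - J p (VectorField.mlieBracket (𝓡 (2 * n + 2)) X Y p) = 0
  /- `∇ξ = Dξ = Id` -/
  nabla_xi : ∀ (p : M) (v : TangentSpace (𝓡 (2 * n + 2)) p), nabla xi p v = v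
  D_xi : ∀ (p : M) (v : TangentSpace (𝓡 (2 * n + 2)) p), D xi p v = v
  /- `g` is positive definite on the distribution `span {ξ, Jξ}` and negative definite on its
  orthogonal complement -/
  xi_ne_zero : ∀ p : M, xi p ≠ 0
  pos : ∀ p : M, ∀ v ∈ toTensorTriple.dist p, v ≠ 0 → 0 < g p v v
  neg : ∀ (p : M) (v : TangentSpace (𝓡 (2 * n + 2)) p),
    (∀ w ∈ toTensorTriple.dist p, g p v w = 0) → v ≠ 0 → g p v v < 0

end Kaehler

/-! ### Regular boundary behaviour -/

section Boundary

variable {n : ℕ} {B : Type*} [TopologicalSpace B]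
  [ChartedSpace (EuclideanHalfSpace (2 * n + 2)) B] [IsManifold (𝓡∂ (2 * n + 2)) ∞ B]

/-- The tangent space `T_p ∂B` at a boundary point `p`, as a subspace of `T_p B`: the kernel
of the differential of the zeroth coordinate of the chart at `p`, which takes values in the
half-space `{x | 0 ≤ x 0}`. -/
def boundaryTangent (p : B) : Submodule ℝ (TangentSpace (𝓡∂ (2 * n + 2)) p) :=
  LinearMap.ker (mvfderiv (𝓡∂ (2 * n + 2)) (fun q : B =>
    (extChartAt (𝓡∂ (2 * n + 2)) p q : EuclideanSpace ℝ (Fin (2 * n + 2))) 0) p).toLinearMap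

/-- `H_p = T_p ∂B ∩ J (T_p ∂B)`. -/
def holTangent (T : TensorTriple (𝓡∂ (2 * n + 2)) B) (p : B) :
    Submodule ℝ (TangentSpace (𝓡∂ (2 * n + 2)) p) :=
  boundaryTangent p ⊓ (boundaryTangent p).map (T.J p).toLinearMap

variable {M : Type*} [TopologicalSpace M]
  [ChartedSpace (EuclideanSpace ℝ (Fin (2 * n + 2))) M] [IsManifold (𝓡 (2 * n + 2)) ∞ M]

/-- Regular boundary behaviour of the conical affine special Kähler manifold `M`, realised by an
embedding `i` onto the interior of the manifold with boundary `B`. -/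
structure RegularBoundary (C : ConicalSpecialKaehler n M) (T : TensorTriple (𝓡∂ (2 * n + 2)) B)
    (i : M → B) : Prop where
  embedding : Manifold.IsSmoothEmbedding (𝓡 (2 * n + 2)) (𝓡∂ (2 * n + 2)) ∞ i
  range_eq : Set.range i = (𝓡∂ (2 * n + 2)).interior B
  /- `(J, g, ξ)` on `B` extend the tensor fields of `M` -/
  extends_J : ∀ (p : M) (v : TangentSpace (𝓡 (2 * n + 2)) p),
    T.J (i p) (mfderiv (𝓡 (2 * n + 2)) (𝓡∂ (2 * n + 2)) i p v)
      = mfderiv (𝓡 (2 * n + 2)) (𝓡∂ (2 * n + 2)) i p (C.J p v)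
  extends_g : ∀ (p : M) (v w : TangentSpace (𝓡 (2 * n + 2)) p),
    T.g (i p) (mfderiv (𝓡 (2 * n + 2)) (𝓡∂ (2 * n + 2)) i p v)
      (mfderiv (𝓡 (2 * n + 2)) (𝓡∂ (2 * n + 2)) i p w) = C.g p v w
  extends_xi : ∀ p : M,
    T.xi (i p) = mfderiv (𝓡 (2 * n + 2)) (𝓡∂ (2 * n + 2)) i p (C.xi p)
  /- the conditions at the boundary points -/
  f_eq_zero : ∀ p ∈ (𝓡∂ (2 * n + 2)).boundary B, T.f p = 0
  df_ne_zero : ∀ p ∈ (𝓡∂ (2 * n + 2)).boundary B,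
    mfderiv (𝓡∂ (2 * n + 2)) 𝓘(ℝ, ℝ) T.f p ≠ 0
  semidefinite : ∀ p ∈ (𝓡∂ (2 * n + 2)).boundary B, ∀ v ∈ holTangent T p, T.g p v v ≤ 0
  kernel : ∀ p ∈ (𝓡∂ (2 * n + 2)).boundary B, ∀ v : TangentSpace (𝓡∂ (2 * n + 2)) p,
    (v ∈ holTangent T p ∧ ∀ w ∈ holTangent T p, T.g p v w = 0) ↔ v ∈ T.dist p

end Boundary

/-! ### Conical special Kähler domains -/

/-- The partial derivative `F_I`. -/
def dF {n : ℕ} (F : (Fin (n + 1) → ℂ) → ℂ) (I : Fin (n + 1)) (z : Fin (n + 1) → ℂ) : ℂ :=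
  fderiv ℂ F z (Pi.single I 1)

/-- The matrix `(F_IJ)` of second partial derivatives. -/
def ddF {n : ℕ} (F : (Fin (n + 1) → ℂ) → ℂ) (z : Fin (n + 1) → ℂ) :
    Matrix (Fin (n + 1)) (Fin (n + 1)) ℂ :=
  fun I J => fderiv ℂ (dF F I) z (Pi.single J 1)

/-- The real matrix `N_IJ = 2 Im F_IJ`. -/
def matN {n : ℕ} (F : (Fin (n + 1) → ℂ) → ℂ) (z : Fin (n + 1) → ℂ) :
    Matrix (Fin (n + 1)) (Fin (n + 1)) ℝ :=
  fun I J => 2 * (ddF F z I J).im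

/-- The bilinear form `g = ∑ N_IJ dz^I dz̄^J` at the point `z`. -/
def domMetric {n : ℕ} (F : (Fin (n + 1) → ℂ) → ℂ) (z a b : Fin (n + 1) → ℂ) : ℝ :=
  (∑ I, ∑ J, (matN F z I J : ℂ) * a I * (starRingEnd ℂ) (b J)).re

/-- A conical special Kähler domain: a `ℂ^*`-invariant open subset of `ℂ^{n+1} \ {0}` with a
holomorphic prepotential `F`, homogeneous of degree two, such that `(N_IJ)` has signature `(1, n)`
and `f = ∑ N_IJ z^I z̄^J > 0`. -/
structure ConicalDomain (n : ℕ) where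
  /-- the underlying open set -/
  carrier : Set (Fin (n + 1) → ℂ)
  /-- the holomorphic prepotential -/
  F : (Fin (n + 1) → ℂ) → ℂ
  isOpen : IsOpen carrier
  zero_notMem : (0 : Fin (n + 1) → ℂ) ∉ carrier
  smul_mem : ∀ a : ℂ, a ≠ 0 → ∀ z ∈ carrier, a • z ∈ carrier
  holomorphic : DifferentiableOn ℂ F carrier
  homogeneous : ∀ a : ℂ, a ≠ 0 → ∀ z ∈ carrier, F (a • z) = a ^ 2 * F z
  signature : ∀ z ∈ carrier, ∃ P : Matrix (Fin (n + 1)) (Fin (n + 1)) ℝ, IsUnit P.det ∧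
    P.transpose * matN F z * P = Matrix.diagonal (fun I => if I = 0 then 1 else -1)
  f_pos : ∀ z ∈ carrier, 0 < domMetric F z z z

section Charts

variable {n : ℕ} {M : Type*} [TopologicalSpace M]
  [ChartedSpace (EuclideanSpace ℝ (Fin (2 * n + 2))) M] [IsManifold (𝓡 (2 * n + 2)) ∞ M]
  [MulAction ℂˣ M]

/-- A system of conical affine special coordinates `z : M_α → ℂ^{n+1}` with `z^0 ≠ 0`: an
isomorphism of conical affine special Kähler manifolds from a `ℂ^*`-invariant open subset `M_α` of
`M` onto a conical special Kähler domain. The special connection of the domain is the one for which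
the functions `Re z^I` and `Re F_I` are affine. -/
structure SpecialChart (C : ConicalSpecialKaehler n M) where
  /-- the conical special Kähler domain -/
  dom : ConicalDomain n
  /-- the subset `M_α` of `M` -/
  source : Set M
  /-- the coordinates -/
  z : M → Fin (n + 1) → ℂ
  isOpen_source : IsOpen source
  smul_mem_source : ∀ (a : ℂˣ), ∀ p ∈ source, a • p ∈ source
  dom_ne_zero : ∀ w ∈ dom.carrier, w 0 ≠ 0
  bijOn : Set.BijOn z source dom.carrier
  localDiffeo : IsLocalDiffeomorphOn (𝓡 (2 * n + 2)) 𝓘(ℝ, Fin (n + 1) → ℂ) ∞ z source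
  equivariant : ∀ (a : ℂˣ), ∀ p ∈ source, z (a • p) = (a : ℂ) • z p
  holomorphic : ∀ p ∈ source, ∀ v : TangentSpace (𝓡 (2 * n + 2)) p,
    mvfderiv (𝓡 (2 * n + 2)) z p (C.J p v) = Complex.I • mvfderiv (𝓡 (2 * n + 2)) z p v
  isometric : ∀ p ∈ source, ∀ v w : TangentSpace (𝓡 (2 * n + 2)) p,
    C.g p v w = domMetric dom.F (z p) (mvfderiv (𝓡 (2 * n + 2)) z p v)
      (mvfderiv (𝓡 (2 * n + 2)) z p w)
  affine_z : ∀ I, IsAffineFunOn C.nabla (fun p => (z p I).re) source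
  affine_F : ∀ I, IsAffineFunOn C.nabla (fun p => (dF dom.F I (z p)).re) source

/-- The conical Lagrangian immersion `φ_α = (z^I, F_I)`. -/
def SpecialChart.phi {C : ConicalSpecialKaehler n M} (S : SpecialChart C) (p : M) :
    Fin (n + 1) ⊕ Fin (n + 1) → ℂ :=
  Sum.elim (S.z p) (fun I => dF S.dom.F I (S.z p))

/-- The inhomogeneous coordinates `X^μ = z^μ / z^0`, `μ = 1, …, n`. -/
def SpecialChart.X {C : ConicalSpecialKaehler n M} (S : SpecialChart C) (p : M) : Fin n → ℂ :=
  fun μ => S.z p μ.succ / S.z p 0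

end Charts

/-! ### The one-loop deformed Ferrara-Sabharwal metric on a coordinate domain -/

/-- The space of coordinates `(X^μ, ρ, φ̃, p_a)`, where `p_a = (ζ̃_I, ζ^J)`. -/
abbrev Coord (n : ℕ) : Type := (Fin n → ℂ) × ℝ × ℝ × (Fin (n + 1) ⊕ Fin (n + 1) → ℝ)

/-- The point `(1, X^1, …, X^n)` of `ℂ^{n+1}`. -/
def hom {n : ℕ} (X : Fin n → ℂ) : Fin (n + 1) → ℂ := Matrix.vecCons 1 X

/-- The projective special Kähler metric `ḡ(dX, dX)` on the domain of inhomogeneous coordinates: the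
pull-back of `-g / f + (α² + (J^*α)²) / f²`, `α = g(ξ, ·)`, by the section `X ↦ (1, X)`. -/
def gBar {n : ℕ} (F : (Fin (n + 1) → ℂ) → ℂ) (X dX : Fin n → ℂ) : ℝ :=
  let z : Fin (n + 1) → ℂ := hom X
  let dz : Fin (n + 1) → ℂ := Matrix.vecCons 0 dX
  let f : ℝ := domMetric F z z z;
  -(domMetric F z dz dz / f)
    + ((domMetric F z z dz) ^ 2 + (domMetric F z z (Complex.I • dz)) ^ 2) / f ^ 2

/-- The Kähler potential `𝒦 = - log ∑ X^I N_IJ X̄^J`. -/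
def potK {n : ℕ} (F : (Fin (n + 1) → ℂ) → ℂ) (X : Fin n → ℂ) : ℝ :=
  - Real.log (domMetric F (hom X) (hom X) (hom X))

/-- `d^c 𝒦 = - d𝒦 ∘ J`. -/
def dcK {n : ℕ} (F : (Fin (n + 1) → ℂ) → ℂ) (X dX : Fin n → ℂ) : ℝ :=
  - fderiv ℝ (potK F) X (Complex.I • dX)

/-- The matrix `𝓝_IJ = F̄_IJ + i (∑ N_IK z^K) (∑ N_JL z^L) / ∑ N_IJ z^I z^J`. -/
def matCalN {n : ℕ} (F : (Fin (n + 1) → ℂ) → ℂ) (z : Fin (n + 1) → ℂ) :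
    Matrix (Fin (n + 1)) (Fin (n + 1)) ℂ :=
  fun I J => (starRingEnd ℂ) (ddF F z I J)
    + Complex.I * ((∑ K, (matN F z I K : ℂ) * z K) * (∑ L, (matN F z J L : ℂ) * z L))
      / (∑ K, ∑ L, (matN F z K L : ℂ) * z K * z L)

/-- `𝓡 = Re 𝓝`. -/
def matR {n : ℕ} (F : (Fin (n + 1) → ℂ) → ℂ) (z : Fin (n + 1) → ℂ) :
    Matrix (Fin (n + 1)) (Fin (n + 1)) ℝ := fun I J => (matCalN F z I J).re

/-- `𝓘 = Im 𝓝`. -/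
def matI {n : ℕ} (F : (Fin (n + 1) → ℂ) → ℂ) (z : Fin (n + 1) → ℂ) :
    Matrix (Fin (n + 1)) (Fin (n + 1)) ℝ := fun I J => (matCalN F z I J).im

/-- The matrix `Ĥ`. -/
def matH {n : ℕ} (F : (Fin (n + 1) → ℂ) → ℂ) (z : Fin (n + 1) → ℂ) :
    Matrix (Fin (n + 1) ⊕ Fin (n + 1)) (Fin (n + 1) ⊕ Fin (n + 1)) ℝ :=
  Matrix.fromBlocks (matI F z)⁻¹ ((matI F z)⁻¹ * matR F z)
    (matR F z * (matI F z)⁻¹) (matI F z + matR F z * (matI F z)⁻¹ * matR F z)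

/-- The quadratic form `u ↦ g^c_FS(u, u)` of the one-loop deformed Ferrara-Sabharwal metric at the
point `e = (X, ρ, φ̃, p)`, evaluated on `u = (dX, dρ, dφ̃, dp)`. -/
def gFS {n : ℕ} (c : ℝ) (F : (Fin (n + 1) → ℂ) → ℂ) (e u : Coord n) : ℝ :=
  let X := e.1
  let ρ := e.2.1
  let ζt : Fin (n + 1) → ℝ := fun I => e.2.2.2 (Sum.inl I)
  let ζ : Fin (n + 1) → ℝ := fun I => e.2.2.2 (Sum.inr I)
  let dX := u.1
  let dρ := u.2.1
  let dφ := u.2.2.1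
  let dp := u.2.2.2
  let dζt : Fin (n + 1) → ℝ := fun I => dp (Sum.inl I)
  let dζ : Fin (n + 1) → ℝ := fun I => dp (Sum.inr I);
  (ρ + c) / ρ * gBar F X dX
    + 1 / (4 * ρ ^ 2) * ((ρ + 2 * c) / (ρ + c)) * dρ ^ 2
    + 1 / (4 * ρ ^ 2) * ((ρ + c) / (ρ + 2 * c))
      * (dφ + ∑ I, (ζ I * dζt I - ζt I * dζ I) + c * dcK F X dX) ^ 2
    + 1 / (2 * ρ) * (dp ⬝ᵥ (matH F (hom X)).mulVec dp)
    + 2 * c / ρ ^ 2 * Real.exp (potK F X)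
      * ‖∑ I, (hom X I * (dζt I : ℂ) + dF F I (hom X) * (dζ I : ℂ))‖ ^ 2

/-! ### The global manifold -/

section Global

variable {n : ℕ} {M : Type*} [TopologicalSpace M]
  [ChartedSpace (EuclideanSpace ℝ (Fin (2 * n + 2))) M] [IsManifold (𝓡 (2 * n + 2)) ∞ M]
  [MulAction ℂˣ M] {C : ConicalSpecialKaehler n M}

/-- `N̄_α = M̄_α × ℝ^{>0} × S^1_c × ℝ^{2n+2}` with `S^1_c = ℝ / 2πcℤ`, where
`M̄_α = M_α / ℂ^*` is identified with its image `{X | (1, X) ∈ z(M_α)}` under the inhomogeneous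
coordinates. -/
def LocalN (S : SpecialChart C) (c : ℝ) : Type :=
  {x : (Fin n → ℂ) × ℝ × AddCircle (2 * Real.pi * c) × (Fin (n + 1) ⊕ Fin (n + 1) → ℝ) //
    hom x.1 ∈ S.dom.carrier ∧ 0 < x.2.1}

instance (S : SpecialChart C) (c : ℝ) : TopologicalSpace (LocalN S c) :=
  inferInstanceAs (TopologicalSpace {x : (Fin n → ℂ) × ℝ × AddCircle (2 * Real.pi * c) ×
    (Fin (n + 1) ⊕ Fin (n + 1) → ℝ) // hom x.1 ∈ S.dom.carrier ∧ 0 < x.2.1})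

variable {A : Type*}

/-- The gluing relation on the disjoint union of the `N̄_α`. The point `p` lies over the common
point `m_α = m_β` of `M̄`, the matrix `O` is the real symplectic transition matrix
`φ_β = O φ_α` near `p`, and `- i c log w = c arg w` modulo `2πc` for `|w| = 1`. -/
def glue (U : A → SpecialChart C) (c : ℝ) (x y : Σ α, LocalN (U α) c) : Prop :=
  ∃ p : M, p ∈ (U x.1).source ∧ p ∈ (U y.1).source ∧
    x.2.1.1 = (U x.1).X p ∧ y.2.1.1 = (U y.1).X p ∧
    y.2.1.2.1 = x.2.1.2.1 ∧
    y.2.1.2.2.1 = x.2.1.2.2.1 + ((c * Complex.arg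
      (((U x.1).z p 0 * (starRingEnd ℂ) ((U y.1).z p 0))
        / ((U y.1).z p 0 * (starRingEnd ℂ) ((U x.1).z p 0))) : ℝ) :
          AddCircle (2 * Real.pi * c)) ∧
    ∃ O ∈ Matrix.symplecticGroup (Fin (n + 1)) ℝ,
      (∀ᶠ q in 𝓝 p, (U y.1).phi q = (O.map (fun r : ℝ => (r : ℂ))).mulVec ((U x.1).phi q)) ∧
      y.2.1.2.2.2 = (O.transpose⁻¹).mulVec x.2.1.2.2.2

/-- The space `N̄`, glued from the `N̄_α`. -/
def NBar (U : A → SpecialChart C) (c : ℝ) : Type _ := Quot (glue U c)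

instance (U : A → SpecialChart C) (c : ℝ) : TopologicalSpace (NBar U c) :=
  inferInstanceAs (TopologicalSpace (Quot (glue U c)))

/-- The open set of coordinates `(X, ρ, φ̃, p)` with `X ∈ M̄_α` and `ρ > 0`. -/
def coordDomain (S : SpecialChart C) : TopologicalSpace.Opens (Coord n) where
  carrier := {e | hom e.1 ∈ S.dom.carrier ∧ 0 < e.2.1}
  is_open' := by
    have h : Continuous (fun e : Coord n => hom e.1) := by
      refine continuous_pi fun I => ?_
      refine Fin.cases ?_ (fun μ => ?_) I
      · exact continuous_const
      · exact (continuous_apply μ).comp continuous_fst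
    exact (S.dom.isOpen.preimage h).inter
      (isOpen_lt continuous_const (continuous_fst.comp continuous_snd))

/-- The point of `N̄` with coordinates `(X, ρ, φ̃, p)` in `N̄_α`. -/
def coordMap (U : A → SpecialChart C) (c : ℝ) (α : A) (e : coordDomain (U α)) : NBar U c :=
  Quot.mk _ ⟨α, ⟨(e.1.1, e.1.2.1, (e.1.2.2.1 : AddCircle (2 * Real.pi * c)), e.1.2.2.2), e.2⟩⟩

/-- The smooth structure and the Riemannian metric of `N̄` are the ones of the global one-loop
deformed Ferrara-Sabharwal manifold: each system of coordinates on an `N̄_α` is a local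
diffeomorphism, in which the metric is `g^c_FS`. -/
structure IsOneLoopMetric (U : A → SpecialChart C) (c : ℝ) [ChartedSpace (Coord n) (NBar U c)]
    [IsManifold 𝓘(ℝ, Coord n) ∞ (NBar U c)]
    (g : Bundle.ContMDiffRiemannianMetric 𝓘(ℝ, Coord n) ∞ (Coord n)
      (TangentSpace 𝓘(ℝ, Coord n) : NBar U c → Type _)) : Prop where
  localDiffeo : ∀ α, IsLocalDiffeomorph 𝓘(ℝ, Coord n) 𝓘(ℝ, Coord n) ∞ (coordMap U c α)
  metric_eq : ∀ (α : A) (e : coordDomain (U α)) (u : Coord n),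
    g.inner (coordMap U c α e)
      (mfderiv 𝓘(ℝ, Coord n) 𝓘(ℝ, Coord n) (coordMap U c α) e u)
      (mfderiv 𝓘(ℝ, Coord n) 𝓘(ℝ, Coord n) (coordMap U c α) e u)
    = gFS c (U α).dom.F e.1 u

end Global

/-- A Riemannian metric on a manifold is complete: every sequence that is Cauchy for the Riemannian
distance converges. -/
def IsCompleteMetric {E : Type*} [NormedAddCommGroup E] [NormedSpace ℝ E] {N : Type*}
    [TopologicalSpace N] [ChartedSpace E N] [IsManifold 𝓘(ℝ, E) ∞ N]
    (g : Bundle.ContMDiffRiemannianMetric 𝓘(ℝ, E) ∞ E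
      (fun x : N => TangentSpace 𝓘(ℝ, E) x)) : Prop :=
  letI : Bundle.RiemannianBundle (fun x : N => TangentSpace 𝓘(ℝ, E) x) := ⟨g.toRiemannianMetric⟩
  ∀ u : ℕ → N,
    (∀ ε > 0, ∃ k, ∀ i ≥ k, ∀ j ≥ k, Manifold.riemannianEDist 𝓘(ℝ, E) (u i) (u j) < ε) →
    ∃ x, Filter.Tendsto u Filter.atTop (𝓝 x)

end OneLoop
end

noncomputable section

namespace OneLoop

/-! ### Holomorphic functions of several variables -/

section SeveralVariables

variable {V : Type*} [NormedAddCommGroup V] [NormedSpace ℂ V]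

/-! Completeness rests on two features of the metric. It dominates `ḡ + dρ² / (4ρ²)` (`le_gFS`), so
short curves in `N̄` project to short curves in `M̄` and on the line of `log ρ`. And the
translations `heisenberg` in `(φ̃, p)` preserve the metric and act transitively on the fibres of
`(X, ρ)` (`gFS_heisenberg`), so over a neighbourhood of a given `(X, ρ)` all balls of one fixed
radius are relatively compact (`IsOneLoopMetric.exists_isCompact`). Hence a Cauchy sequence
converges as soon as its image in the base and on the `ρ`-line accumulates.

For the base, a curve in `M̄` is lifted to `M` orthogonally to `ξ` and `Jξ`. The function `f` is
constant along the lift `y`, and `-g(y', y') = f ḡ(X', X')`. On the manifold with boundary `df = 2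
g(ξ, ·)`, so at a boundary point `H_p` contains the orthogonal complement of `ξ` and `Jξ`, and the
assumption on the kernel says that a vector of this complement which is not negative lies in `span
{ξ, Jξ}` (`RegularBoundary.mem_dist`). A compactness argument on the unit sphere turns this into
`-g(v, v) ≥ ε f |v|²` for horizontal `v` near `p`, with `|v|` the norm in a chart that includes the
boundary (`exists_lower_bound`, `RegularBoundary.exists_bound`). The factor `f` cancels: the lift
has chart speed at most `ε^(-1/2)` times the speed of the curve, however close it is to the
boundary. It therefore stays in a small chart ball, and a compact set of the manifold with boundary
meets a level `f = f₀ > 0` in a compact subset of `M`. The resulting radius depends only on `p`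
(`IsOneLoopMetric.exists_isCompact_base`), and compactness of the quotient by `ℂ^*`, with the
equivariance of the embedding, provides a `p` near which infinitely many terms of the sequence can
be lifted. No horizontal lift is integrated: `exists_lift` passes from infinitesimal lifts in a
compact space to the endpoint.

That `N̄` carries the metric is special geometry. In two special charts the functions `Re z^I`, `Re
F_I` are affine for the same flat connection, so their differentials are related by a constant real
matrix. Homogeneity of the prepotentials excludes translations, and invariance of the Kähler form
makes the matrix symplectic (`exists_symplectic_of_flat`, `SpecialChart.exists_transition`). The
ingredients of the formula come from objects on `ℂ^{2n+2}` that such a matrix preserves: `N` from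
the pairing of `V` with its conjugate, `Ĥ` from the splitting into the line of `φ` and conjugate
horizontal vectors. The change of `c d^c𝒦` is compensated by the shift of `φ̃` (`gFS_transCoord`).
Positivity follows from the Lorentzian signature of `N`: the orthogonal complement of a positive
vector is negative. Finally `N̄` is Hausdorff because the action on `M` is proper. -/

theorem norm_fderiv_le_of_forall_mem_closedBall {f : V → ℂ} {w : V} {R K : ℝ} (hR : 0 < R)
    (hf : ∀ z ∈ Metric.closedBall w R, DifferentiableAt ℂ f z)
    (hK : ∀ z ∈ Metric.closedBall w R, ‖f z‖ ≤ K) : ‖fderiv ℂ f w‖ ≤ K / R := by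
  have hK0 : 0 ≤ K := (norm_nonneg _).trans (hK w (Metric.mem_closedBall_self hR.le))
  refine ContinuousLinearMap.opNorm_le_of_unit_norm (by positivity) fun u hu => ?_
  have hmem : ∀ t ∈ Metric.closedBall (0 : ℂ) R, w + t • u ∈ Metric.closedBall w R := by
    intro t ht
    simpa [dist_eq_norm, norm_smul, hu] using ht
  have hline : ∀ t : ℂ, HasDerivAt (fun t : ℂ => w + t • u) u t := fun t => by
    simpa using ((hasDerivAt_id t).smul_const u).const_add w
  have hd : DiffContOnCl ℂ (fun t : ℂ => f (w + t • u)) (Metric.ball 0 R) := by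
    refine DifferentiableOn.diffContOnCl fun t ht => ?_
    rw [closure_ball _ hR.ne'] at ht
    exact ((hf _ (hmem t ht)).comp t (hline t).differentiableAt).differentiableWithinAt
  have h1 := Complex.norm_deriv_le_of_forall_mem_sphere_norm_le hR hd
    (fun z hz => hK _ (hmem z (Metric.sphere_subset_closedBall hz)))
  have h2 : HasDerivAt (fun t : ℂ => f (w + t • u)) (fderiv ℂ f w u) 0 := by
    have h := (hf w (Metric.mem_closedBall_self hR.le)).hasFDerivAt
    have h' : HasFDerivAt f (fderiv ℂ f w) (w + (0 : ℂ) • u) := by simpa using h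
    exact h'.comp_hasDerivAt (0 : ℂ) (hline 0)
  rwa [h2.deriv] at h1

variable [FiniteDimensional ℂ V]

/-- Cauchy's formula on the complex line through `z` in the direction `v` writes the directional
derivative as an integral of values of `f` over a circle. Near a given point the radius can be kept
fixed, and one differentiates under the integral sign. The Cauchy estimate provides the dominating
function. -/
theorem differentiableOn_fderiv_apply {f : V → ℂ} {s : Set V} (hs : IsOpen s)
    (hf : DifferentiableOn ℂ f s) (v : V) :
    DifferentiableOn ℂ (fun z => fderiv ℂ f z v) s := by
  have : ProperSpace V := FiniteDimensional.proper ℂ V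
  let : MeasurableSpace V := borel V
  have : BorelSpace V := ⟨rfl⟩
  intro z₀ hz₀
  obtain ⟨R, hR, hRs⟩ := Metric.nhds_basis_closedBall.mem_iff.1 (hs.mem_nhds hz₀)
  obtain ⟨K, hK⟩ := (isCompact_closedBall z₀ R).exists_bound_of_continuousOn
    (hf.continuousOn.mono hRs)
  have hdf : ∀ z ∈ Metric.closedBall z₀ R, DifferentiableAt ℂ f z :=
    fun z hz => (hf z (hRs hz)).differentiableAt (hs.mem_nhds (hRs hz))
  -- The radius `R` is divided into thirds: one for the variation of `z`, one for the circle in the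
  -- direction `v`, one for the Cauchy estimate of the derivative at the resulting point.
  obtain ⟨r, hr, hrv⟩ : ∃ r > 0, r * ‖v‖ ≤ R / 3 := by
    refine ⟨R / 3 / (‖v‖ + 1), by positivity, ?_⟩
    rw [div_mul_eq_mul_div, div_le_iff₀ (by positivity)]
    nlinarith [norm_nonneg v]
  have hin : ∀ z ∈ Metric.ball z₀ (R / 3), ∀ ζ : ℂ, ‖ζ‖ ≤ r →
      z + ζ • v ∈ Metric.closedBall z₀ (2 * R / 3) := by
    intro z hz ζ hζ
    rw [mem_closedBall_iff_norm]
    rw [mem_ball_iff_norm] at hz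
    calc ‖z + ζ • v - z₀‖ = ‖(z - z₀) + ζ • v‖ := by congr 1; abel
      _ ≤ ‖z - z₀‖ + ‖ζ‖ * ‖v‖ := (norm_add_le _ _).trans (by rw [norm_smul])
      _ ≤ R / 3 + r * ‖v‖ := by gcongr
      _ ≤ 2 * R / 3 := by linarith
  have hsub : Metric.closedBall z₀ (2 * R / 3) ⊆ Metric.closedBall z₀ R :=
    Metric.closedBall_subset_closedBall (by linarith)
  have hbound : ∀ w ∈ Metric.closedBall z₀ (2 * R / 3), ‖fderiv ℂ f w‖ ≤ K / (R / 3) := by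
    intro w hw
    have hww : Metric.closedBall w (R / 3) ⊆ Metric.closedBall z₀ R := by
      refine Metric.closedBall_subset_closedBall' ?_
      have := Metric.mem_closedBall.1 hw
      linarith
    exact norm_fderiv_le_of_forall_mem_closedBall (by positivity) (fun z hz => hdf z (hww hz))
      (fun z hz => hK z (hww hz))
  have hcirc : ∀ θ : ℝ, ‖circleMap 0 r θ‖ ≤ r := fun θ => by simp [abs_of_pos hr]
  -- The kernel `dζ / ζ²` of Cauchy's formula for the first derivative, parametrized by the angle.
  let k : ℝ → ℂ := fun θ => deriv (circleMap 0 r) θ * (circleMap 0 r θ ^ 2)⁻¹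
  have hk : Continuous k := by
    refine Continuous.mul ?_ ?_
    · rw [show deriv (circleMap 0 r) = fun θ => circleMap 0 r θ * Complex.I from
        funext fun θ => by simp [deriv_circleMap]]
      fun_prop
    · refine Continuous.inv₀ (by fun_prop) fun θ => ?_
      exact pow_ne_zero _ (circleMap_ne_center hr.ne')
  have hcont : ∀ z ∈ Metric.ball z₀ (R / 3),
      Continuous (fun θ : ℝ => f (z + circleMap 0 r θ • v)) := by
    intro z hz
    refine (hf.continuousOn.mono (hsub.trans hRs)).comp_continuous (by fun_prop) fun θ => ?_
    exact hin z hz _ (hcirc θ)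
  have key := intervalIntegral.hasFDerivAt_integral_of_dominated_of_fderiv_le (𝕜 := ℂ)
    (μ := MeasureTheory.volume) (a := 0) (b := 2 * Real.pi)
    (s := Metric.ball z₀ (R / 3)) (bound := fun θ => ‖k θ‖ * (K / (R / 3)))
    (F := fun z θ => k θ * f (z + circleMap 0 r θ • v))
    (F' := fun z θ => k θ • fderiv ℂ f (z + circleMap 0 r θ • v)) (x₀ := z₀)
    (Metric.ball_mem_nhds z₀ (by positivity)) ?_ ?_ ?_ ?_ ?_ ?_
  rotate_left
  · filter_upwards [Metric.ball_mem_nhds z₀ (show 0 < R / 3 by positivity)] with z hz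
    exact (hk.mul (hcont z hz)).aestronglyMeasurable
  · exact (hk.mul (hcont z₀ (Metric.mem_ball_self (by positivity)))).intervalIntegrable _ _
  · refine hk.aestronglyMeasurable.smul ?_
    exact ((measurable_fderiv ℂ f).comp
      (show Measurable fun θ : ℝ => z₀ + circleMap 0 r θ • v from
        (by fun_prop : Continuous fun θ : ℝ => z₀ + circleMap 0 r θ • v).measurable)).aestronglyMeasurable
  · refine Filter.Eventually.of_forall fun θ _ z hz => ?_
    rw [norm_smul]
    gcongr
    exact hbound _ (hin z hz _ (hcirc θ))
  · exact (by fun_prop : Continuous fun θ => ‖k θ‖ * (K / (R / 3))).intervalIntegrable _ _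
  · refine Filter.Eventually.of_forall fun θ _ z hz => ?_
    have h := (hdf _ (hsub (hin z hz _ (hcirc θ)))).hasFDerivAt
    exact (h.comp z ((hasFDerivAt_id z).add_const _)).const_mul (k θ)
  refine DifferentiableAt.differentiableWithinAt ?_
  have hrep : (fun z => fderiv ℂ f z v) =ᶠ[𝓝 z₀] fun z => (2 * Real.pi * Complex.I : ℂ)⁻¹ *
      ∫ θ in (0 : ℝ)..(2 * Real.pi), k θ * f (z + circleMap 0 r θ • v) := by
    filter_upwards [Metric.ball_mem_nhds z₀ (show 0 < R / 3 by positivity)] with z hz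
    have hline : ∀ t : ℂ, HasDerivAt (fun t : ℂ => z + t • v) v t := fun t => by
      simpa using ((hasDerivAt_id t).smul_const v).const_add z
    have h2 : HasDerivAt (fun t : ℂ => f (z + t • v)) (fderiv ℂ f z v) 0 := by
      have h := (hdf z (hsub (by simpa using hin z hz 0 (by simpa using hr.le)))).hasFDerivAt
      have h' : HasFDerivAt f (fderiv ℂ f z) (z + (0 : ℂ) • v) := by simpa using h
      exact h'.comp_hasDerivAt (0 : ℂ) (hline 0)
    have hU : IsOpen ((fun t : ℂ => z + t • v) ⁻¹' s) := hs.preimage (by fun_prop)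
    have h3 := Complex.two_pi_I_inv_smul_circleIntegral_sub_sq_inv_smul_of_differentiable hU
      (c := 0) (w₀ := 0) (R := r) (f := fun t : ℂ => f (z + t • v))
      (fun t ht => hRs (hsub (hin z hz t (by simpa using ht))))
      (fun t ht => ((hf _ ht).differentiableAt (hs.mem_nhds ht)).comp t
        (hline t).differentiableAt |>.differentiableWithinAt) (Metric.mem_ball_self hr)
    rw [h2.deriv] at h3
    rw [← h3, smul_eq_mul, circleIntegral]
    congr 1
    refine intervalIntegral.integral_congr fun θ _ => ?_
    simp only [k, smul_eq_mul, sub_zero]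
    ring
  exact (key.differentiableAt.const_mul _).congr_of_eventuallyEq hrep

/-- By induction on the order: in finite dimension `C^k` regularity of the derivative can be tested
on each vector, and the directional derivatives are again holomorphic. -/
theorem contDiffOn_of_differentiableOn_complex {f : V → ℂ} {s : Set V} (hs : IsOpen s)
    (hf : DifferentiableOn ℂ f s) : ContDiffOn ℂ ∞ f s := by
  refine contDiffOn_infty.2 fun k => ?_
  induction k generalizing f with
  | zero => simpa using hf.continuousOn
  | succ k ih =>
    have hk : ((k + 1 : ℕ) : WithTop ℕ∞) = (k : WithTop ℕ∞) + 1 := by norm_cast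
    rw [hk, contDiffOn_succ_iff_fderiv_of_isOpen hs]
    refine ⟨hf, fun h => ?_, ?_⟩
    · exact absurd h (by exact_mod_cast WithTop.natCast_ne_top (α := ℕ∞) k)
    · rw [contDiffOn_clm_apply]
      exact fun v => ih (differentiableOn_fderiv_apply hs hf v)

end SeveralVariables

open ComplexConjugate

/-! ### Hermitian forms of Lorentzian signature -/

section Hermitian

variable {m : Type*} [Fintype m]

theorem mulVec_dotProduct {R : Type*} [CommRing R] (A : Matrix m m R) (v w : m → R) :
    A.mulVec v ⬝ᵥ w = v ⬝ᵥ A.transpose.mulVec w := by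
  rw [dotProduct_comm, Matrix.dotProduct_mulVec, dotProduct_comm, Matrix.mulVec_transpose]

/-- The hermitian form of a real matrix. -/
def hermForm (N : Matrix m m ℝ) (a b : m → ℂ) : ℂ :=
  ∑ I, ∑ J, (N I J : ℂ) * a I * conj (b J)

theorem hermForm_eq_dotProduct (N : Matrix m m ℝ) (a b : m → ℂ) :
    hermForm N a b = a ⬝ᵥ (N.map (fun r : ℝ => (r : ℂ))).mulVec (star b) := by
  simp only [hermForm, dotProduct, Matrix.mulVec, Finset.mul_sum, Matrix.map_apply, Pi.star_apply]
  refine Finset.sum_congr rfl fun I _ => Finset.sum_congr rfl fun J _ => ?_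
  simp only [RCLike.star_def]
  ring

theorem hermForm_add_left (N : Matrix m m ℝ) (a a' b : m → ℂ) :
    hermForm N (a + a') b = hermForm N a b + hermForm N a' b := by
  simp [hermForm_eq_dotProduct]

theorem hermForm_smul_left (N : Matrix m m ℝ) (k : ℂ) (a b : m → ℂ) :
    hermForm N (k • a) b = k * hermForm N a b := by
  simp [hermForm_eq_dotProduct]

theorem hermForm_add_right (N : Matrix m m ℝ) (a b b' : m → ℂ) :
    hermForm N a (b + b') = hermForm N a b + hermForm N a b' := by
  simp [hermForm_eq_dotProduct, Matrix.mulVec_add]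

theorem hermForm_smul_right (N : Matrix m m ℝ) (k : ℂ) (a b : m → ℂ) :
    hermForm N a (k • b) = conj k * hermForm N a b := by
  simp [hermForm_eq_dotProduct, Matrix.mulVec_smul]

theorem hermForm_conj_symm {N : Matrix m m ℝ} (hN : N.IsSymm) (a b : m → ℂ) :
    conj (hermForm N a b) = hermForm N b a := by
  simp only [hermForm, map_sum, map_mul, Complex.conj_ofReal, Complex.conj_conj]
  rw [Finset.sum_comm]
  refine Finset.sum_congr rfl fun I _ => Finset.sum_congr rfl fun J _ => ?_
  rw [hN.apply]
  ring

theorem hermForm_self_im {N : Matrix m m ℝ} (hN : N.IsSymm) (a : m → ℂ) :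
    (hermForm N a a).im = 0 := Complex.conj_eq_iff_im.1 (hermForm_conj_symm hN a a)

theorem hermForm_star_star (N : Matrix m m ℝ) (a b : m → ℂ) :
    hermForm N (star a) (star b) = conj (hermForm N a b) := by
  simp [hermForm]

theorem hermForm_mulVec [DecidableEq m] (N P : Matrix m m ℝ) (a b : m → ℂ) :
    hermForm N ((P.map (fun r : ℝ => (r : ℂ))).mulVec a) ((P.map (fun r : ℝ => (r : ℂ))).mulVec b)
      = hermForm (P.transpose * N * P) a b := by
  have h1 : star ((P.map (fun r : ℝ => (r : ℂ))).mulVec b)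
      = (P.map (fun r : ℝ => (r : ℂ))).mulVec (star b) := by
    ext I
    simp [Matrix.mulVec, dotProduct]
  have h2 : (P.transpose * N * P).map (fun r : ℝ => (r : ℂ))
      = (P.map (fun r : ℝ => (r : ℂ))).transpose * N.map (fun r : ℝ => (r : ℂ))
        * P.map (fun r : ℝ => (r : ℂ)) := by
    have := Matrix.map_mul (L := P.transpose * N) (M := P) (f := Complex.ofRealHom)
    have h3 := Matrix.map_mul (L := P.transpose) (M := N) (f := Complex.ofRealHom)
    rw [h3] at this
    exact this
  rw [hermForm_eq_dotProduct, hermForm_eq_dotProduct, h1, h2, ← Matrix.mulVec_mulVec,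
    ← Matrix.mulVec_mulVec, mulVec_dotProduct]

end Hermitian

/-- The symmetric matrix `N` has signature `(1, n)`. -/
def IsLorentzian {n : ℕ} (N : Matrix (Fin (n + 1)) (Fin (n + 1)) ℝ) : Prop :=
  ∃ P : Matrix (Fin (n + 1)) (Fin (n + 1)) ℝ, IsUnit P.det ∧
    P.transpose * N * P = Matrix.diagonal (fun I => if I = 0 then 1 else -1)

theorem hermForm_diagonal_lorentz {n : ℕ} (a b : Fin (n + 1) → ℂ) :
    hermForm (Matrix.diagonal (fun I : Fin (n + 1) => if I = 0 then (1 : ℝ) else -1)) a b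
      = a 0 * conj (b 0) - ∑ k : Fin n, a k.succ * conj (b k.succ) := by
  have : ∀ I : Fin (n + 1), ∑ J, ((Matrix.diagonal (fun I : Fin (n + 1) =>
      if I = 0 then (1 : ℝ) else -1) I J : ℝ) : ℂ) * a I * conj (b J)
      = (if I = 0 then (1 : ℂ) else -1) * a I * conj (b I) := by
    intro I
    rw [Finset.sum_eq_single I]
    · simp only [Matrix.diagonal_apply_eq]
      split_ifs <;> simp
    · intro J _ hJ
      rw [Matrix.diagonal_apply_ne' _ hJ]; simp
    · simp
  simp only [hermForm, this]
  rw [Fin.sum_univ_succ]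
  simp [Fin.succ_ne_zero, sub_eq_add_neg]

/-- A vector orthogonal to a positive vector is negative. -/
theorem IsLorentzian.neg_of_orthogonal {n : ℕ} {N : Matrix (Fin (n + 1)) (Fin (n + 1)) ℝ}
    (hN : IsLorentzian N) {z a : Fin (n + 1) → ℂ} (hz : 0 < (hermForm N z z).re)
    (haz : hermForm N a z = 0) (ha : a ≠ 0) : (hermForm N a a).re < 0 := by
  obtain ⟨P, hP, hPN⟩ := hN
  have hdet : IsUnit (P.map (fun r : ℝ => (r : ℂ))).det := by
    have h := (Complex.ofRealHom.map_det P).symm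
    rw [show (P.map (fun r : ℝ => (r : ℂ))) = Complex.ofRealHom.mapMatrix P from rfl, h]
    exact hP.map _
  have hsurj : ∀ x : Fin (n + 1) → ℂ, ∃ y, (P.map (fun r : ℝ => (r : ℂ))).mulVec y = x := fun x =>
    ⟨(P.map (fun r : ℝ => (r : ℂ)))⁻¹.mulVec x, by
      rw [Matrix.mulVec_mulVec, Matrix.mul_nonsing_inv _ hdet, Matrix.one_mulVec]⟩
  obtain ⟨w, rfl⟩ := hsurj z
  obtain ⟨v, rfl⟩ := hsurj a
  rw [hermForm_mulVec, hPN, hermForm_diagonal_lorentz] at *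
  have hsq : ∀ x : Fin (n + 1) → ℂ, (x 0 * conj (x 0) - ∑ k : Fin n, x k.succ * conj (x k.succ)).re
      = ‖x 0‖ ^ 2 - ∑ k : Fin n, ‖x k.succ‖ ^ 2 := by
    intro x
    simp only [Complex.mul_conj, Complex.normSq_eq_norm_sq, ← Complex.ofReal_sum, Complex.sub_re,
      Complex.ofReal_re]
  rw [hsq] at *
  have hv : v ≠ 0 := by rintro rfl; simp at ha
  -- In the diagonalizing basis orthogonality says that the time components pair to the same number
  -- as the space components, to which the Cauchy–Schwarz inequality applies.
  have hCS : ‖v 0‖ ^ 2 * ‖w 0‖ ^ 2 ≤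
      (∑ k : Fin n, ‖v k.succ‖ ^ 2) * ∑ k : Fin n, ‖w k.succ‖ ^ 2 := by
    have h1 : v 0 * conj (w 0) = ∑ k : Fin n, v k.succ * conj (w k.succ) := sub_eq_zero.1 haz
    have h2 : ‖v 0‖ * ‖w 0‖ ≤ ∑ k : Fin n, ‖v k.succ‖ * ‖w k.succ‖ := by
      calc ‖v 0‖ * ‖w 0‖ = ‖v 0 * conj (w 0)‖ := by simp
        _ ≤ ∑ k : Fin n, ‖v k.succ * conj (w k.succ)‖ := by rw [h1]; exact norm_sum_le _ _
        _ = _ := by simp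
    calc ‖v 0‖ ^ 2 * ‖w 0‖ ^ 2 = (‖v 0‖ * ‖w 0‖) ^ 2 := by ring
      _ ≤ (∑ k : Fin n, ‖v k.succ‖ * ‖w k.succ‖) ^ 2 := by gcongr
      _ ≤ _ := Finset.sum_mul_sq_le_sq_mul_sq _ _ _
  have hw : 0 < ‖w 0‖ ^ 2 := by
    have : 0 ≤ ∑ k : Fin n, ‖w k.succ‖ ^ 2 := by positivity
    linarith
  -- If the space part of `v` is zero then so is its time part, because the time component of `w` is
  -- not; this contradicts `v ≠ 0`.
  rcases (show 0 ≤ ∑ k : Fin n, ‖v k.succ‖ ^ 2 by positivity).eq_or_lt with h0 | h0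
  · exfalso
    rw [← h0, zero_mul] at hCS
    have hv0 : ‖v 0‖ ^ 2 = 0 := by nlinarith [sq_nonneg ‖v 0‖]
    have hk := (Finset.sum_eq_zero_iff_of_nonneg (fun k _ => by positivity)).1 h0.symm
    refine hv (funext fun I => ?_)
    refine Fin.cases ?_ (fun k => ?_) I
    · simpa using hv0
    · simpa using hk k (Finset.mem_univ k)
  · nlinarith

/-! ### The symplectic form -/

section Symplectic

variable {m R : Type*} [Fintype m] [CommRing R]

/-- The standard symplectic form. -/
def sympForm (V W : m ⊕ m → R) : R :=
  ∑ I, (V (Sum.inr I) * W (Sum.inl I) - V (Sum.inl I) * W (Sum.inr I))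

theorem sympForm_eq_dotProduct [DecidableEq m] (V W : m ⊕ m → R) :
    sympForm V W = V ⬝ᵥ (Matrix.J m R).mulVec W := by
  simp [sympForm, dotProduct, Matrix.J, Matrix.fromBlocks_mulVec, Fintype.sum_sum_type,
    Finset.sum_sub_distrib, Matrix.neg_mulVec]
  ring

theorem sympForm_mulVec [DecidableEq m] {O : Matrix (m ⊕ m) (m ⊕ m) R}
    (hO : O ∈ Matrix.symplecticGroup m R) (V W : m ⊕ m → R) :
    sympForm (O.mulVec V) (O.mulVec W) = sympForm V W := by
  rw [sympForm_eq_dotProduct, sympForm_eq_dotProduct, mulVec_dotProduct, Matrix.mulVec_mulVec, Matrix.mulVec_mulVec,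
    SymplecticGroup.mem_iff'.1 hO]

theorem map_ofReal_mem_symplecticGroup [DecidableEq m] {O : Matrix (m ⊕ m) (m ⊕ m) ℝ}
    (hO : O ∈ Matrix.symplecticGroup m ℝ) :
    O.map (fun r : ℝ => (r : ℂ)) ∈ Matrix.symplecticGroup m ℂ := by
  have h := congrArg (fun A : Matrix (m ⊕ m) (m ⊕ m) ℝ => A.map Complex.ofRealHom)
    (SymplecticGroup.mem_iff.1 hO)
  have hJ : (Matrix.J m ℝ).map Complex.ofRealHom = Matrix.J m ℂ := by
    simp [Matrix.J, Matrix.fromBlocks_map, Matrix.map_neg]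
  simp only [Matrix.map_mul, hJ] at h
  exact SymplecticGroup.mem_iff.2 h

theorem sympForm_add_left (V V' W : m ⊕ m → R) :
    sympForm (V + V') W = sympForm V W + sympForm V' W := by
  simp only [sympForm, Pi.add_apply, ← Finset.sum_add_distrib]
  exact Finset.sum_congr rfl fun _ _ => by ring

theorem sympForm_smul_left (k : R) (V W : m ⊕ m → R) :
    sympForm (k • V) W = k * sympForm V W := by
  simp only [sympForm, Pi.smul_apply, smul_eq_mul, Finset.mul_sum]
  exact Finset.sum_congr rfl fun _ _ => by ring

theorem sympForm_swap (V W : m ⊕ m → R) : sympForm V W = - sympForm W V := by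
  simp only [sympForm, ← Finset.sum_neg_distrib]
  exact Finset.sum_congr rfl fun _ _ => by ring

theorem sympForm_add_right (V W W' : m ⊕ m → R) :
    sympForm V (W + W') = sympForm V W + sympForm V W' := by
  rw [sympForm_swap, sympForm_add_left, sympForm_swap V W, sympForm_swap V W']; ring

theorem sympForm_smul_right (k : R) (V W : m ⊕ m → R) :
    sympForm V (k • W) = k * sympForm V W := by
  rw [sympForm_swap, sympForm_smul_left, sympForm_swap V W]; ring

theorem sympForm_star (V W : m ⊕ m → ℂ) : sympForm (star V) (star W) = conj (sympForm V W) := by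
  simp [sympForm]

theorem star_map_ofReal_mulVec {k : Type*} [Fintype k] (O : Matrix k k ℝ) (V : k → ℂ) :
    star ((O.map (fun r : ℝ => (r : ℂ))).mulVec V)
      = (O.map (fun r : ℝ => (r : ℂ))).mulVec (star V) := by
  ext I
  simp [Matrix.mulVec, dotProduct]

end Symplectic

/-! ### Calculus on conical special Kähler domains -/

section Domain

variable {n : ℕ}

/-- The map `z ↦ (z^I, F_I(z))`. -/
def period (F : (Fin (n + 1) → ℂ) → ℂ) (z : Fin (n + 1) → ℂ) : Fin (n + 1) ⊕ Fin (n + 1) → ℂ :=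
  Sum.elim z (fun I => dF F I z)

/-- The differential of `period`. -/
def dPeriod (F : (Fin (n + 1) → ℂ) → ℂ) (z : Fin (n + 1) → ℂ) :
    (Fin (n + 1) → ℂ) →L[ℂ] (Fin (n + 1) ⊕ Fin (n + 1) → ℂ) :=
  LinearMap.toContinuousLinearMap
    { toFun := fun a => Sum.elim a ((ddF F z).mulVec a)
      map_add' := fun a b => by ext (I | I) <;> simp [Matrix.mulVec_add]
      map_smul' := fun k a => by ext (I | I) <;> simp [Matrix.mulVec_smul] }

@[simp] theorem dPeriod_inl (F : (Fin (n + 1) → ℂ) → ℂ) (z a : Fin (n + 1) → ℂ)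
    (I : Fin (n + 1)) : dPeriod F z a (Sum.inl I) = a I := rfl

@[simp] theorem dPeriod_inr (F : (Fin (n + 1) → ℂ) → ℂ) (z a : Fin (n + 1) → ℂ)
    (I : Fin (n + 1)) : dPeriod F z a (Sum.inr I) = ((ddF F z).mulVec a) I := rfl

@[simp] theorem period_inl (F : (Fin (n + 1) → ℂ) → ℂ) (z : Fin (n + 1) → ℂ)
    (I : Fin (n + 1)) : period F z (Sum.inl I) = z I := rfl

@[simp] theorem period_inr (F : (Fin (n + 1) → ℂ) → ℂ) (z : Fin (n + 1) → ℂ)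
    (I : Fin (n + 1)) : period F z (Sum.inr I) = dF F I z := rfl

theorem domMetric_eq (F : (Fin (n + 1) → ℂ) → ℂ) (z a b : Fin (n + 1) → ℂ) :
    domMetric F z a b = (hermForm (matN F z) a b).re := rfl

namespace ConicalDomain

variable (D : ConicalDomain n)

theorem contDiffOn_F : ContDiffOn ℂ ∞ D.F D.carrier :=
  contDiffOn_of_differentiableOn_complex D.isOpen D.holomorphic

theorem differentiableOn_dF (I : Fin (n + 1)) : DifferentiableOn ℂ (dF D.F I) D.carrier :=
  differentiableOn_fderiv_apply D.isOpen D.holomorphic _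

theorem contDiffOn_dF (I : Fin (n + 1)) : ContDiffOn ℂ ∞ (dF D.F I) D.carrier :=
  contDiffOn_of_differentiableOn_complex D.isOpen (D.differentiableOn_dF I)

theorem contDiffOn_ddF (I J : Fin (n + 1)) :
    ContDiffOn ℂ ∞ (fun z => ddF D.F z I J) D.carrier :=
  contDiffOn_of_differentiableOn_complex D.isOpen
    (differentiableOn_fderiv_apply D.isOpen (D.differentiableOn_dF I) _)

variable {D} {z : Fin (n + 1) → ℂ}

theorem fderiv_dF_apply (I : Fin (n + 1)) (a : Fin (n + 1) → ℂ) :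
    fderiv ℂ (dF D.F I) z a = (ddF D.F z).mulVec a I := by
  have h := LinearMap.pi_apply_eq_sum_univ (fderiv ℂ (dF D.F I) z).toLinearMap a
  rw [ContinuousLinearMap.coe_coe] at h
  rw [h, Matrix.mulVec, dotProduct]
  refine Finset.sum_congr rfl fun J _ => ?_
  simp only [smul_eq_mul, ddF]
  rw [mul_comm]
  congr 2
  ext K
  simp [Pi.single_apply, eq_comm]

theorem hasFDerivAt_period (hz : z ∈ D.carrier) : HasFDerivAt (period D.F) (dPeriod D.F z) z := by
  rw [hasFDerivAt_pi']
  rintro (I | I)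
  · have : (ContinuousLinearMap.proj (R := ℂ) (φ := fun _ : Fin (n + 1) ⊕ Fin (n + 1) => ℂ)
        (Sum.inl I)).comp (dPeriod D.F z)
        = ContinuousLinearMap.proj (R := ℂ) (φ := fun _ : Fin (n + 1) => ℂ) I := by
      ext a; rfl
    rw [this]
    exact hasFDerivAt_apply I z
  · have h := ((D.differentiableOn_dF I) z hz).differentiableAt (D.isOpen.mem_nhds hz)
    have h' : (ContinuousLinearMap.proj (R := ℂ) (φ := fun _ : Fin (n + 1) ⊕ Fin (n + 1) => ℂ)
        (Sum.inr I)).comp (dPeriod D.F z) = fderiv ℂ (dF D.F I) z := by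
      refine ContinuousLinearMap.ext fun a => ?_
      exact (fderiv_dF_apply I a).symm
    rw [h']
    exact h.hasFDerivAt

theorem ddF_isSymm (hz : z ∈ D.carrier) : (ddF D.F z).IsSymm := by
  ext I J
  have hd : ∀ᶠ y in 𝓝 z, HasFDerivAt D.F (fderiv ℂ D.F y) y := by
    filter_upwards [D.isOpen.mem_nhds hz] with y hy
    exact ((D.holomorphic y hy).differentiableAt (D.isOpen.mem_nhds hy)).hasFDerivAt
  have h2 : DifferentiableAt ℂ (fderiv ℂ D.F) z :=
    (((contDiffOn_infty_iff_fderiv_of_isOpen D.isOpen).1 D.contDiffOn_F).2.differentiableOn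
      (by simp) z hz).differentiableAt (D.isOpen.mem_nhds hz)
  have h3 := second_derivative_symmetric_of_eventually hd h2.hasFDerivAt
    (Pi.single I 1) (Pi.single J 1)
  have h4 : ∀ K : Fin (n + 1), fderiv ℂ (dF D.F K) z = (fderiv ℂ (fderiv ℂ D.F) z).flip (Pi.single K 1) := by
    intro K
    exact (h2.hasFDerivAt.clm_apply (hasFDerivAt_const (Pi.single K 1) z)).fderiv.trans (by ext; simp)
  rw [Matrix.transpose_apply, ddF, ddF, h4, h4]
  simpa using h3

theorem matN_isSymm (hz : z ∈ D.carrier) : (matN D.F z).IsSymm := by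
  ext I J
  simp only [Matrix.transpose_apply, matN, (ddF_isSymm hz).apply]

theorem isLorentzian_matN (hz : z ∈ D.carrier) : IsLorentzian (matN D.F z) := D.signature z hz

/-- Differentiating the homogeneity relation of degree two gives a factor `k` on the left by the
chain rule, so one degree is lost. The same argument once more gives degree zero for the second
derivatives. -/
theorem dF_smul {k : ℂ} (hk : k ≠ 0) (hz : z ∈ D.carrier) (I : Fin (n + 1)) :
    dF D.F I (k • z) = k * dF D.F I z := by
  have h1 : HasFDerivAt (fun y => D.F (k • y)) ((fderiv ℂ D.F (k • z)).comp
      (k • ContinuousLinearMap.id ℂ (Fin (n + 1) → ℂ))) z := by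
    have hkz := D.smul_mem k hk z hz
    exact ((D.holomorphic _ hkz).differentiableAt (D.isOpen.mem_nhds hkz)).hasFDerivAt.comp z
      ((hasFDerivAt_id z).const_smul k)
  have h2 : HasFDerivAt (fun y => D.F (k • y)) (k ^ 2 • fderiv ℂ D.F z) z := by
    have := ((D.holomorphic z hz).differentiableAt (D.isOpen.mem_nhds hz)).hasFDerivAt.const_mul
      (k ^ 2)
    refine this.congr_of_eventuallyEq ?_
    filter_upwards [D.isOpen.mem_nhds hz] with y hy using D.homogeneous k hk y hy
  have h3 := congrArg (fun L : (Fin (n + 1) → ℂ) →L[ℂ] ℂ => L (Pi.single I 1)) (h1.unique h2)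
  simp only [ContinuousLinearMap.comp_apply, smul_apply,
    ContinuousLinearMap.id_apply, map_smul, smul_eq_mul] at h3
  exact mul_left_cancel₀ hk (by rw [dF, dF, h3]; ring)

theorem ddF_smul {k : ℂ} (hk : k ≠ 0) (hz : z ∈ D.carrier) : ddF D.F (k • z) = ddF D.F z := by
  ext I J
  have h1 : HasFDerivAt (fun y => dF D.F I (k • y)) ((fderiv ℂ (dF D.F I) (k • z)).comp
      (k • ContinuousLinearMap.id ℂ (Fin (n + 1) → ℂ))) z := by
    have hkz := D.smul_mem k hk z hz
    exact ((D.differentiableOn_dF I _ hkz).differentiableAt (D.isOpen.mem_nhds hkz)).hasFDerivAt.comp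
      z ((hasFDerivAt_id z).const_smul k)
  have h2 : HasFDerivAt (fun y => dF D.F I (k • y)) (k • fderiv ℂ (dF D.F I) z) z := by
    have := ((D.differentiableOn_dF I z hz).differentiableAt
      (D.isOpen.mem_nhds hz)).hasFDerivAt.const_mul k
    refine this.congr_of_eventuallyEq ?_
    filter_upwards [D.isOpen.mem_nhds hz] with y hy using dF_smul hk hy I
  have h3 := congrArg (fun L : (Fin (n + 1) → ℂ) →L[ℂ] ℂ => L (Pi.single J 1)) (h1.unique h2)
  simp only [ContinuousLinearMap.comp_apply, smul_apply,
    ContinuousLinearMap.id_apply, map_smul, smul_eq_mul] at h3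
  exact mul_left_cancel₀ hk h3

theorem matN_smul {k : ℂ} (hk : k ≠ 0) (hz : z ∈ D.carrier) : matN D.F (k • z) = matN D.F z := by
  ext I J
  simp only [matN, ddF_smul hk hz]

theorem period_smul {k : ℂ} (hk : k ≠ 0) (hz : z ∈ D.carrier) :
    period D.F (k • z) = k • period D.F z := by
  ext (I | I)
  · rfl
  · exact dF_smul hk hz I

/-- Euler's relation for functions homogeneous of degree one. It makes the position vector its own
image under the differential of `period`, which later excludes translations in the changes of
charts. -/
theorem ddF_mulVec_self (hz : z ∈ D.carrier) (I : Fin (n + 1)) :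
    (ddF D.F z).mulVec z I = dF D.F I z := by
  have h1 : HasDerivAt (fun t : ℂ => dF D.F I (t • z)) (fderiv ℂ (dF D.F I) z z) 1 := by
    have h := ((D.differentiableOn_dF I z hz).differentiableAt (D.isOpen.mem_nhds hz)).hasFDerivAt
    have h' : HasFDerivAt (dF D.F I) (fderiv ℂ (dF D.F I) z) ((1 : ℂ) • z) := by simpa using h
    have h'' : HasDerivAt (fun t : ℂ => t • z) z 1 := by
      simpa using (hasDerivAt_id (1 : ℂ)).smul_const z
    exact h'.comp_hasDerivAt (1 : ℂ) h''
  have h2 : HasDerivAt (fun t : ℂ => dF D.F I (t • z)) (dF D.F I z) 1 := by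
    have : HasDerivAt (fun t : ℂ => t * dF D.F I z) (dF D.F I z) 1 := by
      simpa using (hasDerivAt_id (1 : ℂ)).mul_const (dF D.F I z)
    refine this.congr_of_eventuallyEq ?_
    filter_upwards [isOpen_ne.mem_nhds (one_ne_zero (α := ℂ))] with t ht using dF_smul ht hz I
  rw [← fderiv_dF_apply]
  exact h1.unique h2

theorem dPeriod_self (hz : z ∈ D.carrier) : dPeriod D.F z z = period D.F z := by
  ext (I | I)
  · rfl
  · exact ddF_mulVec_self hz I

/-- The hermitian form `N` is the restriction of the standard one on `ℂ^{2n+2}`. -/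
theorem sympForm_dPeriod_star (hz : z ∈ D.carrier) (a b : Fin (n + 1) → ℂ) :
    sympForm (dPeriod D.F z a) (star (dPeriod D.F z b))
      = Complex.I * hermForm (matN D.F z) a b := by
  simp only [sympForm, dPeriod_inl, dPeriod_inr, Pi.star_apply, hermForm, Matrix.mulVec, dotProduct,
    Finset.sum_sub_distrib, RCLike.star_def, map_sum, map_mul, Finset.sum_mul, Finset.mul_sum]
  rw [Finset.sum_comm]
  rw [← Finset.sum_sub_distrib]
  refine Finset.sum_congr rfl fun I _ => ?_
  rw [← Finset.sum_sub_distrib]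
  refine Finset.sum_congr rfl fun J _ => ?_
  rw [(ddF_isSymm hz).apply]
  have : Complex.I * (matN D.F z I J : ℂ) = ddF D.F z I J - conj (ddF D.F z I J) := by
    rw [Complex.sub_conj, matN]; ring
  linear_combination (-(a I * conj (b J))) * this

/-- The image of `period` is Lagrangian because the matrix of second derivatives is symmetric. -/
theorem sympForm_dPeriod (hz : z ∈ D.carrier) (a b : Fin (n + 1) → ℂ) :
    sympForm (dPeriod D.F z a) (dPeriod D.F z b) = 0 := by
  simp only [sympForm, dPeriod_inl, dPeriod_inr, Matrix.mulVec, dotProduct,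
    Finset.sum_sub_distrib, Finset.sum_mul, Finset.mul_sum]
  rw [Finset.sum_comm, sub_eq_zero]
  refine Finset.sum_congr rfl fun I _ => Finset.sum_congr rfl fun J _ => ?_
  rw [(ddF_isSymm hz).apply]
  ring

theorem hermForm_self_eq (hz : z ∈ D.carrier) :
    hermForm (matN D.F z) z z = (domMetric D.F z z z : ℂ) :=
  Complex.ext rfl (hermForm_self_im (matN_isSymm hz) z)

/-- This is the denominator in `𝓝`. If it vanished, the conjugate of `z` would be orthogonal to the
positive vector `z`, hence negative; but `N` is real, so the conjugate has the same norm as `z`. -/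
theorem matN_conj_pairing_ne_zero (hz : z ∈ D.carrier) :
    hermForm (matN D.F z) z (star z) ≠ 0 := by
  intro h
  have hz0 : star z ≠ 0 := by
    rw [star_ne_zero]
    rintro rfl
    exact D.zero_notMem hz
  have h1 := (isLorentzian_matN hz).neg_of_orthogonal (z := z) (a := star z) (D.f_pos z hz)
    (by rw [← hermForm_conj_symm (matN_isSymm hz), h, map_zero]) hz0
  rw [hermForm_star_star, Complex.conj_re] at h1
  exact lt_asymm h1 (D.f_pos z hz)

/-- A real covector which vanishes on the tangent space of the image of `period` is zero. -/
theorem eq_zero_of_dotProduct_dPeriod (hz : z ∈ D.carrier) {v : Fin (n + 1) ⊕ Fin (n + 1) → ℝ}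
    (hv : ∀ a, ∑ i, (v i : ℂ) * dPeriod D.F z a i = 0) : v = 0 := by
  have h1 : ∀ J, (v (Sum.inl J) : ℂ) + ∑ I, (v (Sum.inr I) : ℂ) * ddF D.F z I J = 0 := by
    intro J
    have h := hv (Pi.single J 1)
    rw [Fintype.sum_sum_type] at h
    simpa [Pi.single_apply] using h
  -- Taking imaginary parts removes the real components of `v` with index `inl` and leaves a kernel
  -- vector of `N`.
  have h2 : ∀ J, ∑ I, matN D.F z I J * v (Sum.inr I) = 0 := by
    intro J
    have h := congrArg Complex.im (h1 J)
    simp only [Complex.add_im, Complex.ofReal_im, Complex.im_sum, Complex.im_ofReal_mul, zero_add,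
      Complex.zero_im] at h
    have : ∑ I, matN D.F z I J * v (Sum.inr I) = 2 * ∑ I, v (Sum.inr I) * (ddF D.F z I J).im := by
      rw [Finset.mul_sum]
      exact Finset.sum_congr rfl fun I _ => by rw [matN]; ring
    rw [this, h, mul_zero]
  have h3 : ∀ x, hermForm (matN D.F z) (fun I => (v (Sum.inr I) : ℂ)) x = 0 := by
    intro x
    rw [hermForm, Finset.sum_comm]
    refine Finset.sum_eq_zero fun J _ => ?_
    rw [← Finset.sum_mul]
    have := congrArg (fun r : ℝ => (r : ℂ)) (h2 J)
    push_cast at this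
    rw [this, zero_mul]
  -- Nondegeneracy of `N`: a nonzero vector orthogonal to everything would be orthogonal to `z`,
  -- hence strictly negative, and also orthogonal to itself.
  have h4 : (fun I => (v (Sum.inr I) : ℂ)) = 0 := by
    by_contra hne
    have := (isLorentzian_matN hz).neg_of_orthogonal (D.f_pos z hz) (h3 z) hne
    rw [h3] at this
    simp at this
  have h5 : ∀ I, v (Sum.inr I) = 0 := fun I => by simpa using congrFun h4 I
  ext (I | I)
  · have := h1 I
    simp only [h5, Complex.ofReal_zero, zero_mul, Finset.sum_const_zero, add_zero] at this
    exact_mod_cast this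
  · exact h5 I

end ConicalDomain

end Domain

/-! ### The matrices `𝓝`, `𝓡`, `𝓘` and `Ĥ` -/

section WeilMatrix

variable {n : ℕ} {D : ConicalDomain n} {z : Fin (n + 1) → ℂ}

namespace ConicalDomain

theorem I_mul_matN (F : (Fin (n + 1) → ℂ) → ℂ) (z : Fin (n + 1) → ℂ) (I J : Fin (n + 1)) :
    Complex.I * (matN F z I J : ℂ) = ddF F z I J - conj (ddF F z I J) := by
  rw [Complex.sub_conj, matN]; ring

theorem matCalN_isSymm (hz : z ∈ D.carrier) : (matCalN D.F z).IsSymm := by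
  ext I J
  simp only [Matrix.transpose_apply, matCalN, (ddF_isSymm hz).apply]
  ring

theorem matR_isSymm (hz : z ∈ D.carrier) : (matR D.F z).IsSymm := by
  ext I J
  simp only [Matrix.transpose_apply, matR, (matCalN_isSymm hz).apply]

/-- The graph of `𝓝` is spanned by the line of `period` and the conjugates of the horizontal
tangent vectors. -/
theorem matCalN_mulVec (hz : z ∈ D.carrier) {Y : Fin (n + 1) → ℂ}
    (hY : hermForm (matN D.F z) Y z = 0) (k : ℂ) (I : Fin (n + 1)) :
    (matCalN D.F z).mulVec (k • z + star Y) I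
      = (dPeriod D.F z (k • z) + star (dPeriod D.F z Y)) (Sum.inr I) := by
  set q : ℂ := ∑ K, ∑ L, (matN D.F z K L : ℂ) * z K * z L with hq
  have hq0 : q ≠ 0 := by
    have := matN_conj_pairing_ne_zero hz
    simpa [hermForm] using this
  set w : Fin (n + 1) → ℂ := fun I => ∑ K, (matN D.F z I K : ℂ) * z K with hw
  have h1 : ∑ J, w J * z J = q := by
    simp only [hw, hq, Finset.sum_mul]
    exact Finset.sum_congr rfl fun I _ => Finset.sum_congr rfl fun J _ => by ring
  have h2 : ∑ J, w J * conj (Y J) = 0 := by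
    have h := congrArg conj hY
    rw [hermForm_conj_symm (matN_isSymm hz), map_zero] at h
    rw [← h, hermForm, Finset.sum_comm]
    simp only [hw, Finset.sum_mul]
    refine Finset.sum_congr rfl fun I _ => Finset.sum_congr rfl fun J _ => ?_
    rw [(matN_isSymm hz).apply]
  -- The rank one correction in `𝓝` only sees the component along `z`, since conjugates of vectors
  -- orthogonal to `z` pair to zero with `w = N z`. On that component it turns the conjugate of
  -- `F_IJ` into `F_IJ`, because their difference is `i N`.
  have h3 : ∑ J, w J * (k • z + star Y) J = k * q := by
    have : ∀ J, w J * (k • z + star Y) J = k * (w J * z J) + w J * conj (Y J) := fun J => by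
      simp only [Pi.add_apply, Pi.smul_apply, smul_eq_mul, Pi.star_apply, RCLike.star_def]; ring
    simp only [this, Finset.sum_add_distrib, ← Finset.mul_sum, h1, h2, add_zero]
  have h4 : (matCalN D.F z).mulVec (k • z + star Y) I
      = ∑ J, conj (ddF D.F z I J) * (k • z + star Y) J + Complex.I * w I * k := by
    have : ∀ J, matCalN D.F z I J * (k • z + star Y) J = conj (ddF D.F z I J) * (k • z + star Y) J
        + Complex.I * w I / q * (w J * (k • z + star Y) J) := fun J => by
      simp only [matCalN, ← hq, hw]; ring
    simp only [Matrix.mulVec, dotProduct, this, Finset.sum_add_distrib, ← Finset.mul_sum, h3]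
    field_simp
  have h5 : Complex.I * w I = ∑ J, (ddF D.F z I J - conj (ddF D.F z I J)) * z J := by
    simp only [hw, Finset.mul_sum, ← I_mul_matN]
    exact Finset.sum_congr rfl fun J _ => by ring
  rw [h4, h5]
  simp only [Pi.add_apply, dPeriod_inr, Pi.star_apply, RCLike.star_def, Matrix.mulVec, dotProduct,
    map_sum, map_mul, Pi.smul_apply, smul_eq_mul, Finset.sum_mul, ← Finset.sum_add_distrib]
  exact Finset.sum_congr rfl fun J _ => by ring

/-- The conjugates of vectors orthogonal to `z` form the kernel of the bilinear, not hermitian,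
pairing with `z`. This hyperplane does not contain `z` by `matN_conj_pairing_ne_zero`. -/
theorem exists_decomposition (hz : z ∈ D.carrier) (u : Fin (n + 1) → ℂ) :
    ∃ (k : ℂ) (Y : Fin (n + 1) → ℂ), hermForm (matN D.F z) Y z = 0 ∧ u = k • z + star Y := by
  have hq := matN_conj_pairing_ne_zero hz
  refine ⟨hermForm (matN D.F z) z (star u) / hermForm (matN D.F z) z (star z),
    star (u - (hermForm (matN D.F z) z (star u) / hermForm (matN D.F z) z (star z)) • z), ?_, ?_⟩
  · rw [← hermForm_conj_symm (matN_isSymm hz), star_sub, star_smul, sub_eq_add_neg, ← neg_smul,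
      hermForm_add_right, hermForm_smul_right]
    simp only [map_neg, RCLike.star_def, Complex.conj_conj]
    rw [neg_mul, div_mul_cancel₀ _ hq, add_neg_cancel, map_zero]
  · simp

/-- Both sides compute the symplectic pairing of `V = (u, 𝓝 u)` with its conjugate. As a point of
the graph of the symmetric matrix `𝓝`, `V` yields twice its imaginary part. As a sum of a tangent
vector and a conjugate one it yields the two values of `N`, the mixed terms vanishing by the
Lagrangian property and the conjugate term changing sign. -/
theorem hermForm_matI (hz : z ∈ D.carrier) {Y : Fin (n + 1) → ℂ}
    (hY : hermForm (matN D.F z) Y z = 0) (k : ℂ) :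
    2 * hermForm (matI D.F z) (k • z + star Y) (k • z + star Y)
      = hermForm (matN D.F z) (k • z) (k • z) - hermForm (matN D.F z) Y Y := by
  set u := k • z + star Y with hu
  set V := dPeriod D.F z (k • z) + star (dPeriod D.F z Y) with hV
  have hV1 : ∀ I, V (Sum.inl I) = u I := fun I => rfl
  have hV2 : ∀ I, V (Sum.inr I) = (matCalN D.F z).mulVec u I := fun I =>
    (matCalN_mulVec hz hY k I).symm
  have h1 : sympForm V (star V) = 2 * Complex.I * hermForm (matI D.F z) u u := by
    simp only [sympForm, hV1, hV2, Pi.star_apply, hermForm, Matrix.mulVec, dotProduct,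
      Finset.sum_sub_distrib, RCLike.star_def, map_sum, map_mul, Finset.sum_mul, Finset.mul_sum]
    rw [Finset.sum_comm, ← Finset.sum_sub_distrib]
    refine Finset.sum_congr rfl fun I _ => ?_
    rw [← Finset.sum_sub_distrib]
    refine Finset.sum_congr rfl fun J _ => ?_
    rw [(matCalN_isSymm hz).apply]
    have : 2 * Complex.I * (matI D.F z I J : ℂ)
        = matCalN D.F z I J - conj (matCalN D.F z I J) := by
      rw [Complex.sub_conj, matI]; push_cast; ring
    linear_combination (-(u I * conj (u J))) * this
  have h2 : sympForm V (star V) = Complex.I * hermForm (matN D.F z) (k • z) (k • z)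
      - Complex.I * hermForm (matN D.F z) Y Y := by
    rw [hV, star_add, star_star, sympForm_add_left, sympForm_add_right, sympForm_add_right,
      sympForm_dPeriod_star hz, sympForm_dPeriod hz, sympForm_star, sympForm_dPeriod hz,
      sympForm_swap (star _), sympForm_dPeriod_star hz]
    simp
    ring
  have h3 := h1.symm.trans h2
  refine mul_left_cancel₀ Complex.I_ne_zero ?_
  linear_combination h3

/-- By `hermForm_matI` the form `𝓘` arises from `N` by reversing the sign on the complement of `z`,
which turns signature `(1, n)` into a definite form. -/
theorem hermForm_matI_pos (hz : z ∈ D.carrier) {u : Fin (n + 1) → ℂ} (hu : u ≠ 0) :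
    0 < (hermForm (matI D.F z) u u).re := by
  obtain ⟨k, Y, hY, rfl⟩ := exists_decomposition hz u
  have h := congrArg Complex.re (hermForm_matI hz hY k)
  rw [hermForm_smul_left, hermForm_smul_right, hermForm_self_eq hz, ← mul_assoc,
    Complex.mul_conj, ← Complex.ofReal_mul, Complex.sub_re, Complex.ofReal_re,
    show (2 : ℂ) = ((2 : ℝ) : ℂ) by norm_num, Complex.re_ofReal_mul] at h
  have hf := D.f_pos z hz
  by_cases hY0 : Y = 0
  · subst hY0
    have hk : k ≠ 0 := by rintro rfl; simp at hu
    have := Complex.normSq_pos.2 hk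
    have h0 : (hermForm (matN D.F z) 0 0).re = 0 := by simp [hermForm]
    have : 0 < Complex.normSq k * domMetric D.F z z z := by positivity
    linarith
  · have h1 := (isLorentzian_matN hz).neg_of_orthogonal hf hY hY0
    have : 0 ≤ Complex.normSq k * domMetric D.F z z z :=
      mul_nonneg (Complex.normSq_nonneg k) hf.le
    linarith

theorem isUnit_det_matI (hz : z ∈ D.carrier) : IsUnit (matI D.F z).det := by
  rw [isUnit_iff_ne_zero]
  intro h
  obtain ⟨x, hx, hx0⟩ := Matrix.exists_mulVec_eq_zero_iff.2 h
  have hne : (fun I => (x I : ℂ)) ≠ 0 := by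
    intro h0
    exact hx (funext fun I => by simpa using congrFun h0 I)
  have h1 := hermForm_matI_pos hz hne
  have h2 : hermForm (matI D.F z) (fun I => (x I : ℂ)) (fun I => (x I : ℂ)) = 0 := by
    rw [hermForm]
    refine Finset.sum_eq_zero fun I _ => ?_
    have h3 := congrArg (fun r : ℝ => (r : ℂ)) (congrFun hx0 I)
    simp only [Matrix.mulVec, dotProduct, Pi.zero_apply, Complex.ofReal_sum, Complex.ofReal_mul,
      Complex.ofReal_zero] at h3
    calc _ = (x I : ℂ) * ∑ J, (matI D.F z I J : ℂ) * (x J : ℂ) := by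
          rw [Finset.mul_sum]
          exact Finset.sum_congr rfl fun J _ => by rw [Complex.conj_ofReal]; ring
      _ = 0 := by rw [h3, mul_zero]
  rw [h2] at h1
  simp at h1

/-- Completion of the square in `Ĥ`: with `p = (a, b)` and `x = 𝓘⁻¹ (a + 𝓡 b)`, the form splits into
two copies of `𝓘`. -/
theorem dotProduct_matH (hz : z ∈ D.carrier) (p : Fin (n + 1) ⊕ Fin (n + 1) → ℝ)
    {x : Fin (n + 1) → ℝ} (hx : (matI D.F z).mulVec x
      = (fun I => p (Sum.inl I)) + (matR D.F z).mulVec (fun I => p (Sum.inr I))) :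
    p ⬝ᵥ (matH D.F z).mulVec p = x ⬝ᵥ (matI D.F z).mulVec x
      + (fun I => p (Sum.inr I)) ⬝ᵥ (matI D.F z).mulVec (fun I => p (Sum.inr I)) := by
  set a : Fin (n + 1) → ℝ := fun I => p (Sum.inl I)
  set b : Fin (n + 1) → ℝ := fun I => p (Sum.inr I)
  have hp : p = Sum.elim a b := by ext (I | I) <;> rfl
  have hI := isUnit_det_matI hz
  have hx' : (matI D.F z)⁻¹.mulVec (a + (matR D.F z).mulVec b) = x := by
    rw [← hx, Matrix.mulVec_mulVec, Matrix.nonsing_inv_mul _ hI, Matrix.one_mulVec]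
  have hsum : ∀ c d c' d' : Fin (n + 1) → ℝ,
      Sum.elim c d ⬝ᵥ Sum.elim c' d' = c ⬝ᵥ c' + d ⬝ᵥ d' := fun c d c' d' => by
    simp [dotProduct, Fintype.sum_sum_type]
  rw [hp, matH, Matrix.fromBlocks_mulVec]
  simp only [Sum.elim_comp_inl, Sum.elim_comp_inr]
  rw [hsum]
  have e1 : (matI D.F z)⁻¹.mulVec a + ((matI D.F z)⁻¹ * matR D.F z).mulVec b = x := by
    rw [← hx', Matrix.mulVec_add, Matrix.mulVec_mulVec]
  have e2 : (matR D.F z * (matI D.F z)⁻¹).mulVec a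
      + (matI D.F z + matR D.F z * (matI D.F z)⁻¹ * matR D.F z).mulVec b
      = (matI D.F z).mulVec b + (matR D.F z).mulVec x := by
    rw [← hx', Matrix.add_mulVec, Matrix.mulVec_mulVec, Matrix.mulVec_add, Matrix.mulVec_mulVec]
    abel
  rw [e1, e2, dotProduct_add]
  have e3 : b ⬝ᵥ (matR D.F z).mulVec x = (matR D.F z).mulVec b ⬝ᵥ x := by
    rw [mulVec_dotProduct, (matR_isSymm hz).eq]
  have e4 : x ⬝ᵥ (matI D.F z).mulVec x = a ⬝ᵥ x + (matR D.F z).mulVec b ⬝ᵥ x := by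
    rw [hx, dotProduct_comm, add_dotProduct]
  rw [e3, e4]
  ring

theorem hermForm_re_add_im (N : Matrix (Fin (n + 1)) (Fin (n + 1)) ℝ)
    (u : Fin (n + 1) → ℂ) :
    (hermForm N u u).re = (fun I => (u I).im) ⬝ᵥ N.mulVec (fun I => (u I).im)
      + (fun I => (u I).re) ⬝ᵥ N.mulVec (fun I => (u I).re) := by
  simp only [hermForm, Complex.re_sum, dotProduct, Matrix.mulVec, Finset.mul_sum,
    ← Finset.sum_add_distrib]
  refine Finset.sum_congr rfl fun I _ => Finset.sum_congr rfl fun J _ => ?_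
  simp [mul_assoc]
  ring

/-- An invariant description of `Ĥ`: the real covector `p` is identified with the real part of an
element of the graph of `𝓝`. -/
theorem dotProduct_matH_eq (hz : z ∈ D.carrier) {p : Fin (n + 1) ⊕ Fin (n + 1) → ℝ}
    {Y : Fin (n + 1) → ℂ} (hY : hermForm (matN D.F z) Y z = 0) {k : ℂ}
    (h1 : ∀ I, ((dPeriod D.F z (k • z) + star (dPeriod D.F z Y)) (Sum.inl I)).re = p (Sum.inr I))
    (h2 : ∀ I, ((dPeriod D.F z (k • z) + star (dPeriod D.F z Y)) (Sum.inr I)).re = -p (Sum.inl I)) :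
    2 * (p ⬝ᵥ (matH D.F z).mulVec p)
      = (hermForm (matN D.F z) (k • z) (k • z)).re - (hermForm (matN D.F z) Y Y).re := by
  set u := k • z + star Y with hu
  have h1' : ∀ I, (u I).re = p (Sum.inr I) := h1
  have hx : (matI D.F z).mulVec (fun I => (u I).im)
      = (fun I => p (Sum.inl I)) + (matR D.F z).mulVec (fun I => p (Sum.inr I)) := by
    ext I
    have h := h2 I
    rw [← matCalN_mulVec hz hY k I, ← hu] at h
    simp only [Matrix.mulVec, dotProduct, Complex.re_sum, Complex.mul_re, Finset.sum_sub_distrib]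
      at h
    simp only [Matrix.mulVec, dotProduct, Pi.add_apply, ← h1', matI, matR]
    linarith
  rw [dotProduct_matH hz p hx, ← Complex.sub_re, ← hermForm_matI hz hY k, ← hu,
    show (2 : ℂ) = ((2 : ℝ) : ℂ) by norm_num, Complex.re_ofReal_mul,
    hermForm_re_add_im]
  simp only [h1']

/-- With `p = (a, b)`, one looks for `u = b + i c` with `Re (𝓝 u) = -a`. As `Re (𝓝 u) = 𝓡 b - 𝓘 c`,
this is solved by `c = 𝓘⁻¹ (a + 𝓡 b)`; the vector `u` is then decomposed along `z` and its
complement. -/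
theorem exists_weil_decomposition (hz : z ∈ D.carrier) (p : Fin (n + 1) ⊕ Fin (n + 1) → ℝ) :
    ∃ (k : ℂ) (Y : Fin (n + 1) → ℂ), hermForm (matN D.F z) Y z = 0 ∧
      (∀ I, ((dPeriod D.F z (k • z) + star (dPeriod D.F z Y)) (Sum.inl I)).re = p (Sum.inr I)) ∧
      (∀ I, ((dPeriod D.F z (k • z) + star (dPeriod D.F z Y)) (Sum.inr I)).re = -p (Sum.inl I)) := by
  set c : Fin (n + 1) → ℝ := (matI D.F z)⁻¹.mulVec
    ((fun I => p (Sum.inl I)) + (matR D.F z).mulVec (fun I => p (Sum.inr I))) with hc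
  have hc' : (matI D.F z).mulVec c
      = (fun I => p (Sum.inl I)) + (matR D.F z).mulVec (fun I => p (Sum.inr I)) := by
    rw [hc, Matrix.mulVec_mulVec, Matrix.mul_nonsing_inv _ (isUnit_det_matI hz), Matrix.one_mulVec]
  obtain ⟨k, Y, hY, hu⟩ := exists_decomposition hz
    (fun I => (⟨p (Sum.inr I), c I⟩ : ℂ))
  refine ⟨k, Y, hY, fun I => ?_, fun I => ?_⟩
  · exact congrArg Complex.re (congrFun hu I).symm
  · rw [← matCalN_mulVec hz hY k I, ← hu]
    have h := congrFun hc' I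
    simp only [Matrix.mulVec, dotProduct, Pi.add_apply, matI, matR] at h
    simp only [Matrix.mulVec, dotProduct, Complex.re_sum, Complex.mul_re, Finset.sum_sub_distrib]
    linarith

/-- The invariant description of `Ĥ` and the formula for `𝓘` have the same right-hand side, so `Ĥ`
at `p` is the value of the definite form `𝓘` at the vector `u` representing `p`. -/
theorem dotProduct_matH_pos (hz : z ∈ D.carrier) {p : Fin (n + 1) ⊕ Fin (n + 1) → ℝ}
    (hp : p ≠ 0) : 0 < p ⬝ᵥ (matH D.F z).mulVec p := by
  obtain ⟨k, Y, hY, h1, h2⟩ := exists_weil_decomposition hz p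
  have h := dotProduct_matH_eq hz hY h1 h2
  have hu : k • z + star Y ≠ 0 := by
    intro h0
    refine hp (funext fun i => ?_)
    rcases i with I | I
    · have := h2 I
      rw [← matCalN_mulVec hz hY k I, h0] at this
      simpa using this.symm
    · have := h1 I
      rw [← this]
      exact congrArg Complex.re (congrFun h0 I)
  have h3 := hermForm_matI_pos hz hu
  have h4 := congrArg Complex.re (hermForm_matI hz hY k)
  rw [show (2 : ℂ) = ((2 : ℝ) : ℂ) by norm_num, Complex.re_ofReal_mul, Complex.sub_re] at h4
  linarith

end ConicalDomain

end WeilMatrix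

/-! ### The projective special Kähler metric -/

section Bar

variable {n : ℕ}

/-- The quadratic form `-g / f + (α² + (J^*α)²) / f²`. -/
def barForm (N : Matrix (Fin (n + 1)) (Fin (n + 1)) ℝ) (z a : Fin (n + 1) → ℂ) : ℝ :=
  -((hermForm N a a).re / (hermForm N z z).re)
    + Complex.normSq (hermForm N z a) / (hermForm N z z).re ^ 2

theorem gBar_eq (F : (Fin (n + 1) → ℂ) → ℂ) (X dX : Fin n → ℂ) :
    gBar F X dX = barForm (matN F (hom X)) (hom X) (Matrix.vecCons 0 dX) := by
  simp only [gBar, barForm, domMetric_eq, hermForm_smul_right, Complex.normSq_apply]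
  simp
  ring

theorem barForm_of_orthogonal {N : Matrix (Fin (n + 1)) (Fin (n + 1)) ℝ}
    {z a : Fin (n + 1) → ℂ} (h : hermForm N z a = 0) :
    barForm N z a = -((hermForm N a a).re / (hermForm N z z).re) := by
  simp [barForm, h]

/-- The form only depends on the component of `a` orthogonal to `z`: it is minus the norm of this
component divided by the norm of `z`. With `barForm_smul` this makes it a form on the
projectivization. -/
theorem barForm_add_smul {N : Matrix (Fin (n + 1)) (Fin (n + 1)) ℝ} (hN : N.IsSymm)
    {z : Fin (n + 1) → ℂ} (hz : 0 < (hermForm N z z).re) (a : Fin (n + 1) → ℂ) (k : ℂ) :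
    barForm N z (a + k • z) = barForm N z a := by
  have hzz : hermForm N z z = ((hermForm N z z).re : ℂ) :=
    Complex.ext rfl (hermForm_self_im hN z)
  set f := (hermForm N z z).re with hf
  have h1 : hermForm N a z = conj (hermForm N z a) := (hermForm_conj_symm hN z a).symm
  simp only [barForm, hermForm_add_left, hermForm_add_right, hermForm_smul_left,
    hermForm_smul_right, h1]
  rw [hzz]
  set w := hermForm N z a
  simp only [Complex.add_re, Complex.mul_re, Complex.mul_im, Complex.conj_re, Complex.conj_im,
    Complex.normSq_apply, Complex.add_im, Complex.ofReal_re, Complex.ofReal_im]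
  field_simp
  ring

theorem barForm_smul (N : Matrix (Fin (n + 1)) (Fin (n + 1)) ℝ) {k : ℂ} (hk : k ≠ 0)
    (z a : Fin (n + 1) → ℂ) : barForm N (k • z) (k • a) = barForm N z a := by
  have h : ∀ x y, hermForm N (k • x) (k • y) = ((Complex.normSq k : ℝ) : ℂ) * hermForm N x y := by
    intro x y
    rw [hermForm_smul_left, hermForm_smul_right, ← mul_assoc, Complex.mul_conj]
  have hk' := Complex.normSq_pos.2 hk
  simp only [barForm, h, Complex.re_ofReal_mul, Complex.normSq_mul, Complex.normSq_ofReal]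
  rw [mul_div_mul_left _ _ hk'.ne', mul_pow, pow_two (Complex.normSq k),
    mul_div_mul_left _ _ (mul_pos hk' hk').ne']

/-- Every vector is horizontal up to a multiple of the position vector. -/
theorem exists_horizontal {N : Matrix (Fin (n + 1)) (Fin (n + 1)) ℝ}
    {z : Fin (n + 1) → ℂ} (hz : 0 < (hermForm N z z).re) (a : Fin (n + 1) → ℂ) :
    ∃ k : ℂ, hermForm N (a + k • z) z = 0 := by
  have hzz : hermForm N z z ≠ 0 := fun h => by simp [h] at hz
  exact ⟨-(hermForm N a z / hermForm N z z), by
    rw [hermForm_add_left, hermForm_smul_left, neg_mul, div_mul_cancel₀ _ hzz, add_neg_cancel]⟩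

/-- Replacing `a` by its horizontal representative leaves minus the norm of a vector orthogonal to
`z`, which is positive unless that representative is zero. -/
theorem barForm_nonneg {N : Matrix (Fin (n + 1)) (Fin (n + 1)) ℝ} (hN : N.IsSymm)
    (hL : IsLorentzian N) {z : Fin (n + 1) → ℂ} (hz : 0 < (hermForm N z z).re)
    (a : Fin (n + 1) → ℂ) : 0 ≤ barForm N z a ∧ (barForm N z a = 0 → ∃ k : ℂ, a = k • z) := by
  obtain ⟨k, hk⟩ := exists_horizontal hz a
  have hk' : hermForm N z (a + k • z) = 0 := by rw [← hermForm_conj_symm hN, hk, map_zero]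
  rw [← barForm_add_smul hN hz a k, barForm_of_orthogonal hk']
  by_cases h0 : a + k • z = 0
  · refine ⟨by rw [h0]; simp [hermForm], fun _ => ⟨-k, ?_⟩⟩
    rw [neg_smul]
    exact eq_neg_of_add_eq_zero_left h0
  · have := hL.neg_of_orthogonal hz hk h0
    have h2 := div_neg_of_neg_of_pos this hz
    exact ⟨by linarith, fun h => by linarith⟩

end Bar

/-! ### Quadratic forms -/

section Quad

/-- The function `q` is a quadratic form. -/
def IsQuad {V : Type*} [AddCommGroup V] [Module ℝ V] (q : V → ℝ) : Prop :=
  ∃ Q : QuadraticForm ℝ V, ∀ u, Q u = q u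

variable {V : Type*} [AddCommGroup V] [Module ℝ V] {q q' : V → ℝ}

theorem IsQuad.add (h : IsQuad q) (h' : IsQuad q') : IsQuad (fun u => q u + q' u) := by
  obtain ⟨Q, hQ⟩ := h
  obtain ⟨Q', hQ'⟩ := h'
  exact ⟨Q + Q', fun u => by simp [hQ, hQ']⟩

theorem IsQuad.const_mul (h : IsQuad q) (k : ℝ) : IsQuad (fun u => k * q u) := by
  obtain ⟨Q, hQ⟩ := h
  exact ⟨k • Q, fun u => by simp [hQ]⟩

theorem IsQuad.neg (h : IsQuad q) : IsQuad (fun u => -q u) := by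
  simpa using h.const_mul (-1)

theorem IsQuad.div_const (h : IsQuad q) (k : ℝ) : IsQuad (fun u => q u / k) := by
  simpa [div_eq_inv_mul] using h.const_mul k⁻¹

theorem IsQuad.sum {ι : Type*} (s : Finset ι) {q : ι → V → ℝ} (h : ∀ i, IsQuad (q i)) :
    IsQuad (fun u => ∑ i ∈ s, q i u) := by
  choose Q hQ using h
  exact ⟨∑ i ∈ s, Q i, fun u => by simp [hQ]⟩

theorem isQuad_mul {f g : V → ℝ} (hf : IsLinearMap ℝ f) (hg : IsLinearMap ℝ g) :
    IsQuad (fun u => f u * g u) :=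
  ⟨QuadraticMap.linMulLin (hf.mk' f) (hg.mk' g), fun u => by simp⟩

theorem isQuad_sq {f : V → ℝ} (hf : IsLinearMap ℝ f) : IsQuad (fun u => f u ^ 2) := by
  simpa [pow_two] using isQuad_mul hf hf

end Quad

/-! ### The one-loop metric as a positive definite quadratic form -/

section FS

variable {n : ℕ}

section

variable {V : Type*} [AddCommGroup V] [Module ℝ V]

theorem isQuad_hermForm (N : Matrix (Fin (n + 1)) (Fin (n + 1)) ℝ) {l : V → Fin (n + 1) → ℂ}
    (hl : IsLinearMap ℝ l) : IsQuad (fun u => (hermForm N (l u) (l u)).re) := by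
  have hre : ∀ I, IsLinearMap ℝ (fun u => (l u I).re) := fun I =>
    ⟨fun x y => by simp [hl.map_add], fun k x => by simp [hl.map_smul]⟩
  have him : ∀ I, IsLinearMap ℝ (fun u => (l u I).im) := fun I =>
    ⟨fun x y => by simp [hl.map_add], fun k x => by simp [hl.map_smul]⟩
  have : (fun u => (hermForm N (l u) (l u)).re) = fun u => ∑ I, ∑ J, N I J *
      ((l u I).re * (l u J).re + (l u I).im * (l u J).im) := by
    ext u
    simp only [hermForm, Complex.re_sum]
    refine Finset.sum_congr rfl fun I _ => Finset.sum_congr rfl fun J _ => ?_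
    simp [mul_assoc]
  rw [this]
  exact IsQuad.sum _ fun I => IsQuad.sum _ fun J =>
    ((isQuad_mul (hre I) (hre J)).add (isQuad_mul (him I) (him J))).const_mul _

theorem isQuad_normSq {l : V → ℂ} (hl : IsLinearMap ℝ l) :
    IsQuad (fun u => Complex.normSq (l u)) := by
  have hre : IsLinearMap ℝ (fun u => (l u).re) :=
    ⟨fun x y => by simp [hl.map_add], fun k x => by simp [hl.map_smul]⟩
  have him : IsLinearMap ℝ (fun u => (l u).im) :=
    ⟨fun x y => by simp [hl.map_add], fun k x => by simp [hl.map_smul]⟩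
  simpa only [Complex.normSq_apply] using (isQuad_mul hre hre).add (isQuad_mul him him)

theorem isQuad_barForm (N : Matrix (Fin (n + 1)) (Fin (n + 1)) ℝ) (z : Fin (n + 1) → ℂ)
    {l : V → Fin (n + 1) → ℂ} (hl : IsLinearMap ℝ l) : IsQuad (fun u => barForm N z (l u)) := by
  refine ((isQuad_hermForm N hl).div_const _).neg.add (IsQuad.div_const (isQuad_normSq ?_) _)
  refine ⟨fun x y => by rw [hl.map_add, hermForm_add_right], fun k x => ?_⟩
  rw [hl.map_smul, show k • l x = (k : ℂ) • l x from (Complex.coe_smul k _).symm,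
    hermForm_smul_right, Complex.conj_ofReal]
  simp

end

theorem gFS_eq (c : ℝ) (F : (Fin (n + 1) → ℂ) → ℂ) (e u : Coord n) :
    gFS c F e u = (e.2.1 + c) / e.2.1 *
        barForm (matN F (hom e.1)) (hom e.1) (Matrix.vecCons 0 u.1)
      + 1 / (4 * e.2.1 ^ 2) * ((e.2.1 + 2 * c) / (e.2.1 + c)) * u.2.1 ^ 2
      + 1 / (4 * e.2.1 ^ 2) * ((e.2.1 + c) / (e.2.1 + 2 * c))
        * (u.2.2.1 + sympForm e.2.2.2 u.2.2.2 + c * dcK F e.1 u.1) ^ 2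
      + 1 / (2 * e.2.1) * (u.2.2.2 ⬝ᵥ (matH F (hom e.1)).mulVec u.2.2.2)
      + 2 * c / e.2.1 ^ 2 * Real.exp (potK F e.1)
        * Complex.normSq (period F (hom e.1) ⬝ᵥ (fun i => (u.2.2.2 i : ℂ))) := by
  rw [gFS, gBar_eq, Complex.normSq_eq_norm_sq]
  simp only [sympForm, dotProduct, Fintype.sum_sum_type, period_inl, period_inr,
    Finset.sum_add_distrib]

theorem isLinearMap_coord_fst : IsLinearMap ℝ
    (fun u : Coord n => (Matrix.vecCons 0 u.1 : Fin (n + 1) → ℂ)) := by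
  refine ⟨fun x y => ?_, fun k x => ?_⟩
  · simp
  · ext I
    refine Fin.cases ?_ (fun μ => ?_) I <;> simp

/-- The formula is given on the diagonal only; being quadratic, it can be polarized to the
coefficients of a metric. -/
theorem isQuad_gFS (c : ℝ) (F : (Fin (n + 1) → ℂ) → ℂ) (e : Coord n) : IsQuad (gFS c F e) := by
  have h : gFS c F e = _ := funext fun u => gFS_eq c F e u
  rw [h]
  refine ((((isQuad_barForm _ _ isLinearMap_coord_fst).const_mul _).add
    ((isQuad_sq ?_).const_mul _)).add ((isQuad_sq ?_).const_mul _)).add (IsQuad.const_mul ?_ _)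
    |>.add ((isQuad_normSq ?_).const_mul _)
  · exact ⟨fun x y => rfl, fun k x => rfl⟩
  · refine ⟨fun x y => ?_, fun k x => ?_⟩
    · simp only [Prod.snd_add, Prod.fst_add, sympForm_add_right, dcK, smul_add, map_add]
      ring
    · simp only [Prod.smul_snd, Prod.smul_fst, sympForm_smul_right, dcK, smul_eq_mul,
        smul_comm Complex.I k, map_smul]
      ring
  · simp only [dotProduct, Matrix.mulVec, Finset.mul_sum]
    refine IsQuad.sum _ fun i => IsQuad.sum _ fun j => ?_
    have : (fun u : Coord n => u.2.2.2 i * (matH F (hom e.1) i j * u.2.2.2 j))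
        = fun u => matH F (hom e.1) i j * (u.2.2.2 i * u.2.2.2 j) := by ext u; ring
    rw [this]
    exact (isQuad_mul ⟨fun x y => rfl, fun k x => rfl⟩ ⟨fun x y => rfl, fun k x => rfl⟩).const_mul _
  · refine ⟨fun x y => ?_, fun k x => ?_⟩
    · simp only [dotProduct, Prod.snd_add, Pi.add_apply, Complex.ofReal_add, mul_add,
        Finset.sum_add_distrib]
    · simp only [dotProduct, Prod.smul_snd, Pi.smul_apply, smul_eq_mul, Complex.ofReal_mul,
        Complex.real_smul, Finset.mul_sum]
      exact Finset.sum_congr rfl fun i _ => by ring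

/-- `g^c_FS` as a bilinear form. -/
def bilinFS (c : ℝ) (F : (Fin (n + 1) → ℂ) → ℂ) (e : Coord n) : Coord n →L[ℝ] Coord n →L[ℝ] ℝ :=
  (QuadraticMap.associated (R := ℝ) (N := ℝ)
    (isQuad_gFS c F e).choose).toContinuousBilinearMap

/-- The polarization formula expresses the bilinear form without the chosen quadratic form, so that
its smooth dependence on `e` reduces to that of `gFS`. -/
theorem bilinFS_apply (c : ℝ) (F : (Fin (n + 1) → ℂ) → ℂ) (e u v : Coord n) :
    bilinFS c F e u v = 1 / 2 * (gFS c F e (u + v) - gFS c F e u - gFS c F e v) := by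
  have h := (isQuad_gFS c F e).choose_spec
  have h2 := QuadraticMap.two_nsmul_associated ℝ (isQuad_gFS c F e).choose
  have h3 := congrArg (fun B : LinearMap.BilinMap ℝ (Coord n) ℝ => B u v) h2
  simp only [LinearMap.smul_apply, QuadraticMap.polarBilin_apply_apply, QuadraticMap.polar, h,
    nsmul_eq_mul, Nat.cast_ofNat] at h3
  rw [bilinFS, LinearMap.toContinuousBilinearMap_apply]
  linarith

theorem bilinFS_self (c : ℝ) (F : (Fin (n + 1) → ℂ) → ℂ) (e u : Coord n) :
    bilinFS c F e u u = gFS c F e u := by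
  have h := (isQuad_gFS c F e).choose_spec
  rw [bilinFS, LinearMap.toContinuousBilinearMap_apply, QuadraticMap.associated_eq_self_apply, h]

theorem bilinFS_symm (c : ℝ) (F : (Fin (n + 1) → ℂ) → ℂ) (e u v : Coord n) :
    bilinFS c F e u v = bilinFS c F e v u := by
  rw [bilinFS_apply, bilinFS_apply, add_comm u v]; ring

@[simp] theorem hom_zero (X : Fin n → ℂ) : hom X 0 = 1 := rfl

@[simp] theorem hom_succ (X : Fin n → ℂ) (μ : Fin n) : hom X μ.succ = X μ := rfl

variable {D : ConicalDomain n} {c : ℝ} {e : Coord n}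

/-- A multiple of `(1, X)` whose first coordinate is zero is zero, so the slice `(0, a)` meets the
kernel of `barForm` trivially. -/
theorem barForm_vecCons_pos {X : Fin n → ℂ} (hX : hom X ∈ D.carrier) {a : Fin n → ℂ} (ha : a ≠ 0) :
    0 < barForm (matN D.F (hom X)) (hom X) (Matrix.vecCons 0 a) := by
  have h := barForm_nonneg (ConicalDomain.matN_isSymm hX) (ConicalDomain.isLorentzian_matN hX)
    (D.f_pos _ hX) (Matrix.vecCons 0 a)
  refine h.1.lt_of_ne fun h0 => ha ?_
  obtain ⟨k, hk⟩ := h.2 h0.symm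
  have hk0 : k = 0 := by simpa using (congrFun hk 0).symm
  ext μ
  have := congrFun hk μ.succ
  simpa [hk0] using this

/-- The lower bound of `g^c_FS` by the metrics of the base and of the `ρ`-line. -/
theorem le_gFS (hc : 0 ≤ c) (hX : hom e.1 ∈ D.carrier) (hρ : 0 < e.2.1) (u : Coord n) :
    barForm (matN D.F (hom e.1)) (hom e.1) (Matrix.vecCons 0 u.1)
      + (u.2.1 / (2 * e.2.1)) ^ 2 ≤ gFS c D.F e u := by
  rw [gFS_eq]
  -- For `c ≥ 0` the coefficients `(ρ + c) / ρ` and `(ρ + 2c) / (ρ + c)` are at least one, and the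
  -- other three summands are nonnegative.
  have h1 := (barForm_nonneg (ConicalDomain.matN_isSymm hX) (ConicalDomain.isLorentzian_matN hX)
    (D.f_pos _ hX) (Matrix.vecCons 0 u.1)).1
  have h1' : barForm (matN D.F (hom e.1)) (hom e.1) (Matrix.vecCons 0 u.1) ≤ (e.2.1 + c) / e.2.1 *
      barForm (matN D.F (hom e.1)) (hom e.1) (Matrix.vecCons 0 u.1) :=
    le_mul_of_one_le_left h1 (by rw [one_le_div hρ]; linarith)
  have h2 : (u.2.1 / (2 * e.2.1)) ^ 2
      ≤ 1 / (4 * e.2.1 ^ 2) * ((e.2.1 + 2 * c) / (e.2.1 + c)) * u.2.1 ^ 2 := by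
    have : (u.2.1 / (2 * e.2.1)) ^ 2 = 1 / (4 * e.2.1 ^ 2) * 1 * u.2.1 ^ 2 := by
      field_simp; ring
    rw [this]
    have h3 : 1 ≤ (e.2.1 + 2 * c) / (e.2.1 + c) := by
      rw [one_le_div (by linarith)]; linarith
    gcongr
  have h3 : 0 ≤ 1 / (4 * e.2.1 ^ 2) * ((e.2.1 + c) / (e.2.1 + 2 * c))
        * (u.2.2.1 + sympForm e.2.2.2 u.2.2.2 + c * dcK D.F e.1 u.1) ^ 2 := by positivity
  have h4 : 0 ≤ 1 / (2 * e.2.1) * (u.2.2.2 ⬝ᵥ (matH D.F (hom e.1)).mulVec u.2.2.2) := by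
    by_cases hp : u.2.2.2 = 0
    · simp [hp]
    · have := ConicalDomain.dotProduct_matH_pos hX hp
      positivity
  have h5 : 0 ≤ 2 * c / e.2.1 ^ 2 * Real.exp (potK D.F e.1)
        * Complex.normSq (period D.F (hom e.1) ⬝ᵥ (fun i => (u.2.2.2 i : ℂ))) :=
    mul_nonneg (by positivity) (Complex.normSq_nonneg _)
  linarith

/-- The components of `u` are tested in the order `X`, `ρ`, `p`, `φ̃`: the squared one-form mixes
`dφ̃` with `dp` and `dX`, and reduces to `dφ̃` only when the others vanish. -/
theorem gFS_pos (hc : 0 ≤ c) (hX : hom e.1 ∈ D.carrier) (hρ : 0 < e.2.1) {u : Coord n}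
    (hu : u ≠ 0) : 0 < gFS c D.F e u := by
  have h1 := (barForm_nonneg (ConicalDomain.matN_isSymm hX) (ConicalDomain.isLorentzian_matN hX)
    (D.f_pos _ hX) (Matrix.vecCons 0 u.1)).1
  have hle := le_gFS hc hX hρ u
  have hsq : 0 ≤ (u.2.1 / (2 * e.2.1)) ^ 2 := sq_nonneg _
  by_cases hu1 : u.1 = 0
  swap
  · have := barForm_vecCons_pos hX hu1
    linarith
  by_cases hu2 : u.2.1 = 0
  swap
  · have : 0 < (u.2.1 / (2 * e.2.1)) ^ 2 := by positivity
    linarith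
  have hbar : barForm (matN D.F (hom e.1)) (hom e.1) (Matrix.vecCons 0 u.1) = 0 := by
    have : (Matrix.vecCons 0 u.1 : Fin (n + 1) → ℂ) = 0 := by rw [hu1]; simp
    rw [this]; simp [barForm, hermForm]
  rw [gFS_eq, hbar, hu1, hu2]
  have hdc : dcK D.F e.1 0 = 0 := by simp [dcK]
  rw [hdc]
  by_cases hu4 : u.2.2.2 = 0
  · have hu3 : u.2.2.1 ≠ 0 := by
      intro hu3
      exact hu (Prod.ext hu1 (Prod.ext hu2 (Prod.ext hu3 hu4)))
    have hs : sympForm e.2.2.2 (0 : Fin (n + 1) ⊕ Fin (n + 1) → ℝ) = 0 := by simp [sympForm]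
    rw [hu4, hs]
    simp only [add_zero, mul_zero, zero_add, zero_dotProduct, ne_eq, OfNat.ofNat_ne_zero,
      not_false_eq_true, zero_pow, Pi.zero_apply, Complex.ofReal_zero]
    have h5 : (period D.F (hom e.1) ⬝ᵥ fun _ => (0 : ℂ)) = 0 := by simp [dotProduct]
    rw [h5, map_zero, mul_zero, add_zero]
    positivity
  · have h4 := ConicalDomain.dotProduct_matH_pos hX hu4
    have h5 : 0 ≤ 2 * c / e.2.1 ^ 2 * Real.exp (potK D.F e.1)
        * Complex.normSq (period D.F (hom e.1) ⬝ᵥ (fun i => (u.2.2.2 i : ℂ))) :=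
      mul_nonneg (by positivity) (Complex.normSq_nonneg _)
    have h6 : 0 ≤ 1 / (4 * e.2.1 ^ 2) * ((e.2.1 + c) / (e.2.1 + 2 * c))
        * (u.2.2.1 + sympForm e.2.2.2 u.2.2.2 + c * 0) ^ 2 := by positivity
    have h7 : 0 < 1 / (2 * e.2.1) * (u.2.2.2 ⬝ᵥ (matH D.F (hom e.1)).mulVec u.2.2.2) := by
      positivity
    simp only [mul_zero, zero_add, ne_eq, OfNat.ofNat_ne_zero, not_false_eq_true, zero_pow] at *
    linarith

end FS

/-! ### Smoothness of the metric coefficients -/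

section Smooth

variable {n : ℕ} {D : ConicalDomain n}

theorem contDiff_hom : ContDiff ℝ ∞ (hom : (Fin n → ℂ) → Fin (n + 1) → ℂ) := by
  refine contDiff_pi' fun I => ?_
  refine Fin.cases ?_ (fun μ => ?_) I
  · exact contDiff_const
  · exact contDiff_apply ℝ ℂ μ

/-- The set of inhomogeneous coordinates. -/
def baseSet (D : ConicalDomain n) : Set (Fin n → ℂ) := {X | hom X ∈ D.carrier}

theorem isOpen_baseSet : IsOpen (baseSet D) := D.isOpen.preimage contDiff_hom.continuous

theorem contDiffOn_comp_hom {E : Type*} [NormedAddCommGroup E] [NormedSpace ℂ E]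
    {f : (Fin (n + 1) → ℂ) → E} (hf : ContDiffOn ℂ ∞ f D.carrier) :
    ContDiffOn ℝ ∞ (fun X => f (hom X)) (baseSet D) :=
  (hf.restrict_scalars ℝ).comp contDiff_hom.contDiffOn fun _ h => h

theorem contDiffOn_re {E : Type*} [NormedAddCommGroup E] [NormedSpace ℝ E] {s : Set E}
    {f : E → ℂ} (hf : ContDiffOn ℝ ∞ f s) : ContDiffOn ℝ ∞ (fun x => (f x).re) s :=
  Complex.reCLM.contDiff.comp_contDiffOn hf

theorem contDiffOn_im {E : Type*} [NormedAddCommGroup E] [NormedSpace ℝ E] {s : Set E}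
    {f : E → ℂ} (hf : ContDiffOn ℝ ∞ f s) : ContDiffOn ℝ ∞ (fun x => (f x).im) s :=
  Complex.imCLM.contDiff.comp_contDiffOn hf

theorem contDiffOn_ofReal {E : Type*} [NormedAddCommGroup E] [NormedSpace ℝ E] {s : Set E}
    {f : E → ℝ} (hf : ContDiffOn ℝ ∞ f s) : ContDiffOn ℝ ∞ (fun x => (f x : ℂ)) s :=
  Complex.ofRealCLM.contDiff.comp_contDiffOn hf

theorem contDiffOn_conj {E : Type*} [NormedAddCommGroup E] [NormedSpace ℝ E] {s : Set E}
    {f : E → ℂ} (hf : ContDiffOn ℝ ∞ f s) : ContDiffOn ℝ ∞ (fun x => conj (f x)) s :=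
  (Complex.conjCLE : ℂ ≃L[ℝ] ℂ).contDiff.comp_contDiffOn hf

theorem contDiffOn_ddF_hom (I J : Fin (n + 1)) :
    ContDiffOn ℝ ∞ (fun X => ddF D.F (hom X) I J) (baseSet D) :=
  contDiffOn_comp_hom (f := fun z => ddF D.F z I J) (D.contDiffOn_ddF I J)

theorem contDiffOn_period_hom (i : Fin (n + 1) ⊕ Fin (n + 1)) :
    ContDiffOn ℝ ∞ (fun X => period D.F (hom X) i) (baseSet D) := by
  rcases i with I | I
  · exact ((contDiff_apply ℝ ℂ I).comp contDiff_hom).contDiffOn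
  · exact contDiffOn_comp_hom (f := fun z => dF D.F I z) (D.contDiffOn_dF I)

theorem contDiffOn_hom_apply (I : Fin (n + 1)) (s : Set (Fin n → ℂ)) :
    ContDiffOn ℝ ∞ (fun X : Fin n → ℂ => hom X I) s :=
  ((contDiff_apply ℝ ℂ I).comp contDiff_hom).contDiffOn

theorem contDiffOn_matN_hom (I J : Fin (n + 1)) :
    ContDiffOn ℝ ∞ (fun X => matN D.F (hom X) I J) (baseSet D) :=
  contDiffOn_const.mul (contDiffOn_im (contDiffOn_ddF_hom I J))

theorem contDiffOn_hermForm_hom {u v : (Fin n → ℂ) → Fin (n + 1) → ℂ}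
    (hu : ∀ I, ContDiffOn ℝ ∞ (fun X => u X I) (baseSet D))
    (hv : ∀ I, ContDiffOn ℝ ∞ (fun X => v X I) (baseSet D)) :
    ContDiffOn ℝ ∞ (fun X => hermForm (matN D.F (hom X)) (u X) (v X)) (baseSet D) :=
  ContDiffOn.sum fun I _ => ContDiffOn.sum fun J _ =>
    ((contDiffOn_ofReal (contDiffOn_matN_hom I J)).mul (hu I)).mul
      (contDiffOn_conj (hv J))

theorem contDiffOn_f_hom :
    ContDiffOn ℝ ∞ (fun X => domMetric D.F (hom X) (hom X) (hom X)) (baseSet D) :=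
  contDiffOn_re (contDiffOn_hermForm_hom (fun I => contDiffOn_hom_apply I _)
    (fun I => contDiffOn_hom_apply I _))

theorem contDiffOn_barForm_hom (a : Fin (n + 1) → ℂ) :
    ContDiffOn ℝ ∞ (fun X => barForm (matN D.F (hom X)) (hom X) a) (baseSet D) := by
  have h : ∀ X ∈ baseSet D, domMetric D.F (hom X) (hom X) (hom X) ≠ 0 :=
    fun X hX => (D.f_pos _ hX).ne'
  have h1 : ContDiffOn ℝ ∞ (fun X => hermForm (matN D.F (hom X)) (hom X) a) (baseSet D) :=
    contDiffOn_hermForm_hom (fun I => contDiffOn_hom_apply I _) (fun I => contDiffOn_const)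
  have h2 : ContDiffOn ℝ ∞ (fun X => hermForm (matN D.F (hom X)) a a) (baseSet D) :=
    contDiffOn_hermForm_hom (u := fun _ => a) (v := fun _ => a) (fun I => contDiffOn_const)
      (fun I => contDiffOn_const)
  have h3 : ContDiffOn ℝ ∞ (fun X => Complex.normSq (hermForm (matN D.F (hom X)) (hom X) a))
      (baseSet D) := by
    simp only [Complex.normSq_apply]
    exact ((contDiffOn_re h1).mul (contDiffOn_re h1)).add ((contDiffOn_im h1).mul (contDiffOn_im h1))
  have h4 := contDiffOn_f_hom (D := D)
  simp only [domMetric_eq] at h4 h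
  exact ((contDiffOn_re h2).div h4 h).neg.add (h3.div (h4.pow 2) fun X hX => pow_ne_zero 2 (h X hX))

theorem contDiffOn_potK : ContDiffOn ℝ ∞ (potK D.F) (baseSet D) :=
  (contDiffOn_f_hom.log fun _ hX => (D.f_pos _ hX).ne').neg

theorem contDiffOn_dcK (a : Fin n → ℂ) : ContDiffOn ℝ ∞ (fun X => dcK D.F X a) (baseSet D) := by
  have h := ((contDiffOn_infty_iff_fderiv_of_isOpen isOpen_baseSet).1 (contDiffOn_potK (D := D))).2
  exact (h.clm_apply contDiffOn_const).neg

theorem contDiffOn_matCalN_hom (I J : Fin (n + 1)) :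
    ContDiffOn ℝ ∞ (fun X => matCalN D.F (hom X) I J) (baseSet D) := by
  have hN := fun I J => contDiffOn_ofReal (contDiffOn_matN_hom (D := D) I J)
  have hX := fun I => contDiffOn_hom_apply I (baseSet D)
  have hw : ∀ I, ContDiffOn ℝ ∞
      (fun X => ∑ K, (matN D.F (hom X) I K : ℂ) * hom X K) (baseSet D) := fun I =>
    ContDiffOn.sum fun K _ => (hN I K).mul (hX K)
  have hq : ContDiffOn ℝ ∞ (fun X => ∑ K, ∑ L, (matN D.F (hom X) K L : ℂ) * hom X K * hom X L)
      (baseSet D) :=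
    ContDiffOn.sum fun K _ => ContDiffOn.sum fun L _ => ((hN K L).mul (hX K)).mul (hX L)
  simp only [matCalN, div_eq_mul_inv]
  refine (contDiffOn_conj (contDiffOn_ddF_hom I J)).add
    ((contDiffOn_const.mul ((hw I).mul (hw J))).mul (hq.inv fun X hX => ?_))
  have := ConicalDomain.matN_conj_pairing_ne_zero hX
  simpa [hermForm] using this

theorem contDiffOn_det {E k : Type*} [NormedAddCommGroup E] [NormedSpace ℝ E] [Fintype k]
    [DecidableEq k] {s : Set E} {A : E → Matrix k k ℝ}
    (hA : ∀ i j, ContDiffOn ℝ ∞ (fun x => A x i j) s) : ContDiffOn ℝ ∞ (fun x => (A x).det) s := by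
  simp only [Matrix.det_apply]
  exact ContDiffOn.sum fun σ _ => (contDiffOn_prod fun i _ => hA _ _).const_smul _

theorem contDiffOn_matrix_inv {E k : Type*} [NormedAddCommGroup E] [NormedSpace ℝ E] [Fintype k]
    [DecidableEq k] {s : Set E} {A : E → Matrix k k ℝ}
    (hA : ∀ i j, ContDiffOn ℝ ∞ (fun x => A x i j) s) (hdet : ∀ x ∈ s, IsUnit (A x).det) (i j : k) :
    ContDiffOn ℝ ∞ (fun x => (A x)⁻¹ i j) s := by
  simp only [Matrix.inv_def, Ring.inverse_eq_inv', Matrix.smul_apply, smul_eq_mul,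
    Matrix.adjugate_apply]
  refine ((contDiffOn_det hA).inv fun x hx => (hdet x hx).ne_zero).mul (contDiffOn_det fun a b => ?_)
  by_cases h : a = j
  · subst h
    simpa using contDiffOn_const
  · simpa [Matrix.updateRow_ne h] using hA a b

theorem contDiffOn_matrix_mul {E k : Type*} [NormedAddCommGroup E] [NormedSpace ℝ E] [Fintype k]
    {s : Set E} {A A' : E → Matrix k k ℝ}
    (hA : ∀ i j, ContDiffOn ℝ ∞ (fun x => A x i j) s)
    (hA' : ∀ i j, ContDiffOn ℝ ∞ (fun x => A' x i j) s) (i j : k) :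
    ContDiffOn ℝ ∞ (fun x => (A x * A' x) i j) s := by
  simp only [Matrix.mul_apply]
  exact ContDiffOn.sum fun l _ => (hA i l).mul (hA' l j)

theorem contDiffOn_matH_hom (i j : Fin (n + 1) ⊕ Fin (n + 1)) :
    ContDiffOn ℝ ∞ (fun X => matH D.F (hom X) i j) (baseSet D) := by
  have hR : ∀ I J, ContDiffOn ℝ ∞ (fun X => matR D.F (hom X) I J) (baseSet D) := fun I J =>
    contDiffOn_re (contDiffOn_matCalN_hom I J)
  have hI : ∀ I J, ContDiffOn ℝ ∞ (fun X => matI D.F (hom X) I J) (baseSet D) := fun I J =>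
    contDiffOn_im (contDiffOn_matCalN_hom I J)
  have hinv := contDiffOn_matrix_inv hI fun X hX => ConicalDomain.isUnit_det_matI hX
  rcases i with I | I <;> rcases j with J | J
  · exact hinv I J
  · exact contDiffOn_matrix_mul hinv hR I J
  · exact contDiffOn_matrix_mul hR hinv I J
  · exact (hI I J).add (contDiffOn_matrix_mul (contDiffOn_matrix_mul hR hinv) hR I J)

theorem contDiffOn_gFS {c : ℝ} (hc : 0 ≤ c) (u : Coord n) :
    ContDiffOn ℝ ∞ (fun e => gFS c D.F e u) {e : Coord n | hom e.1 ∈ D.carrier ∧ 0 < e.2.1} := by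
  set s := {e : Coord n | hom e.1 ∈ D.carrier ∧ 0 < e.2.1} with hs
  have hmaps : Set.MapsTo (fun e : Coord n => e.1) s (baseSet D) := fun e he => he.1
  have hρ : ContDiffOn ℝ ∞ (fun e : Coord n => e.2.1) s :=
    (contDiff_fst.comp contDiff_snd).contDiffOn
  have hp : ∀ i, ContDiffOn ℝ ∞ (fun e : Coord n => e.2.2.2 i) s := fun i =>
    ((contDiff_apply ℝ ℝ i).comp (contDiff_snd.comp (contDiff_snd.comp contDiff_snd))).contDiffOn
  have hc1 : ContDiffOn ℝ ∞ (fun e : Coord n => e.2.1 + c) s := hρ.add contDiffOn_const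
  have hc2 : ContDiffOn ℝ ∞ (fun e : Coord n => e.2.1 + 2 * c) s := hρ.add contDiffOn_const
  have n1 : ∀ e ∈ s, e.2.1 ≠ 0 := fun e he => he.2.ne'
  have n2 : ∀ e ∈ s, e.2.1 + c ≠ 0 := fun e he => by have := he.2; positivity
  have n3 : ∀ e ∈ s, e.2.1 + 2 * c ≠ 0 := fun e he => by have := he.2; positivity
  have n4 : ∀ e ∈ s, 4 * e.2.1 ^ 2 ≠ 0 := fun e he => by have := he.2; positivity
  have n5 : ∀ e ∈ s, 2 * e.2.1 ≠ 0 := fun e he => by have := he.2; positivity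
  have n6 : ∀ e ∈ s, e.2.1 ^ 2 ≠ 0 := fun e he => by have := he.2; positivity
  have hq : ContDiffOn ℝ ∞ (fun e : Coord n => 1 / (4 * e.2.1 ^ 2)) s :=
    contDiffOn_const.div (contDiffOn_const.mul (hρ.pow 2)) n4
  simp only [gFS_eq]
  refine ((((ContDiffOn.div hc1 hρ n1).mul ?_).add ((hq.mul (hc2.div hc1 n2)).mul
    contDiffOn_const)).add ((hq.mul (hc1.div hc2 n3)).mul (ContDiffOn.pow ?_ 2))).add
    ((contDiffOn_const.div (contDiffOn_const.mul hρ) n5).mul ?_) |>.add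
    (((contDiffOn_const.div (hρ.pow 2) n6).mul ?_).mul ?_)
  · exact (contDiffOn_barForm_hom _).comp contDiff_fst.contDiffOn hmaps
  · refine (contDiffOn_const.add ?_).add
      (contDiffOn_const.mul ((contDiffOn_dcK u.1).comp contDiff_fst.contDiffOn hmaps))
    exact ContDiffOn.sum fun I _ => ((hp _).mul contDiffOn_const).sub ((hp _).mul contDiffOn_const)
  · simp only [dotProduct, Matrix.mulVec]
    exact ContDiffOn.sum fun i _ => contDiffOn_const.mul (ContDiffOn.sum fun j _ =>
      ((contDiffOn_matH_hom i j).comp contDiff_fst.contDiffOn hmaps).mul contDiffOn_const)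
  · exact (contDiffOn_potK.comp contDiff_fst.contDiffOn hmaps).exp
  · have h : ContDiffOn ℝ ∞
        (fun e : Coord n => period D.F (hom e.1) ⬝ᵥ (fun i => (u.2.2.2 i : ℂ))) s := by
      simp only [dotProduct]
      exact ContDiffOn.sum fun i _ =>
        ((contDiffOn_period_hom i).comp contDiff_fst.contDiffOn hmaps).mul contDiffOn_const
    simp only [Complex.normSq_apply]
    exact ((contDiffOn_re h).mul (contDiffOn_re h)).add ((contDiffOn_im h).mul (contDiffOn_im h))

theorem contDiffOn_bilinFS {c : ℝ} (hc : 0 ≤ c) :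
    ContDiffOn ℝ ∞ (bilinFS c D.F) {e : Coord n | hom e.1 ∈ D.carrier ∧ 0 < e.2.1} := by
  rw [contDiffOn_clm_apply]
  intro u
  rw [contDiffOn_clm_apply]
  intro v
  simp only [bilinFS_apply]
  exact contDiffOn_const.mul
    (((contDiffOn_gFS hc (u + v)).sub (contDiffOn_gFS hc u)).sub (contDiffOn_gFS hc v))

end Smooth

/-! ### Symplectic changes of special coordinates -/

section Transition

variable {n : ℕ} {D D' : ConicalDomain n} {z : Fin (n + 1) → ℂ}
  {O : Matrix (Fin (n + 1) ⊕ Fin (n + 1)) (Fin (n + 1) ⊕ Fin (n + 1)) ℝ}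

/-- The coordinates `z^I` of `O φ`. -/
def transZ (F : (Fin (n + 1) → ℂ) → ℂ)
    (O : Matrix (Fin (n + 1) ⊕ Fin (n + 1)) (Fin (n + 1) ⊕ Fin (n + 1)) ℝ)
    (z : Fin (n + 1) → ℂ) : Fin (n + 1) → ℂ :=
  fun I => (O.map (fun r : ℝ => (r : ℂ))).mulVec (period F z) (Sum.inl I)

/-- The symplectic matrix `O` defines a change of special coordinates near `z`. -/
structure IsTransition (D D' : ConicalDomain n)
    (O : Matrix (Fin (n + 1) ⊕ Fin (n + 1)) (Fin (n + 1) ⊕ Fin (n + 1)) ℝ)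
    (z : Fin (n + 1) → ℂ) : Prop where
  symp : O ∈ Matrix.symplecticGroup (Fin (n + 1)) ℝ
  mem : z ∈ D.carrier
  eventually : ∀ᶠ y in 𝓝 z, transZ D.F O y ∈ D'.carrier ∧
    period D'.F (transZ D.F O y) = (O.map (fun r : ℝ => (r : ℂ))).mulVec (period D.F y)

/-- The differential of `transZ`. -/
def dTransZ (F : (Fin (n + 1) → ℂ) → ℂ)
    (O : Matrix (Fin (n + 1) ⊕ Fin (n + 1)) (Fin (n + 1) ⊕ Fin (n + 1)) ℝ)
    (z : Fin (n + 1) → ℂ) : (Fin (n + 1) → ℂ) →L[ℂ] (Fin (n + 1) → ℂ) :=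
  ContinuousLinearMap.pi fun I => (ContinuousLinearMap.proj (Sum.inl I)).comp
    ((LinearMap.toContinuousLinearMap (O.map (fun r : ℝ => (r : ℂ))).mulVecLin).comp (dPeriod F z))

theorem dTransZ_apply (F : (Fin (n + 1) → ℂ) → ℂ) (z a : Fin (n + 1) → ℂ) (I : Fin (n + 1)) :
    dTransZ F O z a I = (O.map (fun r : ℝ => (r : ℂ))).mulVec (dPeriod F z a) (Sum.inl I) := rfl

theorem hasFDerivAt_mulVec_period (hz : z ∈ D.carrier) :
    HasFDerivAt (fun y => (O.map (fun r : ℝ => (r : ℂ))).mulVec (period D.F y))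
      ((LinearMap.toContinuousLinearMap (O.map (fun r : ℝ => (r : ℂ))).mulVecLin).comp
        (dPeriod D.F z)) z :=
  (LinearMap.toContinuousLinearMap (O.map (fun r : ℝ => (r : ℂ))).mulVecLin).hasFDerivAt.comp z
    (ConicalDomain.hasFDerivAt_period hz)

theorem hasFDerivAt_transZ (hz : z ∈ D.carrier) :
    HasFDerivAt (transZ D.F O) (dTransZ D.F O z) z :=
  hasFDerivAt_pi.2 fun I => (ContinuousLinearMap.proj (R := ℂ)
    (φ := fun _ : Fin (n + 1) ⊕ Fin (n + 1) => ℂ) (Sum.inl I)).hasFDerivAt.comp z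
      (hasFDerivAt_mulVec_period hz)

namespace IsTransition

variable (h : IsTransition D D' O z)
include h

theorem transZ_mem : transZ D.F O z ∈ D'.carrier := h.eventually.self_of_nhds.1

theorem period_transZ : period D'.F (transZ D.F O z)
    = (O.map (fun r : ℝ => (r : ℂ))).mulVec (period D.F z) := h.eventually.self_of_nhds.2

theorem eventually_isTransition : ∀ᶠ y in 𝓝 z, IsTransition D D' O y := by
  filter_upwards [h.eventually.eventually_nhds, D.isOpen.mem_nhds h.mem] with y hy hyD
  exact ⟨h.symp, hyD, hy⟩

/-- The relation between the two period maps holds in a neighbourhood, so it can be differentiated.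
-/
theorem dPeriod_dTransZ (a : Fin (n + 1) → ℂ) :
    dPeriod D'.F (transZ D.F O z) (dTransZ D.F O z a)
      = (O.map (fun r : ℝ => (r : ℂ))).mulVec (dPeriod D.F z a) := by
  have h1 := (ConicalDomain.hasFDerivAt_period h.transZ_mem).comp z
    (hasFDerivAt_transZ (O := O) h.mem)
  have h2 := (hasFDerivAt_mulVec_period (O := O) h.mem).congr_of_eventuallyEq
    (f₁ := period D'.F ∘ transZ D.F O) (by
      filter_upwards [h.eventually] with y hy using hy.2)
  exact congrArg (fun L : (Fin (n + 1) → ℂ) →L[ℂ] _ => L a) (h1.unique h2)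

theorem dTransZ_self : dTransZ D.F O z z = transZ D.F O z := by
  ext I
  rw [dTransZ_apply, ConicalDomain.dPeriod_self h.mem, transZ]

/-- Both hermitian forms are restrictions of the pairing of a vector with its conjugate by the
symplectic form, up to the factor `i`. A real symplectic matrix commutes with conjugation and
preserves this pairing. -/
theorem hermForm_dTransZ (a b : Fin (n + 1) → ℂ) :
    hermForm (matN D'.F (transZ D.F O z)) (dTransZ D.F O z a) (dTransZ D.F O z b)
      = hermForm (matN D.F z) a b := by
  refine mul_left_cancel₀ Complex.I_ne_zero ?_
  rw [← ConicalDomain.sympForm_dPeriod_star h.transZ_mem, ← ConicalDomain.sympForm_dPeriod_star h.mem,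
    h.dPeriod_dTransZ, h.dPeriod_dTransZ, star_map_ofReal_mulVec,
    sympForm_mulVec (map_ofReal_mem_symplecticGroup h.symp)]

theorem hermForm_dTransZ_left (a : Fin (n + 1) → ℂ) :
    hermForm (matN D'.F (transZ D.F O z)) (dTransZ D.F O z a) (transZ D.F O z)
      = hermForm (matN D.F z) a z := by
  rw [← h.hermForm_dTransZ, h.dTransZ_self]

theorem hermForm_dTransZ_right (a : Fin (n + 1) → ℂ) :
    hermForm (matN D'.F (transZ D.F O z)) (transZ D.F O z) (dTransZ D.F O z a)
      = hermForm (matN D.F z) z a := by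
  rw [← h.hermForm_dTransZ, h.dTransZ_self]

theorem hermForm_transZ :
    hermForm (matN D'.F (transZ D.F O z)) (transZ D.F O z) (transZ D.F O z)
      = hermForm (matN D.F z) z z := by
  rw [← h.hermForm_dTransZ, h.dTransZ_self]

theorem barForm_dTransZ (a : Fin (n + 1) → ℂ) :
    barForm (matN D'.F (transZ D.F O z)) (transZ D.F O z) (dTransZ D.F O z a)
      = barForm (matN D.F z) z a := by
  simp only [barForm, h.hermForm_dTransZ, h.hermForm_dTransZ_right, h.hermForm_transZ]

end IsTransition

theorem isUnit_det_of_symplectic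
    (hO : O ∈ Matrix.symplecticGroup (Fin (n + 1)) ℝ) : IsUnit O.det :=
  SymplecticGroup.symplectic_det hO

theorem transpose_inv_mem_symplecticGroup
    (hO : O ∈ Matrix.symplecticGroup (Fin (n + 1)) ℝ) :
    O.transpose⁻¹ ∈ Matrix.symplecticGroup (Fin (n + 1)) ℝ := by
  have h := SymplecticGroup.transpose_mem hO
  have h2 := (⟨O.transpose, h⟩ : Matrix.symplecticGroup (Fin (n + 1)) ℝ)⁻¹.2
  rwa [SymplecticGroup.coe_inv'] at h2

theorem mulVec_dotProduct_transpose_inv (hO : O ∈ Matrix.symplecticGroup (Fin (n + 1)) ℝ)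
    (V : Fin (n + 1) ⊕ Fin (n + 1) → ℂ) (p : Fin (n + 1) ⊕ Fin (n + 1) → ℝ) :
    (O.map (fun r : ℝ => (r : ℂ))).mulVec V ⬝ᵥ (fun i => ((O.transpose⁻¹.mulVec p i : ℝ) : ℂ))
      = V ⬝ᵥ (fun i => (p i : ℂ)) := by
  have hd : IsUnit O.transpose.det := by
    rw [Matrix.det_transpose]; exact isUnit_det_of_symplectic hO
  have hp : p = O.transpose.mulVec (O.transpose⁻¹.mulVec p) := by
    rw [Matrix.mulVec_mulVec, Matrix.mul_nonsing_inv _ hd, Matrix.one_mulVec]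
  have hp' : (fun i => (p i : ℂ)) = (O.map (fun r : ℝ => (r : ℂ))).transpose.mulVec
      (fun i => ((O.transpose⁻¹.mulVec p i : ℝ) : ℂ)) := by
    ext i
    conv_lhs => rw [hp]
    simp only [Matrix.mulVec, dotProduct, Complex.ofReal_sum, Complex.ofReal_mul]
    rfl
  rw [mulVec_dotProduct, ← hp']

/-- The identification of covectors and vectors by the symplectic form. -/
def sharp {m : Type*} (p : m ⊕ m → ℝ) : m ⊕ m → ℝ :=
  Sum.elim (fun I => p (Sum.inr I)) (fun I => -p (Sum.inl I))

theorem sharp_eq {m : Type*} [Fintype m] [DecidableEq m] (p : m ⊕ m → ℝ) :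
    sharp p = -(Matrix.J m ℝ).mulVec p := by
  ext (I | I) <;> simp [sharp, Matrix.J, Matrix.fromBlocks_mulVec, Matrix.neg_mulVec]

/-- From `O J Oᵗ = J`: the symplectic form identifies the action on covectors with the action on
vectors, so covector components can be compared with points of the period map. -/
theorem sharp_transpose_inv (hO : O ∈ Matrix.symplecticGroup (Fin (n + 1)) ℝ)
    (p : Fin (n + 1) ⊕ Fin (n + 1) → ℝ) :
    sharp (O.transpose⁻¹.mulVec p) = O.mulVec (sharp p) := by
  have hd : IsUnit O.transpose.det := by
    rw [Matrix.det_transpose]; exact isUnit_det_of_symplectic hO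
  rw [sharp_eq, sharp_eq, Matrix.mulVec_neg, Matrix.mulVec_mulVec, Matrix.mulVec_mulVec,
    ← SymplecticGroup.mem_iff.1 hO, Matrix.mul_assoc, Matrix.mul_nonsing_inv _ hd, Matrix.mul_one,
    SymplecticGroup.mem_iff.1 hO]

theorem re_map_ofReal_mulVec {k : Type*} [Fintype k] (A : Matrix k k ℝ) (V : k → ℂ) (i : k) :
    ((A.map (fun r : ℝ => (r : ℂ))).mulVec V i).re = A.mulVec (fun j => (V j).re) i := by
  simp [Matrix.mulVec, dotProduct]

/-- The matrix `O` carries the decomposition of `p` into a multiple of `z` and a conjugate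
horizontal vector to the corresponding decomposition of the transformed covector. The invariant
description of `Ĥ` then only involves values of `N`, which are preserved. -/
theorem IsTransition.dotProduct_matH (h : IsTransition D D' O z)
    (p : Fin (n + 1) ⊕ Fin (n + 1) → ℝ) :
    O.transpose⁻¹.mulVec p ⬝ᵥ (matH D'.F (transZ D.F O z)).mulVec (O.transpose⁻¹.mulVec p)
      = p ⬝ᵥ (matH D.F z).mulVec p := by
  obtain ⟨k, Y, hY, h1, h2⟩ := ConicalDomain.exists_weil_decomposition h.mem p
  have e1 := ConicalDomain.dotProduct_matH_eq h.mem hY h1 h2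
  have hY' : hermForm (matN D'.F (transZ D.F O z)) (dTransZ D.F O z Y) (transZ D.F O z) = 0 := by
    rw [h.hermForm_dTransZ_left, hY]
  have hkz : k • transZ D.F O z = dTransZ D.F O z (k • z) := by rw [map_smul, h.dTransZ_self]
  have hV : ∀ i, ((dPeriod D'.F (transZ D.F O z) (k • transZ D.F O z)
      + star (dPeriod D'.F (transZ D.F O z) (dTransZ D.F O z Y))) i).re
      = sharp (O.transpose⁻¹.mulVec p) i := by
    intro i
    rw [hkz, h.dPeriod_dTransZ, h.dPeriod_dTransZ, star_map_ofReal_mulVec, ← Matrix.mulVec_add,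
      re_map_ofReal_mulVec, sharp_transpose_inv h.symp]
    congr 1
    ext (I | I)
    · exact h1 I
    · exact h2 I
  have e2 := ConicalDomain.dotProduct_matH_eq h.transZ_mem hY' (k := k)
    (fun I => hV (Sum.inl I)) (fun I => hV (Sum.inr I))
  rw [hkz, h.hermForm_dTransZ, h.hermForm_dTransZ] at e2
  linarith

theorem dPeriod_smul {k : ℂ} (hk : k ≠ 0) (hz : z ∈ D.carrier) :
    dPeriod D.F (k • z) = dPeriod D.F z := by
  ext a (I | I)
  · rfl
  · rw [dPeriod_inr, dPeriod_inr, ConicalDomain.ddF_smul hk hz]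

/-- Rescaling `z` does not change the line it spans nor its complement; only the coefficient along
`z` is divided by `k`. -/
theorem dotProduct_matH_smul {k : ℂ} (hk : k ≠ 0) (hz : z ∈ D.carrier)
    (p : Fin (n + 1) ⊕ Fin (n + 1) → ℝ) :
    p ⬝ᵥ (matH D.F (k • z)).mulVec p = p ⬝ᵥ (matH D.F z).mulVec p := by
  obtain ⟨l, Y, hY, h1, h2⟩ := ConicalDomain.exists_weil_decomposition hz p
  have e1 := ConicalDomain.dotProduct_matH_eq hz hY h1 h2
  have hl : (l * k⁻¹) • k • z = l • z := by rw [smul_smul, inv_mul_cancel_right₀ hk]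
  have hY' : hermForm (matN D.F (k • z)) Y (k • z) = 0 := by
    rw [ConicalDomain.matN_smul hk hz, hermForm_smul_right, hY, mul_zero]
  have e2 := ConicalDomain.dotProduct_matH_eq (D.smul_mem k hk z hz) hY' (k := l * k⁻¹) (p := p)
    (by rw [hl, dPeriod_smul hk hz]; exact h1) (by rw [hl, dPeriod_smul hk hz]; exact h2)
  rw [hl, ConicalDomain.matN_smul hk hz] at e2
  linarith

end Transition

/-! ### Changes of the coordinates `(X, ρ, φ̃, p)` -/

section CoordChange

variable {n : ℕ} {D D' : ConicalDomain n} {X : Fin n → ℂ}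
  {O : Matrix (Fin (n + 1) ⊕ Fin (n + 1)) (Fin (n + 1) ⊕ Fin (n + 1)) ℝ}

/-- The change of the inhomogeneous coordinates. -/
def transX (F : (Fin (n + 1) → ℂ) → ℂ)
    (O : Matrix (Fin (n + 1) ⊕ Fin (n + 1)) (Fin (n + 1) ⊕ Fin (n + 1)) ℝ) (X : Fin n → ℂ) :
    Fin n → ℂ := fun μ => transZ F O (hom X) μ.succ / transZ F O (hom X) 0

/-- The change of the coordinates `(X, ρ, φ̃, p)`; the number `b` selects a branch of the
logarithm. -/
def transCoord (c : ℝ) (F : (Fin (n + 1) → ℂ) → ℂ)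
    (O : Matrix (Fin (n + 1) ⊕ Fin (n + 1)) (Fin (n + 1) ⊕ Fin (n + 1)) ℝ) (b : ℂ) (k : ℝ)
    (e : Coord n) : Coord n :=
  (transX F O e.1, e.2.1, e.2.2.1 + k - 2 * c * (Complex.log (transZ F O (hom e.1) 0 / b)).im,
    O.transpose⁻¹.mulVec e.2.2.2)

/-- The differential of `hom`. -/
def dHom (n : ℕ) : (Fin n → ℂ) →L[ℂ] (Fin (n + 1) → ℂ) :=
  LinearMap.toContinuousLinearMap
    { toFun := fun a => Matrix.vecCons 0 a
      map_add' := fun a b => by simp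
      map_smul' := fun k a => by simp }

@[simp] theorem dHom_apply (a : Fin n → ℂ) : dHom n a = Matrix.vecCons 0 a := rfl

theorem hasFDerivAt_hom (X : Fin n → ℂ) : HasFDerivAt (𝕜 := ℂ) hom (dHom n) X := by
  rw [hasFDerivAt_pi']
  intro I
  refine Fin.cases ?_ (fun μ => ?_) I
  · have : (ContinuousLinearMap.proj (R := ℂ) (φ := fun _ : Fin (n + 1) => ℂ) 0).comp (dHom n)
        = 0 := by ext a; rfl
    rw [this]
    exact hasFDerivAt_const (1 : ℂ) X
  · exact hasFDerivAt_apply μ X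

theorem hom_transX (h0 : transZ D.F O (hom X) 0 ≠ 0) :
    hom (transX D.F O X) = (transZ D.F O (hom X) 0)⁻¹ • transZ D.F O (hom X) := by
  ext I
  refine Fin.cases ?_ (fun μ => ?_) I
  · simp [inv_mul_cancel₀ h0]
  · simp [transX, div_eq_inv_mul]

theorem contDiffAt_transZ_hom (hX : hom X ∈ D.carrier) :
    ContDiffAt ℂ ∞ (fun X => transZ D.F O (hom X)) X := by
  have hh : ContDiffAt ℂ ∞ (hom : (Fin n → ℂ) → _) X := by
    refine contDiffAt_pi.2 fun I => ?_
    refine Fin.cases ?_ (fun μ => ?_) I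
    · exact contDiffAt_const
    · exact (contDiff_apply ℂ ℂ μ).contDiffAt
  have hp : ContDiffAt ℂ ∞ (period D.F) (hom X) := by
    refine contDiffAt_pi.2 fun i => ?_
    rcases i with I | I
    · exact (contDiff_apply ℂ ℂ I).contDiffAt
    · exact (D.contDiffOn_dF I).contDiffAt (D.isOpen.mem_nhds hX)
  have hz : ContDiffAt ℂ ∞ (transZ D.F O) (hom X) := by
    refine contDiffAt_pi.2 fun I => ?_
    simp only [transZ, Matrix.mulVec, dotProduct]
    exact ContDiffAt.sum fun i _ => contDiffAt_const.mul ((contDiffAt_pi.1 hp) i)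
  exact hz.comp X hh

theorem contDiffAt_transX (hX : hom X ∈ D.carrier) (h0 : transZ D.F O (hom X) 0 ≠ 0) :
    ContDiffAt ℂ ∞ (transX D.F O) X := by
  have h := contDiffAt_pi.1 (contDiffAt_transZ_hom (O := O) hX)
  exact contDiffAt_pi.2 fun μ => (h μ.succ).div (h 0) h0

theorem hasFDerivAt_transZ_hom (hX : hom X ∈ D.carrier) :
    HasFDerivAt (fun X => transZ D.F O (hom X)) ((dTransZ D.F O (hom X)).comp (dHom n)) X :=
  (hasFDerivAt_transZ hX).comp X (hasFDerivAt_hom X)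

/-- Obtained by differentiating `τ⁰ • (1, X') = τ`, where `τ` denotes the transformed homogeneous
coordinates. The term along `τ` lies in the kernel of `barForm`, so only the differential of `τ`
matters for the metric. -/
theorem vecCons_fderiv_transX (hX : hom X ∈ D.carrier) (h0 : transZ D.F O (hom X) 0 ≠ 0)
    (a : Fin n → ℂ) :
    (Matrix.vecCons 0 (fderiv ℂ (transX D.F O) X a) : Fin (n + 1) → ℂ)
      = (transZ D.F O (hom X) 0)⁻¹ • (dTransZ D.F O (hom X) (Matrix.vecCons 0 a)
        + (-(dTransZ D.F O (hom X) (Matrix.vecCons 0 a) 0 * (transZ D.F O (hom X) 0)⁻¹)) •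
          transZ D.F O (hom X)) := by
  have hd := ((contDiffAt_transX hX h0).differentiableAt (by simp)).hasFDerivAt
  have hz := hasFDerivAt_transZ_hom (O := O) hX
  have hz0 := (hasFDerivAt_pi'.1 hz) 0
  have h1 := hz0.smul ((hasFDerivAt_hom (transX D.F O X)).comp X hd)
  have h2 : HasFDerivAt (fun X => transZ D.F O (hom X) 0 • hom (transX D.F O X))
      ((dTransZ D.F O (hom X)).comp (dHom n)) X := by
    refine hz.congr_of_eventuallyEq ?_
    have hne : ∀ᶠ Y in 𝓝 X, transZ D.F O (hom Y) 0 ≠ 0 :=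
      hz0.continuousAt.eventually_ne h0
    filter_upwards [hne] with Y hY
    rw [hom_transX hY, smul_smul, mul_inv_cancel₀ hY, one_smul]
  have h3 := congrArg (fun L : (Fin n → ℂ) →L[ℂ] (Fin (n + 1) → ℂ) => L a) (h1.unique h2)
  simp only [add_apply, smul_apply, ContinuousLinearMap.comp_apply,
    ContinuousLinearMap.smulRight_apply, ContinuousLinearMap.proj_apply, dHom_apply,
    Function.comp_apply] at h3
  rw [hom_transX h0] at h3
  rw [smul_smul] at h3
  rw [eq_inv_smul_iff₀ h0, neg_smul, ← sub_eq_add_neg]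
  exact eq_sub_of_add_eq h3

variable (hT : IsTransition D D' O (hom X)) (h0 : transZ D.F O (hom X) 0 ≠ 0)
include hT h0

theorem IsTransition.hom_transX_mem : hom (transX D.F O X) ∈ D'.carrier := by
  rw [hom_transX h0]
  exact D'.smul_mem _ (inv_ne_zero h0) _ hT.transZ_mem

theorem IsTransition.matN_hom_transX :
    matN D'.F (hom (transX D.F O X)) = matN D'.F (transZ D.F O (hom X)) := by
  rw [hom_transX h0, ConicalDomain.matN_smul (inv_ne_zero h0) hT.transZ_mem]

theorem IsTransition.barForm_transX (a : Fin n → ℂ) :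
    barForm (matN D'.F (hom (transX D.F O X))) (hom (transX D.F O X))
        (Matrix.vecCons 0 (fderiv ℂ (transX D.F O) X a))
      = barForm (matN D.F (hom X)) (hom X) (Matrix.vecCons 0 a) := by
  rw [hT.matN_hom_transX h0, vecCons_fderiv_transX hT.mem h0, hom_transX h0,
    barForm_smul _ (inv_ne_zero h0), barForm_add_smul (ConicalDomain.matN_isSymm hT.transZ_mem)
      (D'.f_pos _ hT.transZ_mem), hT.barForm_dTransZ]

/-- Normalizing the first coordinate to one divides the preserved norm by `|τ⁰|²`, so the potential
changes by the logarithm of this factor. -/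
theorem IsTransition.potK_transX :
    potK D'.F (transX D.F O X) = potK D.F X + Real.log (Complex.normSq (transZ D.F O (hom X) 0)) := by
  have h1 : domMetric D'.F (hom (transX D.F O X)) (hom (transX D.F O X)) (hom (transX D.F O X))
      = (Complex.normSq (transZ D.F O (hom X) 0))⁻¹ * domMetric D.F (hom X) (hom X) (hom X) := by
    rw [domMetric_eq, hT.matN_hom_transX h0, hom_transX h0, hermForm_smul_left,
      hermForm_smul_right, hT.hermForm_transZ, ← mul_assoc, Complex.mul_conj,
      Complex.re_ofReal_mul, map_inv₀, domMetric_eq]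
  rw [potK, h1, Real.log_mul (inv_ne_zero (Complex.normSq_pos.2 h0).ne') (D.f_pos _ hT.mem).ne',
    Real.log_inv, potK]
  ring

theorem IsTransition.eventually_transX : ∀ᶠ Y in 𝓝 X, IsTransition D D' O (hom Y) ∧
    transZ D.F O (hom Y) 0 ≠ 0 := by
  have h1 := (contDiff_hom (n := n)).continuous.continuousAt.eventually hT.eventually_isTransition
  have h2 := (hasFDerivAt_pi'.1 (hasFDerivAt_transZ_hom (O := O) hT.mem) 0).continuousAt
  exact h1.and (h2.eventually_ne h0)

/-- The potential changes by `log |τ⁰|²` with `τ⁰` holomorphic, and `d^c` of this function is twice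
the differential of the argument of `τ⁰`. The shift of `φ̃` in `transCoord` is designed to cancel
it. -/
theorem IsTransition.dcK_transX (a : Fin n → ℂ) :
    dcK D'.F (transX D.F O X) (fderiv ℂ (transX D.F O) X a) = dcK D.F X a
      + 2 * (dTransZ D.F O (hom X) (Matrix.vecCons 0 a) 0 / transZ D.F O (hom X) 0).im := by
  have hd := ((contDiffAt_transX hT.mem h0).differentiableAt (by simp)).hasFDerivAt.restrictScalars ℝ
  have hK' := ((contDiffOn_potK.contDiffAt (isOpen_baseSet.mem_nhds
    (hT.hom_transX_mem h0))).differentiableAt (by simp)).hasFDerivAt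
  have hK := ((contDiffOn_potK.contDiffAt (isOpen_baseSet.mem_nhds hT.mem)).differentiableAt
    (by simp)).hasFDerivAt
  have ht := (hasFDerivAt_pi'.1 (hasFDerivAt_transZ_hom (O := O) hT.mem) 0).restrictScalars ℝ
  have hre := (Complex.reCLM.hasFDerivAt.comp X ht)
  have him := (Complex.imCLM.hasFDerivAt.comp X ht)
  have hnorm := ((hre.mul hre).add (him.mul him)).log
    (by simpa [Complex.normSq_apply] using (Complex.normSq_pos.2 h0).ne')
  have h1 := hK'.comp X hd
  have h2 := (hK.add hnorm).congr_of_eventuallyEq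
    (f₁ := potK D'.F ∘ transX D.F O) (by
      filter_upwards [hT.eventually_transX h0] with Y hY
      rw [Function.comp_apply, hY.1.potK_transX hY.2]
      rfl)
  have h3 := congrArg (fun L : (Fin n → ℂ) →L[ℝ] ℝ => L (Complex.I • a)) (h1.unique h2)
  simp only [ContinuousLinearMap.comp_apply, add_apply, smul_apply,
    ContinuousLinearMap.coe_restrictScalars', map_smul, ContinuousLinearMap.proj_apply, dHom_apply,
    Complex.reCLM_apply, Complex.imCLM_apply, smul_eq_mul,
    Function.comp_apply, Pi.add_apply, Pi.mul_apply] at h3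
  rw [dcK, dcK, h3]
  set w := dTransZ D.F O (hom X) (Matrix.vecCons 0 a) 0
  set t := transZ D.F O (hom X) 0
  rw [Complex.div_im, Complex.normSq_apply]
  have hpos : t.re * t.re + t.im * t.im ≠ 0 := by
    simpa [Complex.normSq_apply] using (Complex.normSq_pos.2 h0).ne'
  simp only [Complex.mul_re, Complex.mul_im, Complex.I_re, Complex.I_im]
  field_simp
  ring

end CoordChange

/-! ### Invariance of the one-loop metric under the coordinate changes -/

section CoordTrans

variable {n : ℕ} {D D' : ConicalDomain n} {e : Coord n} {c : ℝ} {b : ℂ} (k : ℝ)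
  {O : Matrix (Fin (n + 1) ⊕ Fin (n + 1)) (Fin (n + 1) ⊕ Fin (n + 1)) ℝ}

theorem contDiffAt_transCoord (hX : hom e.1 ∈ D.carrier) (h0 : transZ D.F O (hom e.1) 0 ≠ 0)
    (hb : transZ D.F O (hom e.1) 0 / b ∈ Complex.slitPlane) :
    ContDiffAt ℝ ∞ (transCoord c D.F O b k) e := by
  have hf : ContDiffAt ℝ ∞ (fun e : Coord n => e.1) e := contDiffAt_fst
  refine ContDiffAt.prodMk ?_ (ContDiffAt.prodMk ?_ (ContDiffAt.prodMk ?_ ?_))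
  · exact ((contDiffAt_transX hX h0).restrict_scalars ℝ).comp e hf
  · exact contDiffAt_fst.comp e contDiffAt_snd
  · have ht : ContDiffAt ℝ ∞ (fun e : Coord n => transZ D.F O (hom e.1) 0) e :=
      (((contDiffAt_pi.1 (contDiffAt_transZ_hom (O := O) hX)) 0).restrict_scalars ℝ).comp e hf
    have hl : ContDiffAt ℝ ∞ Complex.log (transZ D.F O (hom e.1) 0 / b) :=
      (Complex.contDiffAt_log hb).restrict_scalars ℝ
    have hlog : ContDiffAt ℝ ∞ (fun e : Coord n => Complex.log (transZ D.F O (hom e.1) 0 / b)) e :=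
      hl.comp e (by simpa only [div_eq_mul_inv] using ht.mul (contDiffAt_const (c := b⁻¹)))
    have hφ : ContDiffAt ℝ ∞ (fun e : Coord n => e.2.2.1) e :=
      (contDiff_fst.comp (contDiff_snd.comp contDiff_snd)).contDiffAt
    exact (hφ.add contDiffAt_const).sub
      (contDiffAt_const.mul (Complex.imCLM.contDiff.contDiffAt.comp e hlog))
  · have hL : ContDiff ℝ ∞ (LinearMap.toContinuousLinearMap (O.transpose⁻¹).mulVecLin) :=
      ContinuousLinearMap.contDiff _
    exact hL.contDiffAt.comp e
      (contDiff_snd.comp (contDiff_snd.comp contDiff_snd)).contDiffAt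

/-- The metric `g^c_FS` is invariant under the changes of coordinates. -/
theorem gFS_transCoord (hT : IsTransition D D' O (hom e.1)) (hρ : 0 < e.2.1)
    (h0 : transZ D.F O (hom e.1) 0 ≠ 0)
    (hb : transZ D.F O (hom e.1) 0 / b ∈ Complex.slitPlane) (u : Coord n) :
    gFS c D'.F (transCoord c D.F O b k e) (fderiv ℝ (transCoord c D.F O b k) e u)
      = gFS c D.F e u := by
  have hb0 : b ≠ 0 := by rintro rfl; simp at hb
  have hf : HasFDerivAt (fun e : Coord n => e.1) (ContinuousLinearMap.fst ℝ _ _) e :=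
    hasFDerivAt_fst
  have h1 : HasFDerivAt (fun e : Coord n => transX D.F O e.1) _ e :=
    (((contDiffAt_transX hT.mem h0).differentiableAt (by simp)).hasFDerivAt.restrictScalars ℝ).comp
      e hf
  have hρ' : HasFDerivAt (fun e : Coord n => e.2.1) ((ContinuousLinearMap.fst ℝ _ _).comp
    (ContinuousLinearMap.snd ℝ _ _)) e := hasFDerivAt_fst.comp e hasFDerivAt_snd
  have hφ : HasFDerivAt (fun e : Coord n => e.2.2.1) ((ContinuousLinearMap.fst ℝ _ _).comp
    ((ContinuousLinearMap.snd ℝ _ _).comp (ContinuousLinearMap.snd ℝ _ _))) e :=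
    hasFDerivAt_fst.comp e (hasFDerivAt_snd.comp e hasFDerivAt_snd)
  have hp : HasFDerivAt (fun e : Coord n => e.2.2.2) ((ContinuousLinearMap.snd ℝ _ _).comp
    ((ContinuousLinearMap.snd ℝ _ _).comp (ContinuousLinearMap.snd ℝ _ _))) e :=
    hasFDerivAt_snd.comp e (hasFDerivAt_snd.comp e hasFDerivAt_snd)
  let L : Coord n →L[ℝ] ℂ := (((ContinuousLinearMap.proj (R := ℂ) (φ := fun _ : Fin (n + 1) => ℂ)
    0).comp ((dTransZ D.F O (hom e.1)).comp (dHom n))).restrictScalars ℝ).comp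
      (ContinuousLinearMap.fst ℝ _ _)
  have ht : HasFDerivAt (fun e : Coord n => transZ D.F O (hom e.1) 0) L e :=
    ((hasFDerivAt_pi'.1 (hasFDerivAt_transZ_hom (O := O) hT.mem) 0).restrictScalars ℝ).comp e hf
  have ht' : HasFDerivAt (fun e : Coord n => transZ D.F O (hom e.1) 0 / b) (b⁻¹ • L) e := by
    simp only [div_eq_mul_inv]
    exact ht.mul_const b⁻¹
  have hlog := ((Complex.hasStrictDerivAt_log hb).hasDerivAt.hasFDerivAt.restrictScalars ℝ).comp e
    ht'
  have him := Complex.imCLM.hasFDerivAt.comp e hlog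
  have hL : ∀ q, HasFDerivAt (fun q : Fin (n + 1) ⊕ Fin (n + 1) → ℝ => O.transpose⁻¹.mulVec q)
      (LinearMap.toContinuousLinearMap (O.transpose⁻¹).mulVecLin) q := fun q =>
    (LinearMap.toContinuousLinearMap (O.transpose⁻¹).mulVecLin).hasFDerivAt
  have hfin : HasFDerivAt (transCoord c D.F O b k) _ e :=
    h1.prodMk (hρ'.prodMk (((hφ.add_const k).sub (him.const_mul (2 * c))).prodMk
      ((hL _).comp e hp)))
  -- The constants `b` and `k` only select branches and disappear in the differential.
  have hval : fderiv ℝ (transCoord c D.F O b k) e u = (fderiv ℂ (transX D.F O) e.1 u.1, u.2.1,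
      u.2.2.1 - 2 * c * (dTransZ D.F O (hom e.1) (Matrix.vecCons 0 u.1) 0
        / transZ D.F O (hom e.1) 0).im, O.transpose⁻¹.mulVec u.2.2.2) := by
    rw [hfin.fderiv]
    refine Prod.ext rfl (Prod.ext rfl (Prod.ext ?_ rfl))
    change u.2.2.1 - 2 * c * ((b⁻¹ * dTransZ D.F O (hom e.1) (Matrix.vecCons 0 u.1) 0) *
      (transZ D.F O (hom e.1) 0 / b)⁻¹).im = _
    congr 3
    field_simp
  rw [hval, gFS_eq, gFS_eq]
  simp only [transCoord]
  -- The summands are invariant one by one. In the squared one-form the changes of `φ̃` and of `c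
  -- d^c𝒦` cancel; in the last summand `exp 𝒦` gains `|τ⁰|²` and the squared norm of the pairing
  -- with the period loses it.
  rw [hT.barForm_transX h0, hT.dcK_transX h0, hT.potK_transX h0, hom_transX h0,
    dotProduct_matH_smul (inv_ne_zero h0) hT.transZ_mem, hT.dotProduct_matH,
    sympForm_mulVec (transpose_inv_mem_symplecticGroup hT.symp),
    ConicalDomain.period_smul (inv_ne_zero h0) hT.transZ_mem, hT.period_transZ, smul_dotProduct,
    mulVec_dotProduct_transpose_inv hT.symp, Real.exp_add, Real.exp_log (Complex.normSq_pos.2 h0),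
    smul_eq_mul, Complex.normSq_mul, Complex.normSq_inv]
  have hne := (Complex.normSq_pos.2 h0).ne'
  congr 1
  · congr 3
    ring
  · field_simp

end CoordTrans

/-! ### Heisenberg translations -/

section Heisenberg

variable {n : ℕ} (q : Fin (n + 1) ⊕ Fin (n + 1) → ℝ) (s : ℝ)

/-- The translations in the coordinates `(φ̃, p)`. -/
def heisenberg (e : Coord n) : Coord n :=
  (e.1, e.2.1, e.2.2.1 + s - sympForm q e.2.2.2, e.2.2.2 + q)

/-- The linear part of `heisenberg`. -/
def heisenbergLin : Coord n →L[ℝ] Coord n :=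
  LinearMap.toContinuousLinearMap
    { toFun := fun u => (u.1, u.2.1, u.2.2.1 - sympForm q u.2.2.2, u.2.2.2)
      map_add' := fun u v => by
        refine Prod.ext rfl (Prod.ext rfl (Prod.ext ?_ rfl))
        simp only [Prod.snd_add, Prod.fst_add, sympForm_add_right]
        ring
      map_smul' := fun r u => by
        refine Prod.ext rfl (Prod.ext rfl (Prod.ext ?_ rfl))
        simp only [Prod.smul_snd, Prod.smul_fst, sympForm_smul_right, smul_eq_mul, RingHom.id_apply]
        ring }

theorem heisenberg_eq (e : Coord n) :
    heisenberg q s e = heisenbergLin q e + (0, 0, s, q) := by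
  refine Prod.ext ?_ (Prod.ext ?_ (Prod.ext ?_ ?_))
  · exact (add_zero _).symm
  · exact (add_zero _).symm
  · change e.2.2.1 + s - sympForm q e.2.2.2 = e.2.2.1 - sympForm q e.2.2.2 + s
    ring
  · rfl

theorem hasFDerivAt_heisenberg (e : Coord n) :
    HasFDerivAt (heisenberg q s) (heisenbergLin q) e := by
  have h : heisenberg q s = fun e => heisenbergLin q e + (0, 0, s, q) :=
    funext fun e => heisenberg_eq q s e
  rw [h]
  exact (heisenbergLin q).hasFDerivAt.add_const _

/-- Neither `φ̃` nor `p` occurs in the formula except through the symplectic pairing of `p` with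
`dp`. Translating `p` by `q` adds the pairing of `q` with `dp`, which the linear part of the
translation subtracts from `dφ̃`. -/
theorem gFS_heisenberg (c : ℝ) (F : (Fin (n + 1) → ℂ) → ℂ) (e u : Coord n) :
    gFS c F (heisenberg q s e) (heisenbergLin q u) = gFS c F e u := by
  have h1 : heisenbergLin q u = (u.1, u.2.1, u.2.2.1 - sympForm q u.2.2.2, u.2.2.2) := rfl
  rw [gFS_eq, gFS_eq, h1]
  simp only [heisenberg]
  rw [sympForm_add_left]
  ring

theorem heisenberg_neg_heisenberg (e : Coord n) :
    heisenberg q s (heisenberg (-q) (-s) e) = e := by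
  have hq : sympForm q q = 0 := by
    have := sympForm_swap q q
    linarith
  have h : ∀ p, sympForm (-q) p = -sympForm q p := fun p => by
    simpa using sympForm_smul_left (-1) q p
  refine Prod.ext rfl (Prod.ext rfl (Prod.ext ?_ ?_))
  · simp only [heisenberg, sympForm_add_right, h]
    rw [show sympForm q (-q) = 0 by rw [sympForm_swap, h, hq]; simp]
    ring
  · simp [heisenberg]

end Heisenberg

/-! ### Vector fields and functions on manifolds -/

section Fields

variable {E : Type*} [NormedAddCommGroup E] [NormedSpace ℝ E]
  {H : Type*} [TopologicalSpace H] {I : ModelWithCorners ℝ E H}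
  {M : Type*} [TopologicalSpace M] [ChartedSpace H M]

theorem mvfderiv_congr {F : Type*} [NormedAddCommGroup F] [NormedSpace ℝ F] {ζ η : M → F} {p : M}
    (h : ζ =ᶠ[𝓝 p] η) : mvfderiv I ζ p = mvfderiv I η p := by
  have := h.mfderiv_eq (I := I) (I' := 𝓘(ℝ, F))
  exact ContinuousLinearMap.ext fun v => congrArg (fun L : E →L[ℝ] F => L v) this

theorem mvfderiv_comp_fderiv {F G : Type*} [NormedAddCommGroup F] [NormedSpace ℝ F]
    [NormedAddCommGroup G] [NormedSpace ℝ G] {ζ : M → F} {h : F → G} {p : M}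
    (hh : DifferentiableAt ℝ h (ζ p)) (hζ : MDifferentiableAt I 𝓘(ℝ, F) ζ p)
    (v : TangentSpace I p) :
    mvfderiv I (fun q => h (ζ q)) p v = fderiv ℝ h (ζ p) (mvfderiv I ζ p v) := by
  have := mfderiv_comp_apply (I := I) (I' := 𝓘(ℝ, F)) (I'' := 𝓘(ℝ, G)) p
    hh.mdifferentiableAt hζ v
  rw [mfderiv_eq_fderiv] at this
  exact this

variable [IsManifold I ∞ M]

/-- A local extension of `v` multiplied by a bump function. The connection identities are formulated
for global smooth fields; this allows them to be evaluated at arbitrary tangent vectors. -/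
theorem exists_smoothField [T2Space M] [FiniteDimensional ℝ E] (p : M) (v : TangentSpace I p) :
    ∃ X : ∀ q : M, TangentSpace I q, SmoothField X ∧ X p = v := by
  obtain ⟨s, hs, hX⟩ := FiberBundle.exists_contMDiffOn_extend (k := ∞) I E
    (V := (TangentSpace I : M → Type _)) v
  obtain ⟨u, hus, hu, hpu⟩ := mem_nhds_iff.1 hs
  obtain ⟨f, -, hf⟩ := (SmoothBumpFunction.nhds_basis_tsupport (I := I) p).mem_iff.1
    (hu.mem_nhds hpu)
  refine ⟨fun q => f q • FiberBundle.extend E v q, ?_, ?_⟩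
  · exact ContMDiffOn.smul_section_of_tsupport f.contMDiff.contMDiffOn hu hf (hX.mono hus)
  · simp

theorem contMDiffAt_mvfderiv {F : Type*} [NormedAddCommGroup F] [NormedSpace ℝ F] {ζ : M → F}
    {u : Set M} (hu : IsOpen u) (hζ : ContMDiffOn I 𝓘(ℝ, F) ∞ ζ u)
    {Y : ∀ q : M, TangentSpace I q} (hY : SmoothField Y) {p : M} (hp : p ∈ u) :
    ContMDiffAt I 𝓘(ℝ, F) ∞ (fun q => mvfderiv I ζ q (Y q)) p := by
  have h1 := hζ.contMDiffOn_tangentMapWithin (m := ∞) (by simp) hu.uniqueMDiffOn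
  have h2 : ContMDiffOn I 𝓘(ℝ, F).tangent ∞
      (fun q => tangentMapWithin I 𝓘(ℝ, F) ζ u ⟨q, Y q⟩) u :=
    h1.comp (hY.contMDiffOn (s := u)) fun q hq => hq
  have h3 := (contMDiff_snd_tangentBundle_modelSpace F 𝓘(ℝ, F)).comp_contMDiffOn h2
  refine (h3.contMDiffAt (hu.mem_nhds hp)).congr_of_eventuallyEq ?_
  filter_upwards [hu.mem_nhds hp] with q hq
  change _ = mfderivWithin I 𝓘(ℝ, F) ζ u q (Y q)
  rw [mfderivWithin_of_isOpen hu hq]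
  rfl

/-- In a coordinate system, the affine functions are the solutions of a second order equation. -/
theorem exists_christoffel [T2Space M] [FiniteDimensional ℝ E] {F : Type*} [NormedAddCommGroup F]
    [NormedSpace ℝ F] {ζ : M → F}
    (nabla : CovariantDerivative I E (TangentSpace I : M → Type _)) {u : Set M} (hu : IsOpen u)
    (hζ : IsLocalDiffeomorphOn I 𝓘(ℝ, F) ∞ ζ u) {p : M} (hp : p ∈ u) (x y : F) :
    ∃ Z : F, ∀ h : F → ℝ, ContDiffAt ℝ 2 h (ζ p) → IsAffineFunOn nabla (fun q => h (ζ q)) u →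
      fderiv ℝ (fderiv ℝ h) (ζ p) x y + fderiv ℝ h (ζ p) Z = 0 := by
  have hsurj : ∀ w : F, ∃ v : TangentSpace I p, mvfderiv I ζ p v = w := fun w =>
    ((hζ ⟨p, hp⟩).mfderivToContinuousLinearEquiv (by simp)).surjective w
  obtain ⟨v, hv⟩ := hsurj x
  obtain ⟨w, hw⟩ := hsurj y
  obtain ⟨X, hX, rfl⟩ := exists_smoothField p v
  obtain ⟨Y, hY, rfl⟩ := exists_smoothField p w
  have hζs := hζ.contMDiffOn
  have hζ1 : ∀ q ∈ u, MDifferentiableAt I 𝓘(ℝ, F) ζ q := fun q hq =>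
    (hζs.contMDiffAt (hu.mem_nhds hq)).mdifferentiableAt (by simp)
  set η : M → F := fun q => mvfderiv I ζ q (Y q) with hη
  have hη1 : MDifferentiableAt I 𝓘(ℝ, F) η p :=
    (contMDiffAt_mvfderiv hu hζs hY hp).mdifferentiableAt (by simp)
  -- With `η = dζ(Y)`, the condition `X (Y h) = (∇_X Y) h` becomes a second order equation for `h`
  -- in the coordinates `ζ`; its first order term is `dh` on the vector `X η - dζ(∇_X Y)`, which
  -- does not depend on `h`.
  refine ⟨mvfderiv I η p (X p) - mvfderiv I ζ p (nabla Y p (X p)), fun h hh haff => ?_⟩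
  have h1 := haff X Y hX hY p hp
  rw [mvfderiv_comp_fderiv (hh.differentiableAt (by simp)) (hζ1 p hp)] at h1
  have hev : (fun q => mvfderiv I (fun q => h (ζ q)) q (Y q))
      =ᶠ[𝓝 p] fun q => (fun r : F × F => fderiv ℝ h r.1 r.2) (ζ q, η q) := by
    have h2 : ∀ᶠ r in 𝓝 (ζ p), DifferentiableAt ℝ h r :=
      (hh.eventually (by simp)).mono fun r hr => hr.differentiableAt (by simp)
    filter_upwards [(hζ1 p hp).continuousAt.eventually h2, hu.mem_nhds hp] with q hq hqu
    exact mvfderiv_comp_fderiv hq (hζ1 q hqu) _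
  have hpair : MDifferentiableAt I 𝓘(ℝ, F × F) (fun q => (ζ q, η q)) p :=
    (hζ1 p hp).prodMk_space hη1
  have hd : DifferentiableAt ℝ (fderiv ℝ h) (ζ p) :=
    (hh.fderiv_right (m := 1) (by norm_num)).differentiableAt (by simp)
  have hclm : HasFDerivAt (fun r : F × F => fderiv ℝ h r.1 r.2) _ (ζ p, η p) :=
    (hd.hasFDerivAt.comp (ζ p, η p) hasFDerivAt_fst).clm_apply hasFDerivAt_snd
  have h3 : mvfderiv I (fun q => mvfderiv I (fun q => h (ζ q)) q (Y q)) p (X p)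
      = mvfderiv I (fun q => (fun r : F × F => fderiv ℝ h r.1 r.2) (ζ q, η q)) p (X p) :=
    by rw [mvfderiv_congr hev]
  have h4 : mvfderiv I (fun q => (ζ q, η q)) p (X p)
      = (mvfderiv I ζ p (X p), mvfderiv I η p (X p)) := by
    have h5 := mvfderiv_comp_fderiv (h := Prod.fst) differentiableAt_fst hpair (X p)
    have h6 := mvfderiv_comp_fderiv (h := Prod.snd) differentiableAt_snd hpair (X p)
    rw [fderiv_fst] at h5
    rw [fderiv_snd] at h6
    exact Prod.ext h5.symm h6.symm
  rw [h3, mvfderiv_comp_fderiv (h := fun r : F × F => fderiv ℝ h r.1 r.2)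
    (ζ := fun q => (ζ q, η q)) hclm.differentiableAt hpair, hclm.fderiv, h4] at h1
  simp only [add_apply, ContinuousLinearMap.comp_apply, ContinuousLinearMap.flip_apply,
    ContinuousLinearMap.coe_fst', ContinuousLinearMap.coe_snd', hv] at h1
  have hw' : η p = y := hw
  rw [hw'] at h1
  rw [map_sub]
  linarith

theorem IsAffineFunOn.congr {nabla : CovariantDerivative I E (TangentSpace I : M → Type _)}
    {h h' : M → ℝ} {u : Set M} (hu : IsOpen u) (hh : IsAffineFunOn nabla h u)
    (heq : Set.EqOn h h' u) : IsAffineFunOn nabla h' u := by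
  intro X Y hX hY p hp
  have h1 : ∀ q ∈ u, h =ᶠ[𝓝 q] h' := fun q hq => heq.eventuallyEq_of_mem (hu.mem_nhds hq)
  have h2 : (fun q => mvfderiv I h q (Y q)) =ᶠ[𝓝 p] fun q => mvfderiv I h' q (Y q) := by
    filter_upwards [hu.mem_nhds hp] with q hq
    rw [mvfderiv_congr (h1 q hq)]
  rw [← mvfderiv_congr h2, ← mvfderiv_congr (h1 p hp)]
  exact hh X Y hX hY p hp

end Fields

/-! ### Flat coordinates -/

section Flat

variable {F G : Type*} [NormedAddCommGroup F] [NormedSpace ℝ F] [NormedAddCommGroup G]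
  [NormedSpace ℝ G]

theorem fderiv_fderiv_clm_comp {K : Type*} [NormedAddCommGroup K] [NormedSpace ℝ K] (l : G →L[ℝ] K)
    {P : F → G} {w : F} (hP : ContDiffAt ℝ 2 P w) (x y : F) :
    fderiv ℝ (fderiv ℝ (fun w => l (P w))) w x y = l (fderiv ℝ (fderiv ℝ P) w x y) := by
  have h1 : fderiv ℝ (fun w => l (P w)) =ᶠ[𝓝 w] fun w => l.comp (fderiv ℝ P w) := by
    filter_upwards [hP.eventually (by simp)] with v hv
    exact (l.hasFDerivAt.comp v (hv.differentiableAt (by simp)).hasFDerivAt).fderiv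
  have hd : DifferentiableAt ℝ (fderiv ℝ P) w :=
    (hP.fderiv_right (m := 1) (by norm_num)).differentiableAt (by simp)
  rw [h1.fderiv_eq, ((hasFDerivAt_const l w).clm_comp hd.hasFDerivAt).fderiv]
  simp

/-- If two families of functions solve the same second order equation and the members of one of
them form a coordinate system, then the other ones depend on them affinely. -/
theorem eventually_fderiv_eq_comp {P : F → G} {h : F → ℝ} {V : Set F}
    [CompleteSpace F] (hV : IsOpen V) (hP : ContDiffOn ℝ ∞ P V) (hh : ContDiffOn ℝ ∞ h V)
    (hbij : ∀ w ∈ V, ∃ e : F ≃L[ℝ] G, (e : F →L[ℝ] G) = fderiv ℝ P w)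
    (hZ : ∀ w ∈ V, ∀ x y : F, ∃ Z : F, fderiv ℝ (fderiv ℝ P) w x y + fderiv ℝ P w Z = 0 ∧
      fderiv ℝ (fderiv ℝ h) w x y + fderiv ℝ h w Z = 0) {w₀ : F} (hw₀ : w₀ ∈ V) :
    ∃ c : G →L[ℝ] ℝ, ∀ᶠ w in 𝓝 w₀, fderiv ℝ h w = c.comp (fderiv ℝ P w) := by
  -- The differential of `h` in the coordinates `P`; the claim is that it is locally constant.
  set c : F → G →L[ℝ] ℝ := fun w => (fderiv ℝ h w).comp (fderiv ℝ P w).inverse with hc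
  have hcomp : ∀ w ∈ V, fderiv ℝ h w = (c w).comp (fderiv ℝ P w) := by
    intro w hw
    obtain ⟨e, he⟩ := hbij w hw
    rw [hc]
    simp only [← he, ContinuousLinearMap.inverse_equiv]
    ext x
    simp
  have hdP : ∀ w ∈ V, ContDiffAt ℝ 1 (fderiv ℝ P) w := fun w hw =>
    ((hP.contDiffAt (hV.mem_nhds hw)).fderiv_right (m := ∞) (by simp)).of_le (by simp)
  have hdh : ∀ w ∈ V, ContDiffAt ℝ 1 (fderiv ℝ h) w := fun w hw =>
    ((hh.contDiffAt (hV.mem_nhds hw)).fderiv_right (m := ∞) (by simp)).of_le (by simp)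
  have hcd : ∀ w ∈ V, DifferentiableAt ℝ c w := by
    intro w hw
    obtain ⟨e, he⟩ := hbij w hw
    have h1 : ContDiffAt ℝ 1 (ContinuousLinearMap.inverse : (F →L[ℝ] G) → G →L[ℝ] F)
        (fderiv ℝ P w) := he ▸ contDiffAt_map_inverse e
    have h2 := ((h1.comp w (hdP w hw))).differentiableAt (by simp)
    exact ((hdh w hw).differentiableAt (by simp)).clm_comp h2
  have hzero : ∀ w ∈ V, fderiv ℝ c w = 0 := by
    intro w hw
    obtain ⟨e, he⟩ := hbij w hw
    have h1 : fderiv ℝ h =ᶠ[𝓝 w] fun w => (c w).comp (fderiv ℝ P w) := by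
      filter_upwards [hV.mem_nhds hw] with v hv using hcomp v hv
    have h2 := ((hcd w hw).hasFDerivAt.clm_comp
      (((hdP w hw).differentiableAt (by simp)).hasFDerivAt)).fderiv
    rw [← h1.fderiv_eq] at h2
    ext x g
    obtain ⟨y, rfl⟩ := e.surjective g
    -- Differentiating `dh = c ∘ dP` gives `d²h (x, y) = (dc x)(dP y) + c (d²P (x, y))`. The
    -- equations for `h` and for `P` share the vector `Z`, so the other terms cancel and `(dc x)(dP
    -- y) = 0`.
    obtain ⟨Z, hZ1, hZ2⟩ := hZ w hw x y
    rw [h2, hcomp w hw] at hZ2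
    simp only [add_apply, ContinuousLinearMap.comp_apply, ContinuousLinearMap.flip_apply,
      ContinuousLinearMap.compL_apply] at hZ2
    have h3 : c w (fderiv ℝ (fderiv ℝ P) w x y) + c w (fderiv ℝ P w Z) = 0 := by
      rw [← map_add, hZ1, map_zero]
    have h4 : fderiv ℝ P w y = e y := by rw [← he]; rfl
    rw [h4] at hZ2
    simp only [zero_apply]
    linarith
  obtain ⟨r, hr, hball⟩ := Metric.isOpen_iff.1 hV w₀ hw₀
  refine ⟨c w₀, ?_⟩
  filter_upwards [Metric.ball_mem_nhds w₀ hr] with w hw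
  have h5 : c w = c w₀ := Metric.isOpen_ball.is_const_of_fderiv_eq_zero
    (convex_ball w₀ r).isPreconnected
    (fun v hv => (hcd v (hball hv)).differentiableWithinAt) (fun v hv => hzero v (hball hv)) hw
    (Metric.mem_ball_self hr)
  rw [hcomp w (hball hw), h5]

end Flat

/-! ### Affine functions on conical special Kähler domains -/

section FlatDomain

variable {n : ℕ} {D D' : ConicalDomain n}

/-- The real part of a vector. -/
def reVec (κ : Type*) [Fintype κ] : (κ → ℂ) →L[ℝ] (κ → ℝ) :=
  ContinuousLinearMap.pi fun a => Complex.reCLM.comp (ContinuousLinearMap.proj a)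

@[simp] theorem reVec_apply {κ : Type*} [Fintype κ] (v : κ → ℂ) (a : κ) :
    reVec κ v a = (v a).re := rfl

/-- A complex linear map is determined by its real part, whose values at `i a` are minus the
imaginary parts at `a`. -/
theorem ext_of_reVec_smul {κ V : Type*} [Fintype κ] [AddCommGroup V] [Module ℂ V]
    {f g : V →ₗ[ℂ] (κ → ℂ)} (h : ∀ a, reVec κ (f a) = reVec κ (g a)) : f = g := by
  ext a i
  refine Complex.ext (congrFun (h a) i) ?_
  have := congrFun (h (Complex.I • a)) i
  simp only [map_smul, reVec_apply, Pi.smul_apply, smul_eq_mul, Complex.I_mul_re] at this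
  linarith

/-- The differential of the flat coordinates `Re z^I`, `Re F_I`. -/
def dFlat (F : (Fin (n + 1) → ℂ) → ℂ) (z : Fin (n + 1) → ℂ) :
    (Fin (n + 1) → ℂ) →L[ℝ] (Fin (n + 1) ⊕ Fin (n + 1) → ℝ) :=
  (reVec _).comp ((dPeriod F z).restrictScalars ℝ)

/-- `Re z^I` and `Re F_I` are local real coordinates. The dimensions agree, and a real covector
annihilating all real parts also annihilates the imaginary parts, by complex linearity, so it is
zero by `eq_zero_of_dotProduct_dPeriod`. -/
theorem dFlat_bijective {z : Fin (n + 1) → ℂ} (hz : z ∈ D.carrier) :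
    Function.Bijective (dFlat D.F z) := by
  have hfin : Module.finrank ℝ (Fin (n + 1) → ℂ)
      = Module.finrank ℝ (Fin (n + 1) ⊕ Fin (n + 1) → ℝ) := by
    rw [Module.finrank_pi_fintype, Module.finrank_pi]
    simp [Complex.finrank_real_complex]
    ring
  have hsurj : Function.Surjective (dFlat D.F z).toLinearMap := by
    rw [← LinearMap.dualMap_injective_iff, injective_iff_map_eq_zero]
    intro l hl
    have hl' : ∀ p : Fin (n + 1) ⊕ Fin (n + 1) → ℝ, l p = ∑ i, l (Pi.single i 1) * p i := by
      intro p
      conv_lhs => rw [← Finset.univ_sum_single p]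
      rw [map_sum]
      refine Finset.sum_congr rfl fun i _ => ?_
      rw [← mul_one (p i), ← smul_eq_mul, Pi.single_smul, map_smul, smul_eq_mul, smul_eq_mul,
        mul_one, mul_comm]
    have hre : ∀ a, (∑ i, ((l (Pi.single i 1) : ℝ) : ℂ) * dPeriod D.F z a i).re = 0 := by
      intro a
      have h1 := congrArg (fun m : Module.Dual ℝ (Fin (n + 1) → ℂ) => m a) hl
      simp only [LinearMap.dualMap_apply, LinearMap.zero_apply] at h1
      rw [hl'] at h1
      rw [Complex.re_sum, ← h1]
      exact Finset.sum_congr rfl fun i _ => by rw [Complex.re_ofReal_mul]; rfl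
    have hv := ConicalDomain.eq_zero_of_dotProduct_dPeriod hz
      (v := fun i => l (Pi.single i 1)) (fun a => by
        refine Complex.ext (hre a) ?_
        have h2 := hre (Complex.I • a)
        simp only [map_smul, Pi.smul_apply, smul_eq_mul] at h2
        have h3 : ∑ i, ((l (Pi.single i 1) : ℝ) : ℂ) * (Complex.I * dPeriod D.F z a i)
            = Complex.I * ∑ i, ((l (Pi.single i 1) : ℝ) : ℂ) * dPeriod D.F z a i := by
          rw [Finset.mul_sum]
          exact Finset.sum_congr rfl fun i _ => by ring
        rw [h3, Complex.I_mul_re] at h2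
        exact neg_eq_zero.1 h2)
    ext p
    exact congrFun hv p
  exact ⟨(LinearMap.injective_iff_surjective_of_finrank_eq_finrank hfin).2 hsurj, hsurj⟩

theorem hasFDerivAt_flat {z : Fin (n + 1) → ℂ} (hz : z ∈ D.carrier) :
    HasFDerivAt (fun w => reVec _ (period D.F w)) (dFlat D.F z) z :=
  (reVec _).hasFDerivAt.comp z ((ConicalDomain.hasFDerivAt_period hz).restrictScalars ℝ)

theorem contDiffOn_period : ContDiffOn ℂ ∞ (period D.F) D.carrier := by
  refine contDiffOn_pi.2 fun i => ?_
  rcases i with I | I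
  · exact (contDiff_apply ℂ ℂ I).contDiffOn
  · exact D.contDiffOn_dF I

/-- The flat coordinates are Darboux coordinates for the Kähler form, up to a constant. Writing a
real part as half the sum with the conjugate, the Lagrangian property leaves only the mixed terms.
-/
theorem sympForm_dFlat {z : Fin (n + 1) → ℂ} (hz : z ∈ D.carrier) (a b : Fin (n + 1) → ℂ) :
    2 * sympForm (dFlat D.F z a) (dFlat D.F z b) = - (hermForm (matN D.F z) a b).im := by
  have h1 : ∀ a, (fun i => ((dFlat D.F z a i : ℝ) : ℂ))
      = (1 / 2 : ℂ) • (dPeriod D.F z a + star (dPeriod D.F z a)) := by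
    intro a
    ext i
    simp only [Pi.smul_apply, Pi.add_apply, Pi.star_apply, RCLike.star_def, smul_eq_mul,
      Complex.add_conj]
    change ((dPeriod D.F z a i).re : ℂ) = _
    push_cast
    ring
  have h2 : ((sympForm (dFlat D.F z a) (dFlat D.F z b) : ℝ) : ℂ)
      = sympForm (fun i => ((dFlat D.F z a i : ℝ) : ℂ)) (fun i => ((dFlat D.F z b i : ℝ) : ℂ)) := by
    simp [sympForm]
  rw [h1, h1, sympForm_smul_left, sympForm_smul_right, sympForm_add_left, sympForm_add_right,
    sympForm_add_right, sympForm_star, ConicalDomain.sympForm_dPeriod hz,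
    ConicalDomain.sympForm_dPeriod_star hz, sympForm_swap (star _),
    ConicalDomain.sympForm_dPeriod_star hz, ← hermForm_conj_symm (ConicalDomain.matN_isSymm hz) a b]
    at h2
  have h3 := congrArg Complex.re h2
  simp at h3
  rw [h3]
  ring

theorem mem_symplecticGroup_of_sympForm {m : Type*} [Fintype m] [DecidableEq m]
    {O : Matrix (m ⊕ m) (m ⊕ m) ℝ}
    (h : ∀ V W, sympForm (O.mulVec V) (O.mulVec W) = sympForm V W) :
    O ∈ Matrix.symplecticGroup m ℝ := by
  rw [SymplecticGroup.mem_iff']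
  refine Matrix.ext_of_mulVec_single fun i => ?_
  refine dotProduct_eq _ _ fun V => ?_
  have := h V (Pi.single i 1)
  rw [sympForm_eq_dotProduct, sympForm_eq_dotProduct, mulVec_dotProduct] at this
  simpa only [Matrix.mulVec_mulVec, dotProduct_comm, Matrix.mul_assoc] using this

/-- The functions `Re z^I`, `Re F_I` of both domains solve the same second order equations, so the
differentials of one system are a constant real matrix times those of the other, and complex
linearity extends this to the differentials of the period maps. The matrix is symplectic because the
isometry preserves the imaginary part of `N`, and Euler's relation removes the constant of
integration. -/
theorem exists_symplectic_of_flat {V : Set (Fin (n + 1) → ℂ)} (hV : IsOpen V)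
    (hVD : V ⊆ D.carrier) {τ : (Fin (n + 1) → ℂ) → Fin (n + 1) → ℂ}
    (hτ : ∀ w ∈ V, τ w ∈ D'.carrier ∧ ∃ T : (Fin (n + 1) → ℂ) →L[ℂ] (Fin (n + 1) → ℂ),
      HasFDerivAt τ T w ∧ T w = τ w ∧
      ∀ a b, domMetric D'.F (τ w) (T a) (T b) = domMetric D.F w a b)
    (hZ : ∀ w ∈ V, ∀ x y : Fin (n + 1) → ℂ, ∃ Z : Fin (n + 1) → ℂ, ∀ i,
      (fderiv ℝ (fderiv ℝ (fun w => (period D.F w i).re)) w x y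
        + fderiv ℝ (fun w => (period D.F w i).re) w Z = 0) ∧
      (fderiv ℝ (fderiv ℝ (fun w => (period D'.F (τ w) i).re)) w x y
        + fderiv ℝ (fun w => (period D'.F (τ w) i).re) w Z = 0))
    {w₀ : Fin (n + 1) → ℂ} (hw₀ : w₀ ∈ V) :
    ∃ O ∈ Matrix.symplecticGroup (Fin (n + 1)) ℝ, ∀ᶠ w in 𝓝 w₀,
      period D'.F (τ w) = (O.map (fun r : ℝ => (r : ℂ))).mulVec (period D.F w) := by
  choose! hτm T hT hTw hTg using hτ
  have hψ : ∀ w ∈ V, HasFDerivAt (fun w => period D'.F (τ w))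
      ((dPeriod D'.F (τ w)).comp (T w)) w := fun w hw =>
    (ConicalDomain.hasFDerivAt_period (hτm w hw)).comp w (hT w hw)
  have hψs : ContDiffOn ℝ ∞ (fun w => period D'.F (τ w)) V := by
    refine ContDiffOn.restrict_scalars (𝕜' := ℂ) ℝ ?_
    refine contDiffOn_pi.2 fun i => contDiffOn_of_differentiableOn_complex hV fun w hw => ?_
    exact ((hasFDerivAt_pi'.1 (hψ w hw)) i).differentiableAt.differentiableWithinAt
  have hP : ContDiffOn ℝ ∞ (fun w => reVec _ (period D.F w)) V :=
    (reVec (Fin (n + 1) ⊕ Fin (n + 1))).contDiff.comp_contDiffOn ((contDiffOn_period.restrict_scalars ℝ).mono hVD)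
  have hre : ∀ i, ContDiffOn ℝ ∞ (fun w => (period D'.F (τ w) i).re) V := fun i =>
    Complex.reCLM.contDiff.comp_contDiffOn (contDiffOn_pi.1 hψs i)
  have hdre : ∀ w ∈ V, ∀ i a, fderiv ℝ (fun w => (period D'.F (τ w) i).re) w a
      = (dPeriod D'.F (τ w) (T w a) i).re := by
    intro w hw i a
    have h1 := Complex.reCLM.hasFDerivAt.comp w
      ((hasFDerivAt_pi'.1 ((hψ w hw).restrictScalars ℝ)) i)
    exact congrArg (fun L : _ →L[ℝ] ℝ => L a) h1.fderiv
  have hex : ∀ i, ∃ c : (Fin (n + 1) ⊕ Fin (n + 1) → ℝ) →L[ℝ] ℝ, ∀ᶠ w in 𝓝 w₀,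
      fderiv ℝ (fun w => (period D'.F (τ w) i).re) w
        = c.comp (fderiv ℝ (fun w => reVec _ (period D.F w)) w) := by
    intro i
    refine eventually_fderiv_eq_comp hV hP (hre i) (fun w hw => ?_) (fun w hw x y => ?_) hw₀
    · refine ⟨ContinuousLinearEquiv.ofBijective (dFlat D.F w)
        (LinearMap.ker_eq_bot.2 (dFlat_bijective (hVD hw)).1)
        (LinearMap.range_eq_top.2 (dFlat_bijective (hVD hw)).2), ?_⟩
      rw [(hasFDerivAt_flat (hVD hw)).fderiv]
      rfl
    · obtain ⟨Z, hZ⟩ := hZ w hw x y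
      refine ⟨Z, ?_, (hZ i).2⟩
      ext j
      have hPw : ContDiffAt ℝ 2 (fun w => reVec _ (period D.F w)) w :=
        (hP.contDiffAt (hV.mem_nhds hw)).of_le ENat.LEInfty.out
      have h2 := fderiv_fderiv_clm_comp (ContinuousLinearMap.proj (R := ℝ)
        (φ := fun _ : Fin (n + 1) ⊕ Fin (n + 1) => ℝ) j) hPw x y
      have h3 := ((ContinuousLinearMap.proj (R := ℝ)
        (φ := fun _ : Fin (n + 1) ⊕ Fin (n + 1) => ℝ) j).hasFDerivAt.comp w
        (hPw.differentiableAt (by simp)).hasFDerivAt).fderiv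
      have h4 := (hZ j).1
      have h5 : fderiv ℝ (fun w => (period D.F w j).re) w Z
        = fderiv ℝ (fun w => reVec _ (period D.F w)) w Z j :=
        congrArg (fun L : _ →L[ℝ] ℝ => L Z) h3
      rw [h5] at h4
      exact (congrArg (· + _) h2.symm).trans h4
  choose c hc using hex
  let O : Matrix (Fin (n + 1) ⊕ Fin (n + 1)) (Fin (n + 1) ⊕ Fin (n + 1)) ℝ :=
    Matrix.of fun i j => c i (Pi.single j 1)
  have hO : ∀ i p, c i p = O.mulVec p i := by
    intro i p
    conv_lhs => rw [← Finset.univ_sum_single p]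
    rw [map_sum]
    refine Finset.sum_congr rfl fun j _ => ?_
    rw [← mul_one (p j), ← smul_eq_mul, Pi.single_smul, map_smul, smul_eq_mul, smul_eq_mul,
      mul_one, mul_comm]
    rfl
  have hev : ∀ᶠ w in 𝓝 w₀, w ∈ V ∧ ∀ a, dPeriod D'.F (τ w) (T w a)
      = (O.map (fun r : ℝ => (r : ℂ))).mulVec (dPeriod D.F w a) := by
    filter_upwards [Filter.eventually_all.2 hc, hV.mem_nhds hw₀] with w hw hwV
    refine ⟨hwV, fun a => ?_⟩
    refine congrArg (fun L : (Fin (n + 1) → ℂ) →ₗ[ℂ] _ => L a) (ext_of_reVec_smul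
      (f := ((dPeriod D'.F (τ w)).comp (T w) : _ →ₗ[ℂ] _))
      (g := (O.map (fun r : ℝ => (r : ℂ))).mulVecLin.comp (dPeriod D.F w : _ →ₗ[ℂ] _)) fun a => ?_)
    ext i
    have h1 := congrArg (fun L : _ →L[ℝ] ℝ => L a) (hw i)
    simp only [ContinuousLinearMap.comp_apply] at h1
    rw [hdre w hwV, (hasFDerivAt_flat (hVD hwV)).fderiv, hO] at h1
    refine h1.trans ?_
    exact (re_map_ofReal_mulVec O (dPeriod D.F w a) i).symm
  refine ⟨O, ?_, ?_⟩
  · refine mem_symplecticGroup_of_sympForm fun p q => ?_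
    obtain ⟨hwV, hw⟩ := hev.self_of_nhds
    obtain ⟨a, rfl⟩ := (dFlat_bijective (hVD hwV)).2 p
    obtain ⟨b, rfl⟩ := (dFlat_bijective (hVD hwV)).2 q
    have h1 : ∀ a, O.mulVec (dFlat D.F w₀ a) = dFlat D'.F (τ w₀) (T w₀ a) := by
      intro a
      ext i
      refine (re_map_ofReal_mulVec O (dPeriod D.F w₀ a) i).symm.trans ?_
      rw [← hw]
      rfl
    have h2 := sympForm_dFlat (hVD hwV) a b
    have h3 := sympForm_dFlat (hτm _ hwV) (T w₀ a) (T w₀ b)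
    have h4 : (hermForm (matN D'.F (τ w₀)) (T w₀ a) (T w₀ b)).im
        = (hermForm (matN D.F w₀) a b).im := by
      -- The hypothesis concerns real parts only; complex linearity of the differential recovers the
      -- imaginary parts.
      have := hTg w₀ hwV (Complex.I • a) b
      rw [domMetric_eq, domMetric_eq, map_smul, hermForm_smul_left, hermForm_smul_left,
        Complex.I_mul_re, Complex.I_mul_re] at this
      linarith
    rw [h1, h1]
    linarith
  · filter_upwards [hev] with w hw
    -- On the position vector the differential of a period map is the period map itself, so the
    -- relation between differentials becomes one between the maps.
    have h1 := hw.2 w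
    rwa [hTw w hw.1, ConicalDomain.dPeriod_self (hVD hw.1),
      ConicalDomain.dPeriod_self (hτm w hw.1)] at h1

end FlatDomain

/-! ### Changes of special charts -/

theorem hasDerivAt_comp_integralCurve {E : Type*} [NormedAddCommGroup E] [NormedSpace ℝ E]
    {H : Type*} [TopologicalSpace H] {I : ModelWithCorners ℝ E H}
    {M : Type*} [TopologicalSpace M] [ChartedSpace H M] [IsManifold I ∞ M]
    {F : Type*} [NormedAddCommGroup F] [NormedSpace ℝ F] {γ : ℝ → M} {t : ℝ}
    {X : ∀ p : M, TangentSpace I p} (hγ : IsMIntegralCurve (I := I) γ X) {ζ : M → F}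
    (hζ : MDifferentiableAt I 𝓘(ℝ, F) ζ (γ t)) :
    HasDerivAt (fun s => ζ (γ s)) (mvfderiv I ζ (γ t) (X (γ t))) t := by
  have h1 : HasFDerivAt (fun s => ζ (γ s)) ((mvfderiv I ζ (γ t)).comp
      ((1 : ℝ →L[ℝ] ℝ).smulRight (X (γ t)))) t := (hζ.hasMFDerivAt.comp t (hγ t)).hasFDerivAt
  refine h1.hasDerivAt.congr_deriv ?_
  change mvfderiv I ζ (γ t) ((1 : ℝ) • X (γ t)) = _
  rw [one_smul]

section SpecialCharts

variable {n : ℕ} {M : Type*} [TopologicalSpace M]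
  [ChartedSpace (EuclideanSpace ℝ (Fin (2 * n + 2))) M] [IsManifold (𝓡 (2 * n + 2)) ∞ M]
  [MulAction ℂˣ M] {C : ConicalSpecialKaehler n M}

namespace SpecialChart

variable (S : SpecialChart C) {p : M}

theorem phi_eq (p : M) : S.phi p = period S.dom.F (S.z p) := rfl

theorem z_mem (hp : p ∈ S.source) : S.z p ∈ S.dom.carrier := S.bijOn.mapsTo hp

theorem contMDiffOn_z : ContMDiffOn (𝓡 (2 * n + 2)) 𝓘(ℝ, Fin (n + 1) → ℂ) ∞ S.z S.source :=
  S.localDiffeo.contMDiffOn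

theorem mdifferentiableAt_z (hp : p ∈ S.source) :
    MDifferentiableAt (𝓡 (2 * n + 2)) 𝓘(ℝ, Fin (n + 1) → ℂ) S.z p :=
  (S.localDiffeo ⟨p, hp⟩).mdifferentiableAt (by simp)

theorem continuousOn_z : ContinuousOn S.z S.source := S.contMDiffOn_z.continuousOn

theorem mvfderiv_z_bijective (hp : p ∈ S.source) :
    Function.Bijective (mvfderiv (𝓡 (2 * n + 2)) S.z p) :=
  ((S.localDiffeo ⟨p, hp⟩).mfderivToContinuousLinearEquiv (by simp)).bijective

theorem map_nhds_z (hp : p ∈ S.source) : (𝓝 p).map S.z = 𝓝 (S.z p) :=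
  S.localDiffeo.isLocalHomeomorphOn.map_nhds_eq hp

theorem phi_smul (a : ℂˣ) (hp : p ∈ S.source) : S.phi (a • p) = (a : ℂ) • S.phi p := by
  rw [phi_eq, phi_eq, S.equivariant a p hp, ConicalDomain.period_smul a.ne_zero (S.z_mem hp)]

/-- The inverse of the coordinates. -/
theorem exists_inverse [Nonempty M] : ∃ g : (Fin (n + 1) → ℂ) → M, Set.InvOn g S.z S.source S.dom.carrier ∧
    Set.MapsTo g S.dom.carrier S.source ∧
    ContMDiffOn 𝓘(ℝ, Fin (n + 1) → ℂ) (𝓡 (2 * n + 2)) ∞ g S.dom.carrier := by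
  refine ⟨Function.invFunOn S.z S.source, S.bijOn.invOn_invFunOn, S.bijOn.surjOn.mapsTo_invFunOn,
    fun w hw => ContMDiffAt.contMDiffWithinAt ?_⟩
  obtain ⟨p, hp, rfl⟩ := S.bijOn.surjOn hw
  have hl := S.localDiffeo ⟨p, hp⟩
  refine hl.localInverse_contMDiffAt.congr_of_eventuallyEq ?_
  have h0 : hl.localInverse (S.z p) = p := hl.localInverse_left_inv hl.localInverse_mem_target
  have h1 : ∀ᶠ w in 𝓝 (S.z p), hl.localInverse w ∈ S.source :=
    hl.localInverse_contMDiffAt.continuousAt.eventually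
      (by rw [h0]; exact S.isOpen_source.mem_nhds hp)
  filter_upwards [hl.localInverse_eventuallyEq_right, h1] with w hw hws
  have hw' : S.z (hl.localInverse w) = w := hw
  conv_lhs => rw [← hw']
  exact S.bijOn.invOn_invFunOn.1 hws

variable (hM : IsPrincipalAction C.toTensorTriple)
include hM

/-- Along the flow of `ξ` equivariance makes the coordinates `e^t z`, whose derivative at `t = 0` is
`z`. -/
theorem mvfderiv_z_xi (hp : p ∈ S.source) :
    mvfderiv (𝓡 (2 * n + 2)) S.z p (C.xi p) = S.z p := by
  have h0 : expUnit ((0 : ℝ) : ℂ) • p = p := by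
    have : expUnit ((0 : ℝ) : ℂ) = 1 := Units.ext (by simp [expUnit])
    rw [this, one_smul]
  have hz := S.mdifferentiableAt_z hp
  rw [← h0] at hz
  have h1 := hasDerivAt_comp_integralCurve (hM.generator_xi p) (t := 0) hz
  have h3 : (fun t : ℝ => S.z (expUnit t • p)) = fun t : ℝ => Complex.exp t • S.z p := by
    funext t
    exact S.equivariant _ p hp
  have h4 : HasDerivAt (fun t : ℝ => Complex.exp t • S.z p) (S.z p) 0 := by
    have h5 : HasDerivAt (fun t : ℝ => Complex.exp t) 1 0 := by
      simpa using (Complex.hasDerivAt_exp ((0 : ℝ) : ℂ)).comp_ofReal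
    simpa using h5.smul_const (S.z p)
  rw [h3] at h1
  have h6 := h1.unique h4
  rwa [h0] at h6

/-- `exists_symplectic_of_flat` is applied to the change of coordinates. It is holomorphic since
both charts intertwine `J` with `i`, isometric, and compatible with the position vectors through
`ξ`. The common second order equation is the one expressing `∇ dh = 0` in the first chart. -/
theorem exists_transition [T2Space M] (S' : SpecialChart C) (hp : p ∈ S.source) (hp' : p ∈ S'.source) :
    ∃ O ∈ Matrix.symplecticGroup (Fin (n + 1)) ℝ, ∀ᶠ q in 𝓝 p,
      S'.phi q = (O.map (fun r : ℝ => (r : ℂ))).mulVec (S.phi q) := by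
  have : Nonempty M := ⟨p⟩
  obtain ⟨g, ⟨hgz, hzg⟩, hgm, hgs⟩ := S.exists_inverse
  have hV : IsOpen (S.dom.carrier ∩ g ⁻¹' S'.source) :=
    hgs.continuousOn.isOpen_inter_preimage S.dom.isOpen S'.isOpen_source
  have hgd : ∀ w ∈ S.dom.carrier, MDifferentiableAt 𝓘(ℝ, Fin (n + 1) → ℂ) (𝓡 (2 * n + 2)) g w :=
    fun w hw => (hgs.contMDiffAt (S.dom.isOpen.mem_nhds hw)).mdifferentiableAt (by simp)
  let dg : ∀ w, (Fin (n + 1) → ℂ) →L[ℝ] TangentSpace (𝓡 (2 * n + 2)) (g w) := fun w =>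
    mfderiv 𝓘(ℝ, Fin (n + 1) → ℂ) (𝓡 (2 * n + 2)) g w
  have hdz : ∀ w ∈ S.dom.carrier, ∀ a, mvfderiv (𝓡 (2 * n + 2)) S.z (g w)
      (dg w a) = a := by
    intro w hw a
    have h1 : (fun w => S.z (g w)) =ᶠ[𝓝 w] id := by
      filter_upwards [S.dom.isOpen.mem_nhds hw] with v hv using hzg hv
    have h2 := mfderiv_comp w (S.mdifferentiableAt_z (hgm hw)) (hgd w hw)
    have h3 : mfderiv 𝓘(ℝ, Fin (n + 1) → ℂ) 𝓘(ℝ, Fin (n + 1) → ℂ) (S.z ∘ g) w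
        = ContinuousLinearMap.id ℝ (Fin (n + 1) → ℂ) := by
      rw [mfderiv_eq_fderiv]
      exact (h1.fderiv_eq).trans fderiv_id
    exact congrArg (fun L : (Fin (n + 1) → ℂ) →L[ℝ] (Fin (n + 1) → ℂ) => L a) (h2.symm.trans h3)
  have hdgI : ∀ w ∈ S.dom.carrier, ∀ a,
      dg w (Complex.I • a)
        = C.J (g w) (dg w a) := by
    intro w hw a
    apply (S.mvfderiv_z_bijective (hgm hw)).1
    rw [S.holomorphic _ (hgm hw)]
    exact (hdz w hw _).trans (congrArg (Complex.I • ·) (hdz w hw a).symm)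
  have hdgw : ∀ w ∈ S.dom.carrier,
      dg w w = C.xi (g w) := by
    intro w hw
    apply (S.mvfderiv_z_bijective (hgm hw)).1
    rw [S.mvfderiv_z_xi hM (hgm hw), hzg hw]
    exact hdz w hw w
  have hgp : g (S.z p) = p := hgz hp
  refine (exists_symplectic_of_flat (D := S.dom) (D' := S'.dom) hV
    Set.inter_subset_left (τ := fun w => S'.z (g w)) (fun w hw => ?_) (fun w hw x y => ?_)
    (w₀ := S.z p) ⟨S.z_mem hp, by rw [Set.mem_preimage, hgp]; exact hp'⟩).imp
      fun O hO => ⟨hO.1, ?_⟩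
  · refine ⟨S'.z_mem hw.2, ?_⟩
    let T : (Fin (n + 1) → ℂ) →L[ℝ] (Fin (n + 1) → ℂ) :=
      (mvfderiv (𝓡 (2 * n + 2)) S'.z (g w)).comp (dg w)
    have hT : HasFDerivAt (fun w => S'.z (g w)) T w :=
      ((S'.mdifferentiableAt_z hw.2).hasMFDerivAt.comp w (hgd w hw.1).hasMFDerivAt).hasFDerivAt
    have hTI : ∀ a, T (Complex.I • a) = Complex.I • T a := by
      intro a
      refine (congrArg (mvfderiv (𝓡 (2 * n + 2)) S'.z (g w)) (hdgI w hw.1 a)).trans ?_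
      exact S'.holomorphic _ hw.2 _
    -- A real linear map commuting with `i` is complex linear.
    let T' : (Fin (n + 1) → ℂ) →L[ℂ] (Fin (n + 1) → ℂ) :=
      { toFun := T
        map_add' := T.map_add
        map_smul' := fun k a => by
          rw [← Complex.re_add_im k, add_smul, map_add, mul_comm, mul_smul, hTI, RingHom.id_apply,
            add_smul, mul_smul, Complex.coe_smul, Complex.coe_smul, Complex.coe_smul,
            Complex.coe_smul, map_smul, map_smul, smul_comm, smul_comm]
        cont := T.cont }
    refine ⟨T', hasFDerivAt_of_restrictScalars ℝ hT rfl, ?_, fun a b => ?_⟩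
    · refine (congrArg (mvfderiv (𝓡 (2 * n + 2)) S'.z (g w)) (hdgw w hw.1)).trans ?_
      exact S'.mvfderiv_z_xi hM hw.2
    · have h1 := S'.isometric _ hw.2 (dg w a)
        (dg w b)
      rw [S.isometric _ (hgm hw.1), hzg hw.1, hdz w hw.1, hdz w hw.1] at h1
      exact h1.symm
  · have hu : IsOpen (S.source ∩ S'.source) := S.isOpen_source.inter S'.isOpen_source
    have hloc : IsLocalDiffeomorphOn (𝓡 (2 * n + 2)) 𝓘(ℝ, Fin (n + 1) → ℂ) ∞ S.z
        (S.source ∩ S'.source) := fun q => S.localDiffeo ⟨q, q.2.1⟩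
    obtain ⟨Z, hZ⟩ := exists_christoffel C.nabla hu hloc (p := g w) ⟨hgm hw.1, hw.2⟩ x y
    rw [hzg hw.1] at hZ
    refine ⟨Z, fun i => ⟨hZ _ ?_ ?_, hZ _ ?_ ?_⟩⟩
    · exact (Complex.reCLM.contDiff.contDiffAt.comp w (contDiffAt_pi.1
        ((contDiffOn_period.contDiffAt (S.dom.isOpen.mem_nhds hw.1)).restrict_scalars ℝ) i)).of_le
          ENat.LEInfty.out
    · intro X Y hX hY q hq
      rcases i with I | I
      · exact S.affine_z I X Y hX hY q hq.1
      · exact S.affine_F I X Y hX hY q hq.1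
    · have h1 : ContDiffAt ℝ ∞ (fun w => S'.z (g w)) w :=
        ((S'.contMDiffOn_z.contMDiffAt (S'.isOpen_source.mem_nhds hw.2)).comp w
          (hgs.contMDiffAt (S.dom.isOpen.mem_nhds hw.1))).contDiffAt
      have h2 := ((contDiffOn_period.contDiffAt (S'.dom.isOpen.mem_nhds (S'.z_mem hw.2))).restrict_scalars
        ℝ).comp w h1
      exact (Complex.reCLM.contDiff.contDiffAt.comp w (contDiffAt_pi.1 h2 i)).of_le ENat.LEInfty.out
    · have h1 : IsAffineFunOn C.nabla (fun q => (S'.phi q i).re) (S.source ∩ S'.source) := by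
        intro X Y hX hY q hq
        rcases i with I | I
        · exact S'.affine_z I X Y hX hY q hq.2
        · exact S'.affine_F I X Y hX hY q hq.2
      refine h1.congr hu fun q hq => ?_
      rw [hgz hq.1]
      rfl
  · have h1 := (S.continuousOn_z.continuousAt (S.isOpen_source.mem_nhds hp)).eventually hO.2
    filter_upwards [h1, S.isOpen_source.mem_nhds hp] with q hq hqs
    rw [hgz hqs] at hq
    exact hq

omit hM

theorem transZ_eq {S S' : SpecialChart C} {q : M}
    {O : Matrix (Fin (n + 1) ⊕ Fin (n + 1)) (Fin (n + 1) ⊕ Fin (n + 1)) ℝ}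
    (h : S'.phi q = (O.map (fun r : ℝ => (r : ℂ))).mulVec (S.phi q)) :
    transZ S.dom.F O (S.z q) = S'.z q :=
  funext fun I => (congrFun h (Sum.inl I)).symm

theorem isTransition {S S' : SpecialChart C}
    {O : Matrix (Fin (n + 1) ⊕ Fin (n + 1)) (Fin (n + 1) ⊕ Fin (n + 1)) ℝ}
    (hp : p ∈ S.source) (hp' : p ∈ S'.source) (hO : O ∈ Matrix.symplecticGroup (Fin (n + 1)) ℝ)
    (h : ∀ᶠ q in 𝓝 p, S'.phi q = (O.map (fun r : ℝ => (r : ℂ))).mulVec (S.phi q)) :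
    IsTransition S.dom S'.dom O (S.z p) := by
  refine ⟨hO, S.z_mem hp, ?_⟩
  rw [← S.map_nhds_z hp, Filter.eventually_map]
  filter_upwards [h, S'.isOpen_source.mem_nhds hp'] with q hq hqs
  rw [transZ_eq hq]
  exact ⟨S'.z_mem hqs, hq⟩

/-- Each row of `O - O'` is a real covector vanishing on the tangent space of the image of `φ`, and
there is no such covector except zero. -/
theorem eq_of_mulVec_phi {S : SpecialChart C}
    {O O' : Matrix (Fin (n + 1) ⊕ Fin (n + 1)) (Fin (n + 1) ⊕ Fin (n + 1)) ℝ}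
    (hp : p ∈ S.source) (h : ∀ᶠ q in 𝓝 p, (O.map (fun r : ℝ => (r : ℂ))).mulVec (S.phi q)
      = (O'.map (fun r : ℝ => (r : ℂ))).mulVec (S.phi q)) : O = O' := by
  have h1 : ∀ᶠ w in 𝓝 (S.z p), (O.map (fun r : ℝ => (r : ℂ))).mulVec (period S.dom.F w)
      = (O'.map (fun r : ℝ => (r : ℂ))).mulVec (period S.dom.F w) := by
    rw [← S.map_nhds_z hp, Filter.eventually_map]
    exact h
  have h2 := ((hasFDerivAt_mulVec_period (O := O') (S.z_mem hp)).congr_of_eventuallyEq h1).unique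
    (hasFDerivAt_mulVec_period (O := O) (S.z_mem hp))
  ext i j
  have h3 := ConicalDomain.eq_zero_of_dotProduct_dPeriod (S.z_mem hp) (v := O i - O' i)
    (fun a => by
      have h4 := congrFun (congrArg (fun L : _ →L[ℂ] _ => L a) h2) i
      have h5 : ∀ P : Matrix (Fin (n + 1) ⊕ Fin (n + 1)) (Fin (n + 1) ⊕ Fin (n + 1)) ℝ,
        ((LinearMap.toContinuousLinearMap (P.map (fun r : ℝ => (r : ℂ))).mulVecLin).comp
          (dPeriod S.dom.F (S.z p))) a i = ∑ j, (P i j : ℂ) * dPeriod S.dom.F (S.z p) a j :=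
        fun P => rfl
      simp only [h5] at h4
      simp only [Pi.sub_apply, Complex.ofReal_sub, sub_mul, Finset.sum_sub_distrib, h4, sub_self])
  simpa [sub_eq_zero] using congrFun h3 j

end SpecialChart

end SpecialCharts

/-! ### The gluing relation -/

section Angle

variable (c : ℝ)

/-- The angle of a complex number, in `ℝ / 2πcℤ`. -/
def angle (w : ℂ) : AddCircle (2 * Real.pi * c) := ((c * w.arg : ℝ) : AddCircle (2 * Real.pi * c))

/-- Multiplication by `c` sends `2πℤ` to `2πcℤ`, so `c` times an angle is well defined in the
circle; this includes `c = 0`, where the circle is `ℝ` and both sides are zero. -/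
theorem coe_mul_eq_of_angle_eq {x y : ℝ} (h : (x : Real.Angle) = y) :
    ((c * x : ℝ) : AddCircle (2 * Real.pi * c)) = ((c * y : ℝ) : AddCircle (2 * Real.pi * c)) := by
  obtain ⟨k, hk⟩ := Real.Angle.angle_eq_iff_two_pi_dvd_sub.1 h
  rw [← sub_eq_zero, ← AddCircle.coe_sub, AddCircle.coe_eq_zero_iff]
  refine ⟨k, ?_⟩
  rw [← mul_sub, hk, zsmul_eq_mul]
  ring

theorem angle_mul {v w : ℂ} (hv : v ≠ 0) (hw : w ≠ 0) :
    angle c (v * w) = angle c v + angle c w := by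
  rw [angle, angle, angle, ← AddCircle.coe_add, ← mul_add]
  refine coe_mul_eq_of_angle_eq c ?_
  rw [Complex.arg_mul_coe_angle hv hw, Real.Angle.coe_add]

theorem angle_one : angle c 1 = 0 := by simp [angle]

theorem angle_inv {v : ℂ} (hv : v ≠ 0) : angle c v⁻¹ = -angle c v := by
  rw [eq_neg_iff_add_eq_zero, ← angle_mul c (inv_ne_zero hv) hv, inv_mul_cancel₀ hv, angle_one]

theorem angle_conj (v : ℂ) : angle c (conj v) = -angle c v := by
  rw [angle, angle, ← AddCircle.coe_neg, ← mul_neg]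
  refine coe_mul_eq_of_angle_eq c ?_
  rw [Complex.arg_conj_coe_angle, Real.Angle.coe_neg]

/-- The phase in the gluing relation is a difference of two terms depending on one chart each. In
this form the relation is visibly symmetric and transitive. -/
theorem angle_phase {v w : ℂ} (hv : v ≠ 0) (hw : w ≠ 0) :
    ((c * Complex.arg ((v * conj w) / (w * conj v)) : ℝ) : AddCircle (2 * Real.pi * c))
      = 2 • angle c v - 2 • angle c w := by
  have hv' : conj v ≠ 0 := (map_ne_zero _).2 hv
  have hw' : conj w ≠ 0 := (map_ne_zero _).2 hw
  change angle c _ = _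
  rw [div_eq_mul_inv, angle_mul c (mul_ne_zero hv hw') (inv_ne_zero (mul_ne_zero hw hv')),
    angle_inv c (mul_ne_zero hw hv'), angle_mul c hv hw', angle_mul c hw hv', angle_conj,
    angle_conj, two_nsmul, two_nsmul]
  abel

end Angle

section Glue

variable {n : ℕ} {M : Type*} [TopologicalSpace M]
  [ChartedSpace (EuclideanSpace ℝ (Fin (2 * n + 2))) M] [IsManifold (𝓡 (2 * n + 2)) ∞ M]
  [MulAction ℂˣ M] {C : ConicalSpecialKaehler n M}

namespace SpecialChart

variable (S : SpecialChart C) {p q : M}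

theorem z_zero_ne_zero (hp : p ∈ S.source) : S.z p 0 ≠ 0 := S.dom_ne_zero _ (S.z_mem hp)

theorem z_eq_smul_hom (hp : p ∈ S.source) : S.z p = S.z p 0 • hom (S.X p) := by
  ext I
  refine Fin.cases ?_ (fun μ => ?_) I
  · simp
  · simp [SpecialChart.X, mul_div_cancel₀ _ (S.z_zero_ne_zero hp)]

theorem X_smul (a : ℂˣ) (hp : p ∈ S.source) : S.X (a • p) = S.X p := by
  ext μ
  simp [SpecialChart.X, S.equivariant a p hp, mul_div_mul_left _ _ a.ne_zero]

theorem exists_smul_eq (hp : p ∈ S.source) (hq : q ∈ S.source) (h : S.X p = S.X q) :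
    ∃ a : ℂˣ, a • p = q := by
  refine ⟨Units.mk0 (S.z q 0 / S.z p 0) (div_ne_zero (S.z_zero_ne_zero hq) (S.z_zero_ne_zero hp)),
    S.bijOn.injOn (S.smul_mem_source _ _ hp) hq ?_⟩
  ext I
  have h1 := congrFun (S.z_eq_smul_hom hp) I
  have h2 := congrFun (S.z_eq_smul_hom hq) I
  rw [← h] at h2
  rw [S.equivariant _ _ hp, Pi.smul_apply, h1, h2, Pi.smul_apply, Pi.smul_apply, Units.val_mk0,
    smul_eq_mul, smul_eq_mul, smul_eq_mul, ← mul_assoc, div_mul_cancel₀ _ (S.z_zero_ne_zero hp)]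

theorem exists_z_eq_hom (hp : p ∈ S.source) : ∃ a : ℂˣ, S.z (a • p) = hom (S.X p) := by
  refine ⟨(Units.mk0 _ (S.z_zero_ne_zero hp))⁻¹, ?_⟩
  ext I
  have h1 := congrFun (S.z_eq_smul_hom hp) I
  rw [S.equivariant _ _ hp, Pi.smul_apply, h1, Pi.smul_apply, Units.val_inv_eq_inv_val,
    Units.val_mk0, smul_eq_mul, smul_eq_mul, ← mul_assoc, inv_mul_cancel₀ (S.z_zero_ne_zero hp),
    one_mul]

theorem eventually_phi_smul [ContinuousConstSMul ℂˣ M] {S S' : SpecialChart C}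
    {O : Matrix (Fin (n + 1) ⊕ Fin (n + 1)) (Fin (n + 1) ⊕ Fin (n + 1)) ℝ} (a : ℂˣ)
    (hp : p ∈ S.source) (hp' : p ∈ S'.source)
    (h : ∀ᶠ q in 𝓝 p, S'.phi q = (O.map (fun r : ℝ => (r : ℂ))).mulVec (S.phi q)) :
    ∀ᶠ q in 𝓝 (a • p), S'.phi q = (O.map (fun r : ℝ => (r : ℂ))).mulVec (S.phi q) := by
  have h1 : Filter.Tendsto (fun q : M => a⁻¹ • q) (𝓝 (a • p)) (𝓝 p) := by
    simpa using (continuous_const_smul a⁻¹).tendsto (a • p)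
  filter_upwards [h1.eventually h, h1.eventually (S.isOpen_source.mem_nhds hp),
    h1.eventually (S'.isOpen_source.mem_nhds hp')] with q hq hs hs'
  have h2 := S.phi_smul a hs
  have h2' := S'.phi_smul a hs'
  rw [smul_inv_smul] at h2 h2'
  rw [h2, h2', hq, Matrix.mulVec_smul]

end SpecialChart

variable {A : Type*} (U : A → SpecialChart C) (c : ℝ)

/-- The gluing relation at a given point of `M`. -/
structure GlueAt (S S' : SpecialChart C) (c : ℝ) (p : M) (x : LocalN S c) (y : LocalN S' c) :
    Prop where
  mem : p ∈ S.source
  mem' : p ∈ S'.source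
  X_eq : x.1.1 = S.X p
  X_eq' : y.1.1 = S'.X p
  rho_eq : y.1.2.1 = x.1.2.1
  phi_eq : y.1.2.2.1 + 2 • angle c (S'.z p 0) = x.1.2.2.1 + 2 • angle c (S.z p 0)
  symp : ∃ O ∈ Matrix.symplecticGroup (Fin (n + 1)) ℝ,
      (∀ᶠ q in 𝓝 p, S'.phi q = (O.map (fun r : ℝ => (r : ℂ))).mulVec (S.phi q)) ∧
      y.1.2.2.2 = (O.transpose⁻¹).mulVec x.1.2.2.2

theorem glue_iff {x y : Σ α, LocalN (U α) c} :
    glue U c x y ↔ ∃ p, GlueAt (U x.1) (U y.1) c p x.2 y.2 := by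
  refine exists_congr fun p => ⟨?_, ?_⟩
  · rintro ⟨h1, h2, h3, h4, h5, h6, h7⟩
    rw [angle_phase c (SpecialChart.z_zero_ne_zero _ h1) (SpecialChart.z_zero_ne_zero _ h2)] at h6
    exact ⟨h1, h2, h3, h4, h5, by rw [h6]; abel, h7⟩
  · rintro ⟨h1, h2, h3, h4, h5, h6, h7⟩
    refine ⟨h1, h2, h3, h4, h5, ?_, h7⟩
    rw [angle_phase c (SpecialChart.z_zero_ne_zero _ h1) (SpecialChart.z_zero_ne_zero _ h2)]
    rw [← eq_sub_iff_add_eq] at h6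
    rw [h6]; abel

variable {U c} {S S' S'' : SpecialChart C} {p q : M}

/-- The relation depends only on the orbit of `p`: a factor `a` adds the same phase for both charts,
and `φ` scales by `a` in both. -/
theorem GlueAt.smul [ContinuousConstSMul ℂˣ M] {x : LocalN S c} {y : LocalN S' c}
    (h : GlueAt S S' c p x y) (a : ℂˣ) : GlueAt S S' c (a • p) x y := by
  obtain ⟨O, hO, hev, hv⟩ := h.symp
  refine ⟨S.smul_mem_source a p h.mem, S'.smul_mem_source a p h.mem', ?_, ?_, h.rho_eq, ?_,
    O, hO, SpecialChart.eventually_phi_smul a h.mem h.mem' hev, hv⟩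
  · rw [S.X_smul a h.mem, h.X_eq]
  · rw [S'.X_smul a h.mem', h.X_eq']
  · rw [S.equivariant a p h.mem, S'.equivariant a p h.mem', Pi.smul_apply, Pi.smul_apply,
      smul_eq_mul, smul_eq_mul, angle_mul c a.ne_zero (S.z_zero_ne_zero h.mem),
      angle_mul c a.ne_zero (S'.z_zero_ne_zero h.mem'), smul_add, smul_add, add_left_comm,
      h.phi_eq]
    abel

theorem GlueAt.symm {x : LocalN S c} {y : LocalN S' c} (h : GlueAt S S' c p x y) :
    GlueAt S' S c p y x := by
  obtain ⟨O, hO, hev, hv⟩ := h.symp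
  have hu := isUnit_det_of_symplectic hO
  refine ⟨h.mem', h.mem, h.X_eq', h.X_eq, h.rho_eq.symm, h.phi_eq.symm, O⁻¹, ?_, ?_, ?_⟩
  · have := (⟨O, hO⟩ : Matrix.symplecticGroup (Fin (n + 1)) ℝ)⁻¹.2
    rwa [SymplecticGroup.coe_inv'] at this
  · filter_upwards [hev] with q hq
    have h1 : (O⁻¹).map (fun r : ℝ => (r : ℂ)) * O.map (fun r : ℝ => (r : ℂ)) = 1 := by
      have := congrArg (fun P => P.map Complex.ofRealHom) (Matrix.nonsing_inv_mul O hu)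
      rw [Matrix.map_mul, Matrix.map_one _ (map_zero _) (map_one _)] at this
      exact this
    rw [hq, Matrix.mulVec_mulVec, h1, Matrix.one_mulVec]
  · rw [hv, Matrix.mulVec_mulVec, Matrix.transpose_nonsing_inv,
      Matrix.nonsing_inv_nonsing_inv _ (by rwa [Matrix.det_transpose]),
      Matrix.mul_nonsing_inv _ (by rwa [Matrix.det_transpose]), Matrix.one_mulVec]

theorem GlueAt.trans {x : LocalN S c} {y : LocalN S' c} {z : LocalN S'' c}
    (h : GlueAt S S' c p x y) (h' : GlueAt S' S'' c p y z) : GlueAt S S'' c p x z := by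
  obtain ⟨O, hO, hev, hv⟩ := h.symp
  obtain ⟨O', hO', hev', hv'⟩ := h'.symp
  refine ⟨h.mem, h'.mem', h.X_eq, h'.X_eq', h'.rho_eq.trans h.rho_eq, h'.phi_eq.trans h.phi_eq,
    O' * O, mul_mem hO' hO, ?_, ?_⟩
  · filter_upwards [hev, hev'] with q hq hq'
    have h1 : (O' * O).map (fun r : ℝ => (r : ℂ))
        = O'.map (fun r : ℝ => (r : ℂ)) * O.map (fun r : ℝ => (r : ℂ)) :=
      Matrix.map_mul (f := Complex.ofRealHom)
    rw [hq', hq, Matrix.mulVec_mulVec, h1]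
  · rw [hv', hv, Matrix.mulVec_mulVec, Matrix.transpose_mul, Matrix.mul_inv_rev]

theorem GlueAt.refl (x : LocalN S c) (hp : p ∈ S.source) (hX : x.1.1 = S.X p) :
    GlueAt S S c p x x :=
  ⟨hp, hp, hX, hX, rfl, rfl, 1, one_mem _, Filter.Eventually.of_forall fun q => by simp, by simp⟩

theorem exists_mem_X_eq (x : LocalN S c) : ∃ p ∈ S.source, S.z p = hom x.1.1 ∧ x.1.1 = S.X p := by
  obtain ⟨p, hp, hz⟩ := S.bijOn.surjOn x.2.1
  refine ⟨p, hp, hz, ?_⟩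
  ext μ
  simp [SpecialChart.X, hz]

/-- The two witnesses give the same inhomogeneous coordinates in the middle chart, so they lie in
one orbit and one can be moved to the other. -/
theorem GlueAt.exists_trans [ContinuousConstSMul ℂˣ M] {x : LocalN S c} {y : LocalN S' c}
    {z : LocalN S'' c} (h : GlueAt S S' c p x y) (h' : GlueAt S' S'' c q y z) :
    GlueAt S S'' c p x z := by
  obtain ⟨a, ha⟩ := S'.exists_smul_eq h'.mem h.mem' (h'.X_eq.symm.trans h.X_eq')
  exact h.trans (ha ▸ h'.smul a)

variable (U c)

theorem glue_equivalence [ContinuousConstSMul ℂˣ M] : Equivalence (glue U c) where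
  refl x := by
    obtain ⟨p, hp, -, hX⟩ := exists_mem_X_eq x.2
    exact (glue_iff U c).2 ⟨p, GlueAt.refl x.2 hp hX⟩
  symm h := by
    obtain ⟨p, h⟩ := (glue_iff U c).1 h
    exact (glue_iff U c).2 ⟨p, h.symm⟩
  trans h h' := by
    obtain ⟨p, h⟩ := (glue_iff U c).1 h
    obtain ⟨q, h'⟩ := (glue_iff U c).1 h'
    exact (glue_iff U c).2 ⟨p, h.exists_trans h'⟩

theorem mk_eq_iff [ContinuousConstSMul ℂˣ M] {x y : Σ α, LocalN (U α) c} :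
    (Quot.mk _ x : NBar U c) = Quot.mk _ y ↔ ∃ p, GlueAt (U x.1) (U y.1) c p x.2 y.2 := by
  rw [← glue_iff, Quot.eq, (glue_equivalence U c).eqvGen_iff]

/-- The point of `N̄_α` with given coordinates. -/
def toLocal (S : SpecialChart C) (c : ℝ) (e : coordDomain S) : LocalN S c :=
  ⟨(e.1.1, e.1.2.1, (e.1.2.2.1 : AddCircle (2 * Real.pi * c)), e.1.2.2.2), e.2⟩

/-- The witness can be moved in its orbit to the point with `z = (1, X)`, where the phase of the
first chart is trivial. -/
theorem coordMap_eq_iff [ContinuousConstSMul ℂˣ M] {α β : A} {e : coordDomain (U α)}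
    {e' : coordDomain (U β)} : coordMap U c α e = coordMap U c β e' ↔
      ∃ p, (U α).z p = hom e.1.1 ∧ GlueAt (U α) (U β) c p (toLocal _ c e) (toLocal _ c e') := by
  refine (mk_eq_iff U c).trans ⟨?_, fun ⟨p, h⟩ => ⟨p, h.2⟩⟩
  rintro ⟨p, h⟩
  obtain ⟨a, ha⟩ := (U α).exists_z_eq_hom h.mem
  exact ⟨a • p, ha.trans (by rw [← h.X_eq]), h.smul a⟩

end Glue

/-! ### The topology of `N̄` -/

section Topology

variable {n : ℕ} {M : Type*} [TopologicalSpace M]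
  [ChartedSpace (EuclideanSpace ℝ (Fin (2 * n + 2))) M] [IsManifold (𝓡 (2 * n + 2)) ∞ M]
  [MulAction ℂˣ M] {C : ConicalSpecialKaehler n M} {A : Type*} (U : A → SpecialChart C) (c : ℝ)

theorem coe_im_log_add_angle {w : ℂ} :
    ((-(2 * c * (Complex.log w).im) : ℝ) : AddCircle (2 * Real.pi * c)) + 2 • angle c w = 0 := by
  rw [angle, two_nsmul, ← AddCircle.coe_add, ← AddCircle.coe_add, Complex.log_im]
  have : -(2 * c * w.arg) + (c * w.arg + c * w.arg) = 0 := by ring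
  rw [this, AddCircle.coe_zero]

theorem toLocal_eq_iff {S : SpecialChart C} {e e' : coordDomain S} :
    toLocal S c e = toLocal S c e' ↔ e'.1.1 = e.1.1 ∧ e'.1.2.1 = e.1.2.1 ∧
      (e'.1.2.2.1 : AddCircle (2 * Real.pi * c)) = (e.1.2.2.1 : AddCircle (2 * Real.pi * c)) ∧
      e'.1.2.2.2 = e.1.2.2.2 := by
  refine Subtype.ext_iff.trans ?_
  simp [toLocal, Prod.ext_iff, eq_comm]


theorem continuous_toLocal (S : SpecialChart C) : Continuous (toLocal S c) := by
  refine Continuous.subtype_mk ?_ _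
  have h : Continuous (fun x : ℝ => (x : AddCircle (2 * Real.pi * c))) := continuous_quotient_mk'
  fun_prop

theorem isOpenQuotientMap_toLocal (S : SpecialChart C) : IsOpenQuotientMap (toLocal S c) := by
  refine ⟨?_, continuous_toLocal c S, ?_⟩
  · rintro ⟨⟨X, ρ, φ, v⟩, h⟩
    obtain ⟨φ, rfl⟩ := QuotientAddGroup.mk_surjective φ
    exact ⟨⟨(X, ρ, φ, v), h⟩, rfl⟩
  · have h1 : IsOpenMap (fun e : Coord n => ((e.1, e.2.1, (e.2.2.1 : AddCircle (2 * Real.pi * c)),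
        e.2.2.2) : (Fin n → ℂ) × ℝ × AddCircle (2 * Real.pi * c) × (Fin (n + 1) ⊕ Fin (n + 1) → ℝ))) :=
      IsOpenMap.id.prodMap (IsOpenMap.id.prodMap
        (IsOpenMap.prodMap QuotientAddGroup.isOpenMap_coe IsOpenMap.id))
    intro W hW
    obtain ⟨W', hW', rfl⟩ := isOpen_induced_iff.1 hW
    refine isOpen_induced_iff.2 ⟨_, h1 _ (hW'.inter (coordDomain S).isOpen), ?_⟩
    ext y
    refine ⟨?_, ?_⟩
    · rintro ⟨e, ⟨he, heD⟩, h⟩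
      exact ⟨⟨e, heD⟩, he, Subtype.ext h⟩
    · rintro ⟨e, he, rfl⟩
      exact ⟨e.1, ⟨he, e.2⟩, rfl⟩

variable [ContinuousConstSMul ℂˣ M]

/-- The gluing identifies no distinct points of a single `N̄_α`: the transition matrix from a chart
to itself is the identity by `eq_of_mulVec_phi`. -/
theorem coordMap_eq_iff_toLocal {α : A} {e e' : coordDomain (U α)} :
    coordMap U c α e = coordMap U c α e' ↔ toLocal _ c e = toLocal _ c e' := by
  refine ⟨fun h => ?_, fun h =>
    congrArg (fun x : LocalN (U α) c => (Quot.mk _ ⟨α, x⟩ : NBar U c)) h⟩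
  obtain ⟨p, hz, h⟩ := (coordMap_eq_iff U c).1 h
  obtain ⟨O, hO, hev, hv⟩ := h.symp
  have h1 : O = 1 := SpecialChart.eq_of_mulVec_phi h.mem (by
    filter_upwards [hev] with q hq
    rw [← hq]
    simp)
  refine (toLocal_eq_iff c).2 ⟨h.X_eq'.trans h.X_eq.symm, h.rho_eq, add_right_cancel h.phi_eq, ?_⟩
  rw [h1, Matrix.transpose_one, inv_one, Matrix.one_mulVec] at hv
  exact hv

/-- Two systems of coordinates near the same point of `N̄` are related by an isometric change of
coordinates. -/
theorem exists_coordChange {α β : A} {e : coordDomain (U α)} {e' : coordDomain (U β)}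
    (h : coordMap U c α e = coordMap U c β e') :
    ∃ T : Coord n → Coord n, T e = e' ∧ ContDiffAt ℝ ∞ T e ∧
      (∀ u, gFS c (U β).dom.F e' (fderiv ℝ T e u) = gFS c (U α).dom.F e u) ∧
      ∀ᶠ x in 𝓝 e.1, ∃ (hx : x ∈ coordDomain (U α)) (hx' : T x ∈ coordDomain (U β)),
        coordMap U c β ⟨T x, hx'⟩ = coordMap U c α ⟨x, hx⟩ := by
  obtain ⟨p, hz, h⟩ := (coordMap_eq_iff U c).1 h
  obtain ⟨O, hO, hev, hv⟩ := h.symp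
  have hT : IsTransition (U α).dom (U β).dom O (hom e.1.1) :=
    hz ▸ SpecialChart.isTransition h.mem h.mem' hO hev
  have hτ : transZ (U α).dom.F O (hom e.1.1) = (U β).z p :=
    hz ▸ SpecialChart.transZ_eq hev.self_of_nhds
  have h0 : transZ (U α).dom.F O (hom e.1.1) 0 ≠ 0 := by
    rw [hτ]; exact (U β).z_zero_ne_zero h.mem'
  -- Dividing by the value at the base point keeps the argument of the logarithm near one, so the
  -- principal branch is smooth there.
  set b : ℂ := transZ (U α).dom.F O (hom e.1.1) 0 with hb
  have hb1 : b / b ∈ Complex.slitPlane := by rw [div_self h0]; exact Complex.one_mem_slitPlane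
  set k : ℝ := e'.1.2.2.1 - e.1.2.2.1 with hk
  have hX : transX (U α).dom.F O e.1.1 = e'.1.1 := by
    rw [show e'.1.1 = (U β).X p from h.X_eq']
    ext μ
    rw [transX, SpecialChart.X, hτ]
  have hTe : transCoord c (U α).dom.F O b k e = e' := by
    refine Prod.ext hX (Prod.ext h.rho_eq.symm (Prod.ext ?_ hv.symm))
    simp only [transCoord]
    rw [← hb, div_self h0, Complex.log_one, Complex.zero_im, mul_zero, sub_zero, hk]
    ring
  refine ⟨transCoord c (U α).dom.F O b k, hTe, contDiffAt_transCoord k hT.mem h0 hb1,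
    fun u => ?_, ?_⟩
  · rw [← hTe]
    exact gFS_transCoord k hT e.2.2 h0 hb1 u
  -- The constant `k`, the difference of the chosen real lifts of `φ̃`, accounts for the phase of
  -- `b` that was divided out.
  · have hkb : (k : AddCircle (2 * Real.pi * c)) + 2 • angle c b = 0 := by
      have h1 := h.phi_eq
      rw [hz] at h1
      have h2 : hom e.1.1 0 = 1 := rfl
      rw [h2, angle_one, smul_zero, add_zero, ← hτ] at h1
      change ((e'.1.2.2.1 : ℝ) : AddCircle (2 * Real.pi * c)) + 2 • angle c b
        = ((e.1.2.2.1 : ℝ) : AddCircle (2 * Real.pi * c)) at h1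
      rw [hk, AddCircle.coe_sub, sub_add_eq_add_sub, h1, sub_self]
    have : Nonempty M := ⟨p⟩
    obtain ⟨g, ⟨hgz, hzg⟩, hgm, hgs⟩ := (U α).exists_inverse
    have hcont : Filter.Tendsto (fun x : Coord n => hom x.1) (𝓝 e.1) (𝓝 (hom e.1.1)) :=
      (contDiff_hom.continuous.comp continuous_fst).tendsto e.1
    have hg : Filter.Tendsto (fun x : Coord n => g (hom x.1)) (𝓝 e.1) (𝓝 p) := by
      have h1 := (hgs.continuousOn.continuousAt ((U α).dom.isOpen.mem_nhds e.2.1)).tendsto.comp hcont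
      rwa [← hz, hgz h.mem] at h1
    have hfst : Filter.Tendsto (fun x : Coord n => x.1) (𝓝 e.1) (𝓝 e.1.1) := continuous_fst.tendsto _
    filter_upwards [hcont.eventually hT.eventually_isTransition, hfst.eventually
      (hT.eventually_transX h0), hg.eventually hev.eventually_nhds,
      hg.eventually ((U β).isOpen_source.mem_nhds h.mem'),
      (coordDomain (U α)).isOpen.mem_nhds e.2] with x hx1 hx2 hx3 hx4 hx5
    have hx0 := hx2.2
    have hzx : (U α).z (g (hom x.1)) = hom x.1 := hzg hx5.1
    have hτx : transZ (U α).dom.F O (hom x.1) = (U β).z (g (hom x.1)) := by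
      rw [← SpecialChart.transZ_eq hx3.self_of_nhds, hzx]
    refine ⟨hx5, ⟨hx1.hom_transX_mem hx0, hx5.2⟩, Eq.symm ?_⟩
    refine (coordMap_eq_iff U c).2 ⟨g (hom x.1), hzx, hgm hx5.1, hx4, ?_, ?_, rfl, ?_, O, hO, hx3, rfl⟩
    · ext μ
      simp only [SpecialChart.X, hzx]
      exact (div_one _).symm
    · ext μ
      simp only [SpecialChart.X, ← hτx]
      rfl
    · rw [hzx, ← hτx]
      have h2 : hom x.1 0 = 1 := rfl
      rw [h2, angle_one, smul_zero, add_zero]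
      change ((x.2.2.1 + k - 2 * c * (Complex.log (transZ (U α).dom.F O (hom x.1) 0 / b)).im : ℝ) :
        AddCircle (2 * Real.pi * c)) + _ = (x.2.2.1 : AddCircle (2 * Real.pi * c))
      have h3 := coe_im_log_add_angle c (w := transZ (U α).dom.F O (hom x.1) 0 / b)
      have h4 : angle c (transZ (U α).dom.F O (hom x.1) 0)
          = angle c (transZ (U α).dom.F O (hom x.1) 0 / b) + angle c b := by
        rw [← angle_mul c (div_ne_zero hx0 h0) h0, div_mul_cancel₀ _ h0]
      rw [sub_eq_add_neg, AddCircle.coe_add, AddCircle.coe_add, h4, smul_add]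
      calc _ = (x.2.2.1 : AddCircle (2 * Real.pi * c)) + ((k : AddCircle (2 * Real.pi * c)) + 2 • angle c b)
            + (((-(2 * c * (Complex.log (transZ (U α).dom.F O (hom x.1) 0 / b)).im) : ℝ) :
              AddCircle (2 * Real.pi * c)) + 2 • angle c (transZ (U α).dom.F O (hom x.1) 0 / b)) := by
              abel
        _ = _ := by rw [hkb, h3, add_zero, add_zero]

omit [ContinuousConstSMul ℂˣ M] in
theorem continuous_coordMap (α : A) : Continuous (coordMap U c α) :=
  continuous_quot_mk.comp (continuous_sigmaMk.comp (continuous_toLocal c (U α)))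

omit [ContinuousConstSMul ℂˣ M] in
theorem isOpen_iff_coordMap {W : Set (NBar U c)} :
    IsOpen W ↔ ∀ α, IsOpen (coordMap U c α ⁻¹' W) := by
  refine ⟨fun h α => h.preimage (continuous_coordMap U c α), fun h => ?_⟩
  change IsOpen (Quot.mk _ ⁻¹' W)
  rw [isOpen_sigma_iff]
  intro α
  exact (isOpenQuotientMap_toLocal c (U α)).isQuotientMap.isOpen_preimage.1 (h α)

/-- Openness in `N̄` is tested in every chart, where a continuous coordinate change maps nearby
points into the given open set. -/
theorem isOpenMap_coordMap (α : A) : IsOpenMap (coordMap U c α) := by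
  intro W hW
  rw [isOpen_iff_coordMap]
  intro β
  rw [isOpen_iff_mem_nhds]
  rintro e ⟨e', he', h⟩
  obtain ⟨T, hT, hTs, -, hev⟩ := exists_coordChange U c h.symm
  obtain ⟨W', hW', rfl⟩ := isOpen_induced_iff.1 hW
  have h1 : ∀ᶠ x in 𝓝 e.1, T x ∈ W' :=
    hTs.continuousAt.eventually (by rw [hT]; exact hW'.mem_nhds he')
  filter_upwards [continuous_subtype_val.continuousAt.eventually (h1.and hev)] with x hx
  obtain ⟨hxW, hx1, hx2, hx3⟩ := hx
  exact ⟨⟨T x, hx2⟩, hxW, hx3⟩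

/-- The coordinates of one chart are ambiguous only through the period of `φ̃`, so it suffices to
restrict `φ̃` to an interval no longer than a period. -/
theorem coordMap_injOn_nhds {α : A} (e : coordDomain (U α)) :
    ∃ W ∈ 𝓝 e, Set.InjOn (coordMap U c α) W := by
  obtain ⟨r, hr, hrc⟩ : ∃ r > 0, ∀ t : ℝ, |t| < 2 * r →
      (t : AddCircle (2 * Real.pi * c)) = 0 → t = 0 := by
    rcases eq_or_ne c 0 with rfl | hc
    -- For `c = 0` the circle is the real line and any radius will do; below, half the period is
    -- used.
    · refine ⟨1, one_pos, fun t _ h => ?_⟩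
      obtain ⟨k, hk⟩ := AddCircle.coe_eq_zero_iff (p := 2 * Real.pi * 0).1 h
      simpa using hk.symm
    · refine ⟨Real.pi * |c|, by positivity, fun t ht h => ?_⟩
      obtain ⟨k, hk⟩ := (AddCircle.coe_eq_zero_iff (p := 2 * Real.pi * c)).1 h
      rcases eq_or_ne k 0 with rfl | hk0
      · simpa using hk.symm
      · have h1 : (1 : ℝ) ≤ |(k : ℝ)| := by exact_mod_cast Int.one_le_abs hk0
        rw [← hk, zsmul_eq_mul, abs_mul, abs_mul, abs_mul, abs_of_pos Real.pi_pos, abs_two] at ht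
        have h2 : 0 < 2 * Real.pi * |c| := by positivity
        nlinarith
  refine ⟨{x | |x.1.2.2.1 - e.1.2.2.1| < r}, ?_, ?_⟩
  · have h : Continuous fun x : coordDomain (U α) => |x.1.2.2.1 - e.1.2.2.1| := by fun_prop
    exact (isOpen_lt h continuous_const).mem_nhds (by simpa using hr)
  · intro x hx y hy h
    obtain ⟨h1, h2, h3, h4⟩ := (toLocal_eq_iff c).1 ((coordMap_eq_iff_toLocal U c).1 h)
    have h5 := hrc (y.1.2.2.1 - x.1.2.2.1) (by
      have : y.1.2.2.1 - x.1.2.2.1 = (y.1.2.2.1 - e.1.2.2.1) - (x.1.2.2.1 - e.1.2.2.1) := by ring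
      rw [this]
      refine (abs_sub _ _).trans_lt ?_
      have h6 : |x.1.2.2.1 - e.1.2.2.1| < r := hx
      have h7 : |y.1.2.2.1 - e.1.2.2.1| < r := hy
      linarith) (by rw [AddCircle.coe_sub, h3, sub_self])
    exact Subtype.ext (Prod.ext h1.symm (Prod.ext h2.symm (Prod.ext (sub_eq_zero.1 h5).symm h4.symm)))

theorem isLocalHomeomorph_coordMap (α : A) : IsLocalHomeomorph (coordMap U c α) := by
  rw [isLocalHomeomorph_iff_isOpenEmbedding_restrict]
  intro e
  obtain ⟨W, hW, hinj⟩ := coordMap_injOn_nhds U c e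
  obtain ⟨V, hVW, hV, heV⟩ := mem_nhds_iff.1 hW
  refine ⟨V, hV.mem_nhds heV, Topology.IsOpenEmbedding.of_continuous_injective_isOpenMap
    ((continuous_coordMap U c α).comp continuous_subtype_val) ?_
    ((isOpenMap_coordMap U c α).domRestrict hV)⟩
  exact (hinj.mono hVW).injective

omit [ContinuousConstSMul ℂˣ M] in
theorem exists_coordMap_eq (x : NBar U c) : ∃ α, ∃ e : coordDomain (U α), coordMap U c α e = x := by
  obtain ⟨⟨α, y⟩, rfl⟩ := Quot.exists_rep x
  obtain ⟨e, rfl⟩ := (isOpenQuotientMap_toLocal c (U α)).surjective y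
  exact ⟨α, e, rfl⟩

/-- The points of `N̄` over the class of `p`. -/
def IsOver (x : NBar U c) (p : M) : Prop :=
  ∃ α, ∃ e : coordDomain (U α), coordMap U c α e = x ∧ p ∈ (U α).source ∧ e.1.1 = (U α).X p

variable {U c}

omit [ContinuousConstSMul ℂˣ M] in
theorem exists_isOver (x : NBar U c) : ∃ p, IsOver U c x p := by
  obtain ⟨α, e, rfl⟩ := exists_coordMap_eq U c x
  obtain ⟨p, hp, -, hX⟩ := exists_mem_X_eq (toLocal (U α) c e)
  exact ⟨p, α, e, rfl, hp, hX⟩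

omit [ContinuousConstSMul ℂˣ M] in
theorem IsOver.smul {x : NBar U c} {p : M} (h : IsOver U c x p) (a : ℂˣ) : IsOver U c x (a • p) := by
  obtain ⟨α, e, he, hp, hX⟩ := h
  exact ⟨α, e, he, (U α).smul_mem_source a p hp, by rw [(U α).X_smul a hp, hX]⟩

theorem isOver_coordMap_iff {α : A} {e : coordDomain (U α)} {p : M} :
    IsOver U c (coordMap U c α e) p ↔ p ∈ (U α).source ∧ e.1.1 = (U α).X p := by
  refine ⟨?_, fun h => ⟨α, e, rfl, h.1, h.2⟩⟩
  rintro ⟨β, e', h, hp, hX⟩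
  obtain ⟨q, hz, h⟩ := (coordMap_eq_iff U c).1 h
  obtain ⟨a, rfl⟩ := (U β).exists_smul_eq h.mem hp (h.X_eq.symm.trans hX)
  refine ⟨(U α).smul_mem_source a q h.mem', ?_⟩
  rw [(U α).X_smul a h.mem']
  exact h.X_eq'

theorem IsOver.exists_smul_eq {x : NBar U c} {p q : M} (h : IsOver U c x p) (h' : IsOver U c x q) :
    ∃ a : ℂˣ, a • p = q := by
  obtain ⟨α, e, rfl, hp, hX⟩ := h
  obtain ⟨hq, hX'⟩ := isOver_coordMap_iff.1 h'
  exact (U α).exists_smul_eq hp hq (hX.symm.trans hX')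

/-- A point of `N̄` over `p` has coordinates in every chart containing `p`. They are defined by the
gluing formulas, with the transition matrix supplied by `exists_transition`. -/
theorem IsOver.exists_coordMap_eq [T2Space M] (hM : IsPrincipalAction C.toTensorTriple)
    {x : NBar U c} {p : M} (h : IsOver U c x p) {α : A}
    (hp : p ∈ (U α).source) : ∃ e : coordDomain (U α), coordMap U c α e = x := by
  obtain ⟨β, e, rfl, hpβ, hX⟩ := h
  obtain ⟨O, hO, hev⟩ := (U β).exists_transition hM (U α) hpβ hp
  obtain ⟨a, ha⟩ := (U α).exists_z_eq_hom hp
  let y : LocalN (U α) c := ⟨((U α).X p, e.1.2.1, (e.1.2.2.1 : AddCircle (2 * Real.pi * c))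
    + 2 • angle c ((U β).z p 0) - 2 • angle c ((U α).z p 0), (O.transpose⁻¹).mulVec e.1.2.2.2),
    ha ▸ (U α).z_mem ((U α).smul_mem_source a p hp), e.2.2⟩
  obtain ⟨e', he'⟩ := (isOpenQuotientMap_toLocal c (U α)).surjective y
  refine ⟨e', Eq.symm ((mk_eq_iff U c).2 ⟨p, hpβ, hp, hX, ?_, ?_, ?_, O, hO, hev, ?_⟩)⟩
  · exact congrArg (fun y => y.1.1) he'
  · exact congrArg (fun y => y.1.2.1) he'
  · have h1 : ((e'.1.2.2.1 : ℝ) : AddCircle (2 * Real.pi * c)) = y.1.2.2.1 :=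
      congrArg (fun y => y.1.2.2.1) he'
    change ((e'.1.2.2.1 : ℝ) : AddCircle (2 * Real.pi * c)) + _
      = ((e.1.2.2.1 : ℝ) : AddCircle (2 * Real.pi * c)) + _
    rw [h1]
    exact sub_add_cancel _ _
  · exact congrArg (fun y => y.1.2.2.2) he'

/-- This gives the open sets pulled back from the base. In a chart a representative of the base
point is given by the inverse coordinates, translated by a fixed element of `ℂ^*`, and depends
continuously on the coordinates. -/
theorem isOpen_setOf_isOver {V : Set M} (hV : IsOpen V) :
    IsOpen {x : NBar U c | ∃ p ∈ V, IsOver U c x p} := by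
  rw [isOpen_iff_coordMap]
  intro α
  rw [isOpen_iff_mem_nhds]
  rintro e ⟨p, hpV, hp⟩
  obtain ⟨hp, hX⟩ := isOver_coordMap_iff.1 hp
  have : Nonempty M := ⟨p⟩
  obtain ⟨g, ⟨hgz, hzg⟩, hgm, hgs⟩ := (U α).exists_inverse
  obtain ⟨a, ha⟩ := (U α).exists_z_eq_hom hp
  have hcont : ContinuousAt (fun x : coordDomain (U α) => a⁻¹ • g (hom x.1.1)) e := by
    have h1 : ContinuousAt (fun x : coordDomain (U α) => hom x.1.1) e :=
      (contDiff_hom.continuous.comp (continuous_fst.comp continuous_subtype_val)).continuousAt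
    have h2 := ContinuousAt.comp (x := e) (g := g)
      (hgs.continuousOn.continuousAt ((U α).dom.isOpen.mem_nhds e.2.1)) h1
    exact h2.const_smul a⁻¹
  have hval : a⁻¹ • g (hom e.1.1) = p := by
    rw [hX, ← ha, hgz ((U α).smul_mem_source a p hp), inv_smul_smul]
  have hVn : V ∈ 𝓝 (a⁻¹ • g (hom e.1.1)) := by
    rw [hval]
    exact hV.mem_nhds hpV
  filter_upwards [hcont.preimage_mem_nhds hVn] with x hx
  refine ⟨_, hx, isOver_coordMap_iff.2 ⟨(U α).smul_mem_source _ _ (hgm x.2.1), ?_⟩⟩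
  rw [(U α).X_smul _ (hgm x.2.1)]
  ext μ
  simp only [SpecialChart.X, hzg x.2.1]
  exact (div_one _).symm

/-- Two points over the same orbit lie in a common `N̄_α`, which is Hausdorff and in which nothing
further is identified. Points over different orbits are separated in `M / ℂ^*`, which is Hausdorff
because the action is proper. -/
theorem t2Space_NBar [T2Space M] (hM : IsPrincipalAction C.toTensorTriple)
    (hU : ∀ p : M, ∃ α, p ∈ (U α).source) : T2Space (NBar U c) := by
  have := hM.proper
  refine ⟨fun x y hxy => ?_⟩
  obtain ⟨p, hp⟩ := exists_isOver x
  obtain ⟨q, hq⟩ := exists_isOver y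
  by_cases h : ∃ a : ℂˣ, a • p = q
  · obtain ⟨a, rfl⟩ := h
    obtain ⟨α, hα⟩ := hU (a • p)
    obtain ⟨e, rfl⟩ := (hp.smul a).exists_coordMap_eq hM hα
    obtain ⟨e', rfl⟩ := hq.exists_coordMap_eq hM hα
    have hne : toLocal (U α) c e ≠ toLocal (U α) c e' := fun h =>
      hxy ((coordMap_eq_iff_toLocal U c).2 h)
    have : T2Space (LocalN (U α) c) := inferInstanceAs (T2Space {x : (Fin n → ℂ) × ℝ ×
      AddCircle (2 * Real.pi * c) × (Fin (n + 1) ⊕ Fin (n + 1) → ℝ) //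
        hom x.1 ∈ (U α).dom.carrier ∧ 0 < x.2.1})
    obtain ⟨V, V', hV, hV', he, he', hd⟩ := t2_separation hne
    refine ⟨_, _, isOpenMap_coordMap U c α _ (hV.preimage (continuous_toLocal c (U α))),
      isOpenMap_coordMap U c α _ (hV'.preimage (continuous_toLocal c (U α))), ⟨e, he, rfl⟩,
      ⟨e', he', rfl⟩, ?_⟩
    rw [Set.disjoint_left]
    rintro _ ⟨f, hf, rfl⟩ ⟨f', hf', h⟩
    have hf'' : toLocal (U α) c f' ∈ V' := hf'
    rw [(coordMap_eq_iff_toLocal U c).1 h] at hf''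
    exact Set.disjoint_left.1 hd hf hf''
  · have hne : (Quotient.mk _ p : MulAction.orbitRel.Quotient ℂˣ M) ≠ Quotient.mk _ q := by
      intro hpq
      obtain ⟨a, ha⟩ := MulAction.orbitRel_apply.1 (Quotient.exact hpq.symm)
      exact h ⟨a, ha⟩
    obtain ⟨V, V', hV, hV', hpV, hqV, hd⟩ := t2_separation hne
    refine ⟨_, _, isOpen_setOf_isOver (hV.preimage continuous_quot_mk),
      isOpen_setOf_isOver (hV'.preimage continuous_quot_mk), ⟨p, hpV, hp⟩, ⟨q, hqV, hq⟩, ?_⟩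
    rw [Set.disjoint_left]
    rintro w ⟨p', hp'V, hp'⟩ ⟨q', hq'V, hq'⟩
    obtain ⟨a, rfl⟩ := hp'.exists_smul_eq hq'
    have h1 : (Quotient.mk _ (a • p') : MulAction.orbitRel.Quotient ℂˣ M) = Quotient.mk _ p' :=
      Quotient.sound (MulAction.orbitRel_apply.2 ⟨a, rfl⟩)
    have h2 : (Quotient.mk _ (a • p') : MulAction.orbitRel.Quotient ℂˣ M) ∈ V' := hq'V
    rw [h1] at h2
    exact Set.disjoint_left.1 hd hp'V h2

/-- By the Lindelöf property of `M` countably many of the `M_α` cover it, and the corresponding open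
images of second countable coordinate domains cover `N̄`. -/
theorem secondCountableTopology_NBar [T2Space M] [SecondCountableTopology M]
    (hM : IsPrincipalAction C.toTensorTriple) (hU : ∀ p : M, ∃ α, p ∈ (U α).source) :
    SecondCountableTopology (NBar U c) := by
  obtain ⟨B, hB, hBU⟩ := TopologicalSpace.isOpen_iUnion_countable (fun α => (U α).source)
    (fun α => (U α).isOpen_source)
  have := hB.to_subtype
  have hsc : ∀ α, SecondCountableTopology (Set.range (coordMap U c α)) := by
    intro α
    have hq : IsOpenQuotientMap (Set.rangeFactorization (coordMap U c α)) :=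
      ⟨Set.rangeFactorization_surjective, (continuous_coordMap U c α).subtype_mk _,
        (isOpenMap_coordMap U c α).subtype_mk _⟩
    exact hq.isQuotientMap.secondCountableTopology hq.isOpenMap
  refine TopologicalSpace.secondCountableTopology_of_countable_cover
    (U := fun α : B => Set.range (coordMap U c α))
    (fun α => (isOpenMap_coordMap U c α).isOpen_range) ?_
  refine Set.eq_univ_of_forall fun x => ?_
  obtain ⟨p, hp⟩ := exists_isOver x
  have hpu : p ∈ ⋃ α, (U α).source := Set.mem_iUnion.2 (hU p)
  rw [← hBU] at hpu
  obtain ⟨α, hα, hpα⟩ := Set.mem_iUnion₂.1 hpu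
  obtain ⟨e, he⟩ := hp.exists_coordMap_eq hM hpα
  exact Set.mem_iUnion.2 ⟨⟨α, hα⟩, e, he⟩

end Topology

/-! ### Riemannian manifolds given by local parametrizations -/

section Parametrizations

variable {E : Type*} [NormedAddCommGroup E] [NormedSpace ℝ E] {N : Type*} [TopologicalSpace N]
  {A : Type*} {D : A → TopologicalSpace.Opens E} (φ : ∀ α, D α → N)
  (b : A → E → E →L[ℝ] E →L[ℝ] ℝ)

/-- Local parametrizations `φ α` of a manifold and the coefficients `b α` of a Riemannian metric. -/
structure IsMetricAtlas : Prop where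
  localHomeo : ∀ α, IsLocalHomeomorph (φ α)
  cover : ∀ x, ∃ α, ∃ e, φ α e = x
  change : ∀ (α β : A) (e : D α) (e' : D β), φ α e = φ β e' → ∃ T : E → E, T e = e' ∧
    ContDiffAt ℝ ∞ T e ∧ (∀ u, b β e' (fderiv ℝ T e u) (fderiv ℝ T e u) = b α e u u) ∧
    ∀ᶠ x in 𝓝 e.1, ∃ (hx : x ∈ D α) (hx' : T x ∈ D β), φ β ⟨T x, hx'⟩ = φ α ⟨x, hx⟩
  contDiffOn : ∀ α, ContDiffOn ℝ ∞ (b α) (D α)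
  symm : ∀ α, ∀ e ∈ D α, ∀ u v, b α e u v = b α e v u
  pos : ∀ α, ∀ e ∈ D α, ∀ u, u ≠ 0 → 0 < b α e u u

namespace IsMetricAtlas

variable {φ b} (h : IsMetricAtlas φ b)

/-- The chart inverse to `φ α` near `φ α e`. -/
def chart (α : A) (e : D α) : OpenPartialHomeomorph N E :=
  (h.localHomeo α e).choose.symm.trans ((D α).openPartialHomeomorphSubtypeCoe ⟨e⟩)

theorem eventually_chart (α : A) (e : D α) :
    ∀ᶠ e' in 𝓝 e, φ α e' ∈ (h.chart α e).source ∧ h.chart α e (φ α e') = e' := by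
  obtain ⟨h1, h2⟩ := (h.localHomeo α e).choose_spec
  filter_upwards [(h.localHomeo α e).choose.open_source.mem_nhds h1] with e' he'
  have h3 : φ α e' = (h.localHomeo α e).choose e' := congrFun h2 e'
  refine ⟨?_, ?_⟩
  · rw [h3]
    simpa [chart] using (h.localHomeo α e).choose.map_source he'
  · rw [h3]
    exact congrArg Subtype.val ((h.localHomeo α e).choose.left_inv he')

theorem chart_symm {α : A} {e : D α} {y : E} (hy : y ∈ (h.chart α e).target) :
    ∃ hyD : y ∈ D α, (h.chart α e).symm y = φ α ⟨y, hyD⟩ := by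
  have h2 := (h.localHomeo α e).choose_spec.2
  rw [chart, OpenPartialHomeomorph.trans_target] at hy
  have hyD : y ∈ D α := by simpa using hy.1
  refine ⟨hyD, ?_⟩
  have h3 : ((D α).openPartialHomeomorphSubtypeCoe ⟨e⟩).symm y = ⟨y, hyD⟩ :=
    ((D α).openPartialHomeomorphSubtypeCoe ⟨e⟩).left_inv (x := ⟨y, hyD⟩) (Set.mem_univ _)
  change (h.localHomeo α e).choose (((D α).openPartialHomeomorphSubtypeCoe ⟨e⟩).symm y) = _
  rw [h3, ← h2]

/-- A parametrization read in a chart is locally one of the given changes of coordinates. Smoothness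
of the atlas, the local diffeomorphisms and the compatibility of the metric coefficients are all
read off from it. -/
theorem exists_chart_comp {α β : A} {e : D α} {e' : D β}
    (hx : φ β e' ∈ (h.chart α e).source) : ∃ T : E → E, ContDiffAt ℝ ∞ T e' ∧
      T e' = h.chart α e (φ β e') ∧
      (∀ u, b α (T e') (fderiv ℝ T e' u) (fderiv ℝ T e' u) = b β e' u u) ∧
      ∀ᶠ w in 𝓝 e'.1, ∃ hw : w ∈ D β, φ β ⟨w, hw⟩ ∈ (h.chart α e).source ∧
        h.chart α e (φ β ⟨w, hw⟩) = T w := by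
  obtain ⟨hyD, hy⟩ := h.chart_symm ((h.chart α e).map_source hx)
  rw [(h.chart α e).left_inv hx] at hy
  obtain ⟨T, hT, hTs, hTb, hTe⟩ := h.change β α e' _ hy
  refine ⟨T, hTs, hT, fun u => by rw [hT]; exact hTb u, ?_⟩
  have h1 : ∀ᶠ w in 𝓝 e'.1, T w ∈ (h.chart α e).target := hTs.continuousAt.eventually (by
    rw [hT]
    exact (h.chart α e).open_target.mem_nhds ((h.chart α e).map_source hx))
  filter_upwards [h1, hTe] with w hw hw'
  obtain ⟨hwD, hTw, hφ⟩ := hw'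
  obtain ⟨_, h2⟩ := h.chart_symm hw
  refine ⟨hwD, ?_, ?_⟩
  · rw [← hφ, ← h2]
    exact (h.chart α e).map_target hw
  · rw [← hφ, ← h2]
    exact (h.chart α e).right_inv hw

/-- A parameter for each point. -/
def index (x : N) : Σ α, D α := ⟨(h.cover x).choose, (h.cover x).choose_spec.choose⟩

theorem map_index (x : N) : φ (h.index x).1 (h.index x).2 = x :=
  (h.cover x).choose_spec.choose_spec

/-- The atlas given by the parametrizations. -/
@[reducible] def chartedSpace : ChartedSpace E N where
  atlas := Set.range fun x => h.chart (h.index x).1 (h.index x).2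
  chartAt x := h.chart (h.index x).1 (h.index x).2
  mem_chart_source x := by
    have := (h.eventually_chart (h.index x).1 (h.index x).2).self_of_nhds.1
    rwa [h.map_index x] at this
  chart_mem_atlas x := ⟨x, rfl⟩

theorem isManifold : letI := h.chartedSpace; IsManifold 𝓘(ℝ, E) ∞ N := by
  let _ := h.chartedSpace
  refine isManifold_of_contDiffOn _ _ _ ?_
  rintro _ _ ⟨x, rfl⟩ ⟨x', rfl⟩
  intro y hy
  refine ContDiffAt.contDiffWithinAt ?_
  have hy' : y ∈ ((h.chart (h.index x).1 (h.index x).2).symm.trans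
    (h.chart (h.index x').1 (h.index x').2)).source := by simpa using hy
  rw [OpenPartialHomeomorph.trans_source] at hy'
  obtain ⟨hyD, hyφ⟩ := h.chart_symm hy'.1
  have h2 := hy'.2
  rw [Set.mem_preimage, hyφ] at h2
  obtain ⟨T, hTs, -, -, hT⟩ := h.exists_chart_comp h2
  refine hTs.congr_of_eventuallyEq ?_
  filter_upwards [hT, (h.chart (h.index x).1 (h.index x).2).open_target.mem_nhds hy'.1] with w hw hw'
  obtain ⟨hwD, -, h3⟩ := hw
  obtain ⟨_, h4⟩ := h.chart_symm hw'
  rw [← h3, ← h4]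
  rfl

theorem chart_index_apply (x : N) :
    h.chart (h.index x).1 (h.index x).2 x = (h.index x).2 := by
  have := (h.eventually_chart (h.index x).1 (h.index x).2).self_of_nhds.2
  rwa [h.map_index x] at this

omit [NormedSpace ℝ E] in
theorem opens_symm_apply {S : TopologicalSpace.Opens E} (e : S) {w : E} (hw : w ∈ S) :
    (chartAt E e).symm w = (⟨w, hw⟩ : S) :=
  (chartAt E e).left_inv (x := ⟨w, hw⟩) (by
    rw [TopologicalSpace.Opens.chartAt_eq]
    simp [chartAt_self_eq])

theorem exists_hasMFDerivAt (α : A) (e : D α) : letI := h.chartedSpace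
    ∃ T : E →L[ℝ] E, HasMFDerivAt 𝓘(ℝ, E) 𝓘(ℝ, E) (φ α) e T ∧
      ∀ u, b (h.index (φ α e)).1 (h.index (φ α e)).2 (T u) (T u) = b α e u u := by
  let _ := h.chartedSpace
  obtain ⟨T, hTs, hTe, hTb, hT⟩ := h.exists_chart_comp (e' := e)
    (mem_chart_source E (φ α e))
  rw [hTe] at hTb
  refine ⟨fderiv ℝ T e, ⟨(h.localHomeo α).continuous.continuousAt, ?_⟩, ?_⟩
  · have h1 := (hTs.differentiableAt (by simp)).hasFDerivAt
    refine (h1.congr_of_eventuallyEq ?_).hasFDerivWithinAt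
    filter_upwards [hT] with w hw
    obtain ⟨hwD, -, h3⟩ := hw
    rw [← h3]
    change h.chart _ _ (φ α ((chartAt E e).symm w)) = _
    rw [opens_symm_apply e hwD]
  · intro u
    rw [← hTb u, chart_index_apply]

theorem isLocalDiffeomorph (α : A) : letI := h.chartedSpace
    IsLocalDiffeomorph 𝓘(ℝ, E) 𝓘(ℝ, E) ∞ (φ α) := by
  let _ := h.chartedSpace
  have := h.isManifold
  intro e
  obtain ⟨he, hφ⟩ := (h.localHomeo α e).choose_spec
  set Φ := (h.localHomeo α e).choose with hΦ
  have h1 : ContMDiff 𝓘(ℝ, E) 𝓘(ℝ, E) ∞ (φ α) := by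
    intro e'
    obtain ⟨T, hTs, hTe, -, hT⟩ := h.exists_chart_comp (e' := e')
      (mem_chart_source E (φ α e'))
    refine contMDiffAt_iff.2 ⟨(h.localHomeo α).continuous.continuousAt, ?_⟩
    refine (hTs.congr_of_eventuallyEq ?_).contDiffWithinAt
    filter_upwards [hT] with w hw
    obtain ⟨hwD, -, h3⟩ := hw
    rw [← h3]
    change h.chart _ _ (φ α ((chartAt E e').symm w)) = _
    rw [opens_symm_apply e' hwD]
  have h2 : ContMDiffOn 𝓘(ℝ, E) 𝓘(ℝ, E) ∞ Φ.symm Φ.target := by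
    intro x hx
    refine ContMDiffAt.contMDiffWithinAt ?_
    rw [← ContMDiffAt.subtypeVal_comp_iff]
    have hx' : x ∈ (h.chart α e).source := by simpa [chart] using hx
    have h3 : φ (h.index x).1 (h.index x).2 ∈ (h.chart α e).source := by rwa [h.map_index x]
    obtain ⟨T, hTs, -, -, hT⟩ := h.exists_chart_comp h3
    refine contMDiffAt_iff.2 ⟨continuous_subtype_val.continuousAt.comp
      (Φ.symm.continuousAt hx), ?_⟩
    have h4 : (extChartAt 𝓘(ℝ, E) x) x = (h.index x).2 := h.chart_index_apply x
    rw [h4]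
    refine (hTs.congr_of_eventuallyEq ?_).contDiffWithinAt
    have h5 : (h.chart (h.index x).1 (h.index x).2).target ∈ 𝓝 (h.index x).2.1 := by
      rw [← h.chart_index_apply x]
      exact (chartAt E x).open_target.mem_nhds ((chartAt E x).map_source (mem_chart_source E x))
    filter_upwards [hT, h5] with w hw hw'
    obtain ⟨hwD, -, h6⟩ := hw
    obtain ⟨_, h7⟩ := h.chart_symm hw'
    rw [← h6, ← h7]
    rfl
  refine ⟨{ toPartialEquiv := Φ.toPartialEquiv, open_source := Φ.open_source,
            open_target := Φ.open_target, contMDiffOn_toFun := ?_, contMDiffOn_invFun := h2 },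
          he, ?_⟩
  · exact h1.contMDiffOn.congr fun e' _ => (congrFun hφ e').symm
  · exact fun e' _ => congrFun hφ e'

include h in
theorem apply_eq_of_quad {α : A} {x : E} (hx : x ∈ D α) {b' : E →L[ℝ] E →L[ℝ] ℝ} {L : E →L[ℝ] E}
    (hb' : ∀ u v, b' u v = b' v u) (hq : ∀ u, b α x (L u) (L u) = b' u u) (u v : E) :
    b α x (L u) (L v) = b' u v := by
  have h1 := hq (u + v)
  have h2 := h.symm α x hx (L u) (L v)
  have h3 := hb' u v
  simp only [map_add, add_apply, hq] at h1
  linarith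

/-- The bilinear form on the tangent space at `x` with coefficients `b`. -/
def form (x : N) : letI := h.chartedSpace
    TangentSpace 𝓘(ℝ, E) x →L[ℝ] TangentSpace 𝓘(ℝ, E) x →L[ℝ] ℝ :=
  b (h.index x).1 (h.index x).2

/-- The form at `x` is defined with the chart preferred at `x`, which may jump with `x`. In the
trivialization at a fixed `x₀` the invariance of the coefficients replaces it by the coefficients of
one chart, so that smoothness becomes visible. -/
theorem inCoordinates_form (x₀ : N) : let _ := h.chartedSpace; let _ := h.isManifold
    ∀ x ∈ (chartAt E x₀).source, ContinuousLinearMap.inCoordinates E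
      (TangentSpace 𝓘(ℝ, E) : N → Type _) (E →L[ℝ] ℝ)
      (fun x : N => TangentSpace 𝓘(ℝ, E) x →L[ℝ] ℝ) x₀ x x₀ x (h.form x) = b (h.index x₀).1 (chartAt E x₀ x) := by
  intro _ _ x hx
  have : IsManifold 𝓘(ℝ, E) ∞ N := h.isManifold
  have hb : x ∈ (trivializationAt E (TangentSpace 𝓘(ℝ, E) : N → Type _) x₀).baseSet := by
    simpa using hx
  obtain ⟨hD, hφ⟩ := h.chart_symm ((chartAt E x₀).map_source hx)
  have hφ' : φ (h.index x₀).1 ⟨chartAt E x₀ x, hD⟩ = x := by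
    rw [← hφ]
    exact (chartAt E x₀).left_inv hx
  have hs : φ (h.index x₀).1 ⟨chartAt E x₀ x, hD⟩ ∈ (chartAt E x).source := by
    rw [hφ']
    exact mem_chart_source E x
  obtain ⟨T, hTs, hTe, hTb, hT⟩ := h.exists_chart_comp hs
  have hTe' : T (chartAt E x₀ x) = (h.index x).2 := by
    rw [hTe, hφ', chart_index_apply]
  -- The trivialization at `x₀` differs from the one at `x` by the derivative of the change of
  -- charts, which is the isometry `T`.
  have hco : (trivializationAt E (TangentSpace 𝓘(ℝ, E) : N → Type _) x₀).symmL ℝ x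
      = fderiv ℝ T (chartAt E x₀ x) := by
    rw [TangentBundle.symmL_trivializationAt_eq_core hx, tangentBundleCore_coordChange]
    simp only [modelWithCornersSelf_coe, Set.range_id, fderivWithin_univ]
    refine Filter.EventuallyEq.fderiv_eq ?_
    filter_upwards [hT, (chartAt E x₀).open_target.mem_nhds ((chartAt E x₀).map_source hx)]
      with w hw hw'
    obtain ⟨hwD, -, h3⟩ := hw
    obtain ⟨_, h4⟩ := h.chart_symm hw'
    rw [← h3, ← h4]
    rfl
  ext u v
  refine (inCoordinates_apply_eq₂ (F₃ := ℝ) (E₃ := fun _ : N => ℝ) (ϕ := h.form x)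
    (v := u) (w := v) hb hb (by simp)).trans ?_
  rw [hTe'] at hTb
  have := h.apply_eq_of_quad (h.index x).2.2 (h.symm (h.index x₀).1 _ hD) hTb u v
  rw [← this]
  have hs : ∀ u : E, (trivializationAt E (TangentSpace 𝓘(ℝ, E) : N → Type _) x₀).symm x u
      = fderiv ℝ T (chartAt E x₀ x) u := fun u =>
    (Bundle.Trivialization.symmL_apply (R := ℝ)
      (trivializationAt E (TangentSpace 𝓘(ℝ, E) : N → Type _) x₀) hb u).symm.trans
        (congrArg (fun L : E →L[ℝ] E => L u) hco)
  simp only [Bundle.Trivial.fiberBundle_trivializationAt', Bundle.Trivial.linearMapAt_trivialization,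
    LinearMap.id_coe, id_eq]
  exact congrArg₂ (fun u v : E => b (h.index x).1 (h.index x).2 u v) (hs u) (hs v)

include h in
theorem isVonNBounded [FiniteDimensional ℝ E] {α : A} {x : E} (hx : x ∈ D α) :
    Bornology.IsVonNBounded ℝ {v : E | b α x v v < 1} := by
  have hc : Continuous fun v : E => b α x v v := by fun_prop
  rcases subsingleton_or_nontrivial E with hE | hE
  · exact (Set.subsingleton_of_subsingleton.finite).isVonNBounded
  obtain ⟨v₀, hv₀, hmin⟩ := (isCompact_sphere (0 : E) 1).exists_isMinOn
    (NormedSpace.sphere_nonempty.2 zero_le_one) hc.continuousOn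
  have hv₀' : v₀ ≠ 0 := by
    rintro rfl
    simp at hv₀
  have hm := h.pos α x hx v₀ hv₀'
  rw [NormedSpace.isVonNBounded_iff]
  refine (Metric.isBounded_closedBall (x := (0 : E)) (r := √(1 / b α x v₀ v₀))).subset ?_
  intro v hv
  rw [mem_closedBall_zero_iff]
  refine Real.le_sqrt_of_sq_le ?_
  rw [le_div_iff₀ hm]
  rcases eq_or_ne v 0 with rfl | hv0
  · simp
  have h1 : b α x v₀ v₀ ≤ b α x (‖v‖⁻¹ • v) (‖v‖⁻¹ • v) := hmin (by
    simp [norm_smul, hv0])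
  have hn : 0 < ‖v‖ := norm_pos_iff.2 hv0
  simp only [map_smul, smul_apply, smul_eq_mul] at h1
  have h2 : b α x v v < 1 := hv
  have h3 : ‖v‖ ^ 2 * b α x v₀ v₀ ≤ ‖v‖ ^ 2 * (‖v‖⁻¹ * (‖v‖⁻¹ * b α x v v)) := by gcongr
  have h4 : ‖v‖ ^ 2 * (‖v‖⁻¹ * (‖v‖⁻¹ * b α x v v)) = b α x v v := by field_simp
  linarith

/-- The Riemannian metric with coefficients `b`. -/
def metric [FiniteDimensional ℝ E] : letI := h.chartedSpace; letI := h.isManifold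
    Bundle.ContMDiffRiemannianMetric 𝓘(ℝ, E) ∞ E (TangentSpace 𝓘(ℝ, E) : N → Type _) :=
  letI := h.chartedSpace
  letI := h.isManifold
  { inner := h.form
    symm := fun x => h.symm _ _ (h.index x).2.2
    pos := fun x => h.pos _ _ (h.index x).2.2
    isVonNBounded := fun x => h.isVonNBounded (h.index x).2.2
    contMDiff := by
      intro x₀
      refine (Bundle.contMDiffAt_section x₀).2 ?_
      have hD : (h.index x₀).2.1 ∈ D (h.index x₀).1 := (h.index x₀).2.2
      have h1 : ContDiffAt ℝ ∞ (b (h.index x₀).1) (chartAt E x₀ x₀) := by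
        have h2 : chartAt E x₀ x₀ = (h.index x₀).2.1 := h.chart_index_apply x₀
        rw [h2]
        exact (h.contDiffOn _).contDiffAt ((D (h.index x₀).1).2.mem_nhds hD)
      have h3 : ContMDiffAt 𝓘(ℝ, E) 𝓘(ℝ, E →L[ℝ] E →L[ℝ] ℝ) ∞
          (fun x => b (h.index x₀).1 (chartAt E x₀ x)) x₀ :=
        h1.contMDiffAt.comp x₀ (contMDiffAt_extChartAt (I := 𝓘(ℝ, E)) (x := x₀))
      refine h3.congr_of_eventuallyEq ?_
      filter_upwards [chart_source_mem_nhds E x₀] with x hx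
      exact h.inCoordinates_form x₀ x hx }

include h in
/-- Local parametrizations with compatible coefficients define a Riemannian manifold. -/
theorem exists_metric [FiniteDimensional ℝ E] :
    ∃ (_ : ChartedSpace E N) (_ : IsManifold 𝓘(ℝ, E) ∞ N)
      (g : Bundle.ContMDiffRiemannianMetric 𝓘(ℝ, E) ∞ E (TangentSpace 𝓘(ℝ, E) : N → Type _)),
      (∀ α, IsLocalDiffeomorph 𝓘(ℝ, E) 𝓘(ℝ, E) ∞ (φ α)) ∧
      ∀ (α : A) (e : D α) (u : E), g.inner (φ α e) (mfderiv 𝓘(ℝ, E) 𝓘(ℝ, E) (φ α) e u)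
        (mfderiv 𝓘(ℝ, E) 𝓘(ℝ, E) (φ α) e u) = b α e u u := by
  let _ := h.chartedSpace
  refine ⟨h.chartedSpace, h.isManifold, h.metric, h.isLocalDiffeomorph, fun α e u => ?_⟩
  obtain ⟨T, hT, hb⟩ := h.exists_hasMFDerivAt α e
  rw [hT.mfderiv]
  exact hb u

end IsMetricAtlas

end Parametrizations

/-! ### The one-loop metric on the glued space -/

section OneLoop

variable {n : ℕ} {M : Type*} [TopologicalSpace M]
  [ChartedSpace (EuclideanSpace ℝ (Fin (2 * n + 2))) M] [IsManifold (𝓡 (2 * n + 2)) ∞ M]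
  [MulAction ℂˣ M] {C : ConicalSpecialKaehler n M} {A : Type*} (U : A → SpecialChart C)

theorem isMetricAtlas_coordMap [ContinuousConstSMul ℂˣ M] {c : ℝ} (hc : 0 ≤ c) :
    IsMetricAtlas (coordMap U c) (fun α => bilinFS c (U α).dom.F) where
  localHomeo α := isLocalHomeomorph_coordMap U c α
  cover x := exists_coordMap_eq U c x
  change α β e e' h := by
    obtain ⟨T, h1, h2, h3, h4⟩ := exists_coordChange U c h
    exact ⟨T, h1, h2, fun u => by rw [bilinFS_self, bilinFS_self, h3], h4⟩
  contDiffOn α := contDiffOn_bilinFS hc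
  symm α e _ u v := bilinFS_symm _ _ _ u v
  pos α e he u hu := by
    rw [bilinFS_self]
    exact gFS_pos hc he.1 he.2 hu

/-- The one-loop deformed Ferrara-Sabharwal metric exists on `N̄`. -/
theorem exists_isOneLoopMetric [ContinuousConstSMul ℂˣ M] {c : ℝ} (hc : 0 ≤ c) :
    ∃ (_ : ChartedSpace (Coord n) (NBar U c)) (_ : IsManifold 𝓘(ℝ, Coord n) ∞ (NBar U c))
      (g : Bundle.ContMDiffRiemannianMetric 𝓘(ℝ, Coord n) ∞ (Coord n)
        (TangentSpace 𝓘(ℝ, Coord n) : NBar U c → Type _)), IsOneLoopMetric U c g := by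
  obtain ⟨h1, h2, g, h3, h4⟩ := (isMetricAtlas_coordMap U hc).exists_metric
  exact ⟨h1, h2, g, h3, fun α e u => by rw [h4, bilinFS_self]⟩

end OneLoop

/-! ### A lower bound for forms which are negative transversally to a plane -/

section LowerBound

variable {E : Type*} [NormedAddCommGroup E] [InnerProductSpace ℝ E] [FiniteDimensional ℝ E]
  {X : Type*} [TopologicalSpace X] {p : X} {G : X → E →L[ℝ] E →L[ℝ] ℝ} {a b : X → E}

/-- A family of forms `m + K l` with `l ≥ 0` is uniformly positive near `p` for some `K`, when
at `p` the form `m` is positive where `l` vanishes. -/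
theorem exists_penalty {m l : X → E → ℝ} (hm : ∀ w, ContinuousAt (Function.uncurry m) (p, w))
    (hl : ∀ w, ContinuousAt (Function.uncurry l) (p, w)) (hl0 : ∀ q w, 0 ≤ l q w)
    (hm2 : ∀ q (k : ℝ) w, m q (k • w) = k ^ 2 * m q w)
    (hl2 : ∀ q (k : ℝ) w, l q (k • w) = k ^ 2 * l q w)
    (h : ∀ w, w ≠ 0 → l p w = 0 → 0 < m p w) :
    ∃ K ≥ (0 : ℝ), ∃ ε > 0, ∀ᶠ q in 𝓝 p, ∀ w, ε * ‖w‖ ^ 2 ≤ m q w + K * l q w := by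
  have hcm : Continuous (m p) := continuous_iff_continuousAt.2 fun w =>
    (hm w).comp (f := fun w => (p, w)) (by fun_prop)
  have hcl : Continuous (l p) := continuous_iff_continuousAt.2 fun w =>
    (hl w).comp (f := fun w => (p, w)) (by fun_prop)
  have hS : IsCompact (Metric.sphere (0 : E) 1) := isCompact_sphere 0 1
  have hne : ∀ w ∈ Metric.sphere (0 : E) 1, w ≠ 0 := by
    rintro w hw rfl
    simp at hw
  -- The open sets where `m + K l` is positive increase with `K` and cover the compact sphere: where
  -- `l` vanishes `m` is positive, elsewhere a large `K` compensates `m`.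
  have hK : ∃ K : ℕ, ∀ w ∈ Metric.sphere (0 : E) 1, 0 < m p w + K * l p w := by
    have := hS.elim_directed_cover (fun K : ℕ => {w | 0 < m p w + K * l p w})
      (fun K => isOpen_lt continuous_const (by fun_prop)) (by
        intro w hw
        rw [Set.mem_iUnion]
        rcases (hl0 p w).eq_or_lt with h0 | h0
        · exact ⟨0, by simpa using h w (hne w hw) h0.symm⟩
        · obtain ⟨K, hK⟩ := exists_nat_gt (-m p w / l p w)
          rw [div_lt_iff₀ h0] at hK
          refine ⟨K, ?_⟩
          show 0 < m p w + K * l p w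
          linarith) (by
        refine directed_of_isDirected_le fun K K' hKK' w hw => ?_
        have h1 : (K : ℝ) * l p w ≤ K' * l p w :=
          mul_le_mul_of_nonneg_right (by exact_mod_cast hKK') (hl0 p w)
        have h2 : 0 < m p w + K * l p w := hw
        show 0 < m p w + K' * l p w
        linarith)
    obtain ⟨K, hK⟩ := this
    exact ⟨K, fun w hw => hK hw⟩
  obtain ⟨K, hK⟩ := hK
  obtain ⟨ε, hε, hε'⟩ : ∃ ε > 0, ∀ w ∈ Metric.sphere (0 : E) 1, ε < m p w + K * l p w := by
    rcases (Metric.sphere (0 : E) 1).eq_empty_or_nonempty with he | hne'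
    · exact ⟨1, one_pos, by simp [he]⟩
    · obtain ⟨w₀, hw₀, hmin⟩ := hS.exists_isMinOn hne'
        (f := fun w => m p w + K * l p w) (by fun_prop)
      refine ⟨(m p w₀ + K * l p w₀) / 2, half_pos (hK w₀ hw₀), fun w hw => ?_⟩
      have h1 : m p w₀ + K * l p w₀ ≤ m p w + K * l p w := hmin hw
      linarith [hK w₀ hw₀]
  refine ⟨K, K.cast_nonneg, ε, hε, ?_⟩
  -- Compactness of the sphere makes the neighbourhood of `p` uniform in the unit vector;
  -- homogeneity then gives the estimate for all vectors.
  have := hS.eventually_forall_of_forall_eventually (x₀ := p)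
    (P := fun q w => ε < m q w + K * l q w) (fun w hw => by
      have h1 : ContinuousAt (fun z : X × E => m z.1 z.2 + K * l z.1 z.2) (p, w) :=
        (hm w).add ((hl w).const_mul _)
      exact h1.eventually (lt_mem_nhds (hε' w hw)))
  filter_upwards [this] with q hq w
  rcases eq_or_ne w 0 with rfl | hw
  · have h1 : m q 0 = 0 := by simpa using hm2 q 0 0
    have h2 : l q 0 = 0 := by simpa using hl2 q 0 0
    rw [h1, h2]
    simp
  · have hn : 0 < ‖w‖ := norm_pos_iff.2 hw
    have h1 := (hq (‖w‖⁻¹ • w) (mem_sphere_zero_iff_norm.2 (by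
      rw [norm_smul, norm_inv, norm_norm, inv_mul_cancel₀ hn.ne']))).le
    rw [hm2, hl2] at h1
    have h2 := mul_le_mul_of_nonneg_left h1 (sq_nonneg ‖w‖)
    have h3 : ‖w‖ ^ 2 * (‖w‖⁻¹ ^ 2 * m q w + K * (‖w‖⁻¹ ^ 2 * l q w)) = m q w + K * l q w := by
      field_simp
    linarith

omit [FiniteDimensional ℝ E] in
theorem continuousAt_form (hG : ContinuousAt G p) {u v : X × E → E} {w : E}
    (hu : ContinuousAt u (p, w)) (hv : ContinuousAt v (p, w)) :
    ContinuousAt (fun z : X × E => G z.1 (u z) (v z)) (p, w) := by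
  have h1 : ContinuousAt (fun z : X × E => G z.1) (p, w) :=
    hG.comp (f := Prod.fst) continuousAt_fst
  exact (h1.clm_apply hu).clm_apply hv

/-- The arithmetic for a vector `s a + t b + w` with `W = |w|` and `Q = -G(w, w)`. As `K f ≤ 1/2`,
half of `(s² + t²) f` absorbs the penalty. The other half controls the components along the plane,
whence `6 A² δ ≤ 1`, and `ε W²` controls the transversal part, whence `3 δ ≤ ε`; the threes come
from the square of a sum of three terms. -/
theorem le_of_decomposition {s t A N W ε f K Q : ℝ} (hε : 0 < ε) (hA : 0 < A) (hf : 0 ≤ f)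
    (hf1 : f ≤ 1) (hK : K * f ≤ 1 / 2) (hN : 0 ≤ N) (hNW : N ≤ |s| * A + |t| * A + W)
    (hQ : ε * W ^ 2 ≤ Q + K * (s ^ 2 + t ^ 2) * f ^ 2) :
    min (ε / 3) (1 / (6 * A ^ 2)) * f * N ^ 2 ≤ Q + (s ^ 2 + t ^ 2) * f := by
  set δ := min (ε / 3) (1 / (6 * A ^ 2)) with hδ
  have hδ0 : 0 < δ := by positivity
  have hδ1 : 3 * δ ≤ ε := by linarith [min_le_left (ε / 3) (1 / (6 * A ^ 2))]
  have hδ2 : 6 * A ^ 2 * δ ≤ 1 := by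
    have := min_le_right (ε / 3) (1 / (6 * A ^ 2))
    rw [← hδ, le_div_iff₀ (by positivity)] at this
    linarith
  have h3 (x y z : ℝ) : (x + y + z) ^ 2 ≤ 3 * (x ^ 2 + y ^ 2 + z ^ 2) := by
    linarith [sq_nonneg (x - y), sq_nonneg (x - z), sq_nonneg (y - z)]
  have h6 : N ^ 2 ≤ 3 * ((s ^ 2 + t ^ 2) * A ^ 2 + W ^ 2) := by
    refine (pow_le_pow_left₀ hN hNW 2).trans ((h3 _ _ _).trans_eq ?_)
    rw [mul_pow, mul_pow, sq_abs, sq_abs]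
    ring
  have h7 : δ * f * N ^ 2 ≤ δ * f * (3 * ((s ^ 2 + t ^ 2) * A ^ 2 + W ^ 2)) := by gcongr
  have h8 : (s ^ 2 + t ^ 2) * f * (6 * A ^ 2 * δ) ≤ (s ^ 2 + t ^ 2) * f * 1 := by gcongr
  have h9 : 3 * δ * f * W ^ 2 ≤ ε * 1 * W ^ 2 := by gcongr
  have h10 : (s ^ 2 + t ^ 2) * f * (K * f) ≤ (s ^ 2 + t ^ 2) * f * (1 / 2) := by gcongr
  linarith

/-- A symmetric form `G` for which the plane `span {a, b}` is conformally Euclidean with factor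
`G a a ≥ 0` and which is negative transversally to it is bounded above by `- ε (G a a) |v| ^ 2` on the
orthogonal complement of the plane. -/
theorem exists_lower_bound (hG : ContinuousAt G p) (ha : ContinuousAt a p) (hb : ContinuousAt b p)
    (hsymm : ∀ᶠ q in 𝓝 p, ∀ v w, G q v w = G q w v)
    (hbb : ∀ᶠ q in 𝓝 p, G q (b q) (b q) = G q (a q) (a q))
    (hab : ∀ᶠ q in 𝓝 p, G q (a q) (b q) = 0)
    (hker : ∀ w, 0 ≤ G p w w → G p (a p) w = 0 → G p (b p) w = 0 →
      w ∈ Submodule.span ℝ {a p, b p}) :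
    ∃ ε > 0, ∀ᶠ q in 𝓝 p, 0 ≤ G q (a q) (a q) → ∀ v, G q (a q) v = 0 → G q (b q) v = 0 →
      ε * G q (a q) (a q) * ‖v‖ ^ 2 ≤ -G q v v := by
  have hf : ContinuousAt (fun q => G q (a q) (a q)) p := (hG.clm_apply ha).clm_apply ha
  have ha' (w : E) : ContinuousAt (fun z : X × E => a z.1) (p, w) :=
    ha.comp (f := Prod.fst) continuousAt_fst
  have hb' (w : E) : ContinuousAt (fun z : X × E => b z.1) (p, w) :=
    hb.comp (f := Prod.fst) continuousAt_fst
  -- Where the plane is null, the conditions `G(a, ·) = G(b, ·) = 0` hold on the plane itself, so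
  -- inner products with `a` and `b` are added to the penalty to exclude it. Otherwise the
  -- complement is transversal to the plane and no such term is wanted.
  set κ : ℝ := if G p (a p) (a p) = 0 then 1 else 0 with hκ
  have hκ0 : 0 ≤ κ := by rw [hκ]; split_ifs <;> norm_num
  have hlc (w : E) : ContinuousAt (Function.uncurry fun q w => G q (a q) w ^ 2 + G q (b q) w ^ 2
      + κ * (inner ℝ (a q) w ^ 2 + inner ℝ (b q) w ^ 2)) (p, w) := by
    have h1 := continuousAt_form hG (ha' w) continuousAt_snd
    have h2 := continuousAt_form hG (hb' w) continuousAt_snd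
    have h3 : ContinuousAt (fun z : X × E => inner ℝ (a z.1) z.2) (p, w) :=
      (ha' w).inner continuousAt_snd
    have h4 : ContinuousAt (fun z : X × E => inner ℝ (b z.1) z.2) (p, w) :=
      (hb' w).inner continuousAt_snd
    change ContinuousAt (fun z : X × E => G z.1 (a z.1) z.2 ^ 2 + G z.1 (b z.1) z.2 ^ 2
      + κ * (inner ℝ (a z.1) z.2 ^ 2 + inner ℝ (b z.1) z.2 ^ 2)) (p, w)
    fun_prop
  obtain ⟨K, hK0, ε, hε, hK⟩ := exists_penalty (p := p) (m := fun q w => -G q w w)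
    (l := fun q w => G q (a q) w ^ 2 + G q (b q) w ^ 2
      + κ * (inner ℝ (a q) w ^ 2 + inner ℝ (b q) w ^ 2))
    (fun w => (continuousAt_form hG continuousAt_snd continuousAt_snd).neg)
    hlc
    (fun q w => by positivity)
    (fun q k w => by simp only [map_smul, smul_apply, smul_eq_mul]; ring)
    (fun q k w => by simp only [map_smul, smul_eq_mul, inner_smul_right]; ring) (by
      intro w hw hl
      by_contra! hm
      have h1 : G p (a p) w ^ 2 = 0 := by
        nlinarith [sq_nonneg (G p (a p) w),
        sq_nonneg (G p (b p) w),
        mul_nonneg hκ0 (add_nonneg (sq_nonneg (inner ℝ (a p) w)) (sq_nonneg (inner ℝ (b p) w)))]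
      have h2 : G p (b p) w ^ 2 = 0 := by
        nlinarith [sq_nonneg (G p (a p) w),
        sq_nonneg (G p (b p) w),
        mul_nonneg hκ0 (add_nonneg (sq_nonneg (inner ℝ (a p) w)) (sq_nonneg (inner ℝ (b p) w)))]
      rw [h1, h2] at hl
      rw [sq_eq_zero_iff] at h1 h2
      obtain ⟨s, t, hst⟩ := Submodule.mem_span_pair.1 (hker w (by linarith) h1 h2)
      by_cases hf0 : G p (a p) (a p) = 0
      · rw [hκ, if_pos hf0] at hl
        have h3 : inner ℝ (a p) w = 0 := by
          nlinarith [sq_nonneg (inner ℝ (a p) w), sq_nonneg (inner ℝ (b p) w)]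
        have h4 : inner ℝ (b p) w = 0 := by
          nlinarith [sq_nonneg (inner ℝ (a p) w), sq_nonneg (inner ℝ (b p) w)]
        refine hw ((inner_self_eq_zero (𝕜 := ℝ)).1 ?_)
        nth_rw 1 [← hst]
        rw [inner_add_left, inner_smul_left, inner_smul_left, h3, h4]
        simp
      · have h3 := hab.self_of_nhds
        have h4 := hbb.self_of_nhds
        have h5 := hsymm.self_of_nhds (b p) (a p)
        rw [← hst] at h1 h2
        simp only [map_add, map_smul, smul_eq_mul, h3, h4, h5, mul_zero, zero_add, add_zero,
          mul_eq_zero, hf0, or_false] at h1 h2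
        exact hw (by rw [← hst, h1, h2]; simp))
  by_cases hf0 : G p (a p) (a p) = 0
  · rw [hκ, if_pos hf0] at hK
    set A := ‖a p‖ + ‖b p‖ + 1 with hA
    have hA0 : 0 < A := by positivity
    have e1 : ∀ᶠ q in 𝓝 p, ‖a q‖ < A := ha.norm.eventually (gt_mem_nhds (by
      rw [hA]; linarith [norm_nonneg (b p)]))
    have e2 : ∀ᶠ q in 𝓝 p, ‖b q‖ < A := hb.norm.eventually (gt_mem_nhds (by
      rw [hA]; linarith [norm_nonneg (a p)]))
    have e3 : ∀ᶠ q in 𝓝 p, G q (a q) (a q) < 1 := hf.eventually (gt_mem_nhds (by simp [hf0]))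
    have e4 : ∀ᶠ q in 𝓝 p, K * G q (a q) (a q) < 1 / 2 :=
      (hf.const_mul K).eventually (gt_mem_nhds (by simp [hf0]))
    refine ⟨min (ε / 3) (1 / (6 * A ^ 2)), by positivity, ?_⟩
    filter_upwards [hK, hsymm, hbb, hab, e1, e2, e3, e4] with q hK hs hbb hab e1 e2 e3 e4 hq v hav hbv
    -- In the null case `v` is decomposed orthogonally for the Euclidean structure, which removes
    -- the inner product terms of the penalty on `w`. Orthogonality of `v` for `G` shows that `G(a,
    -- w)` and `G(b, w)` are of order `f`, so the remaining penalty is of order `f²`.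
    obtain ⟨y, hy, w, hw, rfl⟩ :=
      (Submodule.span ℝ {a q, b q}).exists_add_mem_mem_orthogonal v
    obtain ⟨s, t, rfl⟩ := Submodule.mem_span_pair.1 hy
    have ha0 : inner ℝ (a q) w = 0 := hw _ (Submodule.subset_span (by simp))
    have hb0 : inner ℝ (b q) w = 0 := hw _ (Submodule.subset_span (by simp))
    have h1 := hK w
    rw [ha0, hb0] at h1
    have hba : G q (b q) (a q) = 0 := by rw [hs, hab]
    simp only [map_add, map_smul, smul_eq_mul, hab, hbb, hba] at hav hbv
    set f := G q (a q) (a q) with hf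
    have h2 : G q (a q) w = -(s * f) := by linarith
    have h3 : G q (b q) w = -(t * f) := by linarith
    have h4 : G q (s • a q + t • b q + w) (s • a q + t • b q + w)
        = G q w w - (s ^ 2 + t ^ 2) * f := by
      simp only [map_add, map_smul, add_apply, smul_apply, smul_eq_mul, hab, hbb, hba, hs w (a q),
        hs w (b q), h2, h3]
      ring
    rw [h2, h3] at h1
    have h5 : ‖s • a q + t • b q + w‖ ≤ |s| * A + |t| * A + ‖w‖ := by
      refine (norm_add_le _ _).trans (add_le_add ((norm_add_le _ _).trans ?_) le_rfl)
      rw [norm_smul, norm_smul, Real.norm_eq_abs, Real.norm_eq_abs]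
      gcongr
    rw [h4]
    have := le_of_decomposition hε hA0 hq e3.le e4.le (norm_nonneg _) h5
      (Q := -G q w w) (by linarith)
    linarith
  · rw [hκ, if_neg hf0] at hK
    have e1 : ∀ᶠ q in 𝓝 p, G q (a q) (a q) < |G p (a p) (a p)| + 1 :=
      hf.eventually (gt_mem_nhds (by linarith [le_abs_self (G p (a p) (a p))]))
    have hpos : 0 < |G p (a p) (a p)| + 1 := by positivity
    refine ⟨ε / (|G p (a p) (a p)| + 1), by positivity, ?_⟩
    filter_upwards [hK, e1] with q hK e1 hq v hav hbv
    have h1 := hK v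
    rw [hav, hbv] at h1
    have h2 : ε / (|G p (a p) (a p)| + 1) * G q (a q) (a q)
        ≤ ε / (|G p (a p) (a p)| + 1) * (|G p (a p) (a p)| + 1) := by gcongr
    rw [div_mul_cancel₀ _ hpos.ne'] at h2
    have h3 := mul_le_mul_of_nonneg_right h2 (sq_nonneg ‖v‖)
    linarith

end LowerBound

/-! ### Tensor fields on manifolds with boundary -/

section Boundary

variable {E : Type*} [NormedAddCommGroup E] [NormedSpace ℝ E]
  {H : Type*} [TopologicalSpace H] {I : ModelWithCorners ℝ E H}
  {B : Type*} [TopologicalSpace B] [ChartedSpace H B] [IsManifold I ∞ B]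

variable (I B) in
-- In a chart every point of the target is a limit of interior points of the target. Density carries
-- the identities of `J`, `g` and `ξ` from `M` to the boundary.
theorem dense_interior : Dense (I.interior B) := by
  have : IsManifold I 1 B := IsManifold.of_le (n := ∞) (by simp)
  intro p
  rw [mem_closure_iff_nhds]
  intro V hV
  have h1 : (extChartAt I p).symm ⁻¹' V ∈ 𝓝[(extChartAt I p).target] (extChartAt I p p) :=
    (continuousOn_extChartAt_symm p _ (mem_extChartAt_target p)).preimage_mem_nhdsWithin (by simpa)
  obtain ⟨W, hW, hWV⟩ := mem_nhdsWithin_iff_exists_mem_nhds_inter.1 h1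
  obtain ⟨z, hzW, hz⟩ := mem_closure_iff_nhds.1
    (extChartAt_target_subset_closure_interior (mem_extChartAt_target (I := I) p)) W hW
  have hzt : z ∈ (extChartAt I p).target := interior_subset hz
  refine ⟨(extChartAt I p).symm z, hWV ⟨hzW, hzt⟩, ?_⟩
  have h2 : (extChartAt I p).symm z ∈ (chartAt H p).source := by
    simpa using (extChartAt I p).map_target hzt
  refine (I.isInteriorPoint_iff_of_mem_atlas (n := 1) one_ne_zero (chart_mem_atlas H p) h2).2 ?_
  change extChartAt I p ((extChartAt I p).symm z) ∈ interior (extChartAt I p).target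
  rwa [(extChartAt I p).right_inv hzt]

theorem SmoothField.continuousAt {X : ∀ q : B, TangentSpace I q} (hX : SmoothField X) (p : B) :
    ContinuousAt (fun q => (trivializationAt E (TangentSpace I : B → Type _) p
      (⟨q, X q⟩ : TangentBundle I B)).2) p :=
  ((Bundle.contMDiffAt_section p).1 (hX p)).continuousAt

/-- In a trivialization at `p` the field is a continuous vector valued function vanishing on a dense
set. -/
theorem SmoothField.eq_zero_of_dense {X : ∀ q : B, TangentSpace I q} (hX : SmoothField X)
    {D : Set B} (hD : Dense D) (h : ∀ q ∈ D, X q = 0) (p : B) : X p = 0 := by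
  set e := trivializationAt E (TangentSpace I : B → Type _) p with he
  have h1 := hX.continuousAt p
  rw [← he] at h1
  have h2 : ∃ᶠ q in 𝓝 p, (e (⟨q, X q⟩ : TangentBundle I B)).2 = 0 := by
    have h3 : ∀ᶠ q in 𝓝 p, q ∈ e.baseSet :=
      e.open_baseSet.mem_nhds (FiberBundle.mem_baseSet_trivializationAt' p)
    refine ((mem_closure_iff_frequently.1 (hD p)).and_eventually h3).mono ?_
    rintro q ⟨hq, hqe⟩
    have h4 := e.coe_linearMapAt_of_mem (R := ℝ) hqe
    rw [h q hq, ← congrFun h4 0, map_zero]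
  have h5 : (e (⟨p, X p⟩ : TangentBundle I B)).2 = 0 := by
    by_contra hne
    exact h2 ((h1.eventually (isOpen_ne.mem_nhds hne)))
  have hp : p ∈ e.baseSet := FiberBundle.mem_baseSet_trivializationAt' p
  have h6 := congrFun (e.coe_linearMapAt_of_mem (R := ℝ) hp) (X p)
  have h7 := e.symmₗ_linearMapAt (R := ℝ) hp (X p)
  rw [h6, h5, map_zero] at h7
  exact h7.symm

namespace TensorTriple

variable (T : TensorTriple I B)

theorem smoothField_J {X : ∀ q : B, TangentSpace I q} (hX : SmoothField X) :
    SmoothField (fun q => T.J q (X q)) := ContMDiff.clm_bundle_apply T.smooth_J hX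

theorem contMDiff_g {X Y : ∀ q : B, TangentSpace I q} (hX : SmoothField X) (hY : SmoothField Y) :
    ContMDiff I 𝓘(ℝ, ℝ) ∞ (fun q => T.g q (X q) (Y q)) := by
  have h := ContMDiff.clm_bundle_apply₂ (F₃ := ℝ) (E₃ := fun _ : B => ℝ) T.smooth_g hX hY
  intro p
  exact ((Bundle.contMDiffAt_section p).1 (h p))

theorem contMDiff_f : ContMDiff I 𝓘(ℝ, ℝ) ∞ T.f := T.contMDiff_g T.smooth_xi T.smooth_xi

end TensorTriple

end Boundary

/-! ### Identities extended from the interior to the boundary -/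

section Regular

variable {n : ℕ} {M : Type*} [TopologicalSpace M]
  [ChartedSpace (EuclideanSpace ℝ (Fin (2 * n + 2))) M] [IsManifold (𝓡 (2 * n + 2)) ∞ M]
  {C : ConicalSpecialKaehler n M}

namespace ConicalSpecialKaehler

theorem J_skew (C : ConicalSpecialKaehler n M) (p : M) (v w : TangentSpace (𝓡 (2 * n + 2)) p) :
    C.g p (C.J p v) w = -C.g p v (C.J p w) := by
  have h1 := C.hermitian p v (C.J p w)
  rw [C.J_sq, map_neg] at h1
  linarith

/-- The metric is parallel and `Dξ = Id`, so differentiating `g(ξ, ξ)` yields twice `g(ξ, ·)`. -/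
theorem mvfderiv_f (C : ConicalSpecialKaehler n M) [T2Space M] (p : M)
    (v : TangentSpace (𝓡 (2 * n + 2)) p) :
    mvfderiv (𝓡 (2 * n + 2)) C.f p v = 2 * C.g p (C.xi p) v := by
  obtain ⟨X, hX, rfl⟩ := exists_smoothField p v
  have h := C.D_metric X C.xi C.xi hX C.smooth_xi C.smooth_xi p
  rw [C.D_xi] at h
  refine h.trans ?_
  change C.g p (X p) (C.xi p) + C.g p (C.xi p) (X p) = _
  rw [C.symm_g p (X p)]
  ring

end ConicalSpecialKaehler

variable {B : Type*} [TopologicalSpace B]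
  [ChartedSpace (EuclideanHalfSpace (2 * n + 2)) B] [IsManifold (𝓡∂ (2 * n + 2)) ∞ B]
  {T : TensorTriple (𝓡∂ (2 * n + 2)) B} {i : M → B}

namespace RegularBoundary

variable (hT : RegularBoundary C T i)
include hT

theorem dense_range : Dense (Set.range i) := by
  rw [hT.range_eq]
  exact dense_interior _ _

theorem contMDiff : ContMDiff (𝓡 (2 * n + 2)) (𝓡∂ (2 * n + 2)) ∞ i := hT.embedding.contMDiff

/-- The differential preserves the nondegenerate form `g`, hence is injective, and the dimensions
agree. -/
theorem surjective_mfderiv (x : M) :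
    Function.Surjective (mfderiv (𝓡 (2 * n + 2)) (𝓡∂ (2 * n + 2)) i x) := by
  let L : EuclideanSpace ℝ (Fin (2 * n + 2)) →ₗ[ℝ] EuclideanSpace ℝ (Fin (2 * n + 2)) :=
    (mfderiv (𝓡 (2 * n + 2)) (𝓡∂ (2 * n + 2)) i x).toLinearMap
  have hL : Function.Injective L := by
    rw [← LinearMap.ker_eq_bot, LinearMap.ker_eq_bot']
    intro v hv
    refine C.nondegenerate x v fun w => ?_
    have h1 := hT.extends_g x v w
    have hv' : mfderiv (𝓡 (2 * n + 2)) (𝓡∂ (2 * n + 2)) i x v = 0 := hv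
    rw [hv', map_zero] at h1
    exact h1.symm
  exact LinearMap.surjective_of_injective (K := ℝ)
    (V := EuclideanSpace ℝ (Fin (2 * n + 2))) hL

theorem f_comp (x : M) : T.f (i x) = C.f x := by
  rw [TensorTriple.f, hT.extends_xi, hT.extends_g]
  rfl

theorem mvfderiv_comp {F : Type*} [NormedAddCommGroup F] [NormedSpace ℝ F] {h : B → F} {x : M}
    (hh : MDifferentiableAt (𝓡∂ (2 * n + 2)) 𝓘(ℝ, F) h (i x))
    (v : TangentSpace (𝓡 (2 * n + 2)) x) : mvfderiv (𝓡 (2 * n + 2)) (fun y => h (i y)) x v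
      = mvfderiv (𝓡∂ (2 * n + 2)) h (i x) (mfderiv (𝓡 (2 * n + 2)) (𝓡∂ (2 * n + 2)) i x v) :=
  mfderiv_comp_apply x hh ((hT.contMDiff x).mdifferentiableAt (by simp)) v

theorem J_sq [T2Space B] (p : B) (v : TangentSpace (𝓡∂ (2 * n + 2)) p) : T.J p (T.J p v) = -v := by
  obtain ⟨X, hX, rfl⟩ := exists_smoothField p v
  have h : SmoothField (fun q => T.J q (T.J q (X q)) + X q) :=
    ContMDiff.add_section (T.smoothField_J (T.smoothField_J hX)) hX
  refine eq_neg_of_add_eq_zero_left (h.eq_zero_of_dense hT.dense_range ?_ p)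
  rintro _ ⟨x, rfl⟩
  obtain ⟨v, hv⟩ := hT.surjective_mfderiv x (X (i x))
  rw [← hv, hT.extends_J, hT.extends_J, C.J_sq, map_neg, neg_add_cancel]

theorem J_skew [T2Space B] (p : B) (v w : TangentSpace (𝓡∂ (2 * n + 2)) p) :
    T.g p (T.J p v) w = -T.g p v (T.J p w) := by
  obtain ⟨X, hX, rfl⟩ := exists_smoothField p v
  obtain ⟨Y, hY, rfl⟩ := exists_smoothField p w
  have h1 := (T.contMDiff_g (T.smoothField_J hX) hY).continuous
  have h2 := (T.contMDiff_g hX (T.smoothField_J hY)).continuous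
  refine congrFun (h1.ext_on hT.dense_range h2.neg ?_) p
  rintro _ ⟨x, rfl⟩
  obtain ⟨v, hv⟩ := hT.surjective_mfderiv x (X (i x))
  obtain ⟨w, hw⟩ := hT.surjective_mfderiv x (Y (i x))
  change T.g (i x) (T.J (i x) (X (i x))) (Y (i x)) = -T.g (i x) (X (i x)) (T.J (i x) (Y (i x)))
  rw [← hv, ← hw, hT.extends_J, hT.extends_J, hT.extends_g, hT.extends_g, C.J_skew]

/-- The identity of the interior persists by continuity. At boundary points it describes the vectors
orthogonal to `ξ` as the kernel of `df`. -/
theorem mvfderiv_f [T2Space M] [T2Space B] (p : B) (v : TangentSpace (𝓡∂ (2 * n + 2)) p) :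
    mvfderiv (𝓡∂ (2 * n + 2)) T.f p v = 2 * T.g p (T.xi p) v := by
  obtain ⟨X, hX, rfl⟩ := exists_smoothField p v
  have h1 : Continuous fun q => mvfderiv (𝓡∂ (2 * n + 2)) T.f q (X q) :=
    continuous_iff_continuousAt.2 fun q =>
      (contMDiffAt_mvfderiv isOpen_univ T.contMDiff_f.contMDiffOn hX (Set.mem_univ q)).continuousAt
  have h2 := (T.contMDiff_g T.smooth_xi hX).continuous
  refine congrFun (h1.ext_on hT.dense_range (h2.const_mul 2) ?_) p
  rintro _ ⟨x, rfl⟩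
  obtain ⟨v, hv⟩ := hT.surjective_mfderiv x (X (i x))
  simp only [← hv]
  rw [hT.extends_xi, hT.extends_g, ← hT.mvfderiv_comp
    (T.contMDiff_f.contMDiffAt.mdifferentiableAt (by simp)), ← C.mvfderiv_f]
  congr 2
  funext y
  exact hT.f_comp y

theorem g_J_xi [T2Space B] (p : B) : T.g p (T.J p (T.xi p)) (T.J p (T.xi p)) = T.f p := by
  rw [hT.J_skew, hT.J_sq, map_neg, neg_neg]
  rfl

theorem g_xi_J_xi [T2Space B] (p : B) : T.g p (T.xi p) (T.J p (T.xi p)) = 0 := by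
  have h1 := hT.J_skew p (T.xi p) (T.xi p)
  rw [T.symm_g] at h1
  linarith

end RegularBoundary

end Regular

/-! ### The boundary behaviour of the metric -/

section Regular

variable {n : ℕ} {M : Type*} [TopologicalSpace M]
  [ChartedSpace (EuclideanSpace ℝ (Fin (2 * n + 2))) M] [IsManifold (𝓡 (2 * n + 2)) ∞ M]
  {C : ConicalSpecialKaehler n M} {B : Type*} [TopologicalSpace B]
  [ChartedSpace (EuclideanHalfSpace (2 * n + 2)) B] [IsManifold (𝓡∂ (2 * n + 2)) ∞ B]
  {T : TensorTriple (𝓡∂ (2 * n + 2)) B} {i : M → B}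

omit [IsManifold (𝓡∂ (2 * n + 2)) ∞ B] in
theorem extChartAt_zero_of_isBoundaryPoint {p : B}
    (hp : (𝓡∂ (2 * n + 2)).IsBoundaryPoint p) : extChartAt (𝓡∂ (2 * n + 2)) p p 0 = 0 := by
  rw [(𝓡∂ (2 * n + 2)).isBoundaryPoint_iff, frontier_range_modelWithCornersEuclideanHalfSpace] at hp
  exact hp.symm

theorem isBoundaryPoint_extChartAt_symm {p : B} {y : EuclideanSpace ℝ (Fin (2 * n + 2))}
    (hy : y ∈ (extChartAt (𝓡∂ (2 * n + 2)) p).target) (hy0 : y 0 = 0) :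
    (𝓡∂ (2 * n + 2)).IsBoundaryPoint ((extChartAt (𝓡∂ (2 * n + 2)) p).symm y) := by
  have : IsManifold (𝓡∂ (2 * n + 2)) 1 B := IsManifold.of_le (n := ∞) (by simp)
  rw [(𝓡∂ (2 * n + 2)).isBoundaryPoint_iff_not_isInteriorPoint,
    (𝓡∂ (2 * n + 2)).isInteriorPoint_iff_of_mem_atlas (n := 1) one_ne_zero
      (chart_mem_atlas (EuclideanHalfSpace (2 * n + 2)) p)
      (by simpa using (extChartAt (𝓡∂ (2 * n + 2)) p).map_target hy)]
  intro h
  have h1 : extChartAt (𝓡∂ (2 * n + 2)) p ((extChartAt (𝓡∂ (2 * n + 2)) p).symm y)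
      ∈ interior (extChartAt (𝓡∂ (2 * n + 2)) p).target := h
  rw [(extChartAt (𝓡∂ (2 * n + 2)) p).right_inv hy] at h1
  have h2 := interior_mono (extChartAt_target_subset_range p) h1
  rw [interior_range_modelWithCornersEuclideanHalfSpace] at h2
  have h3 : (0 : ℝ) < y 0 := h2
  linarith

omit [IsManifold (𝓡∂ (2 * n + 2)) ∞ B] in
theorem mem_boundaryTangent_iff {p : B} {v : TangentSpace (𝓡∂ (2 * n + 2)) p} :
    v ∈ boundaryTangent p ↔ (show EuclideanSpace ℝ (Fin (2 * n + 2)) from v) 0 = 0 := by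
  have h1 : HasMFDerivAt (𝓡∂ (2 * n + 2)) 𝓘(ℝ, ℝ) (fun q : B =>
      (extChartAt (𝓡∂ (2 * n + 2)) p q : EuclideanSpace ℝ (Fin (2 * n + 2))) 0) p
      (EuclideanSpace.proj (0 : Fin (2 * n + 2)) : EuclideanSpace ℝ (Fin (2 * n + 2)) →L[ℝ] ℝ) := by
    have hc : Continuous fun y : EuclideanSpace ℝ (Fin (2 * n + 2)) => y 0 := by fun_prop
    refine ⟨hc.continuousAt.comp (continuousAt_extChartAt p), ?_⟩
    refine (EuclideanSpace.proj (0 : Fin (2 * n + 2)) :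
      EuclideanSpace ℝ (Fin (2 * n + 2)) →L[ℝ] ℝ).hasFDerivAt.hasFDerivWithinAt.congr_of_eventuallyEq
      ?_ ?_
    · filter_upwards [extChartAt_target_mem_nhdsWithin p] with y hy
      change (extChartAt (𝓡∂ (2 * n + 2)) p ((extChartAt (𝓡∂ (2 * n + 2)) p).symm y)) 0 = y 0
      rw [(extChartAt (𝓡∂ (2 * n + 2)) p).right_inv hy]
    · change (extChartAt (𝓡∂ (2 * n + 2)) p ((extChartAt (𝓡∂ (2 * n + 2)) p).symm
        (extChartAt (𝓡∂ (2 * n + 2)) p p))) 0 = (extChartAt (𝓡∂ (2 * n + 2)) p p) 0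
      rw [extChartAt_to_inv p]
  change mfderiv (𝓡∂ (2 * n + 2)) 𝓘(ℝ, ℝ) _ p v = 0 ↔ _
  rw [h1.mfderiv]
  rfl

namespace RegularBoundary

variable (hT : RegularBoundary C T i)
include hT

/-- The tangent spaces of the boundary are the kernels of `df`. -/
theorem mem_boundaryTangent_of_mvfderiv_eq_zero {p : B}
    (hp : (𝓡∂ (2 * n + 2)).IsBoundaryPoint p) {v : TangentSpace (𝓡∂ (2 * n + 2)) p}
    (hv : mvfderiv (𝓡∂ (2 * n + 2)) T.f p v = 0) : v ∈ boundaryTangent p := by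
  have hd : MDifferentiableAt (𝓡∂ (2 * n + 2)) 𝓘(ℝ, ℝ) T.f p :=
    (T.contMDiff_f p).mdifferentiableAt (by simp)
  let L : EuclideanSpace ℝ (Fin (2 * n + 2)) →L[ℝ] ℝ := mfderiv (𝓡∂ (2 * n + 2)) 𝓘(ℝ, ℝ) T.f p
  have hL : HasFDerivWithinAt (fun y => T.f ((extChartAt (𝓡∂ (2 * n + 2)) p).symm y)) L
      (Set.range (𝓡∂ (2 * n + 2))) (extChartAt (𝓡∂ (2 * n + 2)) p p) := hd.hasMFDerivAt.2
  have hp0 := extChartAt_zero_of_isBoundaryPoint hp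
  -- Straight lines of the chart tangent to the boundary remain in the boundary, where `f` vanishes.
  -- So `df` is a multiple of the zeroth coordinate, and the multiple is not zero.
  have hker : ∀ u : EuclideanSpace ℝ (Fin (2 * n + 2)), u 0 = 0 → L u = 0 := by
    intro u hu
    have hline : HasDerivAt (fun t : ℝ => extChartAt (𝓡∂ (2 * n + 2)) p p + t • u) u 0 := by
      simpa using ((hasDerivAt_id (0 : ℝ)).smul_const u).const_add
        (extChartAt (𝓡∂ (2 * n + 2)) p p)
    have hline0 : ∀ t : ℝ, (extChartAt (𝓡∂ (2 * n + 2)) p p + t • u) 0 = 0 := by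
      intro t
      rw [PiLp.add_apply, PiLp.smul_apply, hp0, hu, smul_zero, add_zero]
    have hmem : ∀ t : ℝ, extChartAt (𝓡∂ (2 * n + 2)) p p + t • u
        ∈ Set.range (𝓡∂ (2 * n + 2)) := by
      intro t
      rw [range_modelWithCornersEuclideanHalfSpace]
      exact (hline0 t).ge
    have h1 : HasDerivAt (fun t : ℝ => T.f ((extChartAt (𝓡∂ (2 * n + 2)) p).symm
        (extChartAt (𝓡∂ (2 * n + 2)) p p + t • u))) (L u) 0 := by
      have h0 : extChartAt (𝓡∂ (2 * n + 2)) p p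
        = extChartAt (𝓡∂ (2 * n + 2)) p p + (0 : ℝ) • u := by simp
      rw [h0] at hL
      have := hL.comp_hasDerivWithinAt (0 : ℝ) hline.hasDerivWithinAt
        (s := Set.univ) (fun t _ => hmem t)
      exact hasDerivWithinAt_univ.1 this
    have h2 : (fun t : ℝ => T.f ((extChartAt (𝓡∂ (2 * n + 2)) p).symm
        (extChartAt (𝓡∂ (2 * n + 2)) p p + t • u))) =ᶠ[𝓝 0] fun _ => 0 := by
      have h3 : Filter.Tendsto (fun t : ℝ => extChartAt (𝓡∂ (2 * n + 2)) p p + t • u) (𝓝 0)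
          (𝓝[Set.range (𝓡∂ (2 * n + 2))] (extChartAt (𝓡∂ (2 * n + 2)) p p)) := by
        refine tendsto_nhdsWithin_iff.2 ⟨?_, Filter.Eventually.of_forall hmem⟩
        simpa using hline.continuousAt.tendsto
      filter_upwards [h3.eventually (extChartAt_target_mem_nhdsWithin p)] with t ht
      exact hT.f_eq_zero _ (isBoundaryPoint_extChartAt_symm ht (hline0 t))
    exact h1.unique ((hasDerivAt_const (0 : ℝ) (0 : ℝ)).congr_of_eventuallyEq h2)
  have hLe : ∀ u : EuclideanSpace ℝ (Fin (2 * n + 2)),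
      L u = u 0 * L (EuclideanSpace.single 0 1) := by
    intro u
    have h1 := hker (u - u 0 • EuclideanSpace.single 0 1) (by simp)
    rw [map_sub, map_smul, smul_eq_mul] at h1
    linarith
  rw [mem_boundaryTangent_iff]
  by_contra hne
  refine hT.df_ne_zero p hp (ContinuousLinearMap.ext fun u => ?_)
  have h2 := (hLe v).symm.trans hv
  have h3 : L (EuclideanSpace.single 0 1) = 0 := (mul_eq_zero.1 h2).resolve_left hne
  have h4 := hLe u
  rw [h3, mul_zero] at h4
  exact h4

/-- The metric is negative transversally to `span {ξ, Jξ}`. -/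
theorem mem_dist [T2Space M] [T2Space B] (p : B) {w : TangentSpace (𝓡∂ (2 * n + 2)) p}
    (h0 : 0 ≤ T.g p w w) (h1 : T.g p (T.xi p) w = 0) (h2 : T.g p (T.J p (T.xi p)) w = 0) :
    w ∈ T.dist p := by
  rcases (𝓡∂ (2 * n + 2)).isInteriorPoint_or_isBoundaryPoint p with hp | hp
  · have hp' : p ∈ Set.range i := by rwa [hT.range_eq]
    obtain ⟨x, rfl⟩ := hp'
    obtain ⟨v, rfl⟩ := hT.surjective_mfderiv x w
    rw [hT.extends_xi] at h1 h2
    rw [hT.extends_g] at h0 h1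
    rw [hT.extends_J, hT.extends_g] at h2
    have hv : v = 0 := by
      by_contra hv
      refine (C.neg x v (fun u hu => ?_) hv).not_ge h0
      obtain ⟨s, t, rfl⟩ := Submodule.mem_span_pair.1 hu
      rw [C.symm_g, map_add, map_smul, map_smul, add_apply, smul_apply, smul_apply, h1, h2]
      simp
    rw [hv, map_zero]
    exact Submodule.zero_mem _
  -- At a boundary point orthogonality to `ξ` means `df = 0`, that is, tangency to the boundary.
  -- Orthogonality to `Jξ` says the same of `J w`, so `w` lies in `H_p`.
  · have hmem : ∀ u : TangentSpace (𝓡∂ (2 * n + 2)) p, T.g p (T.xi p) u = 0 →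
        u ∈ boundaryTangent p := fun u hu =>
      hT.mem_boundaryTangent_of_mvfderiv_eq_zero hp (by rw [hT.mvfderiv_f, hu, mul_zero])
    have hw : w ∈ holTangent T p := by
      refine ⟨hmem w h1, -T.J p w, hmem _ ?_, ?_⟩
      · rw [map_neg, ← hT.J_skew, h2]
      · change T.J p (-T.J p w) = w
        rw [map_neg, hT.J_sq, neg_neg]
    refine (hT.kernel p hp w).1 ⟨hw, fun u hu => ?_⟩
    -- For a negative semi-definite form a null vector `w` is in the kernel: on `t w + u` the
    -- quadratic term in `t` is absent, so the linear one must vanish.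
    have h3 : ∀ t : ℝ, 2 * t * T.g p w u + T.g p u u ≤ 0 := by
      intro t
      have h4 := hT.semidefinite p hp (t • w + u)
        (Submodule.add_mem _ (Submodule.smul_mem _ t hw) hu)
      simp only [map_add, map_smul, add_apply, smul_apply, smul_eq_mul] at h4
      have h5 := hT.semidefinite p hp w hw
      rw [T.symm_g p u w, le_antisymm h5 h0] at h4
      linarith
    by_contra hne
    -- The value of `t` for which the left-hand side equals one.
    have h6 := h3 ((1 - T.g p u u) / (2 * T.g p w u))
    have h7 : 2 * ((1 - T.g p u u) / (2 * T.g p w u)) * T.g p w u = 1 - T.g p u u := by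
      field_simp
    linarith

theorem isMIntegralCurve_comp {X : ∀ x : M, TangentSpace (𝓡 (2 * n + 2)) x}
    {Y : ∀ q : B, TangentSpace (𝓡∂ (2 * n + 2)) q} {γ : ℝ → M}
    (h : ∀ x, Y (i x) = mfderiv (𝓡 (2 * n + 2)) (𝓡∂ (2 * n + 2)) i x (X x))
    (hγ : IsMIntegralCurve γ X) : IsMIntegralCurve (fun t => i (γ t)) Y := by
  intro t
  have h1 := (((hT.contMDiff (γ t)).mdifferentiableAt (by simp)).hasMFDerivAt).comp t (hγ t)
  refine h1.congr_mfderiv ?_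
  ext
  change mfderiv (𝓡 (2 * n + 2)) (𝓡∂ (2 * n + 2)) i (γ t) ((1 : ℝ) • X (γ t)) = (1 : ℝ) • Y (i (γ t))
  rw [one_smul, one_smul, h]

/-- The embedding is equivariant. -/
theorem equivariant [T2Space B] [MulAction ℂˣ M] [MulAction ℂˣ B]
    (hM : IsPrincipalAction C.toTensorTriple) (hB : IsPrincipalAction T) (a : ℂˣ) (x : M) :
    i (a • x) = a • i x := by
  have hint : ∀ y, (𝓡∂ (2 * n + 2)).IsInteriorPoint (i y) := fun y => by
    have : i y ∈ Set.range i := Set.mem_range_self y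
    rwa [hT.range_eq] at this
  have h0 : expUnit 0 = 1 := Units.ext (by simp [expUnit])
  have : IsManifold (𝓡∂ (2 * n + 2)) 1 B := IsManifold.of_le (n := ∞) (by simp)
  -- Both sides are integral curves of `ξ` with the same initial value, and the left one stays in
  -- the interior, where integral curves are unique. The circle action is treated with `Jξ`.
  have h1 : ∀ (t : ℝ) (y : M), i (expUnit t • y) = expUnit t • i y := by
    intro t y
    refine congrFun (isMIntegralCurve_eq_of_contMDiff (t₀ := 0) (fun t => hint _)
      (T.smooth_xi.of_le (by simp)) (hT.isMIntegralCurve_comp hT.extends_xi (hM.generator_xi y))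
      (hB.generator_xi (i y)) ?_) t
    simp [h0]
  have h2 : ∀ (t : ℝ) (y : M), i (expUnit (t * Complex.I) • y) = expUnit (t * Complex.I) • i y := by
    intro t y
    refine congrFun (isMIntegralCurve_eq_of_contMDiff (t₀ := 0) (fun t => hint _)
      ((T.smoothField_J T.smooth_xi).of_le (by simp))
      (hT.isMIntegralCurve_comp (fun x => by rw [hT.extends_xi, hT.extends_J])
        (hM.generator_J_xi y)) (hB.generator_J_xi (i y)) ?_) t
    simp [h0]
  have ha : a = expUnit (Complex.log a).re * expUnit ((Complex.log a).im * Complex.I) := by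
    refine Units.ext ?_
    change (a : ℂ) = Complex.exp _ * Complex.exp _
    rw [← Complex.exp_add, Complex.re_add_im, Complex.exp_log a.ne_zero]
  rw [ha, mul_smul, mul_smul, h1, h2]

end RegularBoundary

/-! ### The transversal estimate in charts of the manifold with boundary -/

theorem TensorTriple.exists_coordinates {E : Type*} [NormedAddCommGroup E] [NormedSpace ℝ E]
    {H : Type*} [TopologicalSpace H] {I : ModelWithCorners ℝ E H}
    {B : Type*} [TopologicalSpace B] [ChartedSpace H B] [IsManifold I ∞ B]
    (T : TensorTriple I B) (p : B) : ∃ G : B → E →L[ℝ] E →L[ℝ] ℝ, ContinuousAt G p ∧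
      ∀ q ∈ (chartAt H p).source, ∀ v w : TangentSpace I q,
        G q (mvfderiv I (extChartAt I p) q v) (mvfderiv I (extChartAt I p) q w) = T.g q v w := by
  refine ⟨_, ((Bundle.contMDiffAt_section p).1 (T.smooth_g p)).continuousAt, fun q hq v w => ?_⟩
  set e := trivializationAt E (TangentSpace I : B → Type _) p with he
  have hb : q ∈ e.baseSet := by simpa [he] using hq
  have h1 : ∀ v : TangentSpace I q, e.symm q (mvfderiv I (extChartAt I p) q v) = v := by
    intro v
    have h2 := congrArg (fun L : E →L[ℝ] E => L v)
      (TangentBundle.continuousLinearMapAt_trivializationAt (I := I) hq)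
    have h3 := e.symmL_continuousLinearMapAt (R := ℝ) hb v
    rw [e.symmL_apply hb] at h3
    exact (congrArg (e.symm q) h2.symm).trans h3
  refine (inCoordinates_apply_eq₂ (F₃ := ℝ) (E₃ := fun _ : B => ℝ) (ϕ := T.g q)
    (v := mvfderiv I (extChartAt I p) q v) (w := mvfderiv I (extChartAt I p) q w)
    hb hb (by simp)).trans ?_
  rw [← he, h1, h1]
  simp

theorem SmoothField.continuousAt_coordinates {E : Type*} [NormedAddCommGroup E] [NormedSpace ℝ E]
    {H : Type*} [TopologicalSpace H] {I : ModelWithCorners ℝ E H}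
    {B : Type*} [TopologicalSpace B] [ChartedSpace H B] [IsManifold I ∞ B]
    {X : ∀ q : B, TangentSpace I q} (hX : SmoothField X) (p : B) :
    ContinuousAt (fun q => mvfderiv I (extChartAt I p) q (X q)) p := by
  refine (contMDiffAt_mvfderiv (u := (chartAt H p).source) (chartAt H p).open_source
    (contMDiffOn_extChartAt) hX (mem_chart_source H p)).continuousAt

namespace RegularBoundary

variable (hT : RegularBoundary C T i)
include hT

/-- `exists_lower_bound` in the chart at `p`, with `a` and `b` the coordinate expressions of `ξ` and
`Jξ`. Its hypothesis at `p` is `mem_dist`, which covers interior and boundary points alike. -/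
theorem exists_form_bound [T2Space M] [T2Space B] (p : B) : ∃ ε > 0, ∀ᶠ q in 𝓝 p, 0 ≤ T.f q →
    ∀ v : TangentSpace (𝓡∂ (2 * n + 2)) q, T.g q (T.xi q) v = 0 →
      T.g q (T.J q (T.xi q)) v = 0 →
      ε * T.f q * ‖mvfderiv (𝓡∂ (2 * n + 2)) (extChartAt (𝓡∂ (2 * n + 2)) p) q v‖ ^ 2
        ≤ -T.g q v v := by
  obtain ⟨G, hG, hGT⟩ := T.exists_coordinates p
  have hsrc : ∀ᶠ q in 𝓝 p, q ∈ (chartAt (EuclideanHalfSpace (2 * n + 2)) p).source :=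
    chart_source_mem_nhds _ p
  have hsurj : ∀ q ∈ (chartAt (EuclideanHalfSpace (2 * n + 2)) p).source,
      ∀ u : EuclideanSpace ℝ (Fin (2 * n + 2)), ∃ v : TangentSpace (𝓡∂ (2 * n + 2)) q,
        mvfderiv (𝓡∂ (2 * n + 2)) (extChartAt (𝓡∂ (2 * n + 2)) p) q v = u := fun q hq u => by
    have := isInvertible_mfderiv_extChartAt (I := 𝓡∂ (2 * n + 2)) (x := p) (y := q) (by simpa using hq)
    exact this.surjective u
  obtain ⟨ε, hε, h⟩ := exists_lower_bound hG (T.smooth_xi.continuousAt_coordinates p)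
    ((T.smoothField_J T.smooth_xi).continuousAt_coordinates p)
    (hsrc.mono fun q hq v w => by
      obtain ⟨v, rfl⟩ := hsurj q hq v
      obtain ⟨w, rfl⟩ := hsurj q hq w
      rw [hGT q hq, hGT q hq, T.symm_g])
    (hsrc.mono fun q hq => by
      rw [hGT q hq, hGT q hq, hT.g_J_xi]
      rfl)
    (hsrc.mono fun q hq => by rw [hGT q hq, hT.g_xi_J_xi]) (fun w h0 h1 h2 => by
      obtain ⟨w, rfl⟩ := hsurj p (mem_chart_source _ p) w
      rw [hGT p (mem_chart_source _ p)] at h0 h1 h2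
      obtain ⟨s, t, hst⟩ := Submodule.mem_span_pair.1 (hT.mem_dist p h0 h1 h2)
      rw [← hst, map_add, map_smul, map_smul]
      exact Submodule.mem_span_pair.2 ⟨s, t, rfl⟩)
  refine ⟨ε, hε, ?_⟩
  filter_upwards [h, hsrc] with q hq hqs hf v hv hv'
  have := hq (by rw [hGT q hqs]; exact hf) (mvfderiv (𝓡∂ (2 * n + 2)) (extChartAt _ p) q v)
    (by rw [hGT q hqs, hv]) (by rw [hGT q hqs, hv'])
  rw [hGT q hqs, hGT q hqs] at this
  exact this

/-- The metric of the interior, on the orthogonal complement of `ξ` and `Jξ`, is bounded by the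
metric of a chart of the manifold with boundary. -/
theorem exists_bound [T2Space M] [T2Space B] (p : B) : ∃ ε > 0, ∃ V ∈ 𝓝 p,
    V ⊆ (extChartAt (𝓡∂ (2 * n + 2)) p).source ∧ ∀ x : M, i x ∈ V → 0 < C.f x →
    ∀ v : TangentSpace (𝓡 (2 * n + 2)) x, C.g x (C.xi x) v = 0 → C.g x (C.J x (C.xi x)) v = 0 →
      ε * C.f x * ‖mvfderiv (𝓡 (2 * n + 2)) (fun y => extChartAt (𝓡∂ (2 * n + 2)) p (i y)) x v‖ ^ 2
        ≤ -C.g x v v := by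
  obtain ⟨ε, hε, h⟩ := hT.exists_form_bound p
  refine ⟨ε, hε, _, Filter.inter_mem h (extChartAt_source_mem_nhds (I := 𝓡∂ (2 * n + 2)) p),
    Set.inter_subset_right, ?_⟩
  rintro x ⟨hx, hxs⟩ hf v hv hv'
  have h1 := hx (by rw [hT.f_comp]; exact hf.le) (mfderiv (𝓡 (2 * n + 2)) (𝓡∂ (2 * n + 2)) i x v)
    (by rw [hT.extends_xi, hT.extends_g, hv])
    (by rw [hT.extends_xi, hT.extends_J, hT.extends_g, hv'])
  rw [hT.f_comp, hT.extends_g] at h1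
  rw [hT.mvfderiv_comp (mdifferentiableAt_extChartAt (by simpa using hxs))]
  exact h1

end RegularBoundary

end Regular

/-! ### Paths and completeness -/

/-- A path can be lifted to a compact space when it can be lifted infinitesimally. -/
theorem exists_lift {X Q Y : Type*} [TopologicalSpace X] [CompactSpace X] [TopologicalSpace Q]
    [T2Space Q] [PseudoMetricSpace Y] {a : X → Q} (ha : Continuous a) {b : X → Y}
    (hb : Continuous b) {m : ℝ → Q} (hm : Continuous m) {l : ℝ → ℝ} (hl : Continuous l)
    (hl0 : ∀ t, 0 ≤ l t) {r : ℝ} (hr : ∫ t in (0 : ℝ)..1, l t < r) {x₀ : X} (hx₀ : a x₀ = m 0)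
    (hlift : ∀ t₀ x, a x = m t₀ → dist (b x) (b x₀) < r → ∀ k > l t₀,
      ∀ᶠ t in 𝓝[>] t₀, ∃ x', a x' = m t ∧ dist (b x') (b x) ≤ k * (t - t₀)) :
    ∃ x₁, a x₁ = m 1 ∧ dist (b x₁) (b x₀) < r := by
  -- The slack `ε` makes the permitted displacement grow strictly faster than the infinitesimal
  -- lifts need.
  obtain ⟨ε, hε, hεr⟩ : ∃ ε > 0, ∫ t in (0 : ℝ)..1, l t + ε < r := by
    refine ⟨(r - ∫ t in (0 : ℝ)..1, l t) / 2, by linarith, ?_⟩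
    have h1 : ∫ t in (0 : ℝ)..1, (l t + (r - ∫ t in (0 : ℝ)..1, l t) / 2)
        = (∫ t in (0 : ℝ)..1, l t) + (r - ∫ t in (0 : ℝ)..1, l t) / 2 := by
      rw [intervalIntegral.integral_add (hl.intervalIntegrable _ _)
        (continuous_const.intervalIntegrable _ _)]
      simp
    rw [h1]
    linarith
  set L : ℝ → ℝ := fun s => ∫ t in (0 : ℝ)..s, l t + ε with hL
  have hLd : ∀ s, HasDerivAt L (l s + ε) s := fun s =>
    (hl.add continuous_const).integral_hasStrictDerivAt 0 s |>.hasDerivAt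
  have hLm : Monotone L := monotone_of_deriv_nonneg (fun s => (hLd s).differentiableAt)
    fun s => by rw [(hLd s).deriv]; linarith [hl0 s]
  have hLc : Continuous L := continuous_iff_continuousAt.2 fun s => (hLd s).continuousAt
  -- The set of times at which the path has a lift within the permitted distance is closed, since it
  -- is a projection of a closed set along the compact space.
  have hcl : IsClosed ({t | ∃ x, a x = m t ∧ dist (b x) (b x₀) ≤ L t} ∩ Set.Icc (0 : ℝ) 1) := by
    have h1 : IsClosed {z : ℝ × X | a z.2 = m z.1 ∧ dist (b z.2) (b x₀) ≤ L z.1} :=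
      (isClosed_eq (ha.comp continuous_snd) (hm.comp continuous_fst)).inter
        (isClosed_le ((hb.comp continuous_snd).dist continuous_const) (hLc.comp continuous_fst))
    have h2 : {t | ∃ x, a x = m t ∧ dist (b x) (b x₀) ≤ L t}
        = Prod.fst '' {z : ℝ × X | a z.2 = m z.1 ∧ dist (b z.2) (b x₀) ≤ L z.1} := by
      ext t
      simp
    rw [h2]
    exact (isClosedMap_fst_of_compactSpace _ h1).inter isClosed_Icc
  -- From a lift at time `t₀` one gets lifts at slightly later times, and the triangle inequality
  -- keeps them within the bound because `L` has slope above `l t₀ + ε / 2` there. Lifts at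
  -- different times need not fit together to a curve.
  have hsub := hcl.Icc_subset_of_forall_exists_gt (⟨x₀, hx₀, by simp [hL]⟩) (by
    rintro t₀ ⟨⟨x, hx, hxd⟩, ht₀⟩ y hy
    have hd : dist (b x) (b x₀) < r := (hxd.trans (hLm ht₀.2.le)).trans_lt hεr
    have h1 := hlift t₀ x hx hd (l t₀ + ε / 2) (by linarith)
    have h2 : ∀ᶠ t in 𝓝[>] t₀, l t₀ + ε / 2 < slope L t₀ t :=
      ((hasDerivAt_iff_tendsto_slope.1 (hLd t₀)).mono_left
        (nhdsWithin_mono _ fun t (ht : t₀ < t) => ht.ne')).eventually (lt_mem_nhds (by linarith))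
    obtain ⟨t, ⟨⟨x', hx', hxd'⟩, h3⟩, h4⟩ := ((h1.and h2).and (Ioc_mem_nhdsGT hy)).exists
    refine ⟨t, ⟨x', hx', ?_⟩, h4⟩
    rw [slope_def_field, lt_div_iff₀ (sub_pos.2 h4.1)] at h3
    linarith [dist_triangle (b x') (b x) (b x₀)])
  obtain ⟨x₁, h1, h2⟩ := hsub (Set.right_mem_Icc.2 zero_le_one)
  exact ⟨x₁, h1, h2.trans_lt hεr⟩

section Riemannian

variable {E : Type*} [NormedAddCommGroup E] [NormedSpace ℝ E] {N : Type*}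
  [TopologicalSpace N] [ChartedSpace E N] [IsManifold 𝓘(ℝ, E) ∞ N]
  (g : Bundle.ContMDiffRiemannianMetric 𝓘(ℝ, E) ∞ E (fun x : N => TangentSpace 𝓘(ℝ, E) x))

/-- The velocity of a curve. -/
def velocity (γ : ℝ → N) (t : ℝ) : TangentSpace 𝓘(ℝ, E) (γ t) :=
  mfderiv 𝓘(ℝ, ℝ) 𝓘(ℝ, E) γ t (1 : ℝ)

/-- The speed of a curve. -/
def speed (γ : ℝ → N) (t : ℝ) : ℝ := √(g.inner (γ t) (velocity γ t) (velocity γ t))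

theorem speed_nonneg (γ : ℝ → N) (t : ℝ) : 0 ≤ speed g γ t := Real.sqrt_nonneg _

theorem continuous_speed {γ : ℝ → N} (hγ : ContMDiff 𝓘(ℝ, ℝ) 𝓘(ℝ, E) 1 γ) :
    Continuous (speed g γ) := by
  have h1 : Continuous fun t : ℝ => Bundle.TotalSpace.mk' E (E := (TangentSpace 𝓘(ℝ, E) : N → Type _))
      (γ t) (velocity γ t) := by
    have h2 := hγ.continuous_tangentMap le_rfl
    have h3 : Continuous fun t : ℝ => (⟨t, (1 : ℝ)⟩ : TangentBundle 𝓘(ℝ, ℝ) ℝ) :=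
      (tangentBundleModelSpaceHomeomorph 𝓘(ℝ, ℝ)).symm.continuous.comp
        (continuous_id.prodMk continuous_const)
    exact h2.comp h3
  have h4 := g.contMDiff.continuous.comp hγ.continuous
  have h5 := Continuous.clm_bundle_apply₂ (F₃ := ℝ) (E₃ := fun _ : N => ℝ) (b := γ) h4 h1 h1
  refine Real.continuous_sqrt.comp (continuous_iff_continuousAt.2 fun t => ?_)
  exact ((FiberBundle.continuousAt_totalSpace ℝ _).1 (h5.continuousAt (x := t))).2

/-- The distance is realized, up to an error, by the length of a path. -/
theorem exists_path {x y : N} {r : ℝ}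
    (h : letI : Bundle.RiemannianBundle (fun x : N => TangentSpace 𝓘(ℝ, E) x) :=
      ⟨g.toRiemannianMetric⟩
      Manifold.riemannianEDist 𝓘(ℝ, E) x y < ENNReal.ofReal r) :
    ∃ γ : ℝ → N, ContMDiff 𝓘(ℝ, ℝ) 𝓘(ℝ, E) 1 γ ∧ γ 0 = x ∧ γ 1 = y ∧
      ∫ t in (0 : ℝ)..1, speed g γ t < r := by
  let _ : Bundle.RiemannianBundle (fun x : N => TangentSpace 𝓘(ℝ, E) x) := ⟨g.toRiemannianMetric⟩
  obtain ⟨γ, h0, h1, hγ, hlt, -⟩ :=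
    Manifold.exists_lt_locally_constant_of_riemannianEDist_lt h zero_lt_one
  refine ⟨γ, hγ, h0, h1, ?_⟩
  have hs : ∀ t, ‖(velocity γ t : TangentSpace 𝓘(ℝ, E) (γ t))‖ₑ = ENNReal.ofReal (speed g γ t) := by
    intro t
    rw [← ofReal_norm, norm_eq_sqrt_real_inner]
    rfl
  rw [Manifold.pathELength_eq_lintegral_mfderiv_Icc] at hlt
  have h2 : ∫⁻ t in Set.Icc (0 : ℝ) 1, ENNReal.ofReal (speed g γ t) < ENNReal.ofReal r := by
    simp only [← hs]
    exact hlt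
  have hc := continuous_speed g hγ
  rw [← MeasureTheory.ofReal_integral_eq_lintegral_ofReal
    (hc.continuousOn.integrableOn_Icc) (Filter.Eventually.of_forall (speed_nonneg g γ)),
    ENNReal.ofReal_lt_ofReal_iff_of_nonneg
      (MeasureTheory.integral_nonneg (speed_nonneg g γ))] at h2
  rwa [intervalIntegral.integral_of_le zero_le_one, ← MeasureTheory.integral_Icc_eq_integral_Ioc]

/-- A metric is complete when the tail of every Cauchy sequence is contained in a compact set. -/
theorem isCompleteMetric_of_isCompact [T2Space N] [FiniteDimensional ℝ E]
    (h : ∀ u : ℕ → N, (∀ r > 0, ∃ k, ∀ i ≥ k, ∀ j ≥ k, ∃ γ : ℝ → N,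
      ContMDiff 𝓘(ℝ, ℝ) 𝓘(ℝ, E) 1 γ ∧ γ 0 = u i ∧ γ 1 = u j ∧
        ∫ t in (0 : ℝ)..1, speed g γ t < r) →
      ∃ K : Set N, IsCompact K ∧ ∀ᶠ k in Filter.atTop, u k ∈ K) : IsCompleteMetric g := by
  let _ : Bundle.RiemannianBundle (fun x : N => TangentSpace 𝓘(ℝ, E) x) := ⟨g.toRiemannianMetric⟩
  intro u hu
  obtain ⟨K, hK, hev⟩ := h u fun r hr => by
    obtain ⟨k, hk⟩ := hu (ENNReal.ofReal r) (ENNReal.ofReal_pos.2 hr)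
    exact ⟨k, fun i hi j hj => exists_path g (hk i hi j hj)⟩
  obtain ⟨x, -, hx⟩ := hK.exists_mapClusterPt (Filter.tendsto_principal.2 hev)
  have : LocallyCompactSpace N := ChartedSpace.locallyCompactSpace E N
  have : IsManifold 𝓘(ℝ, E) 1 N := IsManifold.of_le (n := ∞) (by simp)
  have : IsContinuousRiemannianBundle E (fun x : N => TangentSpace 𝓘(ℝ, E) x) :=
    ⟨g.toContinuousRiemannianMetric.inner, g.toContinuousRiemannianMetric.continuous,
      fun _ _ _ => rfl⟩
  refine ⟨x, fun s hs => ?_⟩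
  obtain ⟨c, hc, hcs⟩ := setOfPred_riemannianEDist_lt_subset_nhds' 𝓘(ℝ, E) hs
  have hc2 : 0 < c / 2 := ENNReal.half_pos hc.ne'
  obtain ⟨k, hk⟩ := hu (c / 2) hc2
  obtain ⟨j, hj, hjk⟩ := ((hx.frequently (eventually_riemannianEDist_lt 𝓘(ℝ, E) x hc2)).and_eventually
    (Filter.eventually_ge_atTop k)).exists
  change ∀ᶠ i in Filter.atTop, u i ∈ s
  filter_upwards [Filter.eventually_ge_atTop k] with i hi
  refine hcs ?_
  calc Manifold.riemannianEDist 𝓘(ℝ, E) x (u i)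
      ≤ Manifold.riemannianEDist 𝓘(ℝ, E) x (u j) + Manifold.riemannianEDist 𝓘(ℝ, E) (u j) (u i) :=
        Manifold.riemannianEDist_triangle
    _ < c / 2 + c / 2 := ENNReal.add_lt_add hj (hk j hjk i hi)
    _ = c := ENNReal.add_halves c

end Riemannian

/-! ### Curves in coordinates -/

section Lift

variable {E : Type*} [NormedAddCommGroup E] [NormedSpace ℝ E]

theorem hasMFDerivAt_subtypeVal {D : TopologicalSpace.Opens E} (e : D) :
    HasMFDerivAt 𝓘(ℝ, E) 𝓘(ℝ, E) (Subtype.val : D → E) e (ContinuousLinearMap.id ℝ E) := by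
  refine ⟨continuous_subtype_val.continuousAt, ?_⟩
  refine ((hasFDerivAt_id e.1).congr_of_eventuallyEq ?_).hasFDerivWithinAt
  filter_upwards [D.isOpen.mem_nhds e.2] with w hw
  change ((chartAt E e).symm w).1 = w
  rw [IsMetricAtlas.opens_symm_apply e hw]

/-- A curve through a point of a local parametrization, in the corresponding coordinates. -/
theorem exists_curve_lift {N : Type*} [TopologicalSpace N] [ChartedSpace E N]
    [IsManifold 𝓘(ℝ, E) ∞ N] {D : TopologicalSpace.Opens E} {φ : D → N}
    (hφ : IsLocalDiffeomorph 𝓘(ℝ, E) 𝓘(ℝ, E) ∞ φ) {γ : ℝ → N}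
    (hγ : ContMDiff 𝓘(ℝ, ℝ) 𝓘(ℝ, E) 1 γ) {t₀ : ℝ} {e₀ : D} (h : φ e₀ = γ t₀) :
    ∃ (e : ℝ → E) (e' : E), e t₀ = e₀ ∧ HasDerivAt e e' t₀ ∧
      (velocity γ t₀ : E) = (mfderiv 𝓘(ℝ, E) 𝓘(ℝ, E) φ e₀ : E →L[ℝ] E) e' ∧
      ∀ᶠ t in 𝓝 t₀, ∃ ht : e t ∈ D, φ ⟨e t, ht⟩ = γ t := by
  have hl := hφ e₀
  have h0 : hl.localInverse (γ t₀) = e₀ := by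
    rw [← h]
    exact hl.localInverse_left_inv hl.localInverse_mem_target
  have hi : MDifferentiableAt 𝓘(ℝ, E) 𝓘(ℝ, E) hl.localInverse (γ t₀) := by
    rw [← h]
    exact hl.localInverse_mdifferentiableAt (by simp)
  have hc : MDifferentiableAt 𝓘(ℝ, ℝ) 𝓘(ℝ, E) (fun t => hl.localInverse (γ t)) t₀ :=
    hi.comp t₀ (hγ.mdifferentiableAt one_ne_zero)
  have hev : ∀ᶠ t in 𝓝 t₀, φ (hl.localInverse (γ t)) = γ t := by
    have h1 := hl.localInverse_eventuallyEq_right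
    rw [h] at h1
    exact hγ.continuous.continuousAt.eventually h1
  let L : ℝ →L[ℝ] E := mfderiv 𝓘(ℝ, ℝ) 𝓘(ℝ, E) (fun t => hl.localInverse (γ t)) t₀
  have hφd : MDifferentiableAt 𝓘(ℝ, E) 𝓘(ℝ, E) φ (hl.localInverse (γ t₀)) := by
    rw [h0]
    exact hl.mdifferentiableAt (by simp)
  refine ⟨fun t => (hl.localInverse (γ t)).1, L 1, congrArg Subtype.val h0, ?_, ?_, ?_⟩
  · have h1 : HasMFDerivAt 𝓘(ℝ, ℝ) 𝓘(ℝ, E) (fun t => (hl.localInverse (γ t)).1) t₀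
        ((ContinuousLinearMap.id ℝ E).comp L) :=
      (hasMFDerivAt_subtypeVal _).comp t₀ hc.hasMFDerivAt
    have h2 : HasFDerivAt (fun t => (hl.localInverse (γ t)).1) L t₀ := h1.hasFDerivAt
    exact h2.hasDerivAt
  · have h1 : HasMFDerivAt 𝓘(ℝ, ℝ) 𝓘(ℝ, E) (fun t => φ (hl.localInverse (γ t))) t₀
        ((mfderiv 𝓘(ℝ, E) 𝓘(ℝ, E) φ (hl.localInverse (γ t₀)) : E →L[ℝ] E).comp L) :=
      hφd.hasMFDerivAt.comp t₀ hc.hasMFDerivAt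
    have h2 : HasMFDerivAt 𝓘(ℝ, ℝ) 𝓘(ℝ, E) γ t₀
        ((mfderiv 𝓘(ℝ, E) 𝓘(ℝ, E) φ (hl.localInverse (γ t₀)) : E →L[ℝ] E).comp L) :=
      h1.congr_of_eventuallyEq (hev.mono fun t ht => ht.symm)
    have h3 : (velocity γ t₀ : E)
        = (mfderiv 𝓘(ℝ, E) 𝓘(ℝ, E) φ (hl.localInverse (γ t₀)) : E →L[ℝ] E) (L 1) :=
      congrArg (fun T : ℝ →L[ℝ] E => T 1) h2.mfderiv
    rwa [h0] at h3
  · filter_upwards [hev] with t ht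
    exact ⟨(hl.localInverse (γ t)).2, ht⟩

end Lift

section Global

variable {n : ℕ} {M : Type*} [TopologicalSpace M]
  [ChartedSpace (EuclideanSpace ℝ (Fin (2 * n + 2))) M] [IsManifold (𝓡 (2 * n + 2)) ∞ M]
  [MulAction ℂˣ M] {C : ConicalSpecialKaehler n M} {A : Type*} {U : A → SpecialChart C} {c : ℝ}
  [ChartedSpace (Coord n) (NBar U c)] [IsManifold 𝓘(ℝ, Coord n) ∞ (NBar U c)]
  {g : Bundle.ContMDiffRiemannianMetric 𝓘(ℝ, Coord n) ∞ (Coord n)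
    (TangentSpace 𝓘(ℝ, Coord n) : NBar U c → Type _)}

theorem IsOneLoopMetric.exists_curve_lift (hg : IsOneLoopMetric U c g) {γ : ℝ → NBar U c}
    (hγ : ContMDiff 𝓘(ℝ, ℝ) 𝓘(ℝ, Coord n) 1 γ) {t₀ : ℝ} {α : A} {e₀ : coordDomain (U α)}
    (h : coordMap U c α e₀ = γ t₀) :
    ∃ (e : ℝ → Coord n) (e' : Coord n), e t₀ = e₀ ∧ HasDerivAt e e' t₀ ∧
      gFS c (U α).dom.F e₀ e' = speed g γ t₀ ^ 2 ∧
      ∀ᶠ t in 𝓝 t₀, ∃ ht : e t ∈ coordDomain (U α), coordMap U c α ⟨e t, ht⟩ = γ t := by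
  obtain ⟨e, e', h1, h2, h3, h4⟩ := OneLoop.exists_curve_lift (hg.localDiffeo α) hγ h
  refine ⟨e, e', h1, h2, ?_, h4⟩
  let G : NBar U c → Coord n →L[ℝ] Coord n →L[ℝ] ℝ := fun x => g.inner x
  have h5 : G (coordMap U c α e₀) (mfderiv 𝓘(ℝ, Coord n) 𝓘(ℝ, Coord n) (coordMap U c α) e₀ e')
      (mfderiv 𝓘(ℝ, Coord n) 𝓘(ℝ, Coord n) (coordMap U c α) e₀ e')
      = gFS c (U α).dom.F e₀ e' := hg.metric_eq α e₀ e'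
  have h6 : speed g γ t₀ ^ 2 = G (γ t₀) (velocity (E := Coord n) γ t₀) (velocity (E := Coord n) γ t₀) := by
    refine Real.sq_sqrt ?_
    by_cases hv : velocity (E := Coord n) γ t₀ = 0
    · rw [hv, map_zero]
    · exact (g.pos _ _ hv).le
  have h7 : G (γ t₀) (velocity (E := Coord n) γ t₀) (velocity (E := Coord n) γ t₀)
      = G (coordMap U c α e₀) (mfderiv 𝓘(ℝ, Coord n) 𝓘(ℝ, Coord n) (coordMap U c α) e₀ e')
        (mfderiv 𝓘(ℝ, Coord n) 𝓘(ℝ, Coord n) (coordMap U c α) e₀ e') := by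
    rw [h]
    exact congrArg (fun w => G (γ t₀) w w) h3
  rw [h6, h7, h5]

end Global

/-! ### Uniform neighbourhoods -/

/-- Continuous positive definite forms are uniformly positive on compact sets. -/
theorem _root_.IsCompact.exists_le_form {E : Type*} [NormedAddCommGroup E] [NormedSpace ℝ E]
    [FiniteDimensional ℝ E] {K : Set E} (hK : IsCompact K) {b : E → E →L[ℝ] E →L[ℝ] ℝ}
    (hb : ContinuousOn b K) (hpos : ∀ y ∈ K, ∀ u, u ≠ 0 → 0 < b y u u) :
    ∃ ε > 0, ∀ y ∈ K, ∀ u, (ε * ‖u‖) ^ 2 ≤ b y u u := by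
  have hc : ContinuousOn (fun w : E × E => b w.1 w.2 w.2) (K ×ˢ Metric.sphere (0 : E) 1) :=
    ((hb.comp continuousOn_fst fun w hw => hw.1).clm_apply continuousOn_snd).clm_apply
      continuousOn_snd
  have hS : IsCompact (K ×ˢ Metric.sphere (0 : E) 1) := hK.prod (isCompact_sphere 0 1)
  have hp : ∀ w ∈ K ×ˢ Metric.sphere (0 : E) 1, 0 < b w.1 w.2 w.2 := fun w hw =>
    hpos w.1 hw.1 w.2 (fun h => by simpa [h] using hw.2)
  obtain ⟨m, hm, hle⟩ := hS.exists_forall_le' hc (a := 0) hp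
  refine ⟨√m, Real.sqrt_pos.2 hm, fun y hy u => ?_⟩
  rw [mul_pow, Real.sq_sqrt hm.le]
  rcases eq_or_ne u 0 with rfl | hu
  · simp
  have h1 := hle (y, ‖u‖⁻¹ • u) ⟨hy, by simp [norm_smul, hu]⟩
  simp only [map_smul, smul_apply, smul_eq_mul] at h1
  have h2 : 0 < ‖u‖ := norm_pos_iff.2 hu
  rw [← mul_assoc, ← mul_inv, ← div_eq_inv_mul, le_div_iff₀ (by positivity)] at h1
  linarith [h1]

theorem _root_.HasDerivAt.eventually_dist_le {E : Type*} [NormedAddCommGroup E] [NormedSpace ℝ E]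
    {f : ℝ → E} {f' : E} {t₀ k : ℝ} (hf : HasDerivAt f f' t₀) (hk : ‖f'‖ < k) :
    ∀ᶠ t in 𝓝[>] t₀, dist (f t) (f t₀) ≤ k * (t - t₀) := by
  filter_upwards [hf.hasDerivWithinAt.limsup_norm_slope_le hk, self_mem_nhdsWithin] with t ht ht'
  have h1 : 0 < t - t₀ := sub_pos.2 ht'
  rw [Real.norm_of_nonneg h1.le, inv_mul_lt_iff₀ h1] at ht
  rw [dist_eq_norm, mul_comm]
  exact ht.le

section Global

variable {n : ℕ} {M : Type*} [TopologicalSpace M]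
  [ChartedSpace (EuclideanSpace ℝ (Fin (2 * n + 2))) M] [IsManifold (𝓡 (2 * n + 2)) ∞ M]
  [MulAction ℂˣ M] {C : ConicalSpecialKaehler n M} {A : Type*} {U : A → SpecialChart C} {c : ℝ}
  [ChartedSpace (Coord n) (NBar U c)] [IsManifold 𝓘(ℝ, Coord n) ∞ (NBar U c)]
  {g : Bundle.ContMDiffRiemannianMetric 𝓘(ℝ, Coord n) ∞ (Coord n)
    (TangentSpace 𝓘(ℝ, Coord n) : NBar U c → Type _)}

/-- The points in the orbit of a compact set of coordinates under the Heisenberg group have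
relatively compact balls of uniform radius. -/
theorem IsOneLoopMetric.exists_isCompact (hg : IsOneLoopMetric U c g) [ContinuousConstSMul ℂˣ M]
    [T2Space (NBar U c)]
    (hc : 0 ≤ c) {α : A} {y₀ : Coord n} (hy₀ : y₀ ∈ coordDomain (U α)) :
    ∃ r > 0, ∃ δ > 0, ∀ (q : Fin (n + 1) ⊕ Fin (n + 1) → ℝ) (s : ℝ), ∃ K : Set (NBar U c),
      IsCompact K ∧ ∀ y, ∀ hy : heisenberg q s y ∈ coordDomain (U α), dist y y₀ < r →
      ∀ γ : ℝ → NBar U c, ContMDiff 𝓘(ℝ, ℝ) 𝓘(ℝ, Coord n) 1 γ →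
        γ 0 = coordMap U c α ⟨heisenberg q s y, hy⟩ → ∫ t in (0 : ℝ)..1, speed g γ t < δ →
        γ 1 ∈ K := by
  obtain ⟨R, hR, hRD⟩ := Metric.nhds_basis_closedBall.mem_iff.1
    ((coordDomain (U α)).isOpen.mem_nhds hy₀)
  have hK := isCompact_closedBall y₀ R
  have hbc : ContinuousOn (bilinFS c (U α).dom.F) (Metric.closedBall y₀ R) :=
    ContinuousOn.mono (contDiffOn_bilinFS (D := (U α).dom) hc).continuousOn hRD
  -- The constant is found on one compact ball; translations being isometric, it serves all
  -- translates of the ball.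
  obtain ⟨ε, hε, hle⟩ := hK.exists_le_form hbc
    (fun y hy u hu => by
      rw [bilinFS_self]
      exact gFS_pos hc (hRD hy).1 (hRD hy).2 hu)
  refine ⟨R / 2, by linarith, ε * (R / 2), by positivity, fun q s => ?_⟩
  let X := Metric.closedBall y₀ R
  have : CompactSpace X := isCompact_iff_compactSpace.1 hK
  have hmem : ∀ x : X, heisenberg q s x.1 ∈ coordDomain (U α) := fun x =>
    ⟨(hRD x.2).1, (hRD x.2).2⟩
  have hhc : Continuous (heisenberg q s : Coord n → Coord n) :=
    continuous_iff_continuousAt.2 fun e => (hasFDerivAt_heisenberg q s e).continuousAt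
  let a : X → NBar U c := fun x => coordMap U c α ⟨heisenberg q s x.1, hmem x⟩
  have ha : Continuous a := (continuous_coordMap U c α).comp
    ((hhc.comp continuous_subtype_val).subtype_mk _)
  refine ⟨Set.range a, isCompact_range ha, fun y hy hyr γ hγ h0 hlt => ?_⟩
  have hyX : y ∈ X := Metric.mem_closedBall.2 (by linarith)
  obtain ⟨x₁, hx₁, -⟩ := exists_lift (X := X) (a := a) (b := Subtype.val) (m := γ)
    (l := fun t => ε⁻¹ * speed g γ t) (r := R / 2) (x₀ := ⟨y, hyX⟩) ha continuous_subtype_val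
    hγ.continuous ((continuous_speed g hγ).const_mul _)
    (fun t => mul_nonneg (inv_nonneg.2 hε.le) (speed_nonneg g γ t))
    (by rw [intervalIntegral.integral_const_mul, inv_mul_lt_iff₀ hε]; exact hlt) h0.symm (by
      intro t₀ x hx hxd k hk
      obtain ⟨e, e', h1, h2, h3, h4⟩ := hg.exists_curve_lift hγ hx
      -- The curve is translated back to the fixed ball, where its coordinate speed is bounded by
      -- `ε⁻¹` times its Riemannian speed.
      have hw := (hasFDerivAt_heisenberg (-q) (-s) (e t₀)).comp_hasDerivAt t₀ h2
      have hback : heisenberg (-q) (-s) (e t₀) = x.1 := by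
        have := heisenberg_neg_heisenberg (-q) (-s) x.1
        rw [neg_neg, neg_neg] at this
        rw [h1]
        exact this
      have hnorm : ‖heisenbergLin (-q) e'‖ < k := by
        have h5 := hle x.1 x.2 (heisenbergLin (-q) e')
        rw [bilinFS_self, ← hback, gFS_heisenberg, h1, h3] at h5
        have h6 := abs_le_of_sq_le_sq' h5 (speed_nonneg g γ t₀)
        refine lt_of_le_of_lt ?_ hk
        rw [le_inv_mul_iff₀ hε]
        exact h6.2
      have hball : ∀ᶠ t in 𝓝 t₀, heisenberg (-q) (-s) (e t) ∈ Metric.ball y₀ R := by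
        refine hw.continuousAt.eventually (Metric.isOpen_ball.mem_nhds ?_)
        change heisenberg (-q) (-s) (e t₀) ∈ _
        rw [hback, Metric.mem_ball]
        have h7 : dist x.1 y < R / 2 := hxd
        linarith [dist_triangle x.1 y y₀]
      filter_upwards [hw.eventually_dist_le hnorm, nhdsWithin_le_nhds h4,
        nhdsWithin_le_nhds hball] with t ht1 ht2 ht3
      obtain ⟨hD, ht2⟩ := ht2
      refine ⟨⟨heisenberg (-q) (-s) (e t), Metric.ball_subset_closedBall ht3⟩, ?_, ?_⟩
      · rw [← ht2]
        exact congrArg (coordMap U c α) (Subtype.ext (heisenberg_neg_heisenberg q s (e t)))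
      · change dist (heisenberg (-q) (-s) (e t)) x.1 ≤ _
        rw [← hback]
        exact ht1)
  exact ⟨x₁, hx₁⟩

end Global

/-! ### Horizontal lifts of curves -/

section Domain

variable {n : ℕ} {D : ConicalDomain n}

theorem ConicalDomain.domMetric_smul {k : ℂ} (hk : k ≠ 0) {z : Fin (n + 1) → ℂ}
    (hz : z ∈ D.carrier) :
    domMetric D.F (k • z) (k • z) (k • z) = Complex.normSq k * domMetric D.F z z z := by
  rw [domMetric_eq, domMetric_eq, ConicalDomain.matN_smul hk hz, hermForm_smul_left,
    hermForm_smul_right, ← mul_assoc, Complex.mul_conj, Complex.re_ofReal_mul]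

theorem hasDerivAt_hom {X : ℝ → Fin n → ℂ} {X' : Fin n → ℂ} {t₀ : ℝ} (hX : HasDerivAt X X' t₀) :
    HasDerivAt (fun t => hom (X t)) (Matrix.vecCons 0 X') t₀ := by
  refine hasDerivAt_pi.2 fun I => ?_
  refine Fin.cases ?_ (fun μ => ?_) I
  · exact hasDerivAt_const _ _
  · exact hasDerivAt_pi.1 hX μ

/-- A curve in the projectivization, lifted to a curve of constant norm which is infinitesimally
horizontal. -/
theorem ConicalDomain.exists_lift {X : ℝ → Fin n → ℂ} {X' : Fin n → ℂ} {t₀ : ℝ}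
    (hX : HasDerivAt X X' t₀) (hmem : hom (X t₀) ∈ D.carrier) {k₀ : ℂ} (hk₀ : k₀ ≠ 0) :
    ∃ k : ℝ → ℂ, k t₀ = k₀ ∧ (∀ t, k t ≠ 0) ∧
      (∀ᶠ t in 𝓝 t₀, hom (X t) ∈ D.carrier ∧
        domMetric D.F (k t • hom (X t)) (k t • hom (X t)) (k t • hom (X t))
          = domMetric D.F (k₀ • hom (X t₀)) (k₀ • hom (X t₀)) (k₀ • hom (X t₀))) ∧
      ∃ κ : ℂ, HasDerivAt (fun t => k t • hom (X t))
        (k₀ • Matrix.vecCons 0 X' + κ • k₀ • hom (X t₀)) t₀ ∧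
        (hermForm (matN D.F (k₀ • hom (X t₀))) (k₀ • hom (X t₀))
          (k₀ • Matrix.vecCons 0 X' + κ • k₀ • hom (X t₀))).im = 0 := by
  set z := k₀ • hom (X t₀) with hz
  have hzD : z ∈ D.carrier := D.smul_mem k₀ hk₀ _ hmem
  set f := domMetric D.F z z z with hf
  have hfpos : 0 < f := D.f_pos z hzD
  -- The speed of the phase of `k` at `t₀` that cancels the imaginary part of the hermitian product
  -- of `z` with the velocity.
  set θ : ℝ := (hermForm (matN D.F z) z (k₀ • Matrix.vecCons 0 X')).im / f with hθ
  have hev : ∀ᶠ t in 𝓝 t₀, hom (X t) ∈ D.carrier :=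
    (contDiff_hom.continuous.continuousAt.comp hX.continuousAt).eventually
      (D.isOpen.mem_nhds hmem)
  have hK : DifferentiableAt ℝ (fun t => potK D.F (X t)) t₀ :=
    ((contDiffOn_potK.contDiffAt (isOpen_baseSet.mem_nhds hmem)).differentiableAt
      (by simp)).comp t₀ hX.differentiableAt
  obtain ⟨K', hK'⟩ : ∃ K', HasDerivAt (fun t => potK D.F (X t)) K' t₀ := ⟨_, hK.hasDerivAt⟩
  have hw : HasDerivAt (fun t : ℝ => (((potK D.F (X t) - potK D.F (X t₀)) / 2 : ℝ) : ℂ)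
      + ((θ * (t - t₀) : ℝ) : ℂ) * Complex.I) (((K' / 2 : ℝ) : ℂ) + (θ : ℂ) * Complex.I) t₀ := by
    have h1 := ((hK'.sub_const (potK D.F (X t₀))).div_const 2).ofReal_comp
    have h2 : HasDerivAt (fun t : ℝ => θ * (t - t₀)) θ t₀ := by
      simpa using ((hasDerivAt_id t₀).sub_const t₀).const_mul θ
    exact h1.add (h2.ofReal_comp.mul_const Complex.I)
  -- Half the change of the potential in the real part of the exponent keeps the norm of `k • (1,
  -- X)` exactly constant. The phase is only chosen to first order, because horizontality is needed
  -- at `t₀` alone.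
  set w : ℝ → ℂ := fun t : ℝ => (((potK D.F (X t) - potK D.F (X t₀)) / 2 : ℝ) : ℂ)
      + ((θ * (t - t₀) : ℝ) : ℂ) * Complex.I with hw'
  have hw0 : w t₀ = 0 := by simp [hw']
  set κ : ℂ := ((K' / 2 : ℝ) : ℂ) + (θ : ℂ) * Complex.I with hκ
  have hk : ∀ t, k₀ * Complex.exp (w t) ≠ 0 := fun t => mul_ne_zero hk₀ (Complex.exp_ne_zero _)
  refine ⟨fun t => k₀ * Complex.exp (w t), by simp [hw0], hk, ?_, κ, ?_, ?_⟩
  · filter_upwards [hev] with t ht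
    refine ⟨ht, ?_⟩
    rw [ConicalDomain.domMetric_smul (hk t) ht, hf, hz, ConicalDomain.domMetric_smul hk₀ hmem,
      map_mul, mul_assoc]
    congr 1
    have hre : (w t).re = (potK D.F (X t) - potK D.F (X t₀)) / 2 := by simp [hw']
    have h1 := D.f_pos _ ht
    have h2 := D.f_pos _ hmem
    rw [Complex.normSq_eq_norm_sq, Complex.norm_exp, ← Real.exp_nat_mul, hre]
    have h3 : ((2 : ℕ) : ℝ) * ((potK D.F (X t) - potK D.F (X t₀)) / 2)
        = Real.log (domMetric D.F (hom (X t₀)) (hom (X t₀)) (hom (X t₀)))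
          - Real.log (domMetric D.F (hom (X t)) (hom (X t)) (hom (X t))) := by
      simp only [potK]
      push_cast
      ring
    rw [h3, Real.exp_sub, Real.exp_log h1, Real.exp_log h2, div_mul_cancel₀ _ h1.ne']
  · have h1 : HasDerivAt (fun t => k₀ * Complex.exp (w t)) (k₀ * κ) t₀ := by
      simpa [hw0] using (hw.cexp.const_mul k₀)
    have h2 := h1.smul (hasDerivAt_hom hX)
    refine h2.congr_deriv ?_
    simp only [hw0, Complex.exp_zero, mul_one, hz, smul_smul, mul_comm k₀ κ]
  · rw [hermForm_add_right, hermForm_smul_right _ κ, ConicalDomain.hermForm_self_eq hzD,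
      Complex.add_im, Complex.im_mul_ofReal, ← hf]
    have : (conj κ).im = -θ := by
      rw [Complex.conj_im, hκ, Complex.add_im, Complex.ofReal_im, Complex.im_ofReal_mul]
      simp
    rw [this, hθ]
    field_simp
    ring

end Domain

section Special

variable {n : ℕ} {M : Type*} [TopologicalSpace M]
  [ChartedSpace (EuclideanSpace ℝ (Fin (2 * n + 2))) M] [IsManifold (𝓡 (2 * n + 2)) ∞ M]
  [MulAction ℂˣ M] {C : ConicalSpecialKaehler n M}

theorem hasDerivAt_comp_velocity {E : Type*} [NormedAddCommGroup E] [NormedSpace ℝ E]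
    {N : Type*} [TopologicalSpace N] [ChartedSpace E N]
    {F : Type*} [NormedAddCommGroup F] [NormedSpace ℝ F] {y : ℝ → N} {t : ℝ}
    (hy : MDifferentiableAt 𝓘(ℝ, ℝ) 𝓘(ℝ, E) y t) {h : N → F}
    (hh : MDifferentiableAt 𝓘(ℝ, E) 𝓘(ℝ, F) h (y t)) :
    HasDerivAt (fun s => h (y s)) (mvfderiv 𝓘(ℝ, E) h (y t) (velocity y t)) t := by
  have h1 : HasFDerivAt (fun s => h (y s)) ((mvfderiv 𝓘(ℝ, E) h (y t)).comp
      (mfderiv 𝓘(ℝ, ℝ) 𝓘(ℝ, E) y t)) t := (hh.hasMFDerivAt.comp t hy.hasMFDerivAt).hasFDerivAt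
  exact h1.hasDerivAt

namespace SpecialChart

variable (S : SpecialChart C) (hM : IsPrincipalAction C.toTensorTriple) {p : M}
include hM

theorem f_eq (hp : p ∈ S.source) : C.f p = domMetric S.dom.F (S.z p) (S.z p) (S.z p) := by
  rw [TensorTriple.f, S.isometric p hp, S.mvfderiv_z_xi hM hp]

/-- A curve in the base, lifted to a curve in `M` which is infinitesimally horizontal. -/
theorem exists_lift [T2Space M] {x : M} (hx : x ∈ S.source) {X : ℝ → Fin n → ℂ} {X' : Fin n → ℂ}
    {t₀ : ℝ} (hX0 : X t₀ = S.X x) (hX : HasDerivAt X X' t₀) :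
    ∃ y : ℝ → M, y t₀ = x ∧ MDifferentiableAt 𝓘(ℝ, ℝ) (𝓡 (2 * n + 2)) y t₀ ∧
      (∀ᶠ t in 𝓝 t₀, y t ∈ S.source ∧ S.X (y t) = X t ∧ C.f (y t) = C.f x) ∧
      C.g (y t₀) (C.xi (y t₀)) (velocity y t₀) = 0 ∧
      C.g (y t₀) (C.J (y t₀) (C.xi (y t₀))) (velocity y t₀) = 0 ∧
      -C.g (y t₀) (velocity y t₀) (velocity y t₀)
        = C.f x * barForm (matN S.dom.F (hom (X t₀))) (hom (X t₀)) (Matrix.vecCons 0 X') := by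
  have : Nonempty M := ⟨x⟩
  have hzx := S.z_eq_smul_hom hx
  have hzD := S.z_mem hx
  have hk₀ := S.z_zero_ne_zero hx
  rw [← hX0] at hzx
  have hmem : hom (X t₀) ∈ S.dom.carrier := by
    have h1 := S.dom.smul_mem _ (inv_ne_zero hk₀) _ hzD
    rwa [hzx, smul_smul, Pi.smul_apply, hom_zero, smul_eq_mul, mul_one, inv_mul_cancel₀ hk₀,
      one_smul] at h1
  obtain ⟨k, hk0, hkne, hev, κ, hd, him⟩ := ConicalDomain.exists_lift hX hmem hk₀
  rw [← hzx] at hev hd him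
  obtain ⟨G, ⟨hGz, hzG⟩, hGm, hGs⟩ := S.exists_inverse
  have hz0 : k t₀ • hom (X t₀) = S.z x := by rw [hk0, ← hzx]
  have hy0 : G (k t₀ • hom (X t₀)) = x := by rw [hz0, hGz hx]
  have hG : MDifferentiableAt 𝓘(ℝ, Fin (n + 1) → ℂ) (𝓡 (2 * n + 2)) G (k t₀ • hom (X t₀)) := by
    rw [hz0]
    exact (hGs.contMDiffAt (S.dom.isOpen.mem_nhds hzD)).mdifferentiableAt (by simp)
  obtain ⟨y, hy⟩ : ∃ y : ℝ → M, y = fun t => G (k t • hom (X t)) := ⟨_, rfl⟩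
  have hyd : MDifferentiableAt 𝓘(ℝ, ℝ) (𝓡 (2 * n + 2)) y t₀ := by
    rw [hy]
    exact hG.comp t₀ hd.differentiableAt.mdifferentiableAt
  obtain rfl : y t₀ = x := by rw [hy]; exact hy0
  have hzy : ∀ᶠ t in 𝓝 t₀, S.z (y t) = k t • hom (X t) := by
    filter_upwards [hev] with t ht
    rw [hy]
    exact hzG (S.dom.smul_mem _ (hkne t) _ ht.1)
  have hev' : ∀ᶠ t in 𝓝 t₀, y t ∈ S.source ∧ S.X (y t) = X t ∧ C.f (y t) = C.f (y t₀) := by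
    filter_upwards [hev, hzy] with t ht hzt
    have hys : y t ∈ S.source := by
      rw [hy]
      exact hGm (S.dom.smul_mem _ (hkne t) _ ht.1)
    refine ⟨hys, ?_, ?_⟩
    · ext μ
      rw [SpecialChart.X, hzt]
      simp [mul_div_cancel_left₀ _ (hkne t)]
    · rw [S.f_eq hM hys, S.f_eq hM hx, hzt, ht.2]
  have hdz : mvfderiv (𝓡 (2 * n + 2)) S.z (y t₀) (velocity y t₀)
      = S.z (y t₀) 0 • Matrix.vecCons 0 X' + κ • S.z (y t₀) :=
    (hasDerivAt_comp_velocity hyd (S.mdifferentiableAt_z hx)).unique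
      (hd.congr_of_eventuallyEq hzy)
  set z' := S.z (y t₀) 0 • Matrix.vecCons 0 X' + κ • S.z (y t₀) with hz'
  set N := matN S.dom.F (S.z (y t₀)) with hN
  -- Since `f` is constant along the lift and `df = 2 g(ξ, ·)`, the real part of the hermitian
  -- product vanishes; the imaginary part vanishes by the choice of phase.
  have hξ : C.g (y t₀) (C.xi (y t₀)) (velocity y t₀) = 0 := by
    have h1 := hasDerivAt_comp_velocity hyd
      ((C.toTensorTriple.contMDiff_f (y t₀)).mdifferentiableAt (by simp))
    have h2 := h1.unique ((hasDerivAt_const t₀ (C.f (y t₀))).congr_of_eventuallyEq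
      (hev'.mono fun t ht => ht.2.2))
    have h3 := C.mvfderiv_f (y t₀) (velocity y t₀)
    have h4 := h3.symm.trans h2
    linarith
  have hre : (hermForm N (S.z (y t₀)) z').re = 0 := by
    rw [S.isometric _ hx, S.mvfderiv_z_xi hM hx, hdz, domMetric_eq] at hξ
    exact hξ
  have hort : hermForm N (S.z (y t₀)) z' = 0 := Complex.ext hre him
  refine ⟨y, rfl, hyd, hev', hξ, ?_, ?_⟩
  · rw [S.isometric _ hx, S.holomorphic _ hx, S.mvfderiv_z_xi hM hx, hdz, domMetric_eq,
      hermForm_smul_left, ← hN, hort, mul_zero, Complex.zero_re]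
  · have hpos : 0 < (hermForm N (S.z (y t₀)) (S.z (y t₀))).re := S.dom.f_pos _ hzD
    have h1 := barForm_of_orthogonal hort
    rw [hz', barForm_add_smul (ConicalDomain.matN_isSymm hzD) hpos, ← hz'] at h1
    have h2 : barForm N (S.z (y t₀)) (S.z (y t₀) 0 • Matrix.vecCons 0 X')
        = barForm N (hom (X t₀)) (Matrix.vecCons 0 X') := by
      conv_lhs => rw [hzx]
      have h3 : (S.z (y t₀) 0 • hom (X t₀)) 0 = S.z (y t₀) 0 := by simp
      rw [h3, barForm_smul N hk₀]
    have h4 : N = matN S.dom.F (hom (X t₀)) := by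
      rw [hN, hzx, ConicalDomain.matN_smul hk₀ hmem]
    rw [← h4, ← h2, h1, S.isometric _ hx, hdz, domMetric_eq, S.f_eq hM hx, domMetric_eq, ← hN,
      mul_neg, mul_div_cancel₀ _ hpos.ne']

end SpecialChart

end Special

/-! ### The projection to the base -/

theorem ConicalSpecialKaehler.f_pos {n : ℕ} {M : Type*} [TopologicalSpace M]
    [ChartedSpace (EuclideanSpace ℝ (Fin (2 * n + 2))) M] [IsManifold (𝓡 (2 * n + 2)) ∞ M]
    (C : ConicalSpecialKaehler n M) (x : M) : 0 < C.f x :=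
  C.pos x _ (Submodule.subset_span (Or.inl rfl)) (C.xi_ne_zero x)

section Base

variable {n : ℕ} {M : Type*} [TopologicalSpace M]
  [ChartedSpace (EuclideanSpace ℝ (Fin (2 * n + 2))) M] [IsManifold (𝓡 (2 * n + 2)) ∞ M]
  [MulAction ℂˣ M] {C : ConicalSpecialKaehler n M} {A : Type*} {U : A → SpecialChart C} {c : ℝ}
  [ContinuousConstSMul ℂˣ M]

/-- The projection of `N̄` to `M / ℂ^*`. -/
def base (x : NBar U c) : MulAction.orbitRel.Quotient ℂˣ M := Quotient.mk'' (exists_isOver x).choose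

/-- The coordinate `ρ` of `N̄`. -/
def rho : NBar U c → ℝ :=
  Quot.lift (fun x : Σ α, LocalN (U α) c => x.2.1.2.1) (by
    rintro _ _ ⟨_, _, _, _, _, h, _⟩
    exact h.symm)

omit [ContinuousConstSMul ℂˣ M] in
@[simp] theorem rho_coordMap (α : A) (e : coordDomain (U α)) : rho (coordMap U c α e) = e.1.2.1 := rfl

omit [ContinuousConstSMul ℂˣ M] in
theorem rho_pos (x : NBar U c) : 0 < rho x := by
  obtain ⟨α, e, rfl⟩ := exists_coordMap_eq U c x
  exact e.2.2

omit [ContinuousConstSMul ℂˣ M] in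
theorem continuous_rho : Continuous (rho : NBar U c → ℝ) :=
  continuous_quot_lift _ (continuous_sigma fun _ =>
    (continuous_fst.comp continuous_snd).comp continuous_subtype_val)

omit [ContinuousConstSMul ℂˣ M] in
theorem continuous_log_rho : Continuous fun x : NBar U c => Real.log (rho x) :=
  continuous_rho.log fun x => (rho_pos x).ne'

theorem base_eq_iff {x : NBar U c} {p : M} :
    base x = (Quotient.mk'' p : MulAction.orbitRel.Quotient ℂˣ M) ↔ IsOver U c x p := by
  have h := (exists_isOver x).choose_spec
  rw [base, Quotient.eq'', MulAction.orbitRel_apply]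
  constructor
  · rintro ⟨a, ha⟩
    have ha' : a • p = _ := ha
    rw [← ha'] at h
    simpa using h.smul a⁻¹
  · intro hp
    exact hp.exists_smul_eq h

theorem continuous_base : Continuous (base : NBar U c → MulAction.orbitRel.Quotient ℂˣ M) := by
  refine continuous_def.2 fun V hV => ?_
  have h := isOpen_setOf_isOver (U := U) (c := c) (hV.preimage continuous_quotient_mk')
  convert h using 1
  ext x
  obtain ⟨p, hp⟩ := exists_isOver x
  constructor
  · intro hx
    refine ⟨p, ?_, hp⟩
    have h1 : base x ∈ V := hx
    rwa [base_eq_iff.2 hp] at h1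
  · rintro ⟨q, hq, hq'⟩
    change base x ∈ V
    rw [base_eq_iff.2 hq']
    exact hq

end Base

/-! ### Lifts of curves in `N̄` bounded by their speed -/

section Bound

variable {n : ℕ} {M : Type*} [TopologicalSpace M] [T2Space M]
  [ChartedSpace (EuclideanSpace ℝ (Fin (2 * n + 2))) M] [IsManifold (𝓡 (2 * n + 2)) ∞ M]
  [MulAction ℂˣ M] {C : ConicalSpecialKaehler n M} {A : Type*} {U : A → SpecialChart C} {c : ℝ}
  [ContinuousConstSMul ℂˣ M]
  [ChartedSpace (Coord n) (NBar U c)] [IsManifold 𝓘(ℝ, Coord n) ∞ (NBar U c)]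
  {g : Bundle.ContMDiffRiemannianMetric 𝓘(ℝ, Coord n) ∞ (Coord n)
    (TangentSpace 𝓘(ℝ, Coord n) : NBar U c → Type _)}

/-- The infinitesimal lift of a curve in `N̄`, whose velocity is bounded by the speed of the
curve. -/
theorem IsOneLoopMetric.exists_lift (hg : IsOneLoopMetric U c g) (hc : 0 ≤ c)
    (hM : IsPrincipalAction C.toTensorTriple) {γ : ℝ → NBar U c}
    (hγ : ContMDiff 𝓘(ℝ, ℝ) 𝓘(ℝ, Coord n) 1 γ) {t₀ : ℝ} {x : M} (hx : IsOver U c (γ t₀) x) :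
    ∃ (y : ℝ → M) (l : ℝ → ℝ) (l' : ℝ), y t₀ = x ∧ l t₀ = Real.log (rho (γ t₀)) ∧
      MDifferentiableAt 𝓘(ℝ, ℝ) (𝓡 (2 * n + 2)) y t₀ ∧ HasDerivAt l l' t₀ ∧
      (∀ᶠ t in 𝓝 t₀, IsOver U c (γ t) (y t) ∧ C.f (y t) = C.f x ∧ l t = Real.log (rho (γ t))) ∧
      C.g (y t₀) (C.xi (y t₀)) (velocity y t₀) = 0 ∧
      C.g (y t₀) (C.J (y t₀) (C.xi (y t₀))) (velocity y t₀) = 0 ∧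
      -C.g (y t₀) (velocity y t₀) (velocity y t₀) ≤ C.f x * speed g γ t₀ ^ 2 ∧
      |l'| ≤ 2 * speed g γ t₀ := by
  obtain ⟨α, e₀, he₀, hxs, hX⟩ := hx
  obtain ⟨e, e', h1, h2, h3, h4⟩ := hg.exists_curve_lift hγ he₀
  have hXd : HasDerivAt (fun t => (e t).1) e'.1 t₀ := h2.fst
  have hρd : HasDerivAt (fun t => (e t).2.1) e'.2.1 t₀ := h2.snd.fst
  have hρ : 0 < (e t₀).2.1 := by rw [h1]; exact e₀.2.2
  have hD : hom (e t₀).1 ∈ (U α).dom.carrier := by rw [h1]; exact e₀.2.1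
  obtain ⟨y, hy0, hyd, hev, hξ, hJξ, hgv⟩ := (U α).exists_lift hM hxs (X := fun t => (e t).1)
    (by rw [h1]; exact hX) hXd
  have hle := le_gFS (e := e t₀) hc hD hρ e'
  have h3' : gFS c (U α).dom.F (e t₀) e' = speed g γ t₀ ^ 2 := by rw [h1]; exact h3
  rw [h3'] at hle
  have hbar := (barForm_nonneg (ConicalDomain.matN_isSymm hD) (ConicalDomain.isLorentzian_matN hD)
    ((U α).dom.f_pos _ hD) (Matrix.vecCons 0 e'.1)).1
  have hs := speed_nonneg g γ t₀
  refine ⟨y, fun t => Real.log (e t).2.1, e'.2.1 / (e t₀).2.1, hy0, ?_, hyd, hρd.log hρ.ne', ?_, hξ,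
    hJξ, ?_, ?_⟩
  · rw [← he₀, rho_coordMap, ← h1]
  · filter_upwards [hev, h4] with t ht ht'
    obtain ⟨hDt, ht'⟩ := ht'
    rw [← ht']
    exact ⟨isOver_coordMap_iff.2 ⟨ht.1, ht.2.1.symm⟩, ht.2.2, rfl⟩
  · rw [hgv]
    exact mul_le_mul_of_nonneg_left (by nlinarith [sq_nonneg (e'.2.1 / (2 * (e t₀).2.1))])
      (C.f_pos x).le
  -- The factor two comes from the coefficient `1 / (4ρ²)` of `dρ²`.
  · have h5 : (e'.2.1 / (e t₀).2.1) ^ 2 ≤ (2 * speed g γ t₀) ^ 2 := by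
      have h6 : e'.2.1 / (2 * (e t₀).2.1) = (e'.2.1 / (e t₀).2.1) / 2 := by
        rw [div_div, mul_comm]
      rw [h6] at hle
      nlinarith
    exact abs_le_of_sq_le_sq h5 (by positivity)

end Bound

/-! ### Completeness -/

section Compact

variable {n : ℕ} {B : Type*} [TopologicalSpace B]
  [ChartedSpace (EuclideanHalfSpace (2 * n + 2)) B] [IsManifold (𝓡∂ (2 * n + 2)) ∞ B]

omit [IsManifold (𝓡∂ (2 * n + 2)) ∞ B] in
/-- Small closed balls of a chart are compact. -/
theorem exists_isCompact_ball (p : B) {V : Set B} (hV : V ∈ 𝓝 p)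
    (hVs : V ⊆ (extChartAt (𝓡∂ (2 * n + 2)) p).source) :
    ∃ r > 0, ∃ K : Set B, IsCompact K ∧ K ⊆ V ∧
      (∀ q ∈ V, dist (extChartAt (𝓡∂ (2 * n + 2)) p q) (extChartAt (𝓡∂ (2 * n + 2)) p p) ≤ r →
        q ∈ K) := by
  set Ψ := extChartAt (𝓡∂ (2 * n + 2)) p with hΨ
  have h1 : Ψ.target ∩ Ψ.symm ⁻¹' V ∈ 𝓝[Set.range (𝓡∂ (2 * n + 2))] (Ψ p) := by
    refine Filter.inter_mem (extChartAt_target_mem_nhdsWithin p) ?_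
    have h2 := extChartAt_preimage_mem_nhdsWithin (I := 𝓡∂ (2 * n + 2)) (s := Set.univ) (x := p)
      (t := V) (by simpa using hV)
    simpa only [Set.preimage_univ, Set.univ_inter] using h2
  obtain ⟨r, hr, hrs⟩ := Metric.nhds_basis_closedBall.mem_iff.1 (mem_nhdsWithin_iff_exists_mem_nhds_inter.1 h1).choose_spec.1
  have hsub := fun y (hy : y ∈ Metric.closedBall (Ψ p) r ∩ Set.range (𝓡∂ (2 * n + 2))) =>
    (mem_nhdsWithin_iff_exists_mem_nhds_inter.1 h1).choose_spec.2 ⟨hrs hy.1, hy.2⟩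
  refine ⟨r, hr, Ψ.symm '' (Metric.closedBall (Ψ p) r ∩ Set.range (𝓡∂ (2 * n + 2))), ?_, ?_, ?_⟩
  · exact ((isCompact_closedBall _ _).inter_right (𝓡∂ (2 * n + 2)).isClosed_range).image_of_continuousOn
      ((continuousOn_extChartAt_symm p).mono fun y hy => (hsub y hy).1)
  · rintro _ ⟨y, hy, rfl⟩
    exact (hsub y hy).2
  · intro q hq hd
    refine ⟨Ψ q, ⟨Metric.mem_closedBall.2 hd, ?_⟩, Ψ.left_inv (hVs hq)⟩
    exact extChartAt_target_subset_range (I := 𝓡∂ (2 * n + 2)) p (Ψ.map_source (hVs hq))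

variable {M : Type*} [TopologicalSpace M]
  [ChartedSpace (EuclideanSpace ℝ (Fin (2 * n + 2))) M] [IsManifold (𝓡 (2 * n + 2)) ∞ M]
  {C : ConicalSpecialKaehler n M} {T : TensorTriple (𝓡∂ (2 * n + 2)) B} {i : M → B}

/-- The level sets of `f` are closed in the manifold with boundary. -/
theorem RegularBoundary.isCompact_level [T2Space B] (hT : RegularBoundary C T i) {K : Set B}
    (hK : IsCompact K) {f : ℝ} (hf : 0 < f) : IsCompact {x : M | C.f x = f ∧ i x ∈ K} := by
  rw [hT.embedding.isEmbedding.isInducing.isCompact_iff]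
  have h1 : i '' {x : M | C.f x = f ∧ i x ∈ K} = K ∩ T.f ⁻¹' {f} := by
    ext q
    constructor
    · rintro ⟨x, ⟨hx, hxK⟩, rfl⟩
      exact ⟨hxK, (hT.f_comp x).trans hx⟩
    · rintro ⟨hqK, hqf⟩
      have hq : q ∈ Set.range i := by
        rw [hT.range_eq]
        rcases (𝓡∂ (2 * n + 2)).isInteriorPoint_or_isBoundaryPoint q with h | h
        · exact h
        · have hq0 := hT.f_eq_zero q h
          have hqf' : T.f q = f := hqf
          exact absurd (hq0.symm.trans hqf') hf.ne
      obtain ⟨x, rfl⟩ := hq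
      exact ⟨x, ⟨(hT.f_comp x).symm.trans hqf, hqK⟩, rfl⟩
  rw [h1]
  exact hK.inter_right (isClosed_singleton.preimage T.contMDiff_f.continuous)

end Compact

section Complete

variable {n : ℕ} {M : Type*} [TopologicalSpace M] [T2Space M]
  [ChartedSpace (EuclideanSpace ℝ (Fin (2 * n + 2))) M] [IsManifold (𝓡 (2 * n + 2)) ∞ M]
  [MulAction ℂˣ M] {C : ConicalSpecialKaehler n M} (hM : IsPrincipalAction C.toTensorTriple)
  {B : Type*} [TopologicalSpace B] [T2Space B]
  [ChartedSpace (EuclideanHalfSpace (2 * n + 2)) B] [IsManifold (𝓡∂ (2 * n + 2)) ∞ B]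
  {T : TensorTriple (𝓡∂ (2 * n + 2)) B} {i : M → B} (hT : RegularBoundary C T i)
  {A : Type*} {U : A → SpecialChart C} {c : ℝ}
  [ChartedSpace (Coord n) (NBar U c)] [IsManifold 𝓘(ℝ, Coord n) ∞ (NBar U c)]
  {g : Bundle.ContMDiffRiemannianMetric 𝓘(ℝ, Coord n) ∞ (Coord n)
    (TangentSpace 𝓘(ℝ, Coord n) : NBar U c → Type _)}

include hM hT in
/-- Near a point of the manifold with boundary, balls of `N̄` of a uniform radius have relatively
compact images in the base and in the `ρ`-line. -/
theorem IsOneLoopMetric.exists_isCompact_base (hg : IsOneLoopMetric U c g) (hc : 0 ≤ c) (p : B) :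
    ∃ W ∈ 𝓝 p, ∃ δ > 0, ∀ (v : NBar U c) (x₀ : M), IsOver U c v x₀ → i x₀ ∈ W →
      ∃ K : Set (M × ℝ), IsCompact K ∧ ∀ γ : ℝ → NBar U c,
        ContMDiff 𝓘(ℝ, ℝ) 𝓘(ℝ, Coord n) 1 γ → γ 0 = v → ∫ t in (0 : ℝ)..1, speed g γ t < δ →
        ∃ w ∈ K, IsOver U c (γ 1) w.1 ∧ Real.log (rho (γ 1)) = w.2 := by
  have := hM.proper
  obtain ⟨ε, hε, V₀, hV₀, hV₀s, hbound⟩ := hT.exists_bound p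
  set V := interior V₀ with hVdef
  have hVo : IsOpen V := isOpen_interior
  have hVs : V ⊆ (extChartAt (𝓡∂ (2 * n + 2)) p).source := interior_subset.trans hV₀s
  have hV : V ∈ 𝓝 p := interior_mem_nhds.2 hV₀
  obtain ⟨r, hr, Kr, hKr, hKrV, hmem⟩ := exists_isCompact_ball p hV hVs
  set Ψ := extChartAt (𝓡∂ (2 * n + 2)) p with hΨ
  -- The two terms bound the chart velocity of the lift and the derivative of `log ρ`, in units of
  -- the speed.
  set k : ℝ := max (√ε)⁻¹ 2 with hk
  have hkpos : 0 < k := lt_of_lt_of_le two_pos (le_max_right _ _)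
  refine ⟨V ∩ Ψ ⁻¹' Metric.ball (Ψ p) (r / 2), Filter.inter_mem hV
    ((continuousAt_extChartAt p).preimage_mem_nhds (Metric.ball_mem_nhds _ (by linarith))),
    r / 2 / k, by positivity, fun v x₀ hv hx₀ => ?_⟩
  -- The space of admissible lifts. Fixing the level of `f` makes it compact inside `M`, although
  -- the chart ball may meet the boundary.
  let X : Set (M × ℝ) := {x : M | C.f x = C.f x₀ ∧ i x ∈ Kr} ×ˢ
    Set.Icc (Real.log (rho v) - r) (Real.log (rho v) + r)
  have hX : IsCompact X := (hT.isCompact_level hKr (C.f_pos x₀)).prod isCompact_Icc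
  have : CompactSpace X := isCompact_iff_compactSpace.1 hX
  refine ⟨X, hX, fun γ hγ h0 hlt => ?_⟩
  let a : X → MulAction.orbitRel.Quotient ℂˣ M × ℝ := fun w => (Quotient.mk'' w.1.1, w.1.2)
  have ha : Continuous a := (continuous_quotient_mk'.comp
    (continuous_fst.comp continuous_subtype_val)).prodMk (continuous_snd.comp continuous_subtype_val)
  let b : X → EuclideanSpace ℝ (Fin (2 * n + 2)) × ℝ := fun w => (Ψ (i w.1.1), w.1.2)
  have hb : Continuous b := by
    refine Continuous.prodMk ?_ (continuous_snd.comp continuous_subtype_val)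
    exact (continuousOn_extChartAt p).comp_continuous
      (hT.contMDiff.continuous.comp (continuous_fst.comp continuous_subtype_val))
      fun w => hVs (hKrV w.2.1.2)
  have hx₀X : (x₀, Real.log (rho v)) ∈ X := ⟨⟨rfl, hmem _ hx₀.1 (by
    have := Metric.mem_ball.1 hx₀.2
    linarith)⟩, by simp [hr.le]⟩
  obtain ⟨w, hw, -⟩ := OneLoop.exists_lift (X := X) (a := a) (b := b)
    (m := fun t => (base (γ t), Real.log (rho (γ t)))) (l := fun t => k * speed g γ t) (r := r / 2)
    (x₀ := ⟨_, hx₀X⟩) ha hb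
    ((continuous_base.comp hγ.continuous).prodMk (continuous_log_rho.comp hγ.continuous))
    ((continuous_speed g hγ).const_mul _) (fun t => mul_nonneg hkpos.le (speed_nonneg g γ t))
    (by rw [intervalIntegral.integral_const_mul, mul_comm]; exact (lt_div_iff₀ hkpos).1 hlt)
    (by rw [h0]; exact Prod.ext (base_eq_iff.2 hv).symm rfl) (by
      rintro t₀ ⟨⟨x, l₀⟩, hxX⟩ hx hxd k' hk'
      have hx1 : base (γ t₀) = Quotient.mk'' x := (congrArg Prod.fst hx).symm
      have hx2 : l₀ = Real.log (rho (γ t₀)) := congrArg Prod.snd hx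
      obtain ⟨y, l, l', hy0, hl0, hyd, hld, hev, hξ, hJξ, hgv, hl'⟩ :=
        hg.exists_lift hc hM hγ (base_eq_iff.1 hx1)
      subst hy0
      rw [← hx2] at hl0
      have hxV : i (y t₀) ∈ V := hKrV hxX.1.2
      have hΨd : MDifferentiableAt (𝓡 (2 * n + 2)) 𝓘(ℝ, EuclideanSpace ℝ (Fin (2 * n + 2)))
          (fun q => Ψ (i q)) (y t₀) :=
        (mdifferentiableAt_extChartAt (I := 𝓡∂ (2 * n + 2)) (by
          have h := hVs hxV
          rwa [hΨ, extChartAt_source] at h)).comp _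
          ((hT.contMDiff _).mdifferentiableAt (by simp))
      have hderiv := (hasDerivAt_comp_velocity hyd hΨd).prodMk hld
      have hs := speed_nonneg g γ t₀
      have hnorm : ‖mvfderiv (𝓡 (2 * n + 2)) (fun q => Ψ (i q)) (y t₀) (velocity y t₀)‖
          ≤ k * speed g γ t₀ := by
        have h1 := (hbound (y t₀) (interior_subset hxV) (C.f_pos _) (velocity y t₀) hξ hJξ).trans hgv
        rw [mul_comm ε, mul_assoc] at h1
        -- The factor `f` occurs on both sides, so the bound on the velocity is uniform up to the
        -- boundary.
        have h2 := le_of_mul_le_mul_left h1 (C.f_pos _)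
        rw [← Real.sq_sqrt hε.le, ← mul_pow] at h2
        have h3 := (abs_le_of_sq_le_sq' h2 hs).2
        rw [mul_comm, ← le_div_iff₀ (Real.sqrt_pos.2 hε), div_eq_inv_mul] at h3
        exact h3.trans (mul_le_mul_of_nonneg_right (le_max_left _ _) hs)
      have hnorm' : ‖(mvfderiv (𝓡 (2 * n + 2)) (fun q => Ψ (i q)) (y t₀) (velocity y t₀), l')‖
          < k' := by
        refine lt_of_le_of_lt (max_le hnorm ?_) hk'
        exact hl'.trans (mul_le_mul_of_nonneg_right (le_max_right _ _) hs)
      have hiy : ContinuousAt (fun t => i (y t)) t₀ :=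
        hT.contMDiff.continuous.continuousAt.comp hyd.continuousAt
      have hball : ∀ᶠ t in 𝓝 t₀, dist (Ψ (i (y t)), l t) (Ψ (i x₀), Real.log (rho v)) < r / 2 := by
        refine (hderiv.continuousAt.dist continuousAt_const).eventually (gt_mem_nhds ?_)
        change dist (Ψ (i (y t₀)), l t₀) (Ψ (i x₀), Real.log (rho v)) < r / 2
        rw [hl0]
        exact hxd
      filter_upwards [hderiv.eventually_dist_le hnorm', nhdsWithin_le_nhds hev,
        nhdsWithin_le_nhds hball, nhdsWithin_le_nhds (hiy.eventually (hVo.mem_nhds hxV))]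
        with t ht1 ht2 ht3 ht4
      obtain ⟨h5, h6⟩ := max_lt_iff.1 ht3
      have h7 : (y t, l t) ∈ X := by
        refine ⟨⟨ht2.2.1.trans hxX.1.1, hmem _ ht4 ?_⟩, ?_⟩
        · have h8 := Metric.mem_ball.1 hx₀.2
          have h9 : dist (Ψ (i (y t))) (Ψ (i x₀)) < r / 2 := h5
          linarith [dist_triangle (Ψ (i (y t))) (Ψ (i x₀)) (Ψ p)]
        · have h9 : |l t - Real.log (rho v)| < r / 2 := h6
          rw [abs_lt] at h9
          exact ⟨by linarith [h9.1], by linarith [h9.2]⟩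
      refine ⟨⟨_, h7⟩, Prod.ext (base_eq_iff.2 ht2.1).symm ht2.2.2, ?_⟩
      rw [hl0] at ht1
      exact ht1)
  exact ⟨w.1, w.2, base_eq_iff.1 (congrArg Prod.fst hw).symm, (congrArg Prod.snd hw).symm⟩

end Complete

section Complete

variable {n : ℕ} {M : Type*} [TopologicalSpace M] [T2Space M]
  [ChartedSpace (EuclideanSpace ℝ (Fin (2 * n + 2))) M] [IsManifold (𝓡 (2 * n + 2)) ∞ M]
  [MulAction ℂˣ M] {C : ConicalSpecialKaehler n M} (hM : IsPrincipalAction C.toTensorTriple)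
  {B : Type*} [TopologicalSpace B] [T2Space B]
  [ChartedSpace (EuclideanHalfSpace (2 * n + 2)) B] [IsManifold (𝓡∂ (2 * n + 2)) ∞ B]
  [MulAction ℂˣ B]
  {T : TensorTriple (𝓡∂ (2 * n + 2)) B} {i : M → B} (hT : RegularBoundary C T i)
  (hB : IsPrincipalAction T)
  {A : Type*} {U : A → SpecialChart C} {c : ℝ}
  [ChartedSpace (Coord n) (NBar U c)] [IsManifold 𝓘(ℝ, Coord n) ∞ (NBar U c)]
  {g : Bundle.ContMDiffRiemannianMetric 𝓘(ℝ, Coord n) ∞ (Coord n)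
    (TangentSpace 𝓘(ℝ, Coord n) : NBar U c → Type _)}

include hM hT hB in
/-- Cauchy sequences in `N̄` have images in the base and in the `ρ`-line which accumulate. -/
theorem IsOneLoopMetric.exists_accumulation (hg : IsOneLoopMetric U c g) (hc : 0 ≤ c)
    [CompactSpace (MulAction.orbitRel.Quotient ℂˣ B)] {u : ℕ → NBar U c}
    (hu : ∀ r > 0, ∃ k, ∀ i ≥ k, ∀ j ≥ k, ∃ γ : ℝ → NBar U c,
      ContMDiff 𝓘(ℝ, ℝ) 𝓘(ℝ, Coord n) 1 γ ∧ γ 0 = u i ∧ γ 1 = u j ∧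
        ∫ t in (0 : ℝ)..1, speed g γ t < r) :
    ∃ w : M × ℝ, ∀ V ∈ 𝓝 w, ∃ᶠ j in Filter.atTop, ∃ w' ∈ V, IsOver U c (u j) w'.1 ∧
      Real.log (rho (u j)) = w'.2 := by
  have := hM.proper
  have := hB.proper
  choose x hx using fun k => exists_isOver (u k)
  let mk : B → MulAction.orbitRel.Quotient ℂˣ B := Quotient.mk''
  have hmk : IsOpenMap mk := isOpenMap_quotient_mk'_mul
  -- The orbits of the lifted terms accumulate in the compact quotient, possibly at an orbit of the
  -- boundary.
  obtain ⟨q, -, hq⟩ := (isCompact_univ (X := MulAction.orbitRel.Quotient ℂˣ B)).exists_mapClusterPt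
    (u := fun k => mk (i (x k))) (f := Filter.atTop) (by simp)
  obtain ⟨p, rfl⟩ : ∃ p, mk p = q := Quotient.exists_rep q
  obtain ⟨W, hW, δ, hδ, h⟩ := hg.exists_isCompact_base hM hT hc p
  obtain ⟨k, hk⟩ := hu δ hδ
  obtain ⟨k', ⟨b, hbW, hb⟩, hk'⟩ := ((hq.frequently (hmk.image_mem_nhds hW)).and_eventually
    (Filter.eventually_ge_atTop k)).exists
  -- Rescaling moves a lift of one term of the tail close to `p`. The level of `f` changes, but the
  -- radius `δ` does not depend on it.
  obtain ⟨a, ha⟩ : ∃ a : ℂˣ, a • i (x k') = b := MulAction.orbitRel_apply.1 (Quotient.eq''.1 hb)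
  rw [← hT.equivariant hM hB] at ha
  obtain ⟨K, hK, hγ⟩ := h (u k') (a • x k') ((hx k').smul a) (by rwa [ha])
  have hmem : ∀ j ≥ k, ∃ w ∈ K, IsOver U c (u j) w.1 ∧ Real.log (rho (u j)) = w.2 := by
    intro j hj
    obtain ⟨γ, h1, h2, h3, h4⟩ := hk k' hk' j hj
    rw [← h3]
    exact hγ γ h1 h2 h4
  have : Nonempty M := ⟨x 0⟩
  choose! w hwK hw using hmem
  obtain ⟨w₀, -, hw₀⟩ := hK.exists_mapClusterPt (u := w) (f := Filter.atTop)
    (Filter.tendsto_principal.2 ((Filter.eventually_ge_atTop k).mono hwK))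
  refine ⟨w₀, fun V hV => ?_⟩
  refine ((hw₀.frequently hV).and_eventually (Filter.eventually_ge_atTop k)).mono ?_
  rintro j ⟨hjV, hj⟩
  exact ⟨w j, hjV, hw j hj⟩

/-- The one-loop deformed Ferrara-Sabharwal metric is complete. -/
theorem IsOneLoopMetric.isCompleteMetric (hg : IsOneLoopMetric U c g) (hc : 0 ≤ c)
    (hM : IsPrincipalAction C.toTensorTriple) (hT : RegularBoundary C T i)
    (hB : IsPrincipalAction T) [CompactSpace (MulAction.orbitRel.Quotient ℂˣ B)]
    (hU : ∀ p : M, ∃ α, p ∈ (U α).source) [T2Space (NBar U c)] : IsCompleteMetric g := by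
  have := hM.proper
  refine isCompleteMetric_of_isCompact g fun u hu => ?_
  obtain ⟨⟨x, l⟩, hacc⟩ := hg.exists_accumulation hM hT hB hc hu
  obtain ⟨α, hα⟩ := hU x
  obtain ⟨a, ha⟩ := (U α).exists_z_eq_hom hα
  have hD : hom ((U α).X x) ∈ (U α).dom.carrier :=
    ha ▸ (U α).z_mem ((U α).smul_mem_source a x hα)
  -- The fibre coordinates `φ̃` and `p` of the sequence need not be bounded. The reference point has
  -- both equal to zero, and a Heisenberg translation will supply the actual values.
  obtain ⟨r, hr, δ, hδ, h⟩ := hg.exists_isCompact hc (α := α)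
    (y₀ := ((U α).X x, Real.exp l, 0, 0)) ⟨hD, Real.exp_pos l⟩
  obtain ⟨k, hk⟩ := hu δ hδ
  have hXc : ContinuousAt (U α).X x := by
    have h1 : ContinuousAt (U α).z x :=
      (U α).continuousOn_z.continuousAt ((U α).isOpen_source.mem_nhds hα)
    refine continuousAt_pi.2 fun μ => ?_
    exact (continuousAt_pi.1 h1 μ.succ).div (continuousAt_pi.1 h1 0) ((U α).z_zero_ne_zero hα)
  have hcont : ContinuousAt (fun w : M × ℝ => (((U α).X w.1, Real.exp w.2, 0, 0) : Coord n))
      (x, l) := by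
    have h1 : ContinuousAt (fun w : M × ℝ => (U α).X w.1) (x, l) :=
      ContinuousAt.comp (f := Prod.fst) (g := (U α).X) hXc continuousAt_fst
    have h2 : ContinuousAt (fun w : M × ℝ => Real.exp w.2) (x, l) :=
      (Real.continuous_exp.comp continuous_snd).continuousAt
    exact h1.prodMk (h2.prodMk continuousAt_const)
  obtain ⟨j, ⟨⟨y, l'⟩, ⟨hyr, hyα⟩, hover, hl'⟩, hjk⟩ := ((hacc _ (Filter.inter_mem
    (hcont.preimage_mem_nhds (Metric.ball_mem_nhds _ hr))
    (continuousAt_fst.preimage_mem_nhds ((U α).isOpen_source.mem_nhds hα)))).and_eventually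
    (Filter.eventually_ge_atTop k)).exists
  obtain ⟨e, he⟩ := hover.exists_coordMap_eq hM (α := α) hyα
  obtain ⟨-, hX⟩ := isOver_coordMap_iff.1 (he ▸ hover)
  have hρ : Real.exp l' = e.1.2.1 := by
    have h1 : l' = Real.log e.1.2.1 := by
      rw [← rho_coordMap (U := U) (c := c), he]
      exact hl'.symm
    rw [h1, Real.exp_log e.2.2]
  obtain ⟨K, hK, hγ⟩ := h e.1.2.2.2 e.1.2.2.1
  -- Translation by the fibre coordinates of the chosen term sends the point with zero fibre
  -- coordinates to it.
  have hheis : heisenberg e.1.2.2.2 e.1.2.2.1 ((U α).X y, Real.exp l', 0, 0) = e.1 := by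
    rw [← hX, hρ]
    have h0 : sympForm e.1.2.2.2 (0 : Fin (n + 1) ⊕ Fin (n + 1) → ℝ) = 0 := by simp [sympForm]
    simp [heisenberg, h0]
  refine ⟨K, hK, (Filter.eventually_ge_atTop k).mono fun i hi => ?_⟩
  obtain ⟨γ, h1, h2, h3, h4⟩ := hk j hjk i hi
  rw [← h3]
  refine hγ _ (by rw [hheis]; exact e.2) hyr γ h1 ?_ h4
  rw [h2, ← he]
  exact congrArg _ (Subtype.ext hheis.symm)

end Complete

end OneLoop

end

theorem mainTheorem2 (n : ℕ)
    (M : Type*) [TopologicalSpace M] [T2Space M] [SecondCountableTopology M]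
    [ChartedSpace (EuclideanSpace ℝ (Fin (2 * n + 2))) M] [IsManifold (𝓡 (2 * n + 2)) ∞ M]
    [MulAction ℂˣ M]
    (C : OneLoop.ConicalSpecialKaehler n M)
    (hM : OneLoop.IsPrincipalAction C.toTensorTriple)
    (B : Type*) [TopologicalSpace B] [T2Space B] [SecondCountableTopology B]
    [ChartedSpace (EuclideanHalfSpace (2 * n + 2)) B] [IsManifold (𝓡∂ (2 * n + 2)) ∞ B]
    [MulAction ℂˣ B]
    (T : OneLoop.TensorTriple (𝓡∂ (2 * n + 2)) B) (i : M → B)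
    (hT : OneLoop.RegularBoundary C T i)
    (hB : OneLoop.IsPrincipalAction T)
    (hcompact : CompactSpace (MulAction.orbitRel.Quotient ℂˣ B))
    {A : Type*} (U : A → OneLoop.SpecialChart C) (hU : ∀ p : M, ∃ α, p ∈ (U α).source)
    (c : ℝ) (hc : 0 ≤ c) :
    T2Space (OneLoop.NBar U c) ∧ SecondCountableTopology (OneLoop.NBar U c) ∧
    (∃ (_ : ChartedSpace (OneLoop.Coord n) (OneLoop.NBar U c))
      (_ : IsManifold 𝓘(ℝ, OneLoop.Coord n) ∞ (OneLoop.NBar U c))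
      (g : Bundle.ContMDiffRiemannianMetric 𝓘(ℝ, OneLoop.Coord n) ∞ (OneLoop.Coord n)
        (TangentSpace 𝓘(ℝ, OneLoop.Coord n) : OneLoop.NBar U c → Type _)),
      OneLoop.IsOneLoopMetric U c g) ∧
    (∀ [ChartedSpace (OneLoop.Coord n) (OneLoop.NBar U c)]
      [IsManifold 𝓘(ℝ, OneLoop.Coord n) ∞ (OneLoop.NBar U c)]
      (g : Bundle.ContMDiffRiemannianMetric 𝓘(ℝ, OneLoop.Coord n) ∞ (OneLoop.Coord n)
        (TangentSpace 𝓘(ℝ, OneLoop.Coord n) : OneLoop.NBar U c → Type _)),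
      OneLoop.IsOneLoopMetric U c g → OneLoop.IsCompleteMetric g) := by
  have := hM.proper
  exact ⟨OneLoop.t2Space_NBar hM hU, OneLoop.secondCountableTopology_NBar hM hU,
    OneLoop.exists_isOneLoopMetric U hc,
    fun g hg => by
      have := OneLoop.t2Space_NBar (c := c) hM hU
      exact hg.isCompleteMetric hc hM hT hB hU⟩
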